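/- **Setting.** Let $G$ be a connected compact Lie group with normalized Haar measure, Lie algebra $\mathfrak g$, an invariant inner product on $\mathfrak g$ and an orthonormal basis $(e_i)$. Let $\mathbb C l(\mathfrak g)$ be the complex Clifford algebra ($xy+yx=2\langle x,y\rangle$), and let $S$ be a $\mathbb Z/2$-graded (grading operator $\epsilon$) cyclic $*$-representation of it on a Hilbert space, with cyclic unit vector $\mathbb I$. The basic Dirac operator is the closure $D$ of $\frac1{\sqrt{-1}}\sum_i e_i\otimes e_i$ on smooth functions in $L^2(G)\otimes S$, where the first $e_i$ acts as a left-invariant vector field and the second by Clifford multiplication. Let $\Gamma_1<\Gamma_2<\cdots$ be a directed system of finite connected directed graphs, with nested free generating sets $\mathfrak F_1\subset\mathfrak F_2\subset\cdots$ of their free groupoids, ordered so that the elements of $\mathfrak F_{n+1}\setminus\mathfrak F_n$ come after those of $\mathfrak F_n$; put $\mathfrak F_0=\emptyset$. Let $\mathcal H$ be the Hilbert space limit of $\bigotimes_{\gamma\in\mathfrak F_n}(L^2(G)\otimes S)=L^2(G^{\mathfrak F_n})\otimes S^{\otimes\mathfrak F_n}$ under $\eta\mapsto\eta\otimes(1\otimes\mathbb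 I)^{\otimes}$, and let $E$ be a finite-dimensional Hilbert space. On $E\otimes\mathcal H=L^2(\overline{\mathcal A},E)\otimes\varinjlim S^{\otimes\mathfrak F_n}$ (with $\overline{\mathcal A}=G^{\bigcup_n\mathfrak F_n}$) the Clifford algebras $\mathbb C l(\mathfrak g^{\mathfrak F_n})$ act in the graded sense: $x\in\mathfrak g$ in the copy at $\gamma$ acts as $\epsilon\otimes\cdots\otimes\epsilon\otimes x\otimes1\otimes1\otimes\cdots$, with $x$ in position $\gamma$. Let $D_\gamma$ be the copy of $D$ at $\gamma$ (formed with this Clifford action, so that different $D_\gamma$ anticommute), let $\mathcal D_k=\sum_{\gamma\in\mathfrak F_k\setminus\mathfrak F_{k-1}}D_\gamma$, and let $\mathcal N$ be the von Neumann algebra generated by $B(L^2(\overline{\mathcal A},E))\otimes1$ and $1\otimes\varinjlim\mathbb C l(\mathfrak g^{\mathfrak F_n})$. Let $J\subset\mathbb R$ be a non-degenerate interval and let $a_k:J\to\mathbb R\setminus\{0\}$ $(k\ge1)$ be continuously differentiable. Let $\mathcal D(t)$ be the closure of $\sum_k a_k(t)\mathcal D_k$ on the smooth vectors that depend on finitely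 many generators. Let $\dot{\mathcal D}(t)$ be the derivative of $s\mapsto\mathcal D(s)$ at $t$: the closure of the operator $v\mapsto\frac{d}{ds}\big|_{s=t}\mathcal D(s)v$, on the vectors $v$ which lie in the domain of $\mathcal D(s)$ for all $s\in J$ near $t$ and for which the derivative exists in norm. **Lemma.** There is a constant $c>0$ such that, if $G$ is non-trivial, $1/c$ is the smallest non-zero eigenvalue of $D^2$, and such that for all graph systems and weights as above the following holds. Suppose that there are $\varepsilon\in[0,1)$ and $m\in(0,\infty)$ with $$\sup_k\frac{|\dot a_k(t)|}{|a_k(t)|^{1+\varepsilon}}\le m\qquad\text{for all }t\in J.$$ Then, for every $t\in J$, the operator $\mathcal D(t)$ is self-adjoint and is the strong resolvent limit of $\sum_{k\le n}a_k(t)\mathcal D_k$ as $n\to\infty$. Moreover there are strongly continuous families of operators $F_t,R_t\in\mathcal N$ $(t\in J)$ with $$\dot{\mathcal D}(t)=F_t\,|\mathcal D(t)|^{1+\varepsilon}+R_t ,\qquad \|F_t\|\le c^{\varepsilon/2}m,\quad \|R_t\|\le c^{\varepsilon/2}m$$ for all $t\in J$. Here the equality means that $\dot{\mathcal D}(t)$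 is the closure of the operator on the right, which is defined on the domain of $|\mathcal D(t)|^{1+\varepsilon}$ (in particular, the two sides agree on that domain). -/

import Mathlib

open Filter Topology MeasureTheory CategoryTheory
open scoped Manifold ContDiff InnerProductSpace TensorProduct

noncomputable section

namespace AGN

/-! ### Unbounded operators on a Hilbert space -/

section Operators

variable {H : Type*} [NormedAddCommGroup H] [InnerProductSpace ℂ H]

/-- The closed operator whose graph is the closed linear span of a set of pairs `(v, T v)`; this is
the closure of `T` when `T` is a densely defined symmetric operator given by these pairs. -/
def closedOperator (Γ : Set (H × H)) : H →ₗ.[ℂ] H :=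
  ((Submodule.span ℂ Γ).topologicalClosure).toLinearPMap

/-- Strong resolvent convergence `T n → T`: for every non-real `z` and every `v`,
`(T n - z)⁻¹ v → (T - z)⁻¹ v`. -/
def StrongResolventTendsto (T : ℕ → H →ₗ.[ℂ] H) (T' : H →ₗ.[ℂ] H) : Prop :=
  ∀ z : ℂ, z.im ≠ 0 → ∀ v : H, ∃ (u : ℕ → H) (u' : H),
    (∀ n, (u n, v + z • u n) ∈ (T n).graph) ∧ (u', v + z • u') ∈ T'.graph ∧
      Tendsto u atTop (𝓝 u')

/-- The derivative at `t` of a family `T` of unbounded operators with parameter in `J`: the closure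
of the operator `v ↦ d/ds (T s v)` at `s = t`, on the vectors `v` which lie in the domain of `T s`
for all `s ∈ J` near `t` and for which the derivative exists in norm. -/
def derivOperator (T : ℝ → H →ₗ.[ℂ] H) (J : Set ℝ) (t : ℝ) : H →ₗ.[ℂ] H :=
  closedOperator {p | ∃ φ : ℝ → H, (∀ᶠ s in 𝓝[J] t, (p.1, φ s) ∈ (T s).graph) ∧
    HasDerivWithinAt φ p.2 J t}

variable [CompleteSpace H]

/-- The closed graph of `T`, in the Hilbert space direct sum `H ⊕ H`. -/
def graphL2 (T : H →ₗ.[ℂ] H) : Submodule ℂ (WithLp 2 (H × H)) :=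
  (T.graph.map (WithLp.linearEquiv 2 ℂ (H × H)).symm.toLinearMap).topologicalClosure

instance (T : H →ₗ.[ℂ] H) : CompleteSpace (graphL2 T) := by
  unfold graphL2; infer_instance

/-- The bounded operator `(1 + T* T)⁻¹` of a closed densely defined operator `T`: the compression
to the first summand of the orthogonal projection of `H ⊕ H` onto the graph of `T`. -/
def invOneAddSq (T : H →ₗ.[ℂ] H) : H →L[ℂ] H :=
  (WithLp.fstL 2 ℂ H H) ∘L (graphL2 T).starProjection ∘L
    ((WithLp.prodContinuousLinearEquiv 2 ℂ H H).symm : (H × H) →L[ℂ] WithLp 2 (H × H)) ∘L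
      (ContinuousLinearMap.inl ℂ H H)

/-- The operator `|T| ^ p`, for `p > 0` and `T` closed and densely defined.
With `R = (1 + T* T)⁻¹`, one has `|T|² = (1 - R) R⁻¹`, hence
`|T| ^ p = (1 - R) ^ (p / 2) (R ^ (p / 2))⁻¹`, with domain the range of `R ^ (p / 2)`.
The powers of `R` and `1 - R` are given by the continuous functional calculus. -/
def absPow (T : H →ₗ.[ℂ] H) (p : ℝ) : H →ₗ.[ℂ] H :=
  (cfc (fun x : ℝ => (1 - x) ^ (p / 2)) (invOneAddSq T) : H →L[ℂ] H).toLinearMap.compPMap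
    ((cfc (fun x : ℝ => x ^ (p / 2)) (invOneAddSq T) : H →L[ℂ] H).toLinearMap.toPMap ⊤).inverse

/-- The von Neumann algebra generated by a set of bounded operators: the double commutant of the
set together with its adjoints. -/
def generatedVN (s : Set (H →L[ℂ] H)) : VonNeumannAlgebra H where
  toStarSubalgebra := StarSubalgebra.centralizer ℂ (StarSubalgebra.centralizer ℂ s : Set (H →L[ℂ] H))
  centralizer_centralizer' := by
    have h : ∀ s : Set (H →L[ℂ] H), (StarSubalgebra.centralizer ℂ s).carrier
        = Set.centralizer (s ∪ star s) := fun s => rfl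
    rw [h, Set.centralizer_centralizer_centralizer]

end Operators

/-! ### Systems of graphs -/

/-- The groupoid morphism `𝒢(Γ) → 𝒢(Γ')` induced by a map of graphs that sends each edge of `Γ` to
a product of edges (a path) of `Γ'`. -/
def refinementFunctor {Γ Γ' : Type} [Quiver.{0} Γ] [Quiver.{0} Γ'] (φ : Γ ⥤q Paths Γ') :
    Quiver.FreeGroupoid Γ ⥤ Quiver.FreeGroupoid Γ' :=
  Quiver.FreeGroupoid.lift (φ ⋙q (Paths.lift (Quiver.FreeGroupoid.of Γ')).toPrefunctor)

/-- A finite family of elements of a groupoid is freely generating if groupoid morphisms to a group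
correspond uniquely to the assignments of group elements to the members of the family. -/
def IsFreeGenerating {C : Type} [Groupoid.{0} C] {n : ℕ} (γ : Fin n → Arrow C) : Prop :=
  ∀ (X : Type) [Group X] (f : Fin n → X), ∃! F : C ⥤ SingleObj X, ∀ i, F.map (γ i).hom = f i

/-- A directed system `Γ 0 < Γ 1 < ⋯` of finite connected directed graphs, with a nested choice of
free generators of the free groupoids. The generating set `𝔉 n` of `𝒢(Γ n)` is enumerated as
`gen n 0, …, gen n (N n - 1)`, where the first generators of `𝔉 (n + 1)` are the images of
those of `𝔉 n`. -/
structure GraphSystem where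
  /-- vertices -/
  Γ : ℕ → Type
  /-- edges -/
  [quiver : ∀ n, Quiver.{0} (Γ n)]
  finite_vertices : ∀ n, Finite (Γ n)
  finite_edges : ∀ n (a b : Γ n), Finite (a ⟶ b)
  connected : ∀ n (a b : Quiver.FreeGroupoid (Γ n)), Nonempty (a ⟶ b)
  /-- the refinement maps -/
  refine : ∀ n, Γ n ⥤q Paths (Γ (n + 1))
  refine_injective : ∀ n, Function.Injective (refinementFunctor (refine n)).obj
  refine_faithful : ∀ n, (refinementFunctor (refine n)).Faithful
  /-- the number of generators of level `n` -/
  N : ℕ → ℕ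
  N_le : ∀ n, N n ≤ N (n + 1)
  /-- the generators of level `n` -/
  gen : ∀ n, Fin (N n) → Arrow (Quiver.FreeGroupoid (Γ n))
  gen_free : ∀ n, IsFreeGenerating (gen n)
  gen_succ : ∀ n (i : Fin (N n)),
    gen (n + 1) (Fin.castLE (N_le n) i) = (refinementFunctor (refine n)).mapArrow.obj (gen n i)

/-- The set of all generators, i.e. the union of the nested sets `𝔉 0 ⊆ 𝔉 1 ⊆ ⋯`. -/
abbrev GraphSystem.Site (𝒢 : GraphSystem) : Type := {j : ℕ // ∃ n, j < 𝒢.N n}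

/-- The level at which a generator is added: `level γ = k` iff `γ ∈ 𝔉 k \ 𝔉 (k - 1)`. -/
def GraphSystem.level (𝒢 : GraphSystem) (γ : 𝒢.Site) : ℕ := sInf {n | (γ : ℕ) < 𝒢.N n}

/-! ### The structure on the Lie algebra -/

section LieGroup

variable {V : Type*} [NormedAddCommGroup V] [NormedSpace ℝ V]
variable {G : Type*} [Group G] [TopologicalSpace G] [ChartedSpace V G]

variable (V G) in
/-- An invariant metric on the Lie algebra of `G`. -/
structure InvariantMetric where
  /-- the inner product -/
  form : LinearMap.BilinForm ℝ (GroupLieAlgebra 𝓘(ℝ, V) G)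
  symm : ∀ x y, form x y = form y x
  pos : ∀ x, x ≠ 0 → 0 < form x x
  invariant : ∀ x y z : GroupLieAlgebra 𝓘(ℝ, V) G, form ⁅z, x⁆ y + form x ⁅z, y⁆ = 0

/-- The quadratic form `x ↦ ⟨x, x⟩`; in its Clifford algebra, `a b + b a = 2 ⟨a, b⟩`. -/
def InvariantMetric.quadratic (g : InvariantMetric V G) :
    QuadraticForm ℝ (GroupLieAlgebra 𝓘(ℝ, V) G) :=
  LinearMap.BilinMap.toQuadraticMap g.form

/-- A `ℤ/2`-graded cyclic `*`-representation of the complex Clifford algebra on a Hilbert space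
`S`, together with an orthonormal basis of `S` whose first vector is the cyclic vector.
The grading operator is what makes `ℂl(𝔤 ^ n)` act on `S ^ ⊗ n`. -/
structure SpinorModule {W : Type*} [AddCommGroup W] [Module ℝ W] (Q : QuadraticForm ℝ W)
    (S : Type*) [NormedAddCommGroup S] [InnerProductSpace ℂ S] [CompleteSpace S] where
  /-- the representation -/
  rep : (ℂ ⊗[ℝ] CliffordAlgebra Q) →ₐ[ℂ] (S →L[ℂ] S)
  rep_selfAdjoint : ∀ x : W, IsSelfAdjoint (rep (1 ⊗ₜ CliffordAlgebra.ι Q x))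
  /-- the grading operator -/
  grading : S →L[ℂ] S
  grading_selfAdjoint : IsSelfAdjoint grading
  grading_sq : grading * grading = 1
  grading_anticomm : ∀ x : W, grading * rep (1 ⊗ₜ CliffordAlgebra.ι Q x)
    = - (rep (1 ⊗ₜ CliffordAlgebra.ι Q x) * grading)
  /-- `dim S = d + 1` -/
  d : ℕ
  /-- an orthonormal basis that starts with the cyclic vector -/
  basis : OrthonormalBasis (Fin (d + 1)) ℂ S
  cyclic : ∀ s : S, ∃ w, rep w (basis 0) = s

/-- Clifford multiplication by a vector. -/
def SpinorModule.c {W : Type*} [AddCommGroup W] [Module ℝ W] {Q : QuadraticForm ℝ W}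
    {S : Type*} [NormedAddCommGroup S] [InnerProductSpace ℂ S] [CompleteSpace S]
    (M : SpinorModule Q S) (x : W) : S →L[ℂ] S :=
  M.rep (1 ⊗ₜ CliffordAlgebra.ι Q x)

/-- The action of an element `v` of the Lie algebra on a function on `G` as a left-invariant
differential operator. -/
def leftDeriv {E : Type*} [NormedAddCommGroup E] [NormedSpace ℝ E]
    (v : GroupLieAlgebra 𝓘(ℝ, V) G) (f : G → E) (x : G) : E :=
  mfderiv 𝓘(ℝ, V) 𝓘(ℝ, E) f x (mulInvariantVectorField v x)

variable {g : InvariantMetric V G}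
  {S : Type*} [NormedAddCommGroup S] [InnerProductSpace ℂ S] [CompleteSpace S]
variable {q : ℕ} (e : Module.Basis (Fin q) ℝ (GroupLieAlgebra 𝓘(ℝ, V) G))
  (M : SpinorModule g.quadratic S)
variable [MeasurableSpace G] (μ : Measure G)

/-- The basic Dirac operator `D = (1 / √-1) ∑ i, e i ⊗ e i` on `L²(G) ⊗ S = L²(G, S)`, the
closure of its restriction to the smooth functions. -/
def basicDirac : Lp S 2 μ →ₗ.[ℂ] Lp S 2 μ :=
  closedOperator {p | ∃ f : G → S, ContMDiff 𝓘(ℝ, V) 𝓘(ℝ, S) ∞ f ∧ p.1 =ᵐ[μ] f ∧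
    p.2 =ᵐ[μ] fun x => (1 / Complex.I) • ∑ i, M.c (e i) (leftDeriv (e i) f x)}

/-- The non-zero eigenvalues of `D²`. -/
def nonzeroEigenvaluesSq : Set ℝ :=
  {l | l ≠ 0 ∧ ∃ v w : Lp S 2 μ, v ≠ 0 ∧ (v, w) ∈ (basicDirac e M μ).graph ∧
    (w, (l : ℂ) • v) ∈ (basicDirac e M μ).graph}

/-! ### The limit Hilbert space and the Dirac operators on it -/

variable (𝒢 : GraphSystem) (E : Type*) [NormedAddCommGroup E] [InnerProductSpace ℂ E]

/-- The labels `σ` of the orthonormal basis `⨂ γ, b (σ γ)` of the limit of the spaces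
`S ^ ⊗ 𝔉 n` under the embeddings `s ↦ s ⊗ 𝕀 ⊗ ⋯ ⊗ 𝕀`, where `b` is the basis of `S`, and
`b 0 = 𝕀`. -/
abbrev Conf : Type := 𝒢.Site →₀ Fin (M.d + 1)

/-- `L²(𝒜̄, E)`, for the space `𝒜̄` of generalized connections, which the choice of generators
identifies with the product of copies of `G` over all generators, with the product measure. -/
abbrev L2Conn [IsProbabilityMeasure μ] : Type _ :=
  Lp E 2 (Measure.infinitePi (fun _ : 𝒢.Site => μ))

/-- The limit Hilbert space `E ⊗ 𝓗 = L²(𝒜̄, E) ⊗ lim S ^ ⊗ 𝔉 n`: the square summable families,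
indexed by `Conf`, of elements of `L²(𝒜̄, E)`. The family `Ψ` stands for the sum of the
`Ψ σ ⊗ ⨂ γ, b (σ γ)`. -/
abbrev LimitSpace [IsProbabilityMeasure μ] : Type _ :=
  lp (fun _ : Conf M 𝒢 => L2Conn μ 𝒢 E) 2

variable {E} in
/-- Smooth functions of the values of the connection on finitely many generators. -/
def IsSmoothCylinder (f : (𝒢.Site → G) → E) : Prop :=
  ∃ (s : Finset 𝒢.Site) (h : (s → G) → E),
    ContMDiff (ModelWithCorners.pi fun _ : s => 𝓘(ℝ, V)) 𝓘(ℝ, E) ∞ h ∧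
      ∀ x, f x = h fun i => x i

variable {E 𝒢} in
/-- The action of an element of the Lie algebra in the copy of `G` at `γ`. -/
def siteDeriv (γ : 𝒢.Site) (v : GroupLieAlgebra 𝓘(ℝ, V) G) (f : (𝒢.Site → G) → E)
    (x : 𝒢.Site → G) : E :=
  leftDeriv v (fun y => f (Function.update x γ y)) (x γ)

variable {𝒢} in
/-- The matrix, in the basis indexed by `Conf`, of the generator of `ℂl(⨁ γ, 𝔤)` which is
given by the vector `v` in the copy of `𝔤` at `γ`: it acts by
`ε ⊗ ⋯ ⊗ ε ⊗ c(v) ⊗ 1 ⊗ 1 ⊗ ⋯` with `ε` the grading operator of `S` and `c(v)` at `γ`.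
So generators at different sites anticommute. -/
def siteClifford (γ : 𝒢.Site) (v : GroupLieAlgebra 𝓘(ℝ, V) G) (τ σ : Conf M 𝒢) : ℂ :=
  open scoped Classical in
  if ∀ j, γ < j → τ j = σ j then
    (∏ᶠ (j : 𝒢.Site) (_ : j < γ), ⟪M.basis (τ j), M.grading (M.basis (σ j))⟫_ℂ) *
      ⟪M.basis (τ γ), M.c v (M.basis (σ γ))⟫_ℂ
  else 0

variable {E 𝒢} in
/-- The action of `D_γ = (1 / √-1) ∑ i, e i ⊗ e i` in the copy at `γ`, on families of smooth
functions. -/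
def siteDirac (γ : 𝒢.Site) (f : Conf M 𝒢 → (𝒢.Site → G) → E) (τ : Conf M 𝒢)
    (x : 𝒢.Site → G) : E :=
  (1 / Complex.I) • ∑ i, ∑ᶠ σ, siteClifford M γ (e i) τ σ • siteDeriv γ (e i) (f σ) x

variable [IsProbabilityMeasure μ]

/-- The operator `∑ k, a k 𝒟_k`, with `𝒟_k` the sum of the `D_γ` over the generators `γ` of level
`k`: the closure of its restriction to finite sums of `f ⊗ s` with `f` a smooth cylinder
function and `s` a tensor in `S ^ ⊗ 𝔉 n`, for some `n`. On each of these only finitely many terms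
of the sum are non-zero. -/
def diracOperator (a : ℕ → ℝ) : LimitSpace M μ 𝒢 E →ₗ.[ℂ] LimitSpace M μ 𝒢 E :=
  closedOperator {p | ∃ f : Conf M 𝒢 → (𝒢.Site → G) → E,
    {σ | f σ ≠ 0}.Finite ∧ (∀ σ, IsSmoothCylinder (V := V) 𝒢 (f σ)) ∧
    (∀ σ, p.1 σ =ᵐ[Measure.infinitePi (fun _ : 𝒢.Site => μ)] f σ) ∧
    (∀ τ, p.2 τ =ᵐ[Measure.infinitePi (fun _ : 𝒢.Site => μ)]
      fun x => ∑ᶠ γ, (a (𝒢.level γ) : ℂ) • siteDirac e M γ f τ x)}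

/-- The partial sum `∑ k ≤ n, a k 𝒟_k`. -/
def partialDirac (a : ℕ → ℝ) (n : ℕ) : LimitSpace M μ 𝒢 E →ₗ.[ℂ] LimitSpace M μ 𝒢 E :=
  diracOperator e M μ 𝒢 E fun k => if k ≤ n then a k else 0

variable [CompleteSpace E]

/-- The von Neumann algebra `𝓝`, generated by `B(L²(𝒜̄, E)) ⊗ 1` and `1 ⊗ lim ℂl(𝔤 ^ 𝔉 n)`. -/
def vonNeumann : VonNeumannAlgebra (LimitSpace M μ 𝒢 E) :=
  generatedVN
    ({T | ∃ B : L2Conn μ 𝒢 E →L[ℂ] L2Conn μ 𝒢 E, ∀ Ψ σ, (T Ψ) σ = B (Ψ σ)} ∪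
      {T | ∃ (γ : 𝒢.Site) (v : GroupLieAlgebra 𝓘(ℝ, V) G), ∀ Ψ τ,
        (T Ψ) τ = ∑ᶠ σ, siteClifford M γ v τ σ • Ψ σ})

end LieGroup

end AGN

end

noncomputable section

namespace AGN

set_option linter.unusedSectionVars false

open Module.End

/-! ### Locally finite anticommuting families of symmetric operators -/

/-! On a suitable dense subspace all the operators in question are diagonalizable by
finite-dimensional linear algebra. Representative functions of finitely many generators, with
finitely supported spinor labels, form a core on which the D_γ are symmetric and pairwise
anticommute, and every vector of which lies in a finite-dimensional invariant subspace annihilated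
by almost all D_γ (`DiracCore`, `prodCore`). There ∑ a_γ D_γ - z is bijective for non-real z. So
each sum ∑ a_γ D_γ is essentially self-adjoint, and any set of pairs that lies between its graph on
the core and the graph of its adjoint generates the same closed operator (`G_eq_closure`,
`closedOperator_eq_op`). This sandwich identifies the operators defined through smooth functions
(`diracOperator_eq_op`) and shows that the derivative at t is the closure of ∑ b_γ D_γ, where b_γ is
the derivative of a_γ (`derivOperator_op`). Strong resolvent convergence holds because the partial
sums are eventually constant on each core vector (`strongResolventTendsto_op`).

The squares D_γ² commute with every D_γ', so the core is the orthogonal algebraic sum of joint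
eigenspaces, given by D_γ² = χ_γ. On such a block (∑ a_γ D_γ)² is the scalar w_a = ∑ a_γ² χ_γ. Put F
= (∑ b_γ D_γ) |∑ a_γ D_γ|^(-(1+ε)); its norm on a block is at most (w_b / w_a^(1+ε))^(1/2). Each
non-zero χ_γ is at least 1/c. Hence a_γ² ≤ c a_γ² χ_γ ≤ c w_a for those γ, so b_γ² χ_γ ≤ m² (a_γ²)^ε
a_γ² χ_γ ≤ m² c^ε w_a^ε a_γ² χ_γ, and summation gives ‖F‖ ≤ c^(ε/2) m (`Gap.weight_le`,
`norm_coreQuotient_le`). Where w_a = 0 also w_b = 0, so nothing has to be corrected on the kernel,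
and R = 0 serves. Functional calculus on eigenvectors and the same sandwich give the identity of
closures (`closure_quotient_absPow`). The uniform bound reduces strong continuity to single blocks
(`continuousOn_quotient`).

The constant c comes from the basic Dirac operator on L²(G) ⊗ S. Compact self-adjoint convolution
operators show that representative functions separate points (`exists_repAlg_separates`), hence are
dense. The formula for D² has leading part -∑ e_j² and a first-order remainder, which gives a
Gårding inequality (`exists_garding`). Averaging over a small neighbourhood of 1 together with
Bessel's inequality bounds the number of orthonormal functions with bounded derivatives
(`exists_card_le`). So only finitely many eigenvalues of D² lie below any bound, and there is a
least non-zero one (`exists_isLeast_eigenvalue`). Freezing all generators but γ sends an eigenvector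
of D_γ² to an eigenvector of D², so each D_γ has the same gap (`gap_prodCore`).

F lies in the von Neumann algebra by the double commutant. An operator that commutes with B(L²) ⊗ 1
is a matrix of scalars, so it can be carried past derivatives by integration by parts. If it also
commutes with the Clifford algebra, it commutes weakly with each D_γ, hence has no matrix elements
between different blocks and commutes with F (`inner_commutant_connDirac`, `commute_quotient`). -/

/-- A dense subspace of a Hilbert space with pairwise anticommuting symmetric operators, such that
each vector lies in a finite-dimensional invariant subspace on which almost all of them vanish. -/
structure DiracCore (H : Type*) [NormedAddCommGroup H] [InnerProductSpace ℂ H] (ι : Type*) where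
  /-- the common domain -/
  K : Submodule ℂ H
  dense : Dense (K : Set H)
  /-- the operators -/
  D : ι → Module.End ℂ K
  symm : ∀ γ, (D γ).IsSymmetric
  anti : ∀ γ γ', γ ≠ γ' → D γ * D γ' = -(D γ' * D γ)
  locfin : ∀ u : K, ∃ U : Submodule ℂ K, u ∈ U ∧ FiniteDimensional ℂ U ∧
    (∀ γ, ∀ v ∈ U, D γ v ∈ U) ∧ {γ | ∃ v ∈ U, D γ v ≠ 0}.Finite

namespace DiracCore

variable {H : Type*} [NormedAddCommGroup H] [InnerProductSpace ℂ H] {ι : Type*}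
variable (C : DiracCore H ι)

lemma finite_support (a : ι → ℝ) (u : C.K) :
    (Function.support fun γ => (a γ : ℂ) • C.D γ u).Finite := by
  obtain ⟨U, hu, -, -, hf⟩ := C.locfin u
  refine hf.subset fun γ hγ => ⟨u, hu, fun h => hγ ?_⟩
  simp [h]

/-- The operator `∑ γ, a γ • D γ`. -/
def A (a : ι → ℝ) : Module.End ℂ C.K where
  toFun u := ∑ᶠ γ, (a γ : ℂ) • C.D γ u
  map_add' u v := by
    rw [← finsum_add_distrib (C.finite_support a u) (C.finite_support a v)]
    simp
  map_smul' z u := by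
    rw [RingHom.id_apply, smul_finsum' _ (C.finite_support a u)]
    refine finsum_congr fun γ => ?_
    rw [map_smul, smul_comm]

lemma A_apply (a : ι → ℝ) (u : C.K) : C.A a u = ∑ᶠ γ, (a γ : ℂ) • C.D γ u := rfl

lemma A_eq_sum (a : ι → ℝ) (u : C.K) {s : Finset ι} (hs : ∀ γ, C.D γ u ≠ 0 → γ ∈ s) :
    C.A a u = ∑ γ ∈ s, (a γ : ℂ) • C.D γ u := by
  rw [A_apply]
  refine finsum_eq_sum_of_support_subset _ fun γ hγ => hs γ fun h => hγ ?_
  simp [h]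

lemma exists_finset (u : C.K) : ∃ (U : Submodule ℂ C.K) (s : Finset ι), u ∈ U ∧
    FiniteDimensional ℂ U ∧ (∀ γ, ∀ v ∈ U, C.D γ v ∈ U) ∧ (∀ γ, ∀ v ∈ U, C.D γ v ≠ 0 → γ ∈ s) := by
  obtain ⟨U, hu, h1, h2, hf⟩ := C.locfin u
  exact ⟨U, hf.toFinset, hu, h1, h2, fun γ v hv h => by simpa using ⟨v, v.2, hv, h⟩⟩

lemma exists_finset_pair (u v : C.K) : ∃ s : Finset ι,
    (∀ γ, C.D γ u ≠ 0 → γ ∈ s) ∧ (∀ γ, C.D γ v ≠ 0 → γ ∈ s) := by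
  classical
  obtain ⟨_, s, hu, -, -, hs⟩ := C.exists_finset u
  obtain ⟨_, t, hv, -, -, ht⟩ := C.exists_finset v
  exact ⟨s ∪ t, fun γ h => Finset.mem_union_left _ (hs γ u hu h),
    fun γ h => Finset.mem_union_right _ (ht γ v hv h)⟩

lemma A_symm (a : ι → ℝ) : (C.A a).IsSymmetric := by
  intro u v
  obtain ⟨s, hu, hv⟩ := C.exists_finset_pair u v
  rw [C.A_eq_sum a u hu, C.A_eq_sum a v hv, sum_inner, inner_sum]
  refine Finset.sum_congr rfl fun γ _ => ?_
  rw [inner_smul_left, inner_smul_right, C.symm γ u v, Complex.conj_ofReal]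

lemma A_mem (a : ι → ℝ) {U : Submodule ℂ C.K} (hU : ∀ γ, ∀ v ∈ U, C.D γ v ∈ U) {v : C.K}
    (hv : v ∈ U) : C.A a v ∈ U := by
  obtain ⟨s, hs, -⟩ := C.exists_finset_pair v v
  rw [C.A_eq_sum a v hs]
  exact Submodule.sum_mem _ fun γ _ => U.smul_mem _ (hU γ v hv)

/-- For different indices, passing D γ' twice costs two signs. Consequently the squares commute, and
every D γ preserves their joint eigenspaces. -/
lemma D_sq_commute (γ γ' : ι) : Commute (C.D γ) (C.D γ' * C.D γ') := by
  by_cases h : γ = γ'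
  · subst h; exact (Commute.refl _).mul_right (Commute.refl _)
  · have h1 := C.anti γ γ' h
    have h2 : ∀ v, C.D γ (C.D γ' v) = -C.D γ' (C.D γ v) := fun v =>
      congrArg (fun f : Module.End ℂ C.K => f v) h1
    refine LinearMap.ext fun v => ?_
    simp only [mul_apply]
    rw [h2, h2, map_neg, neg_neg]

/-- The cross terms of the square cancel in pairs by anticommutation. -/
lemma A_sq (a : ι → ℝ) (u : C.K) {s : Finset ι} (U : Submodule ℂ C.K) (hu : u ∈ U)
    (hU : ∀ γ, ∀ v ∈ U, C.D γ v ∈ U) (hs : ∀ γ, ∀ v ∈ U, C.D γ v ≠ 0 → γ ∈ s) :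
    C.A a (C.A a u) = ∑ γ ∈ s, ((a γ ^ 2 : ℝ) : ℂ) • C.D γ (C.D γ u) := by
  classical
  have key : C.A a (C.A a u) = ∑ γ ∈ s, ∑ γ' ∈ s, ((a γ * a γ' : ℝ) : ℂ) • C.D γ (C.D γ' u) := by
    rw [C.A_eq_sum a _ (fun γ => hs γ _ (C.A_mem a hU hu))]
    refine Finset.sum_congr rfl fun γ _ => ?_
    rw [C.A_eq_sum a u (fun γ => hs γ _ hu), map_sum, Finset.smul_sum]
    refine Finset.sum_congr rfl fun γ' _ => ?_
    rw [map_smul, smul_smul, Complex.ofReal_mul]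
  -- Adding the double sum to its transpose puts D γ D γ' next to D γ' D γ, so that only the
  -- diagonal terms survive, twice.
  have two : (2 : ℂ) • C.A a (C.A a u)
      = (2 : ℂ) • ∑ γ ∈ s, ((a γ ^ 2 : ℝ) : ℂ) • C.D γ (C.D γ u) := by
    rw [two_smul]
    conv_lhs => rw [key]; enter [2]; rw [Finset.sum_comm]
    rw [← Finset.sum_add_distrib, Finset.smul_sum]
    refine Finset.sum_congr rfl fun γ hγ => ?_
    rw [← Finset.sum_add_distrib, Finset.sum_eq_single γ]
    · rw [two_smul, sq]
    · intro γ' _ hne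
      have h := congrArg (fun f : Module.End ℂ C.K => f u) (C.anti γ γ' hne.symm)
      simp only [mul_apply, LinearMap.neg_apply] at h
      rw [h, smul_neg, mul_comm, neg_add_cancel]
    · exact fun h => absurd hγ h
  exact smul_right_injective _ (two_ne_zero' ℂ) two

/-! #### The closed operators -/

/-- The graph of the adjoint of `∑ γ, a γ • D γ`. -/
def G (a : ι → ℝ) : Submodule ℂ (H × H) where
  carrier := {p | ∀ u : C.K, ⟪p.2, (u : H)⟫_ℂ = ⟪p.1, (C.A a u : H)⟫_ℂ}
  add_mem' hp hp' u := by simp [hp u, hp' u]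
  zero_mem' u := by simp
  smul_mem' z p hp u := by simp [hp u]

lemma mem_G {a : ι → ℝ} {p : H × H} :
    p ∈ C.G a ↔ ∀ u : C.K, ⟪p.2, (u : H)⟫_ℂ = ⟪p.1, (C.A a u : H)⟫_ℂ := Iff.rfl

lemma isClosed_G (a : ι → ℝ) : IsClosed (C.G a : Set (H × H)) := by
  have : (C.G a : Set (H × H))
      = ⋂ u : C.K, {p : H × H | ⟪p.2, (u : H)⟫_ℂ = ⟪p.1, (C.A a u : H)⟫_ℂ} := by
    ext p; simp [mem_G]
  rw [this]
  exact isClosed_iInter fun u => isClosed_eq (by fun_prop) (by fun_prop)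

lemma core_mem_G (a : ι → ℝ) (u : C.K) : ((u : H), (C.A a u : H)) ∈ C.G a := fun v => by
  have := C.A_symm a u v
  rwa [Submodule.coe_inner, Submodule.coe_inner] at this

lemma eq_zero_of_inner {v : H} (h : ∀ u : C.K, ⟪v, (u : H)⟫_ℂ = 0) : v = 0 :=
  C.dense.eq_zero_of_inner_left ℂ fun u hu => h ⟨u, hu⟩

lemma G_functional (a : ι → ℝ) (x : H × H) (hx : x ∈ C.G a) (h : x.1 = 0) : x.2 = 0 :=
  C.eq_zero_of_inner fun u => by rw [hx u, h, inner_zero_left]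

/-- The closure of `∑ γ, a γ • D γ`. -/
def op (a : ι → ℝ) : H →ₗ.[ℂ] H := (C.G a).toLinearPMap

lemma graph_op (a : ι → ℝ) : (C.op a).graph = C.G a :=
  Submodule.toLinearPMap_graph_eq _ (C.G_functional a)

/-- Since ⟪u, w⟫ is real, the imaginary part of ⟪u, w - z u⟫ is -Im z ‖u‖². This one estimate gives
injectivity of A - z, the Cauchy property below, and the resolvent bound. -/
lemma norm_im_le {V : Type*} [NormedAddCommGroup V] [InnerProductSpace ℂ V] {u w : V}
    (h : ⟪w, u⟫_ℂ = ⟪u, w⟫_ℂ) (z : ℂ) : |z.im| * ‖u‖ ≤ ‖w - z • u‖ := by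
  have h1 : (⟪u, w - z • u⟫_ℂ).im = - (z.im * ‖u‖ ^ 2) := by
    have h2 : (⟪u, w⟫_ℂ).im = 0 := by
      have := inner_conj_symm (𝕜 := ℂ) u w
      rw [h] at this
      exact Complex.conj_eq_iff_im.1 this
    have h3 : ⟪u, u⟫_ℂ = ((‖u‖ ^ 2 : ℝ) : ℂ) := by
      rw [inner_self_eq_norm_sq_to_K]; norm_cast
    rw [inner_sub_right, inner_smul_right, h3, Complex.sub_im, h2, Complex.im_mul_ofReal, zero_sub]
  have h3 : |z.im| * ‖u‖ ^ 2 ≤ ‖u‖ * ‖w - z • u‖ := by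
    calc |z.im| * ‖u‖ ^ 2 = |(⟪u, w - z • u⟫_ℂ).im| := by
          rw [h1, abs_neg, abs_mul, abs_of_nonneg (sq_nonneg ‖u‖)]
      _ ≤ ‖⟪u, w - z • u⟫_ℂ‖ := Complex.abs_im_le_norm _
      _ ≤ _ := norm_inner_le_norm _ _
  rcases eq_or_lt_of_le (norm_nonneg u) with h0 | h0
  · rw [← h0, mul_zero]; exact norm_nonneg _
  · nlinarith

/-- A - z is injective by `norm_im_le`, hence surjective on a finite-dimensional invariant subspace.
-/
lemma exists_sub_eq (a : ι → ℝ) {z : ℂ} (hz : z.im ≠ 0) {U : Submodule ℂ C.K}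
    [FiniteDimensional ℂ U] (hU : ∀ γ, ∀ v ∈ U, C.D γ v ∈ U) (v : C.K) (hv : v ∈ U) :
    ∃ u ∈ U, C.A a u - z • u = v := by
  let f : U →ₗ[ℂ] U := ((C.A a) - z • LinearMap.id).restrict (p := U) (q := U) fun w hw =>
    U.sub_mem (C.A_mem a hU hw) (U.smul_mem _ hw)
  have hinj : Function.Injective f := by
    rw [injective_iff_map_eq_zero]
    intro w hw
    have hw' : C.A a w - z • (w : C.K) = 0 := congrArg Subtype.val hw
    have := norm_im_le (C.A_symm a w w) z
    rw [hw', norm_zero] at this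
    have h2 : ‖(w : C.K)‖ = 0 := by
      have h3 := abs_pos.2 hz
      nlinarith [norm_nonneg (w : C.K)]
    exact Subtype.ext (norm_eq_zero.1 h2)
  obtain ⟨u, hu⟩ := (LinearMap.injective_iff_surjective.1 hinj) ⟨v, hv⟩
  exact ⟨u, u.2, congrArg Subtype.val hu⟩

variable [CompleteSpace H]

/-- Every pair `(v, w + z v)` with `w` arbitrary is reached in the closure of the core. -/
lemma exists_mem_closure (a : ι → ℝ) {z : ℂ} (hz : z.im ≠ 0) (v : H) :
    ∃ u : H, (u, v + z • u) ∈ closure (Set.range fun x : C.K => ((x : H), (C.A a x : H))) := by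
  have hr : ∀ x : C.K, ∃ y : C.K, C.A a y - z • y = x := fun x => by
    obtain ⟨U, hx, hfd, hU, -⟩ := C.locfin x
    obtain ⟨y, -, hy⟩ := C.exists_sub_eq a hz hU x hx
    exact ⟨y, hy⟩
  obtain ⟨x, hxK, hx⟩ := mem_closure_iff_seq_limit.1 (C.dense v)
  choose y hy using fun n => hr ⟨x n, hxK n⟩
  have hcauchy : CauchySeq fun n => ((y n : C.K) : H) := by
    have hxc := hx.cauchySeq
    rw [Metric.cauchySeq_iff'] at hxc ⊢
    intro e he
    obtain ⟨N, hN⟩ := hxc (|z.im| * e) (mul_pos (abs_pos.2 hz) he)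
    refine ⟨N, fun n hn => ?_⟩
    have h1 := norm_im_le (C.A_symm a (y n - y N) (y n - y N)) z
    have h2 : C.A a (y n - y N) - z • (y n - y N) = ⟨x n, hxK n⟩ - ⟨x N, hxK N⟩ := by
      rw [← hy n, ← hy N, map_sub, smul_sub]; abel
    rw [h2] at h1
    have h3 := hN n hn
    rw [dist_eq_norm] at h3 ⊢
    have h4 : |z.im| * ‖((y n : C.K) : H) - (y N : C.K)‖ ≤ ‖x n - x N‖ := h1
    exact lt_of_mul_lt_mul_left (h4.trans_lt h3) (abs_nonneg _)
  obtain ⟨u, hu⟩ := cauchySeq_tendsto_of_complete hcauchy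
  refine ⟨u, mem_closure_iff_seq_limit.2 ⟨fun n => ((y n : H), (C.A a (y n) : H)),
    fun n => ⟨y n, rfl⟩, ?_⟩⟩
  refine hu.prodMk_nhds ?_
  have : ∀ n, ((C.A a (y n) : C.K) : H) = x n + z • (y n : H) := fun n => by
    have := congrArg (Subtype.val) (hy n)
    rw [Submodule.coe_sub, Submodule.coe_smul] at this
    exact sub_eq_iff_eq_add.1 this
  simp only [this]
  exact hx.add (hu.const_smul z)

/-- Essential self-adjointness. Given (v, w) in the adjoint graph, let u be in the domain of the
closure with (A - i) u = w - i v. Then v - u is orthogonal to the range of A + i on the core, and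
this range is the whole core. -/
lemma G_eq_closure (a : ι → ℝ) :
    (C.G a : Set (H × H)) = closure (Set.range fun x : C.K => ((x : H), (C.A a x : H))) := by
  refine Set.Subset.antisymm ?_ (closure_minimal ?_ (C.isClosed_G a))
  · rintro ⟨v, w⟩ hvw
    obtain ⟨u, hu⟩ := C.exists_mem_closure a (z := Complex.I) (by simp) (w - Complex.I • v)
    have huG : (u, w - Complex.I • v + Complex.I • u) ∈ C.G a :=
      closure_minimal (t := (C.G a : Set (H × H))) (by rintro _ ⟨x, rfl⟩; exact C.core_mem_G a x)
        (C.isClosed_G a) hu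
    have hd := (C.G a).sub_mem hvw huG
    have hvu : v - u = 0 := by
      refine C.eq_zero_of_inner fun x => ?_
      obtain ⟨U, hx, hfd, hU, -⟩ := C.locfin x
      obtain ⟨y, -, hy⟩ := C.exists_sub_eq a (z := -Complex.I) (by simp) hU x hx
      have h1 := hd y
      have h2 : ((v, w) - (u, w - Complex.I • v + Complex.I • u) : H × H).2
          = Complex.I • (v - u) := by
        simp only [Prod.snd_sub, smul_sub]; abel
      rw [h2, inner_smul_left] at h1
      rw [← hy]
      simp only [Prod.fst_sub, Complex.conj_I] at h1
      rw [Submodule.coe_sub, inner_sub_right, Submodule.coe_smul, inner_smul_right, h1, sub_self]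
    have : u = v := (sub_eq_zero.1 hvu).symm
    subst this
    simpa using hu
  · rintro _ ⟨x, rfl⟩; exact C.core_mem_G a x

/-- By `G_eq_closure` the graph on the core and the adjoint graph have the same closure, so
everything in between generates the same operator. This lemma identifies the basic Dirac operator,
the weighted sums and the derivative. -/
lemma closedOperator_eq_op (a : ι → ℝ) (Γ : Set (H × H))
    (h1 : ∀ u : C.K, ((u : H), (C.A a u : H)) ∈ Γ) (h2 : ∀ p ∈ Γ, p ∈ C.G a) :
    closedOperator Γ = C.op a := by
  unfold closedOperator op
  congr 1
  apply le_antisymm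
  · exact Submodule.topologicalClosure_minimal _ (Submodule.span_le.2 h2) (C.isClosed_G a)
  · intro p hp
    have hp' : p ∈ (C.G a : Set (H × H)) := hp
    rw [G_eq_closure] at hp'
    refine closure_mono ?_ hp'
    rintro _ ⟨x, rfl⟩
    exact Submodule.subset_span (h1 x)

lemma inner_G {a : ι → ℝ} {p p' : H × H} (hp : p ∈ C.G a) (hp' : p' ∈ C.G a) :
    ⟪p.2, p'.1⟫_ℂ = ⟪p.1, p'.2⟫_ℂ := by
  have h : p' ∈ (C.G a : Set (H × H)) := hp'
  rw [G_eq_closure] at h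
  refine closure_minimal (t := {p' : H × H | ⟪p.2, p'.1⟫_ℂ = ⟪p.1, p'.2⟫_ℂ}) ?_
    (isClosed_eq (by fun_prop) (by fun_prop)) h
  rintro _ ⟨x, rfl⟩
  exact hp x

lemma dense_domain_op (a : ι → ℝ) : Dense ((C.op a).domain : Set H) := by
  refine C.dense.mono fun u hu => ?_
  rw [SetLike.mem_coe, LinearPMap.mem_domain_iff]
  exact ⟨_, (C.graph_op a).symm ▸ C.core_mem_G a ⟨u, hu⟩⟩

lemma isSelfAdjoint_op (a : ι → ℝ) : IsSelfAdjoint (C.op a) := by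
  rw [LinearPMap.isSelfAdjoint_def]
  apply LinearPMap.eq_of_eq_graph
  rw [LinearPMap.adjoint_graph_eq_graph_adjoint (C.dense_domain_op a), graph_op]
  ext x
  rw [Submodule.mem_adjoint_iff]
  constructor
  · intro h u
    have := h _ _ (C.core_mem_G a u)
    rw [sub_eq_zero] at this
    rw [← inner_conj_symm, ← this, inner_conj_symm]
  · intro h p1 p2 hp
    rw [sub_eq_zero]
    exact C.inner_G (p := (p1, p2)) (p' := x) hp h

lemma mem_G_of_mem_closure {a : ι → ℝ} {p : H × H}
    (h : p ∈ closure (Set.range fun x : C.K => ((x : H), (C.A a x : H)))) : p ∈ C.G a := by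
  have : p ∈ (C.G a : Set (H × H)) := by rw [G_eq_closure]; exact h
  exact this

lemma resolvent_bound {a : ι → ℝ} {z : ℂ} {u v : H} (h : (u, v + z • u) ∈ C.G a) :
    |z.im| * ‖u‖ ≤ ‖v‖ := by
  have := norm_im_le (u := u) (w := v + z • u) (C.inner_G h h) z
  simpa using this

/-- Strong resolvent convergence of operators which agree eventually on each index. -/
lemma strongResolventTendsto_op (a : ι → ℝ) (b : ℕ → ι → ℝ)
    (hb : ∀ γ, ∀ᶠ n in atTop, b n γ = a γ) :
    StrongResolventTendsto (fun n => C.op (b n)) (C.op a) := by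
  intro z hz v
  simp only [graph_op]
  choose u hu using fun n => C.exists_mem_closure (b n) hz v
  obtain ⟨u', hu'⟩ := C.exists_mem_closure a hz v
  replace hu n := C.mem_G_of_mem_closure (hu n)
  replace hu' := C.mem_G_of_mem_closure hu'
  refine ⟨u, u', hu, hu', ?_⟩
  rw [Metric.tendsto_atTop']
  intro e he
  have hz' := abs_pos.2 hz
  -- The tolerance is chosen so that the resolvent at z, of norm at most 1 / |Im z|, moves the error
  -- by less than e / 2.
  obtain ⟨x, hxK, hx⟩ := Metric.mem_closure_iff.1 (C.dense v) (|z.im| * (e / 2)) (by positivity)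
  obtain ⟨U, s, hxU, hfd, hU, hs⟩ := C.exists_finset ⟨x, hxK⟩
  obtain ⟨y, hyU, hy⟩ := C.exists_sub_eq a hz hU ⟨x, hxK⟩ hxU
  have hev : ∀ᶠ n in atTop, ∀ γ ∈ s, b n γ = a γ := (eventually_all_finset s).2 fun γ _ => hb γ
  obtain ⟨N, hN⟩ := eventually_atTop.1 hev
  refine ⟨N, fun n hn => ?_⟩
  have hyx : ((C.A a y : C.K) : H) = x + z • (y : H) := by
    have := congrArg (Subtype.val) hy
    rw [Submodule.coe_sub, Submodule.coe_smul] at this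
    rw [← sub_eq_iff_eq_add]; exact this
  -- Once b n agrees with a on the finite set s, the vector y solves the resolvent equation at x for
  -- both operators. So y lies within e / 2 of both resolvents at v.
  have hAn : C.A (b n) y = C.A a y := by
    rw [C.A_eq_sum (b n) y (fun γ => hs γ y hyU), C.A_eq_sum a y (fun γ => hs γ y hyU)]
    exact Finset.sum_congr rfl fun γ hγ => by rw [hN n hn.le γ hγ]
  have est : ∀ (c : ι → ℝ) (w : H), C.A c y = C.A a y → (w, v + z • w) ∈ C.G c →
      ‖w - y‖ < e / 2 := by
    intro c w hc hw
    have h1 := C.core_mem_G c y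
    rw [hc, hyx] at h1
    have h2 : (w - y, (v - x) + z • (w - (y : H))) ∈ C.G c := by
      have := (C.G c).sub_mem hw h1
      convert! this using 1
      simp only [Prod.mk_sub_mk, Prod.mk.injEq, smul_sub, true_and]; abel
    have h3 := C.resolvent_bound h2
    rw [dist_eq_norm] at hx
    exact lt_of_mul_lt_mul_left (h3.trans_lt hx) hz'.le
  have e1 := est (b n) (u n) hAn (hu n)
  have e2 := est a u' rfl hu'
  rw [dist_eq_norm]
  calc ‖u n - u'‖ = ‖(u n - y) - (u' - y)‖ := by abel_nf
    _ ≤ _ := norm_sub_le _ _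
    _ < e := by linarith

/-- The derivative of a family of the operators is the operator of the derivatives. -/
lemma derivOperator_op (a : ι → ℝ → ℝ) (b : ι → ℝ) {J : Set ℝ} {t : ℝ} (ht : t ∈ J)
    (hJ : UniqueDiffWithinAt ℝ J t) (hab : ∀ γ, HasDerivWithinAt (a γ) (b γ) J t) :
    derivOperator (fun s => C.op fun γ => a γ s) J t = C.op b := by
  have hd : ∀ u : C.K, HasDerivWithinAt (fun s => (C.A (fun γ => a γ s) u : H)) (C.A b u) J t := by
    intro u
    obtain ⟨s, hs, -⟩ := C.exists_finset_pair u u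
    simp only [C.A_eq_sum _ u hs, Submodule.coe_sum, Submodule.coe_smul]
    refine HasDerivWithinAt.fun_sum fun γ _ => ?_
    exact ((hab γ).ofReal_comp).smul_const _
  unfold derivOperator
  simp only [graph_op]
  apply C.closedOperator_eq_op
  · intro u
    exact ⟨_, Eventually.of_forall fun s => C.core_mem_G _ u, hd u⟩
  -- For a general vector v of the derivative's domain, pair with a core vector u and move the
  -- operators over to u, where the derivative is known. Uniqueness of derivatives puts (v, w) in
  -- the adjoint graph.
  · rintro ⟨v, w⟩ ⟨φ, hφ, hφ'⟩ u
    have h1 : HasDerivWithinAt (fun s => ⟪(u : H), φ s⟫_ℂ) ⟪(u : H), w⟫_ℂ J t :=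
      ((innerSL ℂ (u : H)).restrictScalars ℝ).hasFDerivAt.comp_hasDerivWithinAt t hφ'
    have h2 : HasDerivWithinAt (fun s => ⟪(C.A (fun γ => a γ s) u : H), v⟫_ℂ)
        ⟪(C.A b u : H), v⟫_ℂ J t := by
      have := (hd u).inner ℂ (hasDerivWithinAt_const t J v)
      simpa using this
    have h3 : (fun s => ⟪(u : H), φ s⟫_ℂ) =ᶠ[𝓝[J] t]
        fun s => ⟪(C.A (fun γ => a γ s) u : H), v⟫_ℂ := by
      filter_upwards [hφ] with s hs
      rw [← inner_conj_symm, ← inner_conj_symm _ v, hs u]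
    have h4 : ⟪(u : H), w⟫_ℂ = ⟪(C.A b u : H), v⟫_ℂ :=
      hJ.eq_deriv _ h1 (h2.congr_of_eventuallyEq_of_mem h3 ht)
    change ⟪w, (u : H)⟫_ℂ = ⟪v, (C.A b u : H)⟫_ℂ
    rw [← inner_conj_symm, h4, inner_conj_symm]

end DiracCore

end AGN

end

noncomputable section

namespace AGN

open Module.End

/-! ### Functional calculus on eigenvectors. -/

section Calculus

variable {H : Type*} [NormedAddCommGroup H] [InnerProductSpace ℂ H] [CompleteSpace H]

/-- The continuous functional calculus acts on eigenvectors through the eigenvalue. -/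
lemma cfc_apply_eigenvector {B : H →L[ℂ] H} (hB : IsSelfAdjoint B) {x : H} {r : ℝ}
    (hx : B x = (r : ℂ) • x) {f : ℝ → ℝ} (hf : Continuous f) :
    (cfc f B : H →L[ℂ] H) x = (f r : ℂ) • x := by
  rcases eq_or_ne x 0 with rfl | hx0
  · simp
  have hr : r ∈ spectrum ℝ B := by
    rw [spectrum.mem_iff]
    rintro ⟨u, hu⟩
    have h1 : (u : H →L[ℂ] H) x = 0 := by
      rw [hu, _root_.sub_apply, hx, Algebra.algebraMap_eq_smul_one]
      simp
    have h2 : ((u⁻¹ : (H →L[ℂ] H)ˣ) : H →L[ℂ] H) ((u : H →L[ℂ] H) x) = x := by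
      rw [← mul_apply_eq_comp, Units.inv_mul]; rfl
    exact hx0 (by rw [← h2, h1, map_zero])
  have : CompactSpace (spectrum ℝ B) :=
    isCompact_iff_compactSpace.1 (ContinuousFunctionalCalculus.isCompact_spectrum B)
  rw [cfc_apply f B hB hf.continuousOn]
  -- The property is stable under sums, products and limits and holds for the identity and the
  -- constants, so it holds for all continuous functions on the spectrum.
  have key : ∀ φ : C(spectrum ℝ B, ℝ), cfcHom hB φ x = (φ ⟨r, hr⟩ : ℂ) • x := by
    intro φ
    induction φ using ContinuousMap.induction_on_of_compact with
    | const c =>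
      have : ContinuousMap.const (spectrum ℝ B) c = algebraMap ℝ C(spectrum ℝ B, ℝ) c := rfl
      rw [this, AlgHomClass.commutes, Algebra.algebraMap_eq_smul_one]
      simp
    | id => rw [cfcHom_id hB, hx]; rfl
    | star_id => rw [star_trivial, cfcHom_id hB, hx]; rfl
    | add f g h1 h2 => simp [h1, h2, add_smul]
    | mul f g h1 h2 =>
      rw [map_mul, mul_apply_eq_comp, h2,
        map_smul, h1, smul_smul, mul_comm]
      norm_cast
    | frequently f h =>
      refine h.mem_of_closed (isClosed_eq ?_ ?_)
      · exact (ContinuousLinearMap.apply ℂ H x).continuous.comp (cfcHom_continuous hB)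
      · exact (Complex.continuous_ofReal.comp (ContinuousEvalConst.continuous_eval_const _)).smul
          continuous_const
  exact key _

/-- The hypotheses say that (u, w) lies in the graph and that (v, 0) - (u, w) is orthogonal to it.
So (u, w) is the projection of (v, 0). -/
lemma invOneAddSq_apply {T : H →ₗ.[ℂ] H} {u v w : H} (h : (u, w) ∈ T.graph)
    (h2 : ∀ p ∈ T.graph, ⟪v - u, p.1⟫_ℂ = ⟪w, p.2⟫_ℂ) : invOneAddSq T v = u := by
  have hz : (WithLp.toLp 2 (u, w) : WithLp 2 (H × H))
      = (graphL2 T).starProjection (WithLp.toLp 2 (v, 0)) := by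
    apply (Submodule.eq_starProjection_of_mem_of_inner_eq_zero _ _).symm
    · exact Submodule.le_topologicalClosure _ ⟨(u, w), h, rfl⟩
    · intro z hz
      refine closure_minimal (t := {z | ⟪WithLp.toLp 2 (v, 0) - WithLp.toLp 2 (u, w), z⟫_ℂ = 0})
        ?_ (isClosed_eq (by fun_prop) continuous_const) hz
      rintro _ ⟨p, hp, rfl⟩
      change ⟪v - u, p.1⟫_ℂ + ⟪(0 : H) - w, p.2⟫_ℂ = 0
      rw [h2 p hp, zero_sub, inner_neg_left, add_neg_cancel]
  change ((graphL2 T).starProjection (WithLp.toLp 2 (v, 0))).fst = u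
  rw [← hz]
  rfl

lemma isSelfAdjoint_invOneAddSq (T : H →ₗ.[ℂ] H) : IsSelfAdjoint (invOneAddSq T) := by
  rw [ContinuousLinearMap.isSelfAdjoint_iff_isSymmetric]
  intro v w
  have h1 : ∀ v w : H, ⟪invOneAddSq T v, w⟫_ℂ
      = ⟪(graphL2 T).starProjection (WithLp.toLp 2 (v, 0)), WithLp.toLp 2 (w, 0)⟫_ℂ := fun v w => by
    rw [WithLp.prod_inner_apply]
    simp [invOneAddSq]
  have h2 := h1 w v
  rw [ContinuousLinearMap.coe_coe, h1, Submodule.inner_starProjection_left_eq_right,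
    ← inner_conj_symm, ← h2, inner_conj_symm]

end Calculus

/-- A commuting family of symmetric operators is jointly diagonalizable on a finite-dimensional
invariant subspace. -/
lemma mem_iSup_joint_eigenspace {V ι : Type*} [NormedAddCommGroup V] [InnerProductSpace ℂ V]
    (T : ι → Module.End ℂ V) (hT : ∀ γ, (T γ).IsSymmetric) (hc : ∀ γ γ', Commute (T γ) (T γ'))
    (U : Submodule ℂ V) [FiniteDimensional ℂ U] (hU : ∀ γ, ∀ v ∈ U, T γ v ∈ U) {u : V}
    (hu : u ∈ U) : u ∈ ⨆ χ : ι → ℂ, ⨅ γ, eigenspace (T γ) (χ γ) := by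
  have h1 : ⨆ χ : ι → ℂ, ⨅ γ, eigenspace ((T γ).restrict (hU γ)) (χ γ) = ⊤ := by
    refine LinearMap.IsSymmetric.iSup_iInf_eq_top_of_commute
      (fun γ => (hT γ).restrict_invariant (hU γ)) fun γ γ' _ => ?_
    refine LinearMap.ext fun v => Subtype.ext ?_
    exact congrArg (fun f : Module.End ℂ V => f v) (hc γ γ').eq
  have h2 : (⟨u, hu⟩ : U) ∈ ⨆ χ : ι → ℂ, ⨅ γ, eigenspace ((T γ).restrict (hU γ)) (χ γ) :=
    h1 ▸ Submodule.mem_top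
  have h3 := Submodule.mem_map_of_mem (f := U.subtype) h2
  rw [Submodule.map_iSup] at h3
  refine (show (⨆ χ : ι → ℂ, Submodule.map U.subtype
    (⨅ γ, eigenspace ((T γ).restrict (hU γ)) (χ γ))) ≤ _ from iSup_mono fun χ => ?_) h3
  rintro _ ⟨v, hv, rfl⟩
  refine (Submodule.mem_iInf _).2 fun γ => ?_
  have h4 := (Submodule.mem_iInf _).1 hv γ
  rw [mem_eigenspace_iff] at h4 ⊢
  exact congrArg Subtype.val h4

namespace DiracCore

variable {H : Type*} [NormedAddCommGroup H] [InnerProductSpace ℂ H] {ι : Type*}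
variable (C : DiracCore H ι)

/-! #### Joint eigenspaces -/

/-- The joint eigenspaces of the squares of the operators. -/
def block (χ : ι → ℂ) : Submodule ℂ C.K := ⨅ γ, eigenspace (C.D γ * C.D γ) (χ γ)

lemma mem_block {χ : ι → ℂ} {u : C.K} : u ∈ C.block χ ↔ ∀ γ, C.D γ (C.D γ u) = χ γ • u := by
  simp [block, Submodule.mem_iInf]

lemma D_sq_symm (γ : ι) : (C.D γ * C.D γ).IsSymmetric := fun u v => by
  simp only [mul_apply]
  rw [C.symm γ, C.symm γ]

lemma orthogonalFamily_block :
    OrthogonalFamily ℂ (fun χ => C.block χ) fun χ => (C.block χ).subtypeₗᵢ :=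
  LinearMap.IsSymmetric.orthogonalFamily_iInf_eigenspaces C.D_sq_symm

/-- Local finiteness places each core vector in a finite-dimensional invariant subspace, on which
the commuting symmetric squares are simultaneously diagonalizable. -/
lemma iSup_block : ⨆ χ, C.block χ = ⊤ := by
  rw [eq_top_iff]
  intro u _
  obtain ⟨U, hu, hfd, hU, -⟩ := C.locfin u
  exact mem_iSup_joint_eigenspace (fun γ => C.D γ * C.D γ) C.D_sq_symm
    (fun γ γ' => (C.D_sq_commute γ γ').mul_left (C.D_sq_commute γ γ')) U
    (fun γ v hv => hU γ _ (hU γ v hv)) hu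

lemma block_induction {p : C.K → Prop} (h0 : p 0) (hadd : ∀ u v, p u → p v → p (u + v))
    (h : ∀ χ, ∀ u ∈ C.block χ, p u) (u : C.K) : p u :=
  Submodule.iSup_induction C.block (motive := p) (C.iSup_block ▸ Submodule.mem_top) h h0 hadd

open scoped Classical in
lemma bijective_coeLinearMap_block : Function.Bijective (DirectSum.coeLinearMap C.block) :=
  (DirectSum.isInternal_submodule_iff_iSupIndep_and_iSup_eq_top C.block).2
    ⟨C.orthogonalFamily_block.independent, C.iSup_block⟩

open scoped Classical in
/-- The operator which is multiplication by `φ χ` on each joint eigenspace. -/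
def diag (φ : (ι → ℂ) → ℝ) : Module.End ℂ C.K :=
  DirectSum.toModule ℂ _ C.K (fun χ => (φ χ : ℂ) • (C.block χ).subtype) ∘ₗ
    (LinearEquiv.ofBijective (DirectSum.coeLinearMap C.block) C.bijective_coeLinearMap_block).symm.toLinearMap

lemma diag_apply (φ : (ι → ℂ) → ℝ) {χ : ι → ℂ} {u : C.K} (hu : u ∈ C.block χ) :
    C.diag φ u = (φ χ : ℂ) • u := by
  classical
  have h1 : (LinearEquiv.ofBijective (DirectSum.coeLinearMap C.block) C.bijective_coeLinearMap_block).symm u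
      = DirectSum.lof ℂ _ (fun χ => C.block χ) χ ⟨u, hu⟩ := by
    rw [LinearEquiv.symm_apply_eq, LinearEquiv.ofBijective_apply, DirectSum.coeLinearMap_lof]
  rw [diag, LinearMap.comp_apply, LinearEquiv.coe_coe, h1, DirectSum.toModule_lof]
  rfl

lemma A_mem_block (b : ι → ℝ) {χ : ι → ℂ} {u : C.K} (hu : u ∈ C.block χ) :
    C.A b u ∈ C.block χ := by
  obtain ⟨s, hs, -⟩ := C.exists_finset_pair u u
  rw [C.A_eq_sum b u hs]
  refine Submodule.sum_mem _ fun γ _ => Submodule.smul_mem _ _ ?_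
  rw [C.mem_block] at hu ⊢
  intro γ'
  have := congrArg (fun f : Module.End ℂ C.K => f u) (C.D_sq_commute γ γ').eq
  simp only [mul_apply] at this
  rw [← this, hu γ', map_smul]

lemma norm_D_sq {χ : ι → ℂ} {u : C.K} (hu : u ∈ C.block χ) (γ : ι) :
    ((‖C.D γ u‖ ^ 2 : ℝ) : ℂ) = χ γ * ((‖u‖ ^ 2 : ℝ) : ℂ) := by
  have h := C.symm γ u (C.D γ u)
  rw [C.mem_block.1 hu γ, inner_smul_right, inner_self_eq_norm_sq_to_K,
    inner_self_eq_norm_sq_to_K] at h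
  simpa using h

/-- All four facts are read off from ‖D γ u‖² = χ γ ‖u‖². -/
lemma eigenvalue_real {χ : ι → ℂ} {u : C.K} (hu : u ∈ C.block χ) (h0 : u ≠ 0) (γ : ι) :
    χ γ = ((χ γ).re : ℂ) ∧ 0 ≤ (χ γ).re ∧ (C.D γ u = 0 → χ γ = 0) ∧ (χ γ = 0 → C.D γ u = 0) := by
  have h := C.norm_D_sq hu γ
  have hn : (0 : ℝ) < ‖u‖ ^ 2 := by positivity
  have h1 : χ γ = ((‖C.D γ u‖ ^ 2 / ‖u‖ ^ 2 : ℝ) : ℂ) := by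
    rw [Complex.ofReal_div, h]
    have : ((‖u‖ ^ 2 : ℝ) : ℂ) ≠ 0 := by exact_mod_cast hn.ne'
    field_simp
  refine ⟨by rw [h1, Complex.ofReal_re], by rw [h1, Complex.ofReal_re]; positivity, fun h2 => ?_,
    fun h2 => ?_⟩
  · rw [h1, h2]; simp
  · rw [h2, zero_mul] at h
    have : ‖C.D γ u‖ ^ 2 = 0 := by exact_mod_cast h
    simpa using this

/-- The eigenvalue of `(∑ γ, a γ • D γ) ^ 2` on a joint eigenspace. -/
def weight (a : ι → ℝ) (χ : ι → ℂ) : ℝ := ∑ᶠ γ, a γ ^ 2 * (χ γ).re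

/-- The finite set depends on u alone and serves all coefficient families at once. This allows the
weights of a and of b to be compared term by term, and the weights to be followed continuously in t.
-/
lemma exists_weight_eq {χ : ι → ℂ} {u : C.K} (hu : u ∈ C.block χ) (h0 : u ≠ 0) :
    ∃ s : Finset ι, (∀ γ, γ ∉ s → χ γ = 0) ∧
      (∀ a, weight a χ = ∑ γ ∈ s, a γ ^ 2 * (χ γ).re) ∧
      (∀ a, C.A a u = ∑ γ ∈ s, (a γ : ℂ) • C.D γ u) ∧
      ∀ a, C.A a (C.A a u) = (weight a χ : ℂ) • u := by
  obtain ⟨U, s, huU, -, hU, hs⟩ := C.exists_finset u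
  have h1 : ∀ γ, γ ∉ s → χ γ = 0 := fun γ hγ =>
    (C.eigenvalue_real hu h0 γ).2.2.1 (by_contra fun h => hγ (hs γ u huU h))
  have h2 : ∀ a : ι → ℝ, weight a χ = ∑ γ ∈ s, a γ ^ 2 * (χ γ).re := fun a => by
    refine finsum_eq_sum_of_support_subset _ fun γ hγ => by_contra fun h => hγ ?_
    simp only
    rw [h1 γ h, Complex.zero_re, mul_zero]
  refine ⟨s, h1, h2, fun a => C.A_eq_sum a u fun γ => hs γ u huU, fun a => ?_⟩
  rw [C.A_sq a u U huU hU hs, h2, Complex.ofReal_sum, Finset.sum_smul]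
  refine Finset.sum_congr rfl fun γ _ => ?_
  rw [C.mem_block.1 hu γ, Complex.ofReal_mul, ← (C.eigenvalue_real hu h0 γ).1, smul_smul]

lemma A_A_apply (a : ι → ℝ) {χ : ι → ℂ} {u : C.K} (hu : u ∈ C.block χ) :
    C.A a (C.A a u) = (weight a χ : ℂ) • u := by
  rcases eq_or_ne u 0 with rfl | h0
  · simp
  obtain ⟨s, -, -, -, h⟩ := C.exists_weight_eq hu h0
  exact h a

lemma weight_nonneg (a : ι → ℝ) {χ : ι → ℂ} {u : C.K} (hu : u ∈ C.block χ) (h0 : u ≠ 0) :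
    0 ≤ weight a χ :=
  finsum_nonneg fun γ => mul_nonneg (sq_nonneg _) (C.eigenvalue_real hu h0 γ).2.1

lemma norm_A_sq (a : ι → ℝ) {χ : ι → ℂ} {u : C.K} (hu : u ∈ C.block χ) :
    ‖C.A a u‖ ^ 2 = weight a χ * ‖u‖ ^ 2 := by
  have h := C.A_symm a u (C.A a u)
  rw [C.A_A_apply a hu, inner_smul_right, inner_self_eq_norm_sq_to_K,
    inner_self_eq_norm_sq_to_K] at h
  have h' : ((‖C.A a u‖ ^ 2 : ℝ) : ℂ) = ((weight a χ * ‖u‖ ^ 2 : ℝ) : ℂ) := by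
    push_cast; simpa using h
  exact_mod_cast h'

lemma inner_block {χ χ' : ι → ℂ} (hne : χ ≠ χ') {u v : C.K} (hu : u ∈ C.block χ)
    (hv : v ∈ C.block χ') : ⟪u, v⟫_ℂ = 0 :=
  C.orthogonalFamily_block hne ⟨u, hu⟩ ⟨v, hv⟩

/-- An operator that preserves the joint eigenspaces is bounded if it is bounded on each. -/
lemma norm_le_of_block {T : Module.End ℂ C.K} (hT : ∀ χ, ∀ u ∈ C.block χ, T u ∈ C.block χ) {B : ℝ}
    (hB : 0 ≤ B) (h : ∀ χ, ∀ u ∈ C.block χ, ‖T u‖ ≤ B * ‖u‖) (u : C.K) : ‖T u‖ ≤ B * ‖u‖ := by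
  have hu : u ∈ ⨆ χ, C.block χ := C.iSup_block ▸ Submodule.mem_top
  obtain ⟨f, hf, rfl⟩ := (Submodule.mem_iSup_iff_exists_finsupp _ _).1 hu
  -- Distinct blocks are orthogonal, so the squared norms of u and of T u are sums over blocks,
  -- which are then compared one by one.
  have h1 := C.orthogonalFamily_block.norm_sum (fun χ => ⟨f χ, hf χ⟩) f.support
  have h2 := C.orthogonalFamily_block.norm_sum (fun χ => ⟨T (f χ), hT χ _ (hf χ)⟩) f.support
  simp only [Submodule.coe_subtypeₗᵢ, Submodule.coe_subtype, Submodule.coe_norm] at h1 h2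
  refine abs_le_of_sq_le_sq' ?_ (by positivity) |>.2
  rw [mul_pow, Finsupp.sum, map_sum]
  refine h2.trans_le ((Finset.sum_le_sum fun χ _ => ?_).trans_eq
    ((Finset.mul_sum _ _ _).symm.trans (congrArg _ h1.symm)))
  rw [← mul_pow]
  exact pow_le_pow_left₀ (norm_nonneg _) (h χ _ (hf χ)) 2

end DiracCore

end AGN

end

noncomputable section

namespace AGN

namespace DiracCore

variable {H : Type*} [NormedAddCommGroup H] [InnerProductSpace ℂ H] {ι : Type*}
variable (C : DiracCore H ι)

/-! #### The quotient of the derivative by a power of the operator -/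

/-- `(∑ γ, b γ • D γ) |∑ γ, a γ • D γ| ^ (- p)` on the core. -/
def coreQuotient (a b : ι → ℝ) (p : ℝ) : Module.End ℂ C.K :=
  C.A b * C.diag fun χ => weight a χ ^ (-(p / 2))

lemma coreQuotient_apply (a b : ι → ℝ) (p : ℝ) {χ : ι → ℂ} {u : C.K} (hu : u ∈ C.block χ) :
    C.coreQuotient a b p u = ((weight a χ ^ (-(p / 2)) : ℝ) : ℂ) • C.A b u := by
  rw [coreQuotient, Module.End.mul_apply, C.diag_apply _ hu, map_smul]

lemma coreQuotient_mem_block (a b : ι → ℝ) (p : ℝ) {χ : ι → ℂ} {u : C.K} (hu : u ∈ C.block χ) :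
    C.coreQuotient a b p u ∈ C.block χ := by
  rw [C.coreQuotient_apply a b p hu]
  exact Submodule.smul_mem _ _ (C.A_mem_block b hu)

lemma coreQuotient_symm (a b : ι → ℝ) (p : ℝ) (u v : C.K) :
    ⟪C.coreQuotient a b p u, v⟫_ℂ = ⟪u, C.coreQuotient a b p v⟫_ℂ := by
  induction u using C.block_induction with
  | h0 => simp
  | hadd u u' h h' => simp only [map_add, inner_add_left, h, h']
  | h χ u hu =>
    induction v using C.block_induction with
    | h0 => simp
    | hadd v v' h h' => simp only [map_add, inner_add_right, h, h']
    | h χ' v hv =>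
      by_cases hχ : χ = χ'
      · subst hχ
        rw [C.coreQuotient_apply a b p hu, C.coreQuotient_apply a b p hv, inner_smul_left,
          inner_smul_right, Complex.conj_ofReal, C.A_symm b u v]
      · rw [C.inner_block hχ (C.coreQuotient_mem_block a b p hu) hv,
          C.inner_block hχ hu (C.coreQuotient_mem_block a b p hv)]

/-- The non-zero eigenvalues of the squares of the operators are at least `1 / c`. -/
def Gap (c : ℝ) : Prop :=
  ∀ (γ : ι) (l : ℝ) (u : C.K), u ≠ 0 → C.D γ (C.D γ u) = (l : ℂ) • u → l = 0 ∨ 1 / c ≤ l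

variable {C} in
-- The central estimate, proved term by term. A factor (a γ²)^ε of the hypothesis on b is traded for
-- c^ε times the ε-th power of the total weight, and the remaining a γ² χ γ sum up to the weight
-- itself.
lemma Gap.weight_le {c : ℝ} (hc : 0 < c) (hgap : C.Gap c) {a b : ι → ℝ} {ε m : ℝ} (hε : 0 ≤ ε)
    (hm : 0 < m) (hb : ∀ γ, |b γ| ≤ m * |a γ| ^ (1 + ε)) {χ : ι → ℂ} {u : C.K}
    (hu : u ∈ C.block χ) (h0 : u ≠ 0) :
    weight b χ ≤ (c ^ (ε / 2) * m) ^ 2 * weight a χ ^ (1 + ε) := by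
  obtain ⟨s, -, hw, -, -⟩ := C.exists_weight_eq hu h0
  have hW := C.weight_nonneg a hu h0
  have hnn : ∀ γ, 0 ≤ a γ ^ 2 * (χ γ).re := fun γ =>
    mul_nonneg (sq_nonneg _) (C.eigenvalue_real hu h0 γ).2.1
  have hcc : (c ^ (ε / 2)) ^ 2 = c ^ ε := by
    rw [← Real.rpow_natCast, ← Real.rpow_mul hc.le]; congr 1; push_cast; ring
  have hWW : weight a χ ^ (1 + ε) = weight a χ ^ ε * weight a χ := by
    rcases hW.eq_or_lt with h | h
    · rw [← h, Real.zero_rpow (by linarith), mul_zero]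
    · rw [add_comm, Real.rpow_add_one h.ne']
  rw [mul_pow, hcc, hWW]
  conv_lhs => rw [hw b]
  conv_rhs => enter [2, 2]; rw [hw a]
  rw [Finset.mul_sum, Finset.mul_sum]
  refine Finset.sum_le_sum fun γ hγ => ?_
  have hx : (χ γ).re = 0 ∨ 1 / c ≤ (χ γ).re :=
    hgap γ _ u h0 (by rw [← (C.eigenvalue_real hu h0 γ).1]; exact C.mem_block.1 hu γ)
  rcases hx with hx | hx
  · simp [hx]
  have hxpos : 0 < (χ γ).re := lt_of_lt_of_le (by positivity) hx
  have h1 : b γ ^ 2 ≤ m ^ 2 * (a γ ^ 2) ^ ε * a γ ^ 2 := by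
    have h2 : b γ ^ 2 ≤ (m * |a γ| ^ (1 + ε)) ^ 2 := by
      rw [← sq_abs]; exact pow_le_pow_left₀ (abs_nonneg _) (hb γ) 2
    refine h2.trans_eq ?_
    rcases eq_or_ne (a γ) 0 with h | h
    · rw [h, abs_zero, Real.zero_rpow (by linarith)]; simp
    · have hpos : 0 < |a γ| := abs_pos.2 h
      rw [← sq_abs (a γ), Real.rpow_add hpos, Real.rpow_one, ← Real.rpow_natCast (|a γ|) 2,
        ← Real.rpow_mul hpos.le, mul_comm ((2 : ℕ) : ℝ) ε, Real.rpow_mul hpos.le,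
        Real.rpow_natCast, Real.rpow_natCast]
      ring
  -- The spectral gap enters here: 1 ≤ c χ γ gives a γ² ≤ c a γ² χ γ, and one term of the sum is at
  -- most the whole weight.
  have h3 : (a γ ^ 2) ^ ε ≤ c ^ ε * weight a χ ^ ε := by
    rw [← Real.mul_rpow hc.le hW]
    refine Real.rpow_le_rpow (sq_nonneg _) ?_ hε
    have h4 : a γ ^ 2 * (χ γ).re ≤ weight a χ := by
      rw [hw a]
      exact Finset.single_le_sum (f := fun γ => a γ ^ 2 * (χ γ).re) (fun γ _ => hnn γ) hγ
    have h5 : 1 ≤ c * (χ γ).re := by rwa [div_le_iff₀' hc] at hx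
    nlinarith [sq_nonneg (a γ)]
  calc b γ ^ 2 * (χ γ).re ≤ (m ^ 2 * (a γ ^ 2) ^ ε * a γ ^ 2) * (χ γ).re := by gcongr
    _ ≤ (m ^ 2 * (c ^ ε * weight a χ ^ ε) * a γ ^ 2) * (χ γ).re := by gcongr
    _ = _ := by ring

/-- On a block the squared norm is multiplied by weight a ^ (-(1 + ε)) times weight b when the
weight of a is positive, and `Gap.weight_le` bounds this product. -/
lemma norm_coreQuotient_le {c : ℝ} (hc : 0 < c) (hgap : C.Gap c) {a b : ι → ℝ} {ε m : ℝ}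
    (hε : 0 ≤ ε) (hm : 0 < m) (hb : ∀ γ, |b γ| ≤ m * |a γ| ^ (1 + ε)) (u : C.K) :
    ‖C.coreQuotient a b (1 + ε) u‖ ≤ c ^ (ε / 2) * m * ‖u‖ := by
  refine C.norm_le_of_block (fun χ u hu => C.coreQuotient_mem_block a b _ hu) (by positivity)
    (fun χ u hu => ?_) u
  rcases eq_or_ne u 0 with rfl | h0
  · simp
  have hW := C.weight_nonneg a hu h0
  have h1 := hgap.weight_le hc hε hm hb hu h0
  refine abs_le_of_sq_le_sq' ?_ (by positivity) |>.2
  rw [C.coreQuotient_apply a b _ hu, norm_smul, mul_pow, C.norm_A_sq b hu, mul_pow,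
    Complex.norm_real, Real.norm_eq_abs, sq_abs, ← mul_assoc]
  refine mul_le_mul_of_nonneg_right ?_ (sq_nonneg _)
  -- Equality holds for positive weight; on the kernel the left side is zero, whatever value the
  -- negative power takes there.
  have h2 : (weight a χ ^ (-((1 + ε) / 2))) ^ 2 * weight a χ ^ (1 + ε) ≤ 1 := by
    rcases hW.eq_or_lt with h | h
    · rw [← h, Real.zero_rpow (by linarith : 1 + ε ≠ 0), mul_zero]; exact zero_le_one
    · rw [← Real.rpow_natCast, ← Real.rpow_mul h.le, ← Real.rpow_add h]
      refine (congrArg _ ?_).trans_le (Real.rpow_zero _).le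
      push_cast; ring
  calc (weight a χ ^ (-((1 + ε) / 2))) ^ 2 * weight b χ
      ≤ (weight a χ ^ (-((1 + ε) / 2))) ^ 2 *
        ((c ^ (ε / 2) * m) ^ 2 * weight a χ ^ (1 + ε)) := by gcongr
    _ = (c ^ (ε / 2) * m) ^ 2 *
        ((weight a χ ^ (-((1 + ε) / 2))) ^ 2 * weight a χ ^ (1 + ε)) := by ring
    _ ≤ (c ^ (ε / 2) * m) ^ 2 * 1 := by gcongr
    _ = _ := mul_one _

lemma denseRange_subtype : DenseRange C.K.subtype := by
  rw [DenseRange, Submodule.coe_subtype, Subtype.range_coe]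
  exact C.dense

variable [CompleteSpace H]

/-- The bounded operator `(∑ γ, b γ • D γ) |∑ γ, a γ • D γ| ^ (- p)`. -/
def quotient (a b : ι → ℝ) (p : ℝ) : H →L[ℂ] H :=
  (C.K.subtype ∘ₗ C.coreQuotient a b p).extendOfNorm C.K.subtype

section quotient

variable {c : ℝ} (hc : 0 < c) (hgap : C.Gap c) {a b : ι → ℝ} {ε m : ℝ} (hε : 0 ≤ ε) (hm : 0 < m)
  (hb : ∀ γ, |b γ| ≤ m * |a γ| ^ (1 + ε))
include hc hgap hε hm hb

lemma quotient_apply (u : C.K) :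
    C.quotient a b (1 + ε) (u : H) = (C.coreQuotient a b (1 + ε) u : H) :=
  LinearMap.extendOfNorm_eq (f := C.K.subtype ∘ₗ C.coreQuotient a b (1 + ε)) C.denseRange_subtype
    ⟨_, C.norm_coreQuotient_le hc hgap hε hm hb⟩ u

lemma norm_quotient_le : ‖C.quotient a b (1 + ε)‖ ≤ c ^ (ε / 2) * m :=
  LinearMap.opNorm_extendOfNorm_le C.denseRange_subtype (by positivity)
    (C.norm_coreQuotient_le hc hgap hε hm hb)

lemma quotient_symm (v : H) (u : C.K) :
    ⟪C.quotient a b (1 + ε) v, (u : H)⟫_ℂ = ⟪v, (C.coreQuotient a b (1 + ε) u : H)⟫_ℂ := by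
  refine C.dense.induction (P := fun v => ⟪C.quotient a b (1 + ε) v, (u : H)⟫_ℂ
    = ⟪v, (C.coreQuotient a b (1 + ε) u : H)⟫_ℂ) (fun v hv => ?_)
    (isClosed_eq (by fun_prop) (by fun_prop)) v
  rw [C.quotient_apply hc hgap hε hm hb ⟨v, hv⟩]
  exact C.coreQuotient_symm a b _ ⟨v, hv⟩ u

/-- The closure of the quotient times the power of the operator. -/
lemma closure_quotient_absPow :
    (((0 : H →L[ℂ] H).toLinearMap +ᵥ (C.quotient a b (1 + ε)).toLinearMap.compPMap
      (absPow (C.op a) (1 + ε))).closure) = C.op b := by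
  set R := invOneAddSq (C.op a) with hR
  have hRsa : IsSelfAdjoint R := isSelfAdjoint_invOneAddSq _
  -- With r = (1 + weight)⁻¹, the pair (r u, A (r u)) is the projection of (u, 0) onto the graph,
  -- because A² (r u) = (1 - r) u.
  have hR_apply : ∀ χ, ∀ u ∈ C.block χ, R (u : H) = (((1 + weight a χ)⁻¹ : ℝ) : ℂ) • (u : H) := by
    intro χ u hu
    rcases eq_or_ne u 0 with rfl | h0
    · simp
    have hW := C.weight_nonneg a hu h0
    have hW1 : (1 + (weight a χ : ℂ)) ≠ 0 := by
      have : (1 + weight a χ : ℝ) ≠ 0 := by positivity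
      exact_mod_cast this
    set r : ℂ := (((1 + weight a χ)⁻¹ : ℝ) : ℂ) with hr
    have hr1 : (1 : ℂ) - r = r * weight a χ := by
      rw [hr]; push_cast; field_simp; ring
    refine invOneAddSq_apply (w := ((C.A a (r • u) : C.K) : H)) ?_ ?_
    · rw [graph_op]; exact C.core_mem_G a (r • u)
    · intro p hp
      rw [graph_op] at hp
      have h1 := hp (C.A a (r • u))
      have h2 : ((C.A a (C.A a (r • u)) : C.K) : H) = (u : H) - r • (u : H) := by
        rw [map_smul, map_smul, C.A_A_apply a hu, smul_smul, ← hr1, sub_smul, one_smul]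
        rfl
      rw [h2] at h1
      rw [← inner_conj_symm, ← h1, inner_conj_symm]
  set p2 : ℝ := (1 + ε) / 2 with hp2
  have hp2pos : 0 < p2 := by positivity
  have cont1 : Continuous fun x : ℝ => x ^ p2 := Real.continuous_rpow_const hp2pos.le
  have cont2 : Continuous fun x : ℝ => (1 - x) ^ p2 :=
    (continuous_const.sub continuous_id).rpow_const fun _ => Or.inr hp2pos.le
  set P : H →L[ℂ] H := cfc (fun x : ℝ => x ^ p2) R with hP
  set Q : H →L[ℂ] H := cfc (fun x : ℝ => (1 - x) ^ p2) R with hQ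
  have hPsa : ∀ v w : H, ⟪P v, w⟫_ℂ = ⟪v, P w⟫_ℂ :=
    ContinuousLinearMap.isSelfAdjoint_iff_isSymmetric.1 (IsSelfAdjoint.cfc (f := fun x : ℝ => x ^ p2))
  have hQsa : ∀ v w : H, ⟪Q v, w⟫_ℂ = ⟪v, Q w⟫_ℂ :=
    ContinuousLinearMap.isSelfAdjoint_iff_isSymmetric.1
      (IsSelfAdjoint.cfc (f := fun x : ℝ => (1 - x) ^ p2))
  have hP_apply : ∀ χ, ∀ u ∈ C.block χ,
      P (u : H) = ((((1 + weight a χ)⁻¹) ^ p2 : ℝ) : ℂ) • (u : H) := fun χ u hu =>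
    cfc_apply_eigenvector hRsa (hR_apply χ u hu) cont1
  have hQ_apply : ∀ χ, ∀ u ∈ C.block χ,
      Q (u : H) = (((1 - (1 + weight a χ)⁻¹) ^ p2 : ℝ) : ℂ) • (u : H) := fun χ u hu =>
    cfc_apply_eigenvector hRsa (hR_apply χ u hu) cont2
  have hPpos : ∀ χ, ∀ u ∈ C.block χ, u ≠ 0 → ((((1 + weight a χ)⁻¹) ^ p2 : ℝ) : ℂ) ≠ 0 := by
    intro χ u hu h0
    have hW := C.weight_nonneg a hu h0
    have : ((1 + weight a χ)⁻¹) ^ p2 ≠ 0 := by positivity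
    exact_mod_cast this
  have hQP : ∀ χ, ∀ u ∈ C.block χ, Q (C.coreQuotient a b (1 + ε) u : H) = P (C.A b u : H) := by
    intro χ u hu
    rw [hQ_apply χ _ (C.coreQuotient_mem_block a b _ hu), hP_apply χ _ (C.A_mem_block b hu),
      C.coreQuotient_apply a b _ hu, Submodule.coe_smul, smul_smul]
    rcases eq_or_ne u 0 with rfl | h0
    · simp
    have hW := C.weight_nonneg a hu h0
    -- If the weight of a vanishes, so does that of b, hence A b kills the block and both sides are
    -- zero. Otherwise the power of 1 - R, divided by that of R, cancels the negative power in the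
    -- quotient.
    rcases hW.eq_or_lt with h | h
    · have hb0 : C.A b u = 0 := by
        have h1 := hgap.weight_le hc hε hm hb hu h0
        rw [← h, Real.zero_rpow (by linarith), mul_zero] at h1
        have h2 := C.norm_A_sq b hu
        have h3 : ‖C.A b u‖ ^ 2 ≤ 0 := by
          rw [h2]; exact mul_nonpos_of_nonpos_of_nonneg h1 (sq_nonneg _)
        have h4 : ‖C.A b u‖ = 0 := by nlinarith [norm_nonneg (C.A b u)]
        exact norm_eq_zero.1 h4
      rw [hb0]; simp
    · congr 1
      have h1 : 1 - (1 + weight a χ)⁻¹ = weight a χ * (1 + weight a χ)⁻¹ := by field_simp; ring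
      have h2 : (1 - (1 + weight a χ)⁻¹) ^ p2 * weight a χ ^ (-p2) = ((1 + weight a χ)⁻¹) ^ p2 := by
        rw [h1, Real.mul_rpow h.le (by positivity), mul_right_comm, ← Real.rpow_add h,
          add_neg_cancel, Real.rpow_zero, one_mul]
      rw [← h2]; push_cast; rfl
  -- P is self-adjoint and a positive scalar on each non-zero block, so a vector in its kernel is
  -- orthogonal to all blocks, hence to the dense core.
  have hker : LinearMap.ker ((P.toLinearMap).toPMap ⊤).toFun = ⊥ := by
    rw [LinearMap.ker_eq_bot']
    intro y hy
    have hy' : P (y : H) = 0 := hy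
    refine Subtype.ext (C.eq_zero_of_inner fun u => ?_)
    induction u using C.block_induction with
    | h0 => simp
    | hadd u v h h' => rw [Submodule.coe_add, inner_add_right, h, h', add_zero]
    | h χ u hu =>
      rcases eq_or_ne u 0 with rfl | h0
      · simp
      have h1 := hPsa (y : H) u
      rw [hy', inner_zero_left, hP_apply χ u hu, inner_smul_right] at h1
      exact (mul_eq_zero.1 h1.symm).resolve_left (hPpos χ u hu h0)
  set F := C.quotient a b (1 + ε) with hF
  set S := ((0 : H →L[ℂ] H).toLinearMap +ᵥ F.toLinearMap.compPMap (absPow (C.op a) (1 + ε)))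
    with hS
  have hinv : ∀ v y : H, (v, y) ∈ ((P.toLinearMap).toPMap ⊤).inverse.graph ↔ P y = v := by
    intro v y
    rw [LinearPMap.inverse_graph hker]
    constructor
    · rintro ⟨⟨y', v'⟩, h1, h2⟩
      obtain ⟨z, hz1, hz2⟩ := (LinearPMap.mem_graph_iff _).1 h1
      simp only [LinearEquiv.coe_coe, LinearEquiv.prodComm_apply, Prod.swap_prod_mk,
        Prod.mk.injEq] at h2 hz1 hz2
      rw [← h2.1, ← h2.2, ← hz1, ← hz2]; rfl
    · intro h
      exact ⟨(y, v), (LinearPMap.mem_graph_iff _).2 ⟨⟨y, trivial⟩, rfl, h⟩, rfl⟩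
  -- With P and Q the powers of R and 1 - R, the operator |A| ^ (1 + ε) sends P y to Q y. The graph
  -- of the right-hand side is thus parametrized by y.
  have hS_graph : ∀ v w : H, (v, w) ∈ S.graph ↔ ∃ y, P y = v ∧ F (Q y) = w := by
    intro v w
    constructor
    · intro h
      obtain ⟨z, hz1, hz2⟩ := (LinearPMap.mem_graph_iff _).1 h
      let z' : ((P.toLinearMap).toPMap ⊤).inverse.domain := z
      refine ⟨((P.toLinearMap).toPMap ⊤).inverse z', ?_, ?_⟩
      · rw [← hinv]
        have := LinearPMap.mem_graph _ z'
        rwa [show (z' : H) = v from hz1] at this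
      · refine Eq.trans ?_ hz2
        exact (zero_add _).symm
    · rintro ⟨y, hy, hw⟩
      obtain ⟨z, hz1, hz2⟩ := (LinearPMap.mem_graph_iff _).1 ((hinv v y).2 hy)
      refine (LinearPMap.mem_graph_iff _).2 ⟨z, hz1, ?_⟩
      refine Eq.trans ?_ hw
      refine (zero_add _).trans ?_
      exact congrArg (fun y => F (Q y)) hz2
  -- F, Q and P are moved onto the core vector one after the other; `hQP` then turns Q F into P A b
  -- there. With `hcore` this again places the graph between the core and the adjoint.
  have hS_le : S.graph ≤ C.G b := by
    rintro ⟨v, w⟩ h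
    obtain ⟨y, rfl, rfl⟩ := (hS_graph v w).1 h
    intro u
    simp only
    rw [C.quotient_symm hc hgap hε hm hb, hQsa, hPsa]
    congr 1
    induction u using C.block_induction with
    | h0 => simp
    | hadd u v h h' => simp only [map_add, Submodule.coe_add, h, h']
    | h χ u hu => exact hQP χ u hu
  have hcore : ∀ u : C.K, ((u : H), (C.A b u : H)) ∈ S.graph := by
    intro u
    induction u using C.block_induction with
    | h0 => simp
    | hadd u v h h' =>
      rw [map_add]
      exact S.graph.add_mem h h'
    | h χ u hu =>
      rcases eq_or_ne u 0 with rfl | h0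
      · simp
      rw [hS_graph]
      set r := ((((1 + weight a χ)⁻¹) ^ p2 : ℝ) : ℂ) with hr
      have hr0 : r ≠ 0 := hPpos χ u hu h0
      refine ⟨r⁻¹ • (u : H), ?_, ?_⟩
      · rw [map_smul, hP_apply χ u hu, smul_smul, inv_mul_cancel₀ hr0, one_smul]
      · have h1 := hQP χ u hu
        rw [hP_apply χ _ (C.A_mem_block b hu), hQ_apply χ _ (C.coreQuotient_mem_block a b _ hu)] at h1
        rw [map_smul, hQ_apply χ u hu, map_smul, map_smul, hF, C.quotient_apply hc hgap hε hm hb, h1,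
          smul_smul, inv_mul_cancel₀ hr0, one_smul]
  have hclos : S.graph.topologicalClosure = C.G b := by
    apply le_antisymm
    · exact Submodule.topologicalClosure_minimal _ hS_le (C.isClosed_G b)
    · intro q hq
      have hq' : q ∈ (C.G b : Set (H × H)) := hq
      rw [G_eq_closure] at hq'
      refine closure_mono ?_ hq'
      rintro _ ⟨u, rfl⟩
      exact hcore u
  have hclosable : S.IsClosable := ⟨C.op b, by rw [graph_op, hclos]⟩
  apply LinearPMap.eq_of_eq_graph
  rw [← hclosable.graph_closure_eq_closure_graph, hclos, graph_op]

/-- Weak commutation with each D γ passes to the squares, so T has no matrix elements between blocks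
with different χ. Within one χ the quotient is a scalar multiple of A b, with which T commutes
weakly. -/
lemma commute_quotient {T : H →L[ℂ] H}
    (hT : ∀ γ (u x : C.K), ⟪T (C.D γ u : H), (x : H)⟫_ℂ = ⟪T u, (C.D γ x : H)⟫_ℂ) (v : H) :
    T (C.quotient a b (1 + ε) v) = C.quotient a b (1 + ε) (T v) := by
  have hTA : ∀ u x : C.K, ⟪T (C.A b u : H), (x : H)⟫_ℂ = ⟪T u, (C.A b x : H)⟫_ℂ := by
    intro u x
    obtain ⟨s, hu, hx⟩ := C.exists_finset_pair u x
    simp only [C.A_eq_sum b u hu, C.A_eq_sum b x hx, Submodule.coe_sum, Submodule.coe_smul,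
      map_sum, map_smul, sum_inner, inner_sum, inner_smul_left, inner_smul_right,
      Complex.conj_ofReal, hT]
  refine C.dense.induction (P := fun v => T (C.quotient a b (1 + ε) v)
    = C.quotient a b (1 + ε) (T v)) (fun v hv => ?_) (isClosed_eq (by fun_prop) (by fun_prop)) v
  rw [C.quotient_apply hc hgap hε hm hb ⟨v, hv⟩, ← sub_eq_zero]
  refine C.eq_zero_of_inner fun x => ?_
  rw [inner_sub_left, C.quotient_symm hc hgap hε hm hb, sub_eq_zero]
  change _ = ⟪T ((⟨v, hv⟩ : C.K) : H), _⟫_ℂ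
  generalize (⟨v, hv⟩ : C.K) = u
  induction u using C.block_induction with
  | h0 => simp
  | hadd u u' h h' => simp only [map_add, Submodule.coe_add, inner_add_left, h, h']
  | h χ u hu =>
    induction x using C.block_induction with
    | h0 => simp
    | hadd x x' h h' => simp only [map_add, Submodule.coe_add, inner_add_right, h, h']
    | h χ' x hx =>
      have horth : ∀ (u x : C.K), u ∈ C.block χ → x ∈ C.block χ' → χ ≠ χ' →
          ⟪T (u : H), (x : H)⟫_ℂ = 0 := by
        intro u x hu hx hne
        rcases eq_or_ne x 0 with rfl | hx0
        · simp
        rcases eq_or_ne u 0 with rfl | hu0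
        · simp
        obtain ⟨γ, hγ⟩ := Function.ne_iff.1 hne
        have h1 : ⟪T (C.D γ (C.D γ u) : H), (x : H)⟫_ℂ = ⟪T u, (C.D γ (C.D γ x) : H)⟫_ℂ := by
          rw [hT, hT]
        rw [C.mem_block.1 hu, C.mem_block.1 hx, Submodule.coe_smul, Submodule.coe_smul, map_smul,
          inner_smul_left, inner_smul_right, (C.eigenvalue_real hu hu0 γ).1, Complex.conj_ofReal,
          ← (C.eigenvalue_real hu hu0 γ).1] at h1
        by_contra h2
        exact hγ (mul_right_cancel₀ h2 h1)
      by_cases hχ : χ = χ'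
      · subst hχ
        rw [C.coreQuotient_apply a b _ hu, C.coreQuotient_apply a b _ hx, Submodule.coe_smul,
          Submodule.coe_smul, map_smul, inner_smul_left, inner_smul_right, Complex.conj_ofReal, hTA]
      · rw [horth _ _ (C.coreQuotient_mem_block a b _ hu) hx hχ,
          horth _ _ hu (C.coreQuotient_mem_block a b _ hx) hχ]

end quotient

/-- The norms are bounded uniformly in t, so continuity has to be checked only on the dense core,
and there on a single block, where the quotient is an explicit function of finitely many
coefficients. -/
lemma continuousOn_quotient {c : ℝ} (hc : 0 < c) (hgap : C.Gap c) {a b : ι → ℝ → ℝ} {J : Set ℝ}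
    {ε m : ℝ} (hε : 0 ≤ ε) (hm : 0 < m) (ha : ∀ γ, ContinuousOn (a γ) J)
    (ha0 : ∀ γ, ∀ t ∈ J, a γ t ≠ 0) (hbc : ∀ γ, ContinuousOn (b γ) J)
    (hb : ∀ t ∈ J, ∀ γ, |b γ t| ≤ m * |a γ t| ^ (1 + ε)) (v : H) :
    ContinuousOn (fun t => C.quotient (fun γ => a γ t) (fun γ => b γ t) (1 + ε) v) J := by
  have hcore : ∀ u : C.K, ContinuousOn
      (fun t => (C.coreQuotient (fun γ => a γ t) (fun γ => b γ t) (1 + ε) u : H)) J := by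
    intro u
    induction u using C.block_induction with
    | h0 => simpa using continuousOn_const
    | hadd u v h h' => simp only [map_add, Submodule.coe_add]; exact h.add h'
    | h χ u hu =>
      rcases eq_or_ne u 0 with rfl | h0
      · simpa using continuousOn_const
      obtain ⟨s, hs, hw, hA, -⟩ := C.exists_weight_eq hu h0
      have hAc : ContinuousOn (fun t => (C.A (fun γ => b γ t) u : H)) J := by
        simp only [hA, Submodule.coe_sum, Submodule.coe_smul]
        refine continuousOn_finsetSum _ fun γ _ => ContinuousOn.smul ?_ continuousOn_const
        exact Complex.continuous_ofReal.comp_continuousOn (hbc γ)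
      have heq : ∀ t, (C.coreQuotient (fun γ => a γ t) (fun γ => b γ t) (1 + ε) u : H)
          = ((weight (fun γ => a γ t) χ ^ (-((1 + ε) / 2)) : ℝ) : ℂ) •
            (C.A (fun γ => b γ t) u : H) := fun t => by
        rw [C.coreQuotient_apply _ _ _ hu, Submodule.coe_smul]
      simp only [heq]
      -- A negative power of the weight is continuous where the weight is positive, and since the a
      -- γ t never vanish, one non-zero χ γ suffices for that. If all χ γ vanish, A b u is zero for
      -- all t.
      by_cases hχ : ∀ γ, χ γ = 0
      · have : ∀ t, C.A (fun γ => b γ t) u = 0 := fun t => by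
          rw [hA]
          refine Finset.sum_eq_zero fun γ _ => ?_
          rw [(C.eigenvalue_real hu h0 γ).2.2.2 (hχ γ), smul_zero]
        simpa [this] using continuousOn_const
      · push Not at hχ
        obtain ⟨γ₀, hγ₀⟩ := hχ
        have hγs : γ₀ ∈ s := by_contra fun h => hγ₀ (hs γ₀ h)
        have hre : 0 < (χ γ₀).re := lt_of_le_of_ne (C.eigenvalue_real hu h0 γ₀).2.1 fun h => hγ₀ (by
          rw [(C.eigenvalue_real hu h0 γ₀).1, ← h, Complex.ofReal_zero])
        refine ContinuousOn.smul (Complex.continuous_ofReal.comp_continuousOn ?_) hAc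
        refine ContinuousOn.rpow_const ?_ fun t ht => Or.inl ?_
        · simp only [hw]
          exact continuousOn_finsetSum _ fun γ _ => ((ha γ).pow 2).mul continuousOn_const
        · rw [hw]
          refine (lt_of_lt_of_le ?_ (Finset.single_le_sum
            (f := fun γ => a γ t ^ 2 * (χ γ).re) (fun γ _ => ?_) hγs)).ne'
          · have := ha0 γ₀ t ht
            positivity
          · exact mul_nonneg (sq_nonneg _) (C.eigenvalue_real hu h0 γ).2.1
  intro t₀ ht₀
  rw [ContinuousWithinAt, Metric.tendsto_nhds]
  intro e he
  set B := c ^ (ε / 2) * m with hB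
  have hBpos : 0 < B := by positivity
  obtain ⟨x, hxK, hx⟩ := Metric.mem_closure_iff.1 (C.dense v) (e / (3 * B)) (by positivity)
  have h1 := Metric.tendsto_nhds.1 (hcore ⟨x, hxK⟩ t₀ ht₀) (e / 3) (by positivity)
  filter_upwards [h1, self_mem_nhdsWithin] with t ht htJ
  have est : ∀ t ∈ J, dist (C.quotient (fun γ => a γ t) (fun γ => b γ t) (1 + ε) v)
      (C.coreQuotient (fun γ => a γ t) (fun γ => b γ t) (1 + ε) ⟨x, hxK⟩ : H) < e / 3 := by
    intro t ht
    rw [← C.quotient_apply hc hgap hε hm (hb t ht), dist_eq_norm, ← map_sub]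
    refine ((C.quotient _ _ (1 + ε)).le_of_opNorm_le
      (C.norm_quotient_le hc hgap hε hm (hb t ht)) _).trans_lt ?_
    rw [dist_eq_norm] at hx
    calc B * ‖v - x‖ < B * (e / (3 * B)) := by gcongr
      _ = e / 3 := by field_simp
  have e1 := est t htJ
  have e2 := est t₀ ht₀
  rw [dist_comm] at e2
  calc _ ≤ _ := dist_triangle4 _ _ _ _
    _ < e / 3 + e / 3 + e / 3 := add_lt_add (add_lt_add e1 ht) e2
    _ = e := by ring

end DiracCore

end AGN

end

noncomputable section

namespace AGN

/-! ### Calculus of left-invariant derivatives on a Lie group -/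

section LieCalculus

variable {V : Type*} [NormedAddCommGroup V] [NormedSpace ℝ V]
  {G : Type*} [Group G] [TopologicalSpace G] [ChartedSpace V G]

variable (V G) in
/-- The inverse of the chart at the identity. -/
def expChart : V → G := (extChartAt 𝓘(ℝ, V) (1 : G)).symm

variable (V G) in
/-- The domain of the inverse of the chart at the identity. -/
def expDomain : Set V := (extChartAt 𝓘(ℝ, V) (1 : G)).target

variable (V G) in
/-- The coordinates of the identity. -/
def expBase : V := extChartAt 𝓘(ℝ, V) (1 : G) 1

variable {F : Type*} [NormedAddCommGroup F] [NormedSpace ℝ F]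

/-- `f'` is the left-invariant derivative of `f`, in the chart at the identity. -/
def HasLeftDeriv (f : G → F) (f' : G → V →L[ℝ] F) : Prop :=
  ∀ x, HasFDerivAt (fun u => f (x * expChart V G u)) (f' x) (expBase V G)

variable (V) in
/-- The left-invariant derivative of a function. -/
def leftFDeriv (f : G → F) (x : G) : V →L[ℝ] F :=
  fderiv ℝ (fun u => f (x * expChart V G u)) (expBase V G)

lemma HasLeftDeriv.leftFDeriv_eq {f : G → F} {f' : G → V →L[ℝ] F} (h : HasLeftDeriv f f') :
    leftFDeriv V f = f' :=
  funext fun x => (h x).fderiv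

variable (V G) in
/-- The left logarithmic derivative of `expChart`. -/
def logDeriv (u : V) : V →L[ℝ] V :=
  fderiv ℝ (fun w => extChartAt 𝓘(ℝ, V) (1 : G) ((expChart V G u)⁻¹ * expChart V G w)) u

lemma isOpen_expDomain : IsOpen (expDomain V G) := isOpen_extChartAt_target _

lemma expBase_mem : expBase V G ∈ expDomain V G := mem_extChartAt_target _

lemma expDomain_mem_nhds : expDomain V G ∈ 𝓝 (expBase V G) :=
  isOpen_expDomain.mem_nhds expBase_mem

@[simp] lemma expChart_expBase : expChart V G (expBase V G) = 1 := extChartAt_to_inv _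

variable [LieGroup 𝓘(ℝ, V) ∞ G]

lemma contMDiffAt_expChart {u : V} (hu : u ∈ expDomain V G) :
    ContMDiffAt 𝓘(ℝ, V) 𝓘(ℝ, V) ∞ (expChart V G) u :=
  (contMDiffOn_extChartAt_symm (1 : G)).contMDiffAt (isOpen_expDomain.mem_nhds hu)

lemma contMDiffAt_translate {f : G → F} {n : WithTop ℕ∞} (hn : n ≤ ∞)
    (hf : ContMDiff 𝓘(ℝ, V) 𝓘(ℝ, F) n f) (x : G) {u : V} (hu : u ∈ expDomain V G) :
    ContMDiffAt (𝓘(ℝ, V).prod 𝓘(ℝ, V)) 𝓘(ℝ, F) n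
      (fun p : G × V => f (p.1 * expChart V G p.2)) (x, u) := by
  refine (hf.contMDiffAt).comp (x, u) (ContMDiffAt.mul (contMDiffAt_fst) ?_ |>.of_le hn)
  exact (contMDiffAt_expChart hu).comp (x, u) contMDiffAt_snd

lemma contDiffOn_translate {f : G → F} {n : WithTop ℕ∞} (hn : n ≤ ∞)
    (hf : ContMDiff 𝓘(ℝ, V) 𝓘(ℝ, F) n f) (x : G) :
    ContDiffOn ℝ n (fun u => f (x * expChart V G u)) (expDomain V G) := by
  intro u hu
  refine ContDiffAt.contDiffWithinAt ?_
  rw [← contMDiffAt_iff_contDiffAt]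
  exact (contMDiffAt_translate hn hf x hu).comp u (contMDiffAt_const.prodMk contMDiffAt_id)

lemma hasLeftDeriv_leftFDeriv {f : G → F} (hf : ContMDiff 𝓘(ℝ, V) 𝓘(ℝ, F) ∞ f) :
    HasLeftDeriv f (leftFDeriv V f) := fun x =>
  (((contDiffOn_translate le_rfl hf x).contDiffAt expDomain_mem_nhds).differentiableAt
    (by simp)).hasFDerivAt

lemma contMDiff_leftFDeriv {f : G → F} (hf : ContMDiff 𝓘(ℝ, V) 𝓘(ℝ, F) ∞ f) :
    ContMDiff 𝓘(ℝ, V) 𝓘(ℝ, V →L[ℝ] F) ∞ (leftFDeriv V f) := by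
  intro x
  have h := ContMDiffAt.mfderiv (I := 𝓘(ℝ, V)) (I' := 𝓘(ℝ, F)) (J := 𝓘(ℝ, V)) (m := ∞) (n := ∞)
    (fun (y : G) (u : V) => f (y * expChart V G u)) (fun _ => expBase V G)
    (x₀ := x) (contMDiffAt_translate le_rfl hf x expBase_mem) contMDiffAt_const (by simp)
  -- Source and target of the differentiated map are vector spaces, so expressing the derivative in
  -- tangent coordinates changes nothing.
  have e := inTangentCoordinates_model_space (I := 𝓘(ℝ, V)) (I' := 𝓘(ℝ, F))
    (fun _ : G => expBase V G) (fun x => f (x * expChart V G (expBase V G)))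
    (fun x => mfderiv 𝓘(ℝ, V) 𝓘(ℝ, F) (fun u => f (x * expChart V G u)) (expBase V G)) x
  have h' := (congrArg (fun k => ContMDiffAt 𝓘(ℝ, V) 𝓘(ℝ, V →L[ℝ] F) ∞ k x) e).mp h
  simp only [mfderiv_eq_fderiv] at h'
  exact h'

lemma contDiffAt_logMap {u : V} (hu : u ∈ expDomain V G) :
    ContDiffAt ℝ ∞ (fun p : V × V =>
      extChartAt 𝓘(ℝ, V) (1 : G) ((expChart V G p.1)⁻¹ * expChart V G p.2)) (u, u) := by
  rw [← contMDiffAt_iff_contDiffAt]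
  have h : ContMDiffAt 𝓘(ℝ, V) 𝓘(ℝ, V) ∞ (extChartAt 𝓘(ℝ, V) (1 : G)) (1 : G) :=
    contMDiffAt_extChartAt
  have h1 : (expChart V G u)⁻¹ * expChart V G u = 1 := by simp
  have h2 : ContMDiffAt 𝓘(ℝ, V × V) 𝓘(ℝ, V) ∞ (fun p : V × V =>
      (expChart V G p.1)⁻¹ * expChart V G p.2) (u, u) :=
    ((contMDiffAt_expChart hu).comp (u, u) contDiff_fst.contMDiff.contMDiffAt).inv.mul
      ((contMDiffAt_expChart hu).comp (u, u) contDiff_snd.contMDiff.contMDiffAt)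
  exact ContMDiffAt.comp (u, u) (by rw [h1]; exact h) h2

lemma contDiffOn_logDeriv : ContDiffOn ℝ ∞ (logDeriv V G) (expDomain V G) := by
  intro u hu
  refine ContDiffAt.contDiffWithinAt ?_
  exact ContDiffAt.fderiv (f := fun u w =>
    extChartAt 𝓘(ℝ, V) (1 : G) ((expChart V G u)⁻¹ * expChart V G w)) (n := ∞)
    (contDiffAt_logMap hu) contDiffAt_id (by simp)

lemma hasFDerivAt_logMap {u : V} (hu : u ∈ expDomain V G) :
    HasFDerivAt (fun w => extChartAt 𝓘(ℝ, V) (1 : G) ((expChart V G u)⁻¹ * expChart V G w))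
      (logDeriv V G u) u :=
  (((contDiffAt_logMap hu).comp u (contDiffAt_const.prodMk contDiffAt_id)).differentiableAt
    (by simp)).hasFDerivAt

lemma logDeriv_expBase : logDeriv V G (expBase V G) = ContinuousLinearMap.id ℝ V := by
  refine (hasFDerivAt_logMap expBase_mem).unique ?_
  refine (hasFDerivAt_id _).congr_of_eventuallyEq ?_
  filter_upwards [expDomain_mem_nhds] with w hw
  rw [expChart_expBase, inv_one, one_mul]
  exact (extChartAt 𝓘(ℝ, V) (1 : G)).right_inv hw

/-- Writing g for the inverse chart, x g(w) = (x g(u)) (g(u)⁻¹ g(w)). This moves the derivative at u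
to the identity, and the chain rule contributes the factor `logDeriv`. -/
lemma HasLeftDeriv.hasFDerivAt {f : G → F} {f' : G → V →L[ℝ] F} (h : HasLeftDeriv f f') (x : G)
    {u : V} (hu : u ∈ expDomain V G) :
    HasFDerivAt (fun w => f (x * expChart V G w))
      ((f' (x * expChart V G u)).comp (logDeriv V G u)) u := by
  have h1 : extChartAt 𝓘(ℝ, V) (1 : G) ((expChart V G u)⁻¹ * expChart V G u) = expBase V G := by
    rw [inv_mul_cancel]; rfl
  have h2 := h (x * expChart V G u)
  rw [← h1] at h2
  refine (h2.comp u (hasFDerivAt_logMap hu)).congr_of_eventuallyEq ?_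
  have h3 : ContinuousAt (fun w => (expChart V G u)⁻¹ * expChart V G w) u := by
    have : ContinuousMul G := continuousMul_of_contMDiffMul 𝓘(ℝ, V) ∞
    exact continuousAt_const.mul (contMDiffAt_expChart hu).continuousAt
  have h4 : (extChartAt 𝓘(ℝ, V) (1 : G)).source ∈ 𝓝 ((expChart V G u)⁻¹ * expChart V G u) := by
    rw [inv_mul_cancel]; exact extChartAt_source_mem_nhds _
  filter_upwards [h3 h4] with w hw
  simp only [Function.comp]
  have h5 : expChart V G (extChartAt 𝓘(ℝ, V) (1 : G) ((expChart V G u)⁻¹ * expChart V G w)) =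
    (expChart V G u)⁻¹ * expChart V G w := (extChartAt 𝓘(ℝ, V) (1 : G)).left_inv hw
  rw [h5]
  congr 1
  group

/-- In the translated chart the derivative of f is f' composed with the smooth `logDeriv`, so f is
one order smoother than f'. -/
lemma HasLeftDeriv.contMDiff_succ {f : G → F} {f' : G → V →L[ℝ] F} (h : HasLeftDeriv f f')
    {n : ℕ} (hf' : ContMDiff 𝓘(ℝ, V) 𝓘(ℝ, V →L[ℝ] F) n f') :
    ContMDiff 𝓘(ℝ, V) 𝓘(ℝ, F) (n + 1 : ℕ) f := by
  intro x
  have h1 : ContDiffOn ℝ (n + 1 : ℕ) (fun u => f (x * expChart V G u)) (expDomain V G) := by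
    rw [Nat.cast_add, Nat.cast_one, contDiffOn_succ_iff_fderiv_of_isOpen isOpen_expDomain]
    refine ⟨fun u hu => (h.hasFDerivAt x hu).differentiableAt.differentiableWithinAt, by simp, ?_⟩
    have h2 : ContDiffOn ℝ n
        (fun u => (f' (x * expChart V G u)).comp (logDeriv V G u)) (expDomain V G) :=
      (contDiffOn_translate (by exact_mod_cast le_top) hf' x).clm_comp
        (contDiffOn_logDeriv.of_le (by exact_mod_cast le_top))
    exact h2.congr fun u hu => (h.hasFDerivAt x hu).fderiv
  have h3 := (h1.contDiffAt expDomain_mem_nhds).contMDiffAt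
  have h4 : ContMDiffAt 𝓘(ℝ, V) 𝓘(ℝ, V) (n + 1 : ℕ) (extChartAt 𝓘(ℝ, V) (1 : G)) (x⁻¹ * x) := by
    rw [inv_mul_cancel]
    exact contMDiffAt_extChartAt.of_le (n := ∞) (by exact_mod_cast le_top)
  have h5 : ContMDiffAt 𝓘(ℝ, V) 𝓘(ℝ, V) (n + 1 : ℕ) (fun y : G => x⁻¹ * y) x :=
    (contMDiff_mul_left (n := ∞)).contMDiffAt.of_le (by exact_mod_cast le_top)
  have h6 : ContMDiffAt 𝓘(ℝ, V) 𝓘(ℝ, F) (n + 1 : ℕ) (fun u => f (x * expChart V G u))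
      (extChartAt 𝓘(ℝ, V) (1 : G) (x⁻¹ * x)) := by
    rw [inv_mul_cancel]; exact h3
  refine (ContMDiffAt.comp x h6 (h4.comp x h5)).congr_of_eventuallyEq ?_
  have h7 : (extChartAt 𝓘(ℝ, V) (1 : G)).source ∈ 𝓝 (x⁻¹ * x) := by
    rw [inv_mul_cancel]; exact extChartAt_source_mem_nhds _
  filter_upwards [h5.continuousAt h7] with y hy
  simp only [Function.comp]
  have h8 : expChart V G (extChartAt 𝓘(ℝ, V) (1 : G) (x⁻¹ * y)) = x⁻¹ * y :=
    (extChartAt 𝓘(ℝ, V) (1 : G)).left_inv hy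
  rw [h8, mul_inv_cancel_left]

lemma HasLeftDeriv.continuous {f : G → F} {f' : G → V →L[ℝ] F} (h : HasLeftDeriv f f') :
    Continuous f := by
  have : ContinuousMul G := continuousMul_of_contMDiffMul 𝓘(ℝ, V) ∞
  rw [continuous_iff_continuousAt]
  intro x
  have h1 := (h x).continuousAt
  have h3 : ContinuousAt (fun y : G => extChartAt 𝓘(ℝ, V) (1 : G) (x⁻¹ * y)) x :=
    ContinuousAt.comp (by rw [inv_mul_cancel]; exact continuousAt_extChartAt _)
      (continuousAt_const.mul continuousAt_id)
  have h4 : ContinuousAt (fun u => f (x * expChart V G u))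
      (extChartAt 𝓘(ℝ, V) (1 : G) (x⁻¹ * x)) := by
    rw [inv_mul_cancel]; exact h1
  refine (ContinuousAt.comp (x := x) h4 h3).congr ?_
  have h7 : (extChartAt 𝓘(ℝ, V) (1 : G)).source ∈ 𝓝 (x⁻¹ * x) := by
    rw [inv_mul_cancel]; exact extChartAt_source_mem_nhds _
  filter_upwards [(continuousAt_const.mul continuousAt_id (x := x) : ContinuousAt
    (fun y : G => x⁻¹ * y) x) h7] with y hy
  simp only [Function.comp]
  have h8 : expChart V G (extChartAt 𝓘(ℝ, V) (1 : G) (x⁻¹ * y)) = x⁻¹ * y :=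
    (extChartAt 𝓘(ℝ, V) (1 : G)).left_inv hy
  rw [h8, mul_inv_cancel_left]

/-- The Lie algebra is the model space. -/
def algVec : GroupLieAlgebra 𝓘(ℝ, V) G ≃ₗ[ℝ] V := LinearEquiv.refl ℝ V

/-- The invariant vector field at x is the differential of left multiplication by x applied to v.
The chain rule therefore reduces the manifold derivative to one in the chart at the identity. -/
lemma leftDeriv_eq {f : G → F} (hf : ContMDiff 𝓘(ℝ, V) 𝓘(ℝ, F) ∞ f)
    (v : GroupLieAlgebra 𝓘(ℝ, V) G) (x : G) : leftDeriv v f x = leftFDeriv V f x (algVec v) := by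
  have h1 : MDifferentiableAt 𝓘(ℝ, V) 𝓘(ℝ, F) f (x * 1) :=
    (hf.mdifferentiable (by simp)).mdifferentiableAt
  have h2 : MDifferentiableAt 𝓘(ℝ, V) 𝓘(ℝ, V) (fun y : G => x * y) 1 :=
    (contMDiff_mul_left (n := ∞)).contMDiffAt.mdifferentiableAt (by simp)
  have h3 := mfderiv_comp (1 : G) h1 h2
  have h4 : mfderiv 𝓘(ℝ, V) 𝓘(ℝ, F) (f ∘ fun y : G => x * y) 1 = leftFDeriv V f x := by
    rw [MDifferentiableAt.mfderiv (h1.comp (1 : G) h2)]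
    simp only [mfld_simps, fderivWithin_univ]
    rfl
  rw [← h4, h3, mul_one]
  rfl

end LieCalculus

end AGN

end

noncomputable section

namespace AGN

section LieCalculus

variable {V : Type*} [NormedAddCommGroup V] [NormedSpace ℝ V]
  {G : Type*} [Group G] [TopologicalSpace G] [ChartedSpace V G]
  {F : Type*} [NormedAddCommGroup F] [NormedSpace ℝ F]
  {F₂ : Type*} [NormedAddCommGroup F₂] [NormedSpace ℝ F₂]

/-! ### Rules for left-invariant derivatives -/

lemma HasLeftDeriv.clm {f : G → F} {f' : G → V →L[ℝ] F} (h : HasLeftDeriv f f') (L : F →L[ℝ] F₂) :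
    HasLeftDeriv (fun x => L (f x)) fun x => L.comp (f' x) := fun x =>
  L.hasFDerivAt.comp _ (h x)

lemma HasLeftDeriv.add {f₁ f₂ : G → F} {f₁' f₂' : G → V →L[ℝ] F} (h₁ : HasLeftDeriv f₁ f₁')
    (h₂ : HasLeftDeriv f₂ f₂') : HasLeftDeriv (f₁ + f₂) (f₁' + f₂') := fun x =>
  (h₁ x).add (h₂ x)

lemma HasLeftDeriv.mul {f₁ f₂ : G → ℂ} {f₁' f₂' : G → V →L[ℝ] ℂ} (h₁ : HasLeftDeriv f₁ f₁')
    (h₂ : HasLeftDeriv f₂ f₂') :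
    HasLeftDeriv (f₁ * f₂) fun x => f₁ x • f₂' x + f₂ x • f₁' x := fun x => by
  have h := (h₁ x).mul (h₂ x)
  simp only [expChart_expBase, mul_one] at h
  exact h

variable [LieGroup 𝓘(ℝ, V) ∞ G]

lemma contMDiff_leftDeriv {f : G → F} (hf : ContMDiff 𝓘(ℝ, V) 𝓘(ℝ, F) ∞ f)
    (v : GroupLieAlgebra 𝓘(ℝ, V) G) : ContMDiff 𝓘(ℝ, V) 𝓘(ℝ, F) ∞ (leftDeriv v f) := by
  have h : leftDeriv v f = fun x => ContinuousLinearMap.apply ℝ F (algVec v) (leftFDeriv V f x) :=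
    funext fun x => leftDeriv_eq hf v x
  rw [h]
  exact (ContinuousLinearMap.contDiff _).contMDiff.comp (contMDiff_leftFDeriv hf)

lemma leftDeriv_clm {f : G → F} (hf : ContMDiff 𝓘(ℝ, V) 𝓘(ℝ, F) ∞ f) (L : F →L[ℝ] F₂)
    (v : GroupLieAlgebra 𝓘(ℝ, V) G) :
    leftDeriv v (fun x => L (f x)) = fun x => L (leftDeriv v f x) := by
  funext x
  rw [leftDeriv_eq (f := fun x => L (f x)) (L.contDiff.contMDiff.comp hf), leftDeriv_eq hf,
    ((hasLeftDeriv_leftFDeriv hf).clm L).leftFDeriv_eq]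
  rfl

lemma leftDeriv_add {f₁ f₂ : G → F} (h₁ : ContMDiff 𝓘(ℝ, V) 𝓘(ℝ, F) ∞ f₁)
    (h₂ : ContMDiff 𝓘(ℝ, V) 𝓘(ℝ, F) ∞ f₂) (v : GroupLieAlgebra 𝓘(ℝ, V) G) :
    leftDeriv v (f₁ + f₂) = leftDeriv v f₁ + leftDeriv v f₂ := by
  funext x
  rw [leftDeriv_eq (h₁.add h₂), Pi.add_apply, leftDeriv_eq h₁, leftDeriv_eq h₂,
    ((hasLeftDeriv_leftFDeriv h₁).add (hasLeftDeriv_leftFDeriv h₂)).leftFDeriv_eq]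
  rfl

lemma leftDeriv_mul {f₁ f₂ : G → ℂ} (h₁ : ContMDiff 𝓘(ℝ, V) 𝓘(ℝ, ℂ) ∞ f₁)
    (h₂ : ContMDiff 𝓘(ℝ, V) 𝓘(ℝ, ℂ) ∞ f₂) (v : GroupLieAlgebra 𝓘(ℝ, V) G) :
    leftDeriv v (f₁ * f₂) = f₁ * leftDeriv v f₂ + f₂ * leftDeriv v f₁ := by
  funext x
  have h3 : ContMDiff 𝓘(ℝ, V) 𝓘(ℝ, ℂ) ∞ (f₁ * f₂) :=
    contDiff_mul.contMDiff.comp (h₁.prodMk_space h₂)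
  rw [leftDeriv_eq h3, Pi.add_apply, Pi.mul_apply, Pi.mul_apply, leftDeriv_eq h₁,
    leftDeriv_eq h₂, ((hasLeftDeriv_leftFDeriv h₁).mul (hasLeftDeriv_leftFDeriv h₂)).leftFDeriv_eq]
  rfl

/-- A class of functions that is stable under left-invariant derivatives consists of smooth
functions. -/
lemma contMDiff_of_stable [FiniteDimensional ℝ V] (P : (G → F) → Prop)
    (h : ∀ f, P f → ∃ f' : G → V →L[ℝ] F, HasLeftDeriv f f' ∧ ∀ v, P fun x => f' x v)
    {f : G → F} (hf : P f) : ContMDiff 𝓘(ℝ, V) 𝓘(ℝ, F) ∞ f := by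
  -- The induction on the order runs over the whole class at once: the components of f' in a basis
  -- belong to the class again, so they have the order already reached.
  have key : ∀ (n : ℕ) (f : G → F), P f → ContMDiff 𝓘(ℝ, V) 𝓘(ℝ, F) n f := by
    intro n
    induction n with
    | zero =>
      intro f hf
      obtain ⟨f', h1, -⟩ := h f hf
      exact contMDiff_zero_iff.2 h1.continuous
    | succ n ih =>
      intro f hf
      obtain ⟨f', h1, h2⟩ := h f hf
      refine h1.contMDiff_succ ?_
      let b := Module.finBasis ℝ V
      have h3 : f' = fun x => ∑ i, ContinuousLinearMap.smulRightL ℝ V F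
          (LinearMap.toContinuousLinearMap (b.coord i)) (f' x (b i)) := by
        funext x
        ext v
        rw [_root_.sum_apply]
        simp only [ContinuousLinearMap.smulRightL_apply_apply,
          ContinuousLinearMap.smulRight_apply, LinearMap.coe_toContinuousLinearMap',
          Module.Basis.coord_apply, ← map_smul, ← map_sum, b.sum_repr]
      rw [h3]
      have h4 : ∀ s : Finset (Fin (Module.finrank ℝ V)), ContMDiff 𝓘(ℝ, V) 𝓘(ℝ, V →L[ℝ] F) n
          fun x => ∑ i ∈ s, ContinuousLinearMap.smulRightL ℝ V F
          (LinearMap.toContinuousLinearMap (b.coord i)) (f' x (b i)) := fun s =>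
        contMDiff_finsetSum fun i _ =>
          (ContinuousLinearMap.contDiff _).contMDiff.comp (ih _ (h2 (b i)))
      exact h4 _
  exact contMDiff_infty.2 fun n => key n f hf

/-- The structure constants of the Lie algebra, in the chart at the identity. -/
def chartBracket (V G : Type*) [NormedAddCommGroup V] [NormedSpace ℝ V] [Group G]
    [TopologicalSpace G] [ChartedSpace V G] (v w : V) : V :=
  fderiv ℝ (logDeriv V G) (expBase V G) w v - fderiv ℝ (logDeriv V G) (expBase V G) v w

/-- This is the symmetry of the second derivative of u ↦ f (x g(u)), whose first derivative is the
left derivative composed with `logDeriv`. It suffices for the sequel that the commutator is an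
invariant derivative of first order; the bracket need not be identified further. -/
lemma leftDeriv_comm {f : G → F} (hf : ContMDiff 𝓘(ℝ, V) 𝓘(ℝ, F) ∞ f)
    (v w : GroupLieAlgebra 𝓘(ℝ, V) G) (x : G) :
    leftDeriv v (leftDeriv w f) x - leftDeriv w (leftDeriv v f) x =
      leftDeriv (algVec.symm (chartBracket V G (algVec v) (algVec w))) f x := by
  have h1 := hasLeftDeriv_leftFDeriv hf
  have h2 := hasLeftDeriv_leftFDeriv (contMDiff_leftFDeriv hf)
  have h3 : HasFDerivAt (logDeriv V G) (fderiv ℝ (logDeriv V G) (expBase V G)) (expBase V G) :=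
    ((contDiffOn_logDeriv.contDiffAt expDomain_mem_nhds).differentiableAt (by simp)).hasFDerivAt
  have h4 := (h2 x).clm_comp h3
  have h5 := second_derivative_symmetric_of_eventually_of_real (x := expBase V G)
    (f := fun u => f (x * expChart V G u))
    (f' := fun u => (leftFDeriv V f (x * expChart V G u)).comp (logDeriv V G u))
    (Filter.mem_of_superset expDomain_mem_nhds fun u hu => h1.hasFDerivAt x hu) h4 (algVec v) (algVec w)
  have h6 : ∀ a b : GroupLieAlgebra 𝓘(ℝ, V) G, leftDeriv a (leftDeriv b f) x =
      leftFDeriv V (leftFDeriv V f) x (algVec a) (algVec b) := by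
    intro a b
    have e : leftDeriv b f = fun x => ContinuousLinearMap.apply ℝ F (algVec b) (leftFDeriv V f x) :=
      funext fun x => leftDeriv_eq hf b x
    rw [e, leftDeriv_clm (contMDiff_leftFDeriv hf)]
    change ContinuousLinearMap.apply ℝ F (algVec b) (leftDeriv a (leftFDeriv V f) x) = _
    rw [leftDeriv_eq (contMDiff_leftFDeriv hf)]
    rfl
  rw [h6, h6, leftDeriv_eq hf]
  simp only [expChart_expBase, mul_one, logDeriv_expBase] at h5
  have h7 : leftFDeriv V f x (fderiv ℝ (logDeriv V G) (expBase V G) (algVec v) (algVec w)) +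
      leftFDeriv V (leftFDeriv V f) x (algVec v) (algVec w) =
      leftFDeriv V f x (fderiv ℝ (logDeriv V G) (expBase V G) (algVec w) (algVec v)) +
      leftFDeriv V (leftFDeriv V f) x (algVec w) (algVec v) := h5
  rw [LinearEquiv.apply_symm_apply, chartBracket, map_sub, sub_eq_sub_iff_add_eq_add]
  rw [add_comm, h7]

variable [ConnectedSpace G]

/-- On a ball in the chart translated to x the function is constant; connectedness does the rest. -/
lemma eq_const_of_leftFDeriv_eq_zero {f : G → F} (hf : ContMDiff 𝓘(ℝ, V) 𝓘(ℝ, F) ∞ f)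
    (h : ∀ x, leftFDeriv V f x = 0) (x y : G) : f x = f y := by
  have : ContinuousMul G := continuousMul_of_contMDiffMul 𝓘(ℝ, V) ∞
  have hl : IsLocallyConstant f := by
    rw [IsLocallyConstant.iff_eventually_eq]
    intro x
    obtain ⟨r, hr, hb⟩ := Metric.mem_nhds_iff.1 (expDomain_mem_nhds (V := V) (G := G))
    have h1 : ∀ u ∈ Metric.ball (expBase V G) r, f (x * expChart V G u) = f x := by
      intro u hu
      have h2 := (convex_ball (expBase V G) r).is_const_of_fderivWithin_eq_zero (𝕜 := ℝ)
        (f := fun u => f (x * expChart V G u)) (fun w hw =>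
          ((hasLeftDeriv_leftFDeriv hf).hasFDerivAt x (hb hw)).differentiableAt.differentiableWithinAt)
        (fun w hw => ?_) hu (Metric.mem_ball_self hr)
      · simpa using h2
      · rw [fderivWithin_of_isOpen Metric.isOpen_ball hw,
          ((hasLeftDeriv_leftFDeriv hf).hasFDerivAt x (hb hw)).fderiv, h]
        rfl
    have h3 : ContinuousAt (fun y : G => x⁻¹ * y) x := continuousAt_const.mul continuousAt_id
    have h4 : ContinuousAt (extChartAt 𝓘(ℝ, V) (1 : G)) (x⁻¹ * x) := by
      rw [inv_mul_cancel]; exact continuousAt_extChartAt _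
    have h5 : (extChartAt 𝓘(ℝ, V) (1 : G)).source ∈ 𝓝 (x⁻¹ * x) := by
      rw [inv_mul_cancel]; exact extChartAt_source_mem_nhds _
    have h6 : Metric.ball (expBase V G) r ∈ 𝓝 (extChartAt 𝓘(ℝ, V) (1 : G) (x⁻¹ * x)) := by
      rw [inv_mul_cancel]; exact Metric.ball_mem_nhds _ hr
    filter_upwards [h3 h5, (ContinuousAt.comp (x := x) h4 h3) h6] with y hy hy'
    rw [← h1 _ hy']
    have h8 : expChart V G (extChartAt 𝓘(ℝ, V) (1 : G) (x⁻¹ * y)) = x⁻¹ * y :=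
      (extChartAt 𝓘(ℝ, V) (1 : G)).left_inv hy
    simp only [Function.comp]
    rw [h8, mul_inv_cancel_left]
  exact hl.apply_eq_of_isPreconnected isPreconnected_univ (Set.mem_univ x) (Set.mem_univ y)

end LieCalculus

end AGN

end

noncomputable section

namespace AGN

set_option linter.unusedSectionVars false

section LieIntegral

variable {V : Type*} [NormedAddCommGroup V] [NormedSpace ℝ V]
  {G : Type*} [Group G] [TopologicalSpace G] [ChartedSpace V G]
  {F : Type*} [NormedAddCommGroup F] [NormedSpace ℝ F]
  {F₂ : Type*} [NormedAddCommGroup F₂] [NormedSpace ℝ F₂]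
  [IsTopologicalGroup G] [CompactSpace G] [SecondCountableTopology G]
  [MeasurableSpace G] [BorelSpace G] (μ : Measure G) [IsProbabilityMeasure μ]

/-! ### Integration on a compact Lie group -/

/-- A right translate of the normalized Haar measure is again a left-invariant probability measure,
and there is only one. -/
lemma isMulRightInvariant_of_isHaarMeasure [μ.IsHaarMeasure] : μ.IsMulRightInvariant := by
  refine ⟨fun y => ?_⟩
  have : IsProbabilityMeasure (Measure.map (· * y) μ) :=
    Measure.isProbabilityMeasure_map (measurable_mul_const y).aemeasurable
  exact Measure.isHaarMeasure_eq_of_isProbabilityMeasure _ _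

variable {μ} in
lemma integrable_of_continuous {f : G → F} (hf : Continuous f) : Integrable f μ := by
  obtain ⟨B, hB⟩ := isCompact_univ.exists_bound_of_continuousOn hf.continuousOn
  exact Integrable.of_bound hf.aestronglyMeasurable B (Eventually.of_forall fun x => hB x trivial)

variable [LieGroup 𝓘(ℝ, V) ∞ G]

variable {μ} in
-- Differentiation under the integral, dominated by ‖k‖ times a bound for the continuous left
-- derivative. The map p allows both y (for translates) and y⁻¹ x (for convolutions).
lemma hasFDerivAt_integral_translate {k : G → F →L[ℝ] F₂} (hk : Integrable k μ) {f : G → F}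
    (hf : ContMDiff 𝓘(ℝ, V) 𝓘(ℝ, F) ∞ f) {p : G → G} (hp : Continuous p) {u : V}
    (hu : u ∈ expDomain V G) :
    HasFDerivAt (fun w => ∫ y, k y (f (p y * expChart V G w)) ∂μ)
      (∫ y, (k y).comp ((leftFDeriv V f (p y * expChart V G u)).comp (logDeriv V G u)) ∂μ) u := by
  obtain ⟨B, hB⟩ := isCompact_univ.exists_bound_of_continuousOn
    (contMDiff_leftFDeriv hf).continuous.continuousOn
  obtain ⟨B₀, hB₀⟩ := isCompact_univ.exists_bound_of_continuousOn hf.continuous.continuousOn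
  have hs : {w | w ∈ expDomain V G ∧ ‖logDeriv V G w‖ < ‖logDeriv V G u‖ + 1} ∈ 𝓝 u := by
    have h1 : ContinuousAt (logDeriv V G) u :=
      contDiffOn_logDeriv.continuousOn.continuousAt (isOpen_expDomain.mem_nhds hu)
    exact Filter.inter_mem (isOpen_expDomain.mem_nhds hu)
      (h1.norm.eventually (gt_mem_nhds (lt_add_one _)))
  have hfm : ∀ w, AEStronglyMeasurable (fun y => k y (f (p y * expChart V G w))) μ := fun w =>
    isBoundedBilinearMap_apply.continuous.comp_aestronglyMeasurable (hk.1.prodMk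
      (hf.continuous.comp (hp.mul continuous_const)).aestronglyMeasurable)
  refine hasFDerivAt_integral_of_dominated_of_fderiv_le (𝕜 := ℝ)
    (F' := fun w y => (k y).comp ((leftFDeriv V f (p y * expChart V G w)).comp (logDeriv V G w)))
    (bound := fun y => ‖k y‖ * (B * (‖logDeriv V G u‖ + 1))) hs
    (Eventually.of_forall hfm) ?_ ?_ (Eventually.of_forall fun y w hw => ?_) (hk.norm.mul_const _)
    (Eventually.of_forall fun y w hw => ?_)
  · refine Integrable.mono' (hk.norm.mul_const B₀) (hfm u) (Eventually.of_forall fun y => ?_)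
    exact (k y).le_opNorm_of_le (hB₀ _ trivial)
  · refine isBoundedBilinearMap_comp.continuous.comp_aestronglyMeasurable (hk.1.prodMk ?_)
    have h2 : Continuous fun y => (leftFDeriv V f (p y * expChart V G u)).comp (logDeriv V G u) :=
      ((contMDiff_leftFDeriv hf).continuous.comp (hp.mul continuous_const)).clm_comp
        continuous_const
    exact h2.aestronglyMeasurable
  · have h0 : 0 ≤ B := (norm_nonneg _).trans (hB 1 trivial)
    refine (ContinuousLinearMap.opNorm_comp_le _ _).trans ?_
    gcongr
    refine (ContinuousLinearMap.opNorm_comp_le _ _).trans ?_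
    have := hw.2.le
    gcongr
    exact hB _ trivial
  · exact (k y).hasFDerivAt.comp w ((hasLeftDeriv_leftFDeriv hf).hasFDerivAt (p y) hw.1)

/-- Right invariance makes ∫ f (x g(u)) independent of u; its derivative in u is the integral in
question. -/
lemma integral_leftFDeriv [μ.IsHaarMeasure] {f : G → F} (hf : ContMDiff 𝓘(ℝ, V) 𝓘(ℝ, F) ∞ f) :
    ∫ x, leftFDeriv V f x ∂μ = 0 := by
  have hR := isMulRightInvariant_of_isHaarMeasure μ
  have h1 := hasFDerivAt_integral_translate (μ := μ) (k := fun _ => ContinuousLinearMap.id ℝ F)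
    (integrable_const _) hf continuous_id expBase_mem
  simp only [id, ContinuousLinearMap.id_apply, integral_mul_right_eq_self (μ := μ) f,
    expChart_expBase, mul_one, logDeriv_expBase, ContinuousLinearMap.comp_id,
    ContinuousLinearMap.id_comp] at h1
  exact h1.unique (hasFDerivAt_const _ _)

lemma integral_leftDeriv [μ.IsHaarMeasure] [CompleteSpace F] {f : G → F}
    (hf : ContMDiff 𝓘(ℝ, V) 𝓘(ℝ, F) ∞ f) (v : GroupLieAlgebra 𝓘(ℝ, V) G) :
    ∫ x, leftDeriv v f x ∂μ = 0 := by
  simp only [leftDeriv_eq hf]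
  rw [← ContinuousLinearMap.integral_apply
    (integrable_of_continuous (contMDiff_leftFDeriv hf).continuous), integral_leftFDeriv μ hf]
  rfl

/-- Right convolution by a function. -/
def conv (f h : G → ℂ) (x : G) : ℂ := ∫ y, f y * h (y⁻¹ * x) ∂μ

/-- Left-invariant derivatives of f * h fall on h, so the convolutions of f with smooth functions
form a class that is stable under derivatives. -/
lemma contMDiff_conv [FiniteDimensional ℝ V] {f : G → ℂ} (hf : Integrable f μ) {h : G → ℂ}
    (hh : ContMDiff 𝓘(ℝ, V) 𝓘(ℝ, ℂ) ∞ h) : ContMDiff 𝓘(ℝ, V) 𝓘(ℝ, ℂ) ∞ (conv μ f h) := by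
  refine contMDiff_of_stable
    (fun F => ∃ h : G → ℂ, ContMDiff 𝓘(ℝ, V) 𝓘(ℝ, ℂ) ∞ h ∧ F = conv μ f h) ?_ ⟨h, hh, rfl⟩
  rintro _ ⟨h, hh, rfl⟩
  let k : G → ℂ →L[ℝ] ℂ := fun y => ContinuousLinearMap.mul ℝ ℂ (f y)
  have hk : Integrable k μ := (ContinuousLinearMap.mul ℝ ℂ).integrable_comp hf
  have h2 : ∀ x, Integrable (fun y => (k y).comp (leftFDeriv V h (y⁻¹ * x))) μ := fun x => by
    obtain ⟨B, hB⟩ := isCompact_univ.exists_bound_of_continuousOn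
      (contMDiff_leftFDeriv hh).continuous.continuousOn
    refine Integrable.mono' (hk.norm.mul_const B) ?_ (Eventually.of_forall fun y => ?_)
    · refine isBoundedBilinearMap_comp.continuous.comp_aestronglyMeasurable (hk.1.prodMk ?_)
      exact ((contMDiff_leftFDeriv hh).continuous.comp
        (continuous_inv.mul continuous_const)).aestronglyMeasurable
    · exact (ContinuousLinearMap.opNorm_comp_le _ _).trans (by gcongr; exact hB _ trivial)
  refine ⟨fun x => ∫ y, (k y).comp (leftFDeriv V h (y⁻¹ * x)) ∂μ, fun x => ?_, fun v => ?_⟩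
  · have h1 := hasFDerivAt_integral_translate hk hh (p := fun y => y⁻¹ * x)
      (continuous_inv.mul continuous_const) expBase_mem
    simp only [expChart_expBase, mul_one, logDeriv_expBase, ContinuousLinearMap.comp_id] at h1
    refine h1.congr_of_eventuallyEq (Eventually.of_forall fun u => ?_)
    simp only [conv, k, mul_assoc]
    rfl
  · refine ⟨leftDeriv (algVec.symm v) h, contMDiff_leftDeriv hh _, ?_⟩
    funext x
    rw [ContinuousLinearMap.integral_apply (h2 x), conv]
    simp only [leftDeriv_eq hh]
    rfl

/-- The mean square of a function. -/
def sqInt (f : G → F) : ℝ := ∫ x, ‖f x‖ ^ 2 ∂μ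

lemma sqInt_nonneg (f : G → F) : 0 ≤ sqInt μ f := integral_nonneg fun _ => by positivity

lemma sqInt_mul_right [μ.IsHaarMeasure] (f : G → F) (y : G) :
    sqInt μ (fun x => f (x * y)) = sqInt μ f := by
  have hR := isMulRightInvariant_of_isHaarMeasure μ
  exact integral_mul_right_eq_self (μ := μ) (fun x => ‖f x‖ ^ 2) y

lemma memLp_norm {f : G → F} (hf : Continuous f) :
    MemLp (fun x => ‖f x‖) (ENNReal.ofReal 2) μ := by
  obtain ⟨B, hB⟩ := isCompact_univ.exists_bound_of_continuousOn hf.norm.continuousOn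
  exact MemLp.of_bound hf.norm.aestronglyMeasurable B (Eventually.of_forall fun x => hB x trivial)

lemma integral_norm_mul_le {f : G → F} {h : G → F₂} (hf : Continuous f) (hh : Continuous h) :
    ∫ x, ‖f x‖ * ‖h x‖ ∂μ ≤ √(sqInt μ f) * √(sqInt μ h) := by
  have h2 := integral_mul_le_Lp_mul_Lq_of_nonneg (μ := μ) Real.HolderConjugate.two_two
    (Eventually.of_forall fun x => norm_nonneg (f x))
    (Eventually.of_forall fun x => norm_nonneg (h x)) (memLp_norm μ hf) (memLp_norm μ hh)
  simpa only [Real.rpow_two, Real.sqrt_eq_rpow, sqInt] using h2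

variable {S : Type*} [NormedAddCommGroup S] [InnerProductSpace ℂ S]

/-- The mean value inequality is applied to the scalar function w ↦ ∫ ⟪d, f (x g(w))⟫, where d is
the difference under study. It yields ‖d‖² ≤ C ‖u - base‖ ‖d‖ ‖f'‖ in L², and one factor ‖d‖
cancels. -/
lemma sqInt_translate_sub_le [μ.IsHaarMeasure] {r C : ℝ} (hr : 0 < r)
    (hb : Metric.ball (expBase V G) r ⊆ expDomain V G)
    (hC : ∀ u ∈ Metric.ball (expBase V G) r, ‖logDeriv V G u‖ ≤ C) {f : G → S}
    (hf : ContMDiff 𝓘(ℝ, V) 𝓘(ℝ, S) ∞ f) {u : V} (hu : u ∈ Metric.ball (expBase V G) r) :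
    sqInt μ (fun x => f (x * expChart V G u) - f x) ≤
      (C * ‖u - expBase V G‖) ^ 2 * sqInt μ (leftFDeriv V f) := by
  set g : G → S := fun x => f (x * expChart V G u) - f x with hg
  have hgc : Continuous g :=
    (hf.continuous.comp (continuous_id.mul continuous_const)).sub hf.continuous
  have hLc := (contMDiff_leftFDeriv hf).continuous
  let k : G → S →L[ℝ] ℂ := fun x => (innerSL ℂ (g x)).restrictScalars ℝ
  have hkc : Continuous k :=
    (ContinuousLinearMap.restrictScalarsL ℂ S ℂ ℝ ℝ).continuous.comp
      ((innerSL ℂ).continuous.comp hgc)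
  have hkn : ∀ x, ‖k x‖ = ‖g x‖ := fun x => by
    simp [k, ContinuousLinearMap.norm_restrictScalars]
  have hC0 : 0 ≤ C := (norm_nonneg _).trans (hC u hu)
  have h1 := fun w (hw : w ∈ Metric.ball (expBase V G) r) =>
    (hasFDerivAt_integral_translate (integrable_of_continuous (μ := μ) hkc) hf
      continuous_id (hb hw)).hasFDerivWithinAt (s := Metric.ball (expBase V G) r)
  have h2 := (convex_ball (expBase V G) r).norm_image_sub_le_of_norm_hasFDerivWithin_le
    (C := √(sqInt μ g) * √(sqInt μ (leftFDeriv V f)) * C) h1 (fun w hw => ?_)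
    (Metric.mem_ball_self hr) hu
  · have hc : ∀ w, Integrable (fun y => k y (f (y * expChart V G w))) μ := fun w =>
      integrable_of_continuous (hkc.clm_apply
        (hf.continuous.comp (continuous_id.mul continuous_const)))
    simp only [id] at h2
    rw [← integral_sub (hc _) (hc _)] at h2
    have h3 : (∫ y, (k y (f (y * expChart V G u)) - k y (f (y * expChart V G (expBase V G)))) ∂μ) =
        (sqInt μ g : ℂ) := by
      rw [sqInt, ← integral_complex_ofReal]
      refine integral_congr_ae (Eventually.of_forall fun y => ?_)
      simp only [expChart_expBase, mul_one]
      rw [← map_sub]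
      change ⟪g y, g y⟫_ℂ = _
      rw [inner_self_eq_norm_sq_to_K]
      norm_cast
    rw [h3, Complex.norm_real, Real.norm_of_nonneg (sqInt_nonneg μ g)] at h2
    have hA := sqInt_nonneg μ g
    have hB := sqInt_nonneg μ (leftFDeriv V f)
    have h5 : √(sqInt μ g) ≤ C * ‖u - expBase V G‖ * √(sqInt μ (leftFDeriv V f)) := by
      rcases hA.eq_or_lt with h | h
      · rw [← h, Real.sqrt_zero]; positivity
      · have h6 : 0 < √(sqInt μ g) := Real.sqrt_pos.2 h
        refine le_of_mul_le_mul_left ?_ h6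
        rw [Real.mul_self_sqrt hA]
        linarith
    calc sqInt μ g = √(sqInt μ g) ^ 2 := (Real.sq_sqrt hA).symm
      _ ≤ (C * ‖u - expBase V G‖ * √(sqInt μ (leftFDeriv V f))) ^ 2 := by gcongr
      _ = _ := by rw [mul_pow, Real.sq_sqrt hB]
  · refine (norm_integral_le_integral_norm _).trans ?_
    have h3 : Continuous fun y : G => leftFDeriv V f (y * expChart V G w) :=
      hLc.comp (continuous_id.mul continuous_const)
    calc ∫ y, ‖(k y).comp ((leftFDeriv V f (id y * expChart V G w)).comp (logDeriv V G w))‖ ∂μ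
        ≤ ∫ y, ‖g y‖ * ‖leftFDeriv V f (y * expChart V G w)‖ * C ∂μ := by
          refine integral_mono (integrable_of_continuous ?_) (integrable_of_continuous ?_)
            fun y => ?_
          · exact (hkc.clm_comp (h3.clm_comp continuous_const)).norm
          · exact (hgc.norm.mul h3.norm).mul continuous_const
          · refine (ContinuousLinearMap.opNorm_comp_le _ _).trans ?_
            rw [hkn, mul_assoc]
            gcongr
            refine (ContinuousLinearMap.opNorm_comp_le _ _).trans ?_
            have := hC w hw
            gcongr
            rfl
      _ ≤ _ := by
          rw [integral_mul_const]
          gcongr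
          refine (integral_norm_mul_le μ hgc h3).trans_eq ?_
          rw [sqInt_mul_right μ (leftFDeriv V f)]

lemma exists_ball_logDeriv (V G : Type*) [NormedAddCommGroup V] [NormedSpace ℝ V] [Group G]
    [TopologicalSpace G] [ChartedSpace V G] [LieGroup 𝓘(ℝ, V) ∞ G] :
    ∃ r C : ℝ, 0 < r ∧ Metric.ball (expBase V G) r ⊆ expDomain V G ∧
      ∀ u ∈ Metric.ball (expBase V G) r, ‖logDeriv V G u‖ ≤ C := by
  have h1 : ContinuousAt (logDeriv V G) (expBase V G) :=
    contDiffOn_logDeriv.continuousOn.continuousAt expDomain_mem_nhds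
  obtain ⟨r, hr, hb⟩ := Metric.mem_nhds_iff.1 (Filter.inter_mem expDomain_mem_nhds
    (h1.norm.eventually (gt_mem_nhds (lt_add_one _))))
  exact ⟨r, _, hr, fun u hu => (hb hu).1, fun u hu => (hb hu).2.le⟩

end LieIntegral

end AGN

end

noncomputable section

namespace AGN

set_option linter.unusedSectionVars false

section RepFunctions

variable {V : Type*} [NormedAddCommGroup V] [NormedSpace ℝ V]
  {G : Type*} [Group G] [TopologicalSpace G] [ChartedSpace V G]

/-! ### Functions that generate a finite-dimensional space under left-invariant derivatives -/

variable (V) in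
/-- A space of smooth functions that is stable under left-invariant derivatives. -/
def IsStableSpace (U : Submodule ℂ (G → ℂ)) : Prop :=
  ∀ u ∈ U, ContMDiff 𝓘(ℝ, V) 𝓘(ℝ, ℂ) ∞ u ∧ ∀ v : GroupLieAlgebra 𝓘(ℝ, V) G, leftDeriv v u ∈ U

variable [LieGroup 𝓘(ℝ, V) ∞ G]

lemma IsStableSpace.sup {U U' : Submodule ℂ (G → ℂ)} (h : IsStableSpace V U)
    (h' : IsStableSpace V U') : IsStableSpace V (U ⊔ U') := by
  intro u hu
  obtain ⟨a, ha, b, hb, rfl⟩ := Submodule.mem_sup.1 hu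
  refine ⟨(h a ha).1.add (h' b hb).1, fun v => ?_⟩
  rw [leftDeriv_add (h a ha).1 (h' b hb).1]
  exact Submodule.add_mem_sup ((h a ha).2 v) ((h' b hb).2 v)

lemma IsStableSpace.mul {U U' : Submodule ℂ (G → ℂ)} (h : IsStableSpace V U)
    (h' : IsStableSpace V U') : IsStableSpace V (U * U') := by
  intro u hu
  refine Submodule.mul_induction_on hu (fun a ha b hb => ?_) fun a b ha hb => ?_
  · refine ⟨contDiff_mul.contMDiff.comp ((h a ha).1.prodMk_space (h' b hb).1), fun v => ?_⟩
    rw [leftDeriv_mul (h a ha).1 (h' b hb).1, mul_comm b]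
    exact add_mem (Submodule.mul_mem_mul ha ((h' b hb).2 v))
      (Submodule.mul_mem_mul ((h a ha).2 v) hb)
  · refine ⟨ha.1.add hb.1, fun v => ?_⟩
    rw [leftDeriv_add ha.1 hb.1]
    exact add_mem (ha.2 v) (hb.2 v)

lemma leftDeriv_const {E : Type*} [NormedAddCommGroup E] [NormedSpace ℝ E] (z : E)
    (v : GroupLieAlgebra 𝓘(ℝ, V) G) :
    leftDeriv v (fun _ : G => z) = 0 := by
  funext x
  rw [leftDeriv_eq contMDiff_const]
  have h : HasLeftDeriv (fun _ : G => z) (0 : G → V →L[ℝ] E) := fun x => hasFDerivAt_const _ _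
  rw [h.leftFDeriv_eq]
  rfl

lemma isStableSpace_const : IsStableSpace V (Submodule.span ℂ {(1 : G → ℂ)}) := by
  intro u hu
  obtain ⟨z, rfl⟩ := Submodule.mem_span_singleton.1 hu
  have h : z • (1 : G → ℂ) = fun _ => z := by ext; simp
  rw [h]
  exact ⟨contMDiff_const, fun v => by rw [leftDeriv_const]; exact zero_mem _⟩

lemma IsStableSpace.conj {U : Submodule ℂ (G → ℂ)} (h : IsStableSpace V U) :
    IsStableSpace V (U.map (starLinearEquiv ℂ (A := G → ℂ)).toLinearMap) := by
  rintro _ ⟨u, hu, rfl⟩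
  refine ⟨Complex.conjCLE.contDiff.contMDiff.comp (h u hu).1, fun v => ?_⟩
  exact ⟨leftDeriv v u, (h u hu).2 v,
    (leftDeriv_clm (h u hu).1 (Complex.conjCLE : ℂ →L[ℝ] ℂ) v).symm⟩

variable (V G) in
/-- The algebra of the smooth functions that generate a finite-dimensional space under
left-invariant derivatives. -/
def repAlg : Subalgebra ℂ (G → ℂ) where
  carrier := {f | ∃ U : Submodule ℂ (G → ℂ), f ∈ U ∧ U.FG ∧ IsStableSpace V U}
  mul_mem' := by
    rintro a b ⟨U, ha, hU, h⟩ ⟨U', hb, hU', h'⟩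
    exact ⟨U * U', Submodule.mul_mem_mul ha hb, hU.mul hU', h.mul h'⟩
  add_mem' := by
    rintro a b ⟨U, ha, hU, h⟩ ⟨U', hb, hU', h'⟩
    exact ⟨U ⊔ U', Submodule.add_mem_sup ha hb, hU.sup hU', h.sup h'⟩
  algebraMap_mem' z := ⟨Submodule.span ℂ {1}, Submodule.mem_span_singleton.2 ⟨z, by
    ext; simp⟩, Submodule.fg_span_singleton _, isStableSpace_const⟩

lemma contMDiff_of_mem_repAlg {f : G → ℂ} (hf : f ∈ repAlg V G) :
    ContMDiff 𝓘(ℝ, V) 𝓘(ℝ, ℂ) ∞ f := by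
  obtain ⟨U, h, -, hU⟩ := hf
  exact (hU f h).1

lemma leftDeriv_mem_repAlg {f : G → ℂ} (hf : f ∈ repAlg V G) (v : GroupLieAlgebra 𝓘(ℝ, V) G) :
    leftDeriv v f ∈ repAlg V G := by
  obtain ⟨U, h, hfg, hU⟩ := hf
  exact ⟨U, (hU f h).2 v, hfg, hU⟩

lemma star_mem_repAlg {f : G → ℂ} (hf : f ∈ repAlg V G) : star f ∈ repAlg V G := by
  obtain ⟨U, h, hfg, hU⟩ := hf
  exact ⟨U.map (starLinearEquiv ℂ (A := G → ℂ)).toLinearMap, Submodule.mem_map_of_mem h,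
    hfg.map _, hU.conj⟩

/-- A finite-dimensional space of smooth functions that is stable under right translations is stable
under left-invariant derivatives. -/
lemma isStableSpace_of_translate {U : Submodule ℂ (G → ℂ)} (hfg : U.FG)
    (hs : ∀ u ∈ U, ContMDiff 𝓘(ℝ, V) 𝓘(ℝ, ℂ) ∞ u) (ht : ∀ u ∈ U, ∀ y, (fun x => u (x * y)) ∈ U) :
    IsStableSpace V U := by
  refine fun u hu => ⟨hs u hu, fun v => ?_⟩
  have : FiniteDimensional ℂ U := Module.Finite.iff_fg.2 hfg
  -- The derivative is a pointwise limit of difference quotients of right translates, which stay in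
  -- the finite-dimensional, hence closed, space.
  refine (Submodule.closed_of_finiteDimensional U).mem_of_tendsto
    (f := fun (c : ℝ) (x : G) => (c : ℂ) • (u (x * expChart V G (expBase V G + c⁻¹ • algVec v)) - u x))
    (b := atTop) ?_ (Eventually.of_forall fun c => ?_)
  · rw [tendsto_pi_nhds]
    intro x
    have h := (hasLeftDeriv_leftFDeriv (hs u hu) x).lim_real (algVec v)
    rw [leftDeriv_eq (hs u hu)]
    simp only [expChart_expBase, mul_one] at h
    exact h
  · exact U.smul_mem _ (U.sub_mem (ht u hu _) hu)

/-- Left-invariant derivatives as operators on `repAlg`. -/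
def repDeriv (v : GroupLieAlgebra 𝓘(ℝ, V) G) : Module.End ℂ (repAlg V G) where
  toFun w := ⟨leftDeriv v w, leftDeriv_mem_repAlg w.2 v⟩
  map_add' w w' := Subtype.ext
    (leftDeriv_add (contMDiff_of_mem_repAlg w.2) (contMDiff_of_mem_repAlg w'.2) v)
  map_smul' r w := Subtype.ext (leftDeriv_clm (contMDiff_of_mem_repAlg w.2)
    ((r • ContinuousLinearMap.id ℂ ℂ).restrictScalars ℝ) v)

@[simp] lemma repDeriv_apply (v : GroupLieAlgebra 𝓘(ℝ, V) G) (w : repAlg V G) :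
    (repDeriv v w : G → ℂ) = leftDeriv v w := rfl

lemma continuous_of_mem_repAlg (f : G → ℂ) (hf : f ∈ repAlg V G) : Continuous f :=
  (contMDiff_of_mem_repAlg hf).continuous

lemma exists_repDeriv_stable (w : repAlg V G) : ∃ U : Submodule ℂ (repAlg V G), w ∈ U ∧ U.FG ∧
    ∀ v : GroupLieAlgebra 𝓘(ℝ, V) G, ∀ w ∈ U, repDeriv v w ∈ U := by
  obtain ⟨U, h1, h2, h3⟩ := w.2
  have hle : U ≤ Subalgebra.toSubmodule (repAlg V G) := fun u hu => ⟨U, hu, h2, h3⟩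
  have : FiniteDimensional ℂ U := Module.Finite.iff_fg.2 h2
  refine ⟨U.comap (Subalgebra.toSubmodule (repAlg V G)).subtype, h1, ?_, fun v w hw =>
    (h3 _ hw).2 v⟩
  exact Module.Finite.iff_fg.1
    (Module.Finite.equiv (Submodule.comapSubtypeEquivOfLe hle).symm)

end RepFunctions

section PeterWeyl

variable {V : Type*} [NormedAddCommGroup V] [NormedSpace ℝ V]
  {G : Type*} [Group G] [TopologicalSpace G] [ChartedSpace V G]
  [IsTopologicalGroup G] [CompactSpace G] [SecondCountableTopology G]
  [MeasurableSpace G] [BorelSpace G] (μ : Measure G) [IsProbabilityMeasure μ]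

/-! ### Convolution operators -/

/-- The kernel of right convolution by `h`, as a continuous family in `L²`. -/
def convKernel (h : C(G, ℂ)) : C(G, Lp ℂ 2 μ) :=
  ContinuousMap.comp ⟨ContinuousMap.toLp 2 μ ℂ, (ContinuousMap.toLp 2 μ ℂ).continuous⟩
    (ContinuousMap.curry ⟨fun p : G × G => star (h (p.2⁻¹ * p.1)),
      (h.continuous.comp (continuous_snd.inv.mul continuous_fst)).star⟩)

lemma coeFn_convKernel (h : C(G, ℂ)) (x : G) :
    convKernel μ h x =ᵐ[μ] fun y => star (h (y⁻¹ * x)) :=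
  ContinuousMap.coeFn_toLp (𝕜 := ℂ) μ _

lemma inner_convKernel (h : C(G, ℂ)) (x : G) (v : Lp ℂ 2 μ) :
    ⟪convKernel μ h x, v⟫_ℂ = conv μ v h x := by
  rw [L2.inner_def, conv]
  refine integral_congr_ae ?_
  filter_upwards [coeFn_convKernel μ h x] with y hy
  rw [hy]
  simp

/-- Right convolution by `h`, from `L²` to continuous functions. -/
def convOp (h : C(G, ℂ)) : Lp ℂ 2 μ →L[ℂ] C(G, ℂ) :=
  LinearMap.mkContinuous
    { toFun := fun v => ⟨fun x => ⟪convKernel μ h x, v⟫_ℂ,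
        (convKernel μ h).continuous.inner continuous_const⟩
      map_add' := fun v w => by ext x; simp [inner_add_right]
      map_smul' := fun c v => by ext x; simp [inner_smul_right] }
    ‖convKernel μ h‖ fun v => by
      rw [ContinuousMap.norm_le _ (by positivity)]
      exact fun x => (norm_inner_le_norm (convKernel μ h x) v).trans
        (mul_le_mul_of_nonneg_right ((convKernel μ h).norm_coe_le_norm x) (norm_nonneg v))

lemma convOp_apply (h : C(G, ℂ)) (v : Lp ℂ 2 μ) (x : G) :
    convOp μ h v x = ⟪convKernel μ h x, v⟫_ℂ := rfl

/-- Arzelà–Ascoli: since the kernel is a continuous map from G to L², the images of the unit ball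
are uniformly bounded and equicontinuous by Cauchy–Schwarz. -/
lemma isCompactOperator_convOp (h : C(G, ℂ)) : IsCompactOperator (convOp μ h) := by
  let e := ContinuousMap.linearIsometryBoundedOfCompact G ℂ ℂ
  have h1 : IsCompactOperator (e.toContinuousLinearEquiv.toContinuousLinearMap ∘L convOp μ h) := by
    rw [← ContinuousLinearMap.coe_coe, isCompactOperator_iff_isCompact_closure_image_ball _ one_pos]
    have hb : ∀ v ∈ Metric.ball (0 : Lp ℂ 2 μ) 1, ‖v‖ ≤ 1 := fun v hv => by
      simpa using (mem_ball_zero_iff.1 hv).le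
    refine BoundedContinuousFunction.arzela_ascoli (Metric.closedBall 0 ‖convKernel μ h‖)
      (isCompact_closedBall _ _) _ ?_ ?_
    · rintro _ x ⟨v, hv, rfl⟩
      rw [mem_closedBall_zero_iff]
      refine (norm_inner_le_norm (𝕜 := ℂ) (convKernel μ h x) v).trans ?_
      calc ‖convKernel μ h x‖ * ‖v‖ ≤ ‖convKernel μ h‖ * 1 := by
            gcongr
            · exact (convKernel μ h).norm_coe_le_norm x
            · exact hb v hv
        _ = _ := mul_one _
    · intro x
      rw [Metric.equicontinuousAt_iff_right]
      intro ε hε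
      have h2 := (convKernel μ h).continuous.continuousAt (x := x)
      filter_upwards [Metric.continuousAt_iff'.1 h2 ε hε] with y hy
      rintro ⟨_, v, hv, rfl⟩
      rw [dist_comm, dist_eq_norm]
      change ‖⟪convKernel μ h y, v⟫_ℂ - ⟪convKernel μ h x, v⟫_ℂ‖ < ε
      rw [← inner_sub_left]
      refine (norm_inner_le_norm _ _).trans_lt ?_
      rw [dist_eq_norm] at hy
      calc _ ≤ ‖convKernel μ h y - convKernel μ h x‖ * 1 := by gcongr; exact hb v hv
        _ < ε := by rwa [mul_one]
  have h2 := h1.clm_comp e.symm.toContinuousLinearEquiv.toContinuousLinearMap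
  have h3 : ⇑(convOp μ h) = ⇑e.symm.toContinuousLinearEquiv.toContinuousLinearMap ∘
      ⇑(e.toContinuousLinearEquiv.toContinuousLinearMap ∘L convOp μ h) := by
    funext v
    exact (e.symm_apply_apply (convOp μ h v)).symm
  rw [h3]
  exact h2

/-- Right convolution by `h`, on `L²`. -/
def convL2 (h : C(G, ℂ)) : Lp ℂ 2 μ →L[ℂ] Lp ℂ 2 μ := ContinuousMap.toLp 2 μ ℂ ∘L convOp μ h

lemma coeFn_convL2 (h : C(G, ℂ)) (v : Lp ℂ 2 μ) : convL2 μ h v =ᵐ[μ] conv μ v h := by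
  refine (ContinuousMap.coeFn_toLp (𝕜 := ℂ) μ _).trans (Eventually.of_forall fun x => ?_)
  exact inner_convKernel μ h x v

lemma isCompactOperator_convL2 (h : C(G, ℂ)) : IsCompactOperator (convL2 μ h) :=
  (isCompactOperator_convOp μ h).clm_comp (ContinuousMap.toLp 2 μ ℂ)

lemma integrable_L2 (v : Lp ℂ 2 μ) : Integrable v μ :=
  (Lp.memLp v).integrable (by norm_num)

/-- The hypothesis on h makes the kernel h (y⁻¹ x) Hermitian; the rest is Fubini. -/
lemma isSymmetric_convL2 (h : C(G, ℂ)) (hr : ∀ x, star (h x) = h x⁻¹) :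
    (convL2 μ h).toLinearMap.IsSymmetric := by
  intro v w
  have h1 : ⟪convL2 μ h v, w⟫_ℂ = ∫ x, ∫ y, w x * (star (v y) * h (x⁻¹ * y)) ∂μ ∂μ := by
    rw [L2.inner_def]
    refine integral_congr_ae ?_
    filter_upwards [coeFn_convL2 μ h v] with x hx
    rw [hx, conv, integral_const_mul]
    simp only [RCLike.inner_apply]
    congr 1
    rw [← integral_conj]
    refine integral_congr_ae (Eventually.of_forall fun y => ?_)
    have := hr (y⁻¹ * x)
    simp only [mul_inv_rev, inv_inv] at this
    simp only [map_mul]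
    rw [← this]
    rfl
  have h2 : ⟪v, convL2 μ h w⟫_ℂ = ∫ y, ∫ x, w x * (star (v y) * h (x⁻¹ * y)) ∂μ ∂μ := by
    rw [L2.inner_def]
    refine integral_congr_ae ?_
    filter_upwards [coeFn_convL2 μ h w] with y hy
    rw [hy, conv]
    simp only [RCLike.inner_apply]
    rw [← integral_mul_const]
    refine integral_congr_ae (Eventually.of_forall fun x => ?_)
    simp only [starRingEnd_apply]
    ring
  refine h1.trans ((integral_integral_swap ?_).trans h2.symm)
  obtain ⟨B, hB⟩ := isCompact_univ.exists_bound_of_continuousOn h.continuous.continuousOn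
  have h3 : Integrable (fun p : G × G => w p.1 * star (v p.2)) (μ.prod μ) :=
    (integrable_L2 μ w).mul_prod ((Complex.conjCLE : ℂ →L[ℝ] ℂ).integrable_comp (integrable_L2 μ v))
  have h4 := h3.mul_bdd (c := B) (g := fun p : G × G => h (p.1⁻¹ * p.2))
    (h.continuous.comp (continuous_fst.inv.mul continuous_snd)).aestronglyMeasurable
    (Eventually.of_forall fun p => hB _ trivial)
  refine h4.congr (Eventually.of_forall fun p => ?_)
  simp only [Function.uncurry]
  ring

end PeterWeyl

end AGN

end

noncomputable section

namespace AGN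

set_option linter.unusedSectionVars false

/-! ### Eigenfunctions of convolutions and separation of points. -/

section PeterWeyl

variable {V : Type*} [NormedAddCommGroup V] [NormedSpace ℝ V] [FiniteDimensional ℝ V]
  {G : Type*} [Group G] [TopologicalSpace G] [ChartedSpace V G] [LieGroup 𝓘(ℝ, V) ∞ G]
  [IsTopologicalGroup G] [CompactSpace G] [SecondCountableTopology G]
  [MeasurableSpace G] [BorelSpace G] (μ : Measure G) [IsProbabilityMeasure μ] [μ.IsHaarMeasure]

/-- Right convolution commutes with left translation, by left invariance of the measure. Its
eigenspaces are therefore invariant under left translations. -/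
lemma convOp_toLp_translate (h f : C(G, ℂ)) (z x : G) :
    convOp μ h (ContinuousMap.toLp 2 μ ℂ (f.comp ⟨fun x => z * x, continuous_const_mul z⟩)) x =
      convOp μ h (ContinuousMap.toLp 2 μ ℂ f) (z * x) := by
  have key : ∀ (f : C(G, ℂ)) x, convOp μ h (ContinuousMap.toLp 2 μ ℂ f) x =
      ∫ y, f y * h (y⁻¹ * x) ∂μ := by
    intro f x
    rw [convOp_apply, inner_convKernel, conv]
    refine integral_congr_ae ?_
    filter_upwards [ContinuousMap.coeFn_toLp (𝕜 := ℂ) (p := 2) μ f] with y hy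
    rw [hy]
  rw [key, key, ← integral_mul_left_eq_self (μ := μ) (fun y => f y * h (y⁻¹ * (z * x))) z]
  refine integral_congr_ae (Eventually.of_forall fun y => ?_)
  simp [mul_assoc]

/-- The inverse of an eigenfunction of a convolution operator belongs to `repAlg`. -/
lemma comp_inv_mem_repAlg {h : C(G, ℂ)} (hh : ContMDiff 𝓘(ℝ, V) 𝓘(ℝ, ℂ) ∞ h) {l : ℂ} (hl : l ≠ 0)
    {v : Lp ℂ 2 μ} (hv : convL2 μ h v = l • v) :
    (fun x => convOp μ h v x⁻¹) ∈ repAlg V G := by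
  let T := (convL2 μ h).toLinearMap
  have hfd : FiniteDimensional ℂ (Module.End.eigenspace T l) :=
    ContinuousLinearMap.finite_dimensional_eigenspace (isCompactOperator_convL2 μ h) l hl
  let R : Lp ℂ 2 μ →ₗ[ℂ] (G → ℂ) :=
    { toFun := fun v x => convOp μ h v x⁻¹
      map_add' := fun v w => by ext x; simp
      map_smul' := fun c v => by ext x; simp }
  have hmem : ∀ w, w ∈ Module.End.eigenspace T l ↔ convL2 μ h w = l • w := fun w =>
    Module.End.mem_eigenspace_iff
  refine ⟨(Module.End.eigenspace T l).map R, ⟨v, (hmem v).2 hv, rfl⟩,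
    (Module.Finite.iff_fg.1 hfd).map R, isStableSpace_of_translate
      ((Module.Finite.iff_fg.1 hfd).map R) ?_ ?_⟩
  · rintro _ ⟨w, hw, rfl⟩
    have h1 : ContMDiff 𝓘(ℝ, V) 𝓘(ℝ, ℂ) ∞ (conv μ w h) :=
      contMDiff_conv μ (integrable_L2 μ w) hh
    have h2 : R w = fun x => conv μ w h x⁻¹ := by
      funext x
      exact inner_convKernel μ h x⁻¹ w
    rw [h2]
    exact h1.comp (contMDiff_inv 𝓘(ℝ, V) ∞)
  -- After inversion, right translation by y becomes left translation by y⁻¹, which preserves the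
  -- eigenspace.
  · rintro _ ⟨w, hw, rfl⟩ y
    let f : C(G, ℂ) := (convOp μ h w).comp ⟨fun x => y⁻¹ * x, continuous_const_mul _⟩
    have hw' : w = l⁻¹ • ContinuousMap.toLp 2 μ ℂ (convOp μ h w) := by
      have := (hmem w).1 hw
      rw [eq_inv_smul_iff₀ hl, ← this]
      rfl
    have h3 : convOp μ h (l⁻¹ • ContinuousMap.toLp 2 μ ℂ f) = f := by
      ext x
      rw [map_smul, ContinuousMap.smul_apply, convOp_toLp_translate, ← ContinuousMap.smul_apply,
        ← map_smul, ← hw']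
      rfl
    refine ⟨l⁻¹ • ContinuousMap.toLp 2 μ ℂ f, (hmem _).2 ?_, ?_⟩
    · rw [smul_inv_smul₀ hl]
      exact congrArg (ContinuousMap.toLp 2 μ ℂ) h3
    · funext x
      change convOp μ h (l⁻¹ • ContinuousMap.toLp 2 μ ℂ f) x⁻¹ = convOp μ h w (x * y)⁻¹
      rw [h3]
      simp [f]

/-- The functions that generate a finite-dimensional space under left-invariant derivatives separate
points. -/
theorem exists_repAlg_separates [T2Space G] (μ : Measure G) [IsProbabilityMeasure μ]
    [μ.IsHaarMeasure] {a b : G} (hab : a ≠ b) :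
    ∃ f ∈ repAlg V G, f a ≠ f b := by
  by_contra! hcon
  have hne : (a⁻¹)⁻¹ * b⁻¹ ≠ 1 := by
    intro h
    rw [inv_inv, mul_inv_eq_one] at h
    exact hab h
  -- The bump φ is 1 at the identity and 0 at a b⁻¹. Multiplying φ x by φ x⁻¹ keeps these values and
  -- makes h invariant under inversion, as the self-adjointness of its convolution requires.
  obtain ⟨φ, h0, h1, -⟩ := exists_contMDiffMap_zero_one_of_isClosed (n := ⊤) 𝓘(ℝ, V)
    (isClosed_singleton (x := (a⁻¹)⁻¹ * b⁻¹)) (isClosed_singleton (x := (1 : G)))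
    (by simpa using hne)
  have hs : ContMDiff 𝓘(ℝ, V) 𝓘(ℝ, ℂ) ∞ fun x => ((φ x * φ x⁻¹ : ℝ) : ℂ) :=
    Complex.ofRealCLM.contDiff.contMDiff.comp (contDiff_mul.contMDiff.comp
      (φ.contMDiff.prodMk_space (φ.contMDiff.comp (contMDiff_inv 𝓘(ℝ, V) ∞))))
  let h : C(G, ℂ) := ⟨fun x => ((φ x * φ x⁻¹ : ℝ) : ℂ), hs.continuous⟩
  have hr : ∀ x, star (h x) = h x⁻¹ := fun x => by
    simp [h, mul_comm]
  let ev : C(G, ℂ) →ₗ[ℂ] ℂ :=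
    { toFun := fun f => f a⁻¹ - f b⁻¹
      map_add' := fun f g => by simp; ring
      map_smul' := fun c f => by simp; ring }
  have hev : Continuous ev :=
    (ContinuousEvalConst.continuous_eval_const a⁻¹).sub
      (ContinuousEvalConst.continuous_eval_const b⁻¹)
  let ℓ : Lp ℂ 2 μ →L[ℂ] ℂ := (⟨ev, hev⟩ : C(G, ℂ) →L[ℂ] ℂ) ∘L convOp μ h
  have hℓ : ∀ v, ℓ v = convOp μ h v a⁻¹ - convOp μ h v b⁻¹ := fun v => rfl
  -- The functional ℓ kills all eigenvectors: for l ≠ 0 because the inverted eigenfunction is in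
  -- `repAlg`, which is assumed not to separate a from b, and for l = 0 because the convolution
  -- vanishes identically. The eigenspaces span a dense subspace, so ℓ = 0.
  have hle : (⨆ l, Module.End.eigenspace (convL2 μ h).toLinearMap l) ≤ ℓ.ker := by
    refine iSup_le fun l v hv => ?_
    have hv' : convL2 μ h v = l • v := Module.End.mem_eigenspace_iff.1 hv
    rw [LinearMap.mem_ker]
    change ℓ v = 0
    rw [hℓ]
    rcases eq_or_ne l 0 with rfl | hl
    · have h2 : convOp μ h v = 0 := by
        rw [zero_smul] at hv'
        exact (ContinuousMap.toLp_injective (𝕜 := ℂ) (p := 2) μ)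
          (hv'.trans (map_zero (ContinuousMap.toLp 2 μ ℂ)).symm)
      simp [h2]
    · exact sub_eq_zero.2 (hcon _ (comp_inv_mem_repAlg (V := V) μ hs hl hv'))
  have hbot := ContinuousLinearMap.orthogonalComplement_iSup_eigenspaces_eq_bot
    (isCompactOperator_convL2 μ h) (isSymmetric_convL2 μ h hr)
  have hker : ∀ v, ℓ v = 0 := by
    have h3 : (ℓ.ker)ᗮ = ⊥ := by
      rw [eq_bot_iff, ← hbot]
      exact Submodule.orthogonal_le hle
    have h4 : (ℓ.ker).topologicalClosure = ⊤ :=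
      (Submodule.topologicalClosure_eq_top_iff).2 h3
    have h5 : ℓ.ker = ⊤ := by
      rw [← h4]
      exact ℓ.isClosed_ker.submodule_topologicalClosure_eq.symm
    intro v
    have : v ∈ ℓ.ker := by rw [h5]; trivial
    exact this
  have hk : convKernel μ h a⁻¹ = convKernel μ h b⁻¹ := by
    refine ext_inner_right ℂ fun v => ?_
    exact sub_eq_zero.1 (hker v)
  have hk' := ContinuousMap.toLp_injective (𝕜 := ℂ) (p := 2) μ hk
  -- At a⁻¹ the equality of kernels reads h 1 = h (a b⁻¹), that is 1 = 0.
  have h6 := congrArg (fun f : C(G, ℂ) => f a⁻¹) hk'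
  have h7 : star (h ((a⁻¹)⁻¹ * a⁻¹)) = star (h ((a⁻¹)⁻¹ * b⁻¹)) := h6
  have h8 := star_injective h7
  have h9 : φ ((a⁻¹)⁻¹ * b⁻¹) = 0 := h0 rfl
  have h10 : φ 1 = 1 := h1 rfl
  simp only [h, ContinuousMap.coe_mk, h9, inv_mul_cancel, inv_one, h10] at h8
  simp at h8

end PeterWeyl

end AGN

end

noncomputable section

namespace AGN

set_option linter.unusedSectionVars false

/-! ### Construction of locally finite anticommuting families -/

namespace DiracCore

variable {H : Type*} [NormedAddCommGroup H] [InnerProductSpace ℂ H] {ι : Type*}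
variable {P : Type*} [AddCommGroup P] [Module ℂ P]

lemma eq_zero_of_denseRange {j : P →ₗ[ℂ] H} (hj : DenseRange j) {v : H}
    (h : ∀ p, ⟪v, j p⟫_ℂ = 0) : v = 0 := by
  have h1 : ∀ w, ⟪v, w⟫_ℂ = 0 := fun w =>
    hj.induction_on (p := fun w => ⟪v, w⟫_ℂ = 0) w
      (isClosed_eq (continuous_const.inner continuous_id) continuous_const) h
  exact inner_self_eq_zero.1 (h1 v)

/-- A linear section of a linear map, on its range. -/
def rangeSection (j : P →ₗ[ℂ] H) : LinearMap.range j →ₗ[ℂ] P :=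
  (j.rangeRestrict.exists_rightInverse_of_surjective j.range_rangeRestrict).choose

lemma map_rangeSection (j : P →ₗ[ℂ] H) (u : LinearMap.range j) : j (rangeSection j u) = u :=
  congrArg Subtype.val (LinearMap.congr_fun
    (j.rangeRestrict.exists_rightInverse_of_surjective j.range_rangeRestrict).choose_spec u)

/-- The operator on the range of `j` that is induced by an operator. -/
def rangeOp (j : P →ₗ[ℂ] H) (D : Module.End ℂ P) : Module.End ℂ (LinearMap.range j) :=
  j.rangeRestrict ∘ₗ D ∘ₗ rangeSection j

/-- The map j need not be injective. Symmetry shows that j (D p) depends only on j p, since its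
inner products with the dense range do; hence the choice of section is immaterial. -/
lemma rangeOp_apply {j : P →ₗ[ℂ] H} (hj : DenseRange j) {D : Module.End ℂ P}
    (symm : ∀ p p', ⟪j (D p), j p'⟫_ℂ = ⟪j p, j (D p')⟫_ℂ) (p : P) :
    rangeOp j D (j.rangeRestrict p) = j.rangeRestrict (D p) := by
  apply Subtype.ext
  change j (D (rangeSection j _)) = j (D p)
  rw [← sub_eq_zero, ← map_sub, ← map_sub]
  refine eq_zero_of_denseRange hj fun p' => ?_
  rw [symm, map_sub, map_rangeSection]
  simp

/-- A core that is given as the image of a space on which the operators are defined. -/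
def ofDense (j : P →ₗ[ℂ] H) (hj : DenseRange j) (D : ι → Module.End ℂ P)
    (symm : ∀ γ p p', ⟪j (D γ p), j p'⟫_ℂ = ⟪j p, j (D γ p')⟫_ℂ)
    (anti : ∀ γ γ', γ ≠ γ' → D γ * D γ' = -(D γ' * D γ))
    (locfin : ∀ p : P, ∃ U : Submodule ℂ P, p ∈ U ∧ U.FG ∧
      (∀ γ, ∀ v ∈ U, D γ v ∈ U) ∧ {γ | ∃ v ∈ U, D γ v ≠ 0}.Finite) : DiracCore H ι where
  K := LinearMap.range j
  dense := by
    rw [LinearMap.coe_range]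
    exact hj
  D γ := rangeOp j (D γ)
  symm γ := by
    rintro ⟨_, p, rfl⟩ ⟨_, p', rfl⟩
    have h := fun p => rangeOp_apply hj (symm γ) p
    change ⟪(rangeOp j (D γ) (j.rangeRestrict p) : H), (j.rangeRestrict p' : H)⟫_ℂ =
      ⟪(j.rangeRestrict p : H), (rangeOp j (D γ) (j.rangeRestrict p') : H)⟫_ℂ
    rw [h, h]
    exact symm γ p p'
  anti γ γ' hγ := by
    ext ⟨_, p, rfl⟩
    have h := fun γ p => rangeOp_apply hj (symm γ) p
    change (rangeOp j (D γ) (rangeOp j (D γ') (j.rangeRestrict p)) : H) =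
      -(rangeOp j (D γ') (rangeOp j (D γ) (j.rangeRestrict p)) : H)
    rw [h, h, h, h]
    have h1 := congrArg j (LinearMap.congr_fun (anti γ γ' hγ) p)
    simpa using h1
  locfin := by
    rintro ⟨_, p, rfl⟩
    have h := fun γ p => rangeOp_apply hj (symm γ) p
    obtain ⟨U, hp, hU, h1, h2⟩ := locfin p
    refine ⟨U.map j.rangeRestrict, ⟨p, hp, rfl⟩, Module.Finite.iff_fg.2 (hU.map _), ?_, ?_⟩
    · rintro γ _ ⟨v, hv, rfl⟩
      rw [h]
      exact ⟨_, h1 γ v hv, rfl⟩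
    · refine h2.subset ?_
      rintro γ ⟨_, ⟨v, hv, rfl⟩, h3⟩
      rw [h] at h3
      exact ⟨v, hv, fun h4 => h3 (by rw [h4, map_zero])⟩

end DiracCore

/-! ### Dirac operators on algebraic tensor products. -/

section Tensor

variable {ι : Type*} {q : ℕ} {W : Type*} [AddCommGroup W] [Module ℂ W]
  {Y : Type*} [AddCommGroup Y] [Module ℂ Y]
  (X : ι → Fin q → Module.End ℂ W) (c : ι → Fin q → Module.End ℂ Y)

/-- The algebraic Dirac operators `(1 / √-1) ∑ i, X i ⊗ c i`. -/
def tensorDirac (γ : ι) : Module.End ℂ (W ⊗[ℂ] Y) :=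
  (1 / Complex.I) • ∑ i, TensorProduct.map (X γ i) (c γ i)

variable {X c}

lemma tensorDirac_tmul (γ : ι) (w : W) (y : Y) :
    tensorDirac X c γ (w ⊗ₜ y) = (1 / Complex.I) • ∑ i, X γ i w ⊗ₜ[ℂ] c γ i y := by
  simp [tensorDirac]

lemma tensorDirac_mul (γ γ' : ι) : tensorDirac X c γ * tensorDirac X c γ' =
    -∑ i, ∑ j, TensorProduct.map (X γ i * X γ' j) (c γ i * c γ' j) := by
  have h : (1 / Complex.I) * (1 / Complex.I) = -1 := by
    rw [div_mul_div_comm, Complex.I_mul_I]; norm_num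
  rw [tensorDirac, tensorDirac, smul_mul_smul_comm, h]
  refine (neg_one_smul ℂ (M := Module.End ℂ (W ⊗[ℂ] Y)) _).trans ?_
  rw [Finset.sum_mul_sum]
  simp only [TensorProduct.map_mul]

lemma tensorDirac_anti {γ γ' : ι} (hX : ∀ i j, X γ i * X γ' j = X γ' j * X γ i)
    (hc : ∀ i j, c γ i * c γ' j = -(c γ' j * c γ i)) :
    tensorDirac X c γ * tensorDirac X c γ' = -(tensorDirac X c γ' * tensorDirac X c γ) := by
  have h : ∀ i j, TensorProduct.map (X γ i * X γ' j) (c γ i * c γ' j) =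
      -TensorProduct.map (X γ' j * X γ i) (c γ' j * c γ i) := fun i j => by
    rw [hX, hc, ← neg_one_smul ℂ (c γ' j * c γ i), TensorProduct.map_smul_right]
    exact neg_one_smul ℂ (M := Module.End ℂ (W ⊗[ℂ] Y)) _
  rw [tensorDirac_mul, tensorDirac_mul]
  simp_rw [h, Finset.sum_neg_distrib]
  rw [Finset.sum_comm]

/-- The minus sign of the skew terms is compensated by the conjugate of 1 / √-1. Two different maps
into H are allowed so that the lemma also serves with an operator of the commutant composed on one
side. -/
lemma tensorDirac_symm {H : Type*} [NormedAddCommGroup H] [InnerProductSpace ℂ H]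
    {j j' : W ⊗[ℂ] Y →ₗ[ℂ] H} {γ : ι}
    (h : ∀ i w w' y y', ⟪j (X γ i w ⊗ₜ c γ i y), j' (w' ⊗ₜ y')⟫_ℂ =
      -⟪j (w ⊗ₜ y), j' (X γ i w' ⊗ₜ c γ i y')⟫_ℂ) (p p' : W ⊗[ℂ] Y) :
    ⟪j (tensorDirac X c γ p), j' p'⟫_ℂ = ⟪j p, j' (tensorDirac X c γ p')⟫_ℂ := by
  induction p with
  | zero => simp
  | add a b ha hb => simp only [map_add, inner_add_left, ha, hb]
  | tmul w y =>
    induction p' with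
    | zero => simp
    | add a b ha hb => simp only [map_add, inner_add_right, ha, hb]
    | tmul w' y' =>
      rw [tensorDirac_tmul, tensorDirac_tmul, map_smul, map_smul, map_sum, map_sum,
        inner_smul_left, inner_smul_right, sum_inner, inner_sum, Finset.mul_sum, Finset.mul_sum]
      refine Finset.sum_congr rfl fun i _ => ?_
      rw [h]
      simp

lemma exists_stable_of_finset
    (hW : ∀ w : W, ∃ U : Submodule ℂ W, w ∈ U ∧ U.FG ∧ (∀ γ i, ∀ v ∈ U, X γ i v ∈ U) ∧
      {γ | ∃ i, ∃ v ∈ U, X γ i v ≠ 0}.Finite) (t : Finset W) :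
    ∃ U : Submodule ℂ W, (∀ w ∈ t, w ∈ U) ∧ U.FG ∧ (∀ γ i, ∀ v ∈ U, X γ i v ∈ U) ∧
      {γ | ∃ i, ∃ v ∈ U, X γ i v ≠ 0}.Finite := by
  classical
  induction t using Finset.induction_on with
  | empty => exact ⟨⊥, by simp, Submodule.fg_bot, by simp, by simp⟩
  | insert w t _ ih =>
    obtain ⟨U, h1, h2, h3, h4⟩ := ih
    obtain ⟨U', h1', h2', h3', h4'⟩ := hW w
    refine ⟨U' ⊔ U, fun v hv => ?_, h2'.sup h2, fun γ i v hv => ?_, (h4'.union h4).subset ?_⟩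
    · rcases Finset.mem_insert.1 hv with rfl | hv
      · exact Submodule.mem_sup_left h1'
      · exact Submodule.mem_sup_right (h1 v hv)
    · obtain ⟨a, ha, b, hb, rfl⟩ := Submodule.mem_sup.1 hv
      rw [map_add]
      exact Submodule.add_mem_sup (h3' γ i a ha) (h3 γ i b hb)
    · rintro γ ⟨i, v, hv, hne⟩
      obtain ⟨a, ha, b, hb, rfl⟩ := Submodule.mem_sup.1 hv
      by_cases h5 : X γ i a = 0
      · exact Or.inr ⟨i, b, hb, fun h6 => hne (by rw [map_add, h5, h6, add_zero])⟩
      · exact Or.inl ⟨i, a, ha, h5⟩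

/-- A finite-dimensional stable space of coefficients is moved by finitely many γ only, so the
second factor has to be stable only under the Clifford operators of those γ. -/
lemma tensorDirac_locfin
    (hW : ∀ w : W, ∃ U : Submodule ℂ W, w ∈ U ∧ U.FG ∧ (∀ γ i, ∀ v ∈ U, X γ i v ∈ U) ∧
      {γ | ∃ i, ∃ v ∈ U, X γ i v ≠ 0}.Finite)
    (hY : ∀ (s : Set ι) (_ : s.Finite) (t : Finset Y), ∃ U : Submodule ℂ Y, (∀ y ∈ t, y ∈ U) ∧
      U.FG ∧ ∀ γ ∈ s, ∀ i, ∀ v ∈ U, c γ i v ∈ U) (p : W ⊗[ℂ] Y) :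
    ∃ U : Submodule ℂ (W ⊗[ℂ] Y), p ∈ U ∧ U.FG ∧ (∀ γ, ∀ v ∈ U, tensorDirac X c γ v ∈ U) ∧
      {γ | ∃ v ∈ U, tensorDirac X c γ v ≠ 0}.Finite := by
  classical
  obtain ⟨t, rfl⟩ := TensorProduct.exists_finset p
  obtain ⟨U, h1, h2, h3, h4⟩ := exists_stable_of_finset hW (t.image Prod.fst)
  obtain ⟨Z, k1, k2, k3⟩ := hY _ h4 (t.image Prod.snd)
  let R := Submodule.map₂ (TensorProduct.mk ℂ W Y) U Z
  have hR : ∀ {q : W ⊗[ℂ] Y → Prop} (_ : q 0) (_ : ∀ a b, q a → q b → q (a + b))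
      (_ : ∀ w ∈ U, ∀ y ∈ Z, q (w ⊗ₜ y)), ∀ v ∈ R, q v := by
    intro q q0 qa qt v hv
    rw [show R = Submodule.span ℂ (Set.image2 (fun a b => TensorProduct.mk ℂ W Y a b) U Z) from
      Submodule.map₂_eq_span_image2 _ _ _] at hv
    induction hv using Submodule.closure_induction with
    | zero => exact q0
    | add a b _ _ ha hb => exact qa a b ha hb
    | smul_mem r a ha =>
      obtain ⟨w, hw, y, hy, rfl⟩ := ha
      have := qt (r • w) (U.smul_mem r hw) y hy
      rwa [← TensorProduct.smul_tmul'] at this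
  refine ⟨R, ?_, h2.map₂ _ k2, fun γ => hR ?_ ?_ ?_, h4.subset ?_⟩
  · refine sum_mem fun x hx => Submodule.apply_mem_map₂ _ (h1 _ ?_) (k1 _ ?_)
    · exact Finset.mem_image_of_mem _ hx
    · exact Finset.mem_image_of_mem _ hx
  · simp
  · intro a b ha hb
    rw [map_add]
    exact add_mem ha hb
  · intro w hw y hy
    rw [tensorDirac_tmul]
    refine R.smul_mem _ (sum_mem fun i _ => ?_)
    by_cases hγ : X γ i w = 0
    · rw [hγ, TensorProduct.zero_tmul]; exact zero_mem _
    · exact Submodule.apply_mem_map₂ _ (h3 γ i w hw) (k3 γ ⟨i, w, hw, hγ⟩ i y hy)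
  · rintro γ ⟨v, hv, hne⟩
    by_contra hcon
    refine hne (hR (q := fun v => tensorDirac X c γ v = 0) (map_zero _) ?_ ?_ v hv)
    · intro a b ha hb
      rw [map_add, ha, hb, add_zero]
    · intro w hw y hy
      rw [tensorDirac_tmul]
      have : ∀ i, X γ i w = 0 := fun i => by
        by_contra h5
        exact hcon ⟨i, w, hw, h5⟩
      simp [this]

end Tensor

end AGN

end

noncomputable section

namespace AGN

set_option linter.unusedSectionVars false

/-! ### Algebras of continuous functions in `L²` -/

section Density

variable {T : Type*} [TopologicalSpace T] [CompactSpace T] [MeasurableSpace T] [BorelSpace T]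
  [SecondCountableTopology T]
  (ν : Measure T) [IsFiniteMeasure ν]
  {E : Type*} [NormedAddCommGroup E] [InnerProductSpace ℂ E]

lemma inner_toLp (f : C(T, E)) (v : Lp E 2 ν) :
    ⟪ContinuousMap.toLp 2 ν ℂ f, v⟫_ℂ = ∫ x, ⟪f x, v x⟫_ℂ ∂ν := by
  rw [L2.inner_def]
  refine integral_congr_ae ?_
  filter_upwards [ContinuousMap.coeFn_toLp (𝕜 := ℂ) (p := 2) ν f] with x hx
  rw [hx]

lemma inner_toLp_toLp (f g : C(T, E)) :
    ⟪ContinuousMap.toLp 2 ν ℂ f, ContinuousMap.toLp 2 ν ℂ g⟫_ℂ = ∫ x, ⟪f x, g x⟫_ℂ ∂ν := by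
  rw [inner_toLp]
  refine integral_congr_ae ?_
  filter_upwards [ContinuousMap.coeFn_toLp (𝕜 := ℂ) (p := 2) ν g] with x hx
  rw [hx]

/-- Continuous functions from elements of `A ⊗ E`, for an algebra `A` of continuous functions. -/
def tensorFun (A : Subalgebra ℂ (T → ℂ)) (hA : ∀ f ∈ A, Continuous f) : A ⊗[ℂ] E →ₗ[ℂ] C(T, E) :=
  TensorProduct.lift (LinearMap.mk₂ ℂ
    (fun (f : A) (ξ : E) => ⟨fun x => (f : T → ℂ) x • ξ, (hA f f.2).smul continuous_const⟩)
    (fun f g ξ => by ext x; simp [add_smul])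
    (fun c f ξ => by ext x; simp [mul_smul])
    (fun f ξ η => by ext x; simp)
    (fun c f ξ => by ext x; simp [smul_comm c]))

@[simp] lemma tensorFun_tmul {A : Subalgebra ℂ (T → ℂ)} (hA : ∀ f ∈ A, Continuous f) (f : A) (ξ : E)
    (x : T) : tensorFun A hA (f ⊗ₜ ξ) x = (f : T → ℂ) x • ξ := rfl

lemma dense_of_separates [T2Space T] {A : Subalgebra ℂ (T → ℂ)} (hA : ∀ f ∈ A, Continuous f)
    (hs : ∀ f ∈ A, star f ∈ A) (hsep : ∀ a b : T, a ≠ b → ∃ f ∈ A, f a ≠ f b) :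
    Dense {f : C(T, ℂ) | ⇑f ∈ A} := by
  let B : StarSubalgebra ℂ C(T, ℂ) :=
    { carrier := {f | ⇑f ∈ A}
      mul_mem' := fun {f g} hf hg => A.mul_mem hf hg
      add_mem' := fun {f g} hf hg => A.add_mem hf hg
      algebraMap_mem' := fun r => A.algebraMap_mem r
      star_mem' := fun {f} hf => hs f hf }
  have h := ContinuousMap.starSubalgebra_topologicalClosure_eq_top_of_separatesPoints B ?_
  · intro f
    have h1 : f ∈ B.topologicalClosure := by rw [h]; trivial
    exact h1
  · intro a b hab
    obtain ⟨f, hf, hne⟩ := hsep a b hab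
    exact ⟨f, ⟨⟨f, hA f hf⟩, hf, rfl⟩, hne⟩

/-- Each component ⟪ξ, v⟫ is orthogonal to the algebra A, which by Stone–Weierstrass is dense in the
continuous functions and hence in L². -/
lemma eq_zero_of_inner_tensorFun [T2Space T] [FiniteDimensional ℂ E] {A : Subalgebra ℂ (T → ℂ)}
    (hA : ∀ f ∈ A, Continuous f) (hs : ∀ f ∈ A, star f ∈ A)
    (hsep : ∀ a b : T, a ≠ b → ∃ f ∈ A, f a ≠ f b) {v : Lp E 2 ν}
    (h : ∀ (f : A) (ξ : E), ⟪ContinuousMap.toLp 2 ν ℂ (tensorFun A hA (f ⊗ₜ ξ)), v⟫_ℂ = 0) :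
    v = 0 := by
  have h1 : ∀ ξ : E, (innerSL ℂ ξ).compLp v = 0 := by
    intro ξ
    set w := (innerSL ℂ ξ).compLp v with hw
    have h2 : ∀ f : C(T, ℂ), ⟪ContinuousMap.toLp 2 ν ℂ f, w⟫_ℂ = 0 := by
      intro f
      refine (dense_of_separates hA hs hsep).induction (P := fun f =>
        ⟪ContinuousMap.toLp 2 ν ℂ f, w⟫_ℂ = 0) (fun f hf => ?_)
        (isClosed_eq ((ContinuousMap.toLp 2 ν ℂ).continuous.inner continuous_const)
          continuous_const) f
      rw [← h ⟨f, hf⟩ ξ, inner_toLp, inner_toLp]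
      refine integral_congr_ae ?_
      filter_upwards [(innerSL ℂ ξ).coeFn_compLp v] with x hx
      rw [hw, hx]
      simp
    have h3 : ∀ u, ⟪u, w⟫_ℂ = 0 := fun u =>
      (ContinuousMap.toLp_denseRange (p := 2) ℂ ν ℂ (by simp)).induction_on
        (p := fun u => ⟪u, w⟫_ℂ = 0) u
        (isClosed_eq (continuous_id.inner continuous_const) continuous_const) h2
    exact inner_self_eq_zero.1 (h3 w)
  let b := stdOrthonormalBasis ℂ E
  have h4 : ∀ᵐ x ∂ν, ∀ i, ⟪b i, v x⟫_ℂ = 0 := by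
    rw [ae_all_iff]
    intro i
    have h5 := (innerSL ℂ (b i)).coeFn_compLp v
    rw [h1] at h5
    filter_upwards [h5, Lp.coeFn_zero ℂ 2 ν] with x hx hx0
    rw [hx0] at hx
    exact hx.symm
  refine Lp.ext ?_
  filter_upwards [h4, Lp.coeFn_zero E 2 ν] with x hx hx0
  rw [hx0]
  exact InnerProductSpace.ext_inner_left_basis b.toBasis fun i => by simpa using hx i

end Density

section Clifford

variable {W : Type*} [AddCommGroup W] [Module ℝ W] {Q : QuadraticForm ℝ W}
  {S : Type*} [NormedAddCommGroup S] [InnerProductSpace ℂ S] [CompleteSpace S]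
  (M : SpinorModule Q S)

/-! ### Clifford multiplication -/

lemma SpinorModule.finiteDimensional (M : SpinorModule Q S) : FiniteDimensional ℂ S :=
  Module.Finite.of_basis M.basis.toBasis

lemma SpinorModule.inner_c (x : W) (s t : S) : ⟪M.c x s, t⟫_ℂ = ⟪s, M.c x t⟫_ℂ := by
  have h := M.rep_selfAdjoint x
  rw [ContinuousLinearMap.isSelfAdjoint_iff_isSymmetric] at h
  exact h s t

lemma SpinorModule.inner_grading (s t : S) : ⟪M.grading s, t⟫_ℂ = ⟪s, M.grading t⟫_ℂ := by
  have h := M.grading_selfAdjoint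
  rw [ContinuousLinearMap.isSelfAdjoint_iff_isSymmetric] at h
  exact h s t

lemma SpinorModule.c_mul_add (x y : W) :
    M.c x * M.c y + M.c y * M.c x = ((QuadraticMap.polar Q x y : ℝ) : ℂ) • 1 := by
  rw [SpinorModule.c, SpinorModule.c, ← map_mul, ← map_mul, ← map_add,
    Algebra.TensorProduct.tmul_mul_tmul, Algebra.TensorProduct.tmul_mul_tmul, one_mul,
    ← TensorProduct.tmul_add, CliffordAlgebra.ι_mul_ι_add_swap,
    Algebra.algebraMap_eq_smul_one, TensorProduct.tmul_smul]
  set r := QuadraticMap.polar Q x y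
  have h : r • ((1 : ℂ) ⊗ₜ[ℝ] (1 : CliffordAlgebra Q)) =
      algebraMap ℂ (ℂ ⊗[ℝ] CliffordAlgebra Q) r := by
    rw [TensorProduct.smul_tmul', Algebra.TensorProduct.algebraMap_apply]
    simp
  refine (congrArg M.rep h).trans ?_
  rw [AlgHom.commutes, Algebra.algebraMap_eq_smul_one]

end Clifford

end AGN

end

noncomputable section

namespace AGN

set_option linter.unusedSectionVars false

section BasicDirac

variable {V : Type*} [NormedAddCommGroup V] [NormedSpace ℝ V] [FiniteDimensional ℝ V]
  {G : Type*} [Group G] [TopologicalSpace G] [ChartedSpace V G] [LieGroup 𝓘(ℝ, V) ∞ G]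
  [IsTopologicalGroup G] [CompactSpace G] [SecondCountableTopology G]
  [MeasurableSpace G] [BorelSpace G] (μ : Measure G) [IsProbabilityMeasure μ] [μ.IsHaarMeasure]
  {S : Type*} [NormedAddCommGroup S] [InnerProductSpace ℂ S]

/-! ### The basic Dirac operator on smooth functions -/

lemma contMDiff_inner {f h : G → S} (hf : ContMDiff 𝓘(ℝ, V) 𝓘(ℝ, S) ∞ f)
    (hh : ContMDiff 𝓘(ℝ, V) 𝓘(ℝ, S) ∞ h) :
    ContMDiff 𝓘(ℝ, V) 𝓘(ℝ, ℂ) ∞ fun x => ⟪f x, h x⟫_ℂ :=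
  (contDiff_inner (𝕜 := ℂ) (E := S)).contMDiff.comp (hf.prodMk_space hh)

lemma leftDeriv_inner {f h : G → S} (hf : ContMDiff 𝓘(ℝ, V) 𝓘(ℝ, S) ∞ f)
    (hh : ContMDiff 𝓘(ℝ, V) 𝓘(ℝ, S) ∞ h) (v : GroupLieAlgebra 𝓘(ℝ, V) G) (x : G) :
    leftDeriv v (fun x => ⟪f x, h x⟫_ℂ) x =
      ⟪f x, leftDeriv v h x⟫_ℂ + ⟪leftDeriv v f x, h x⟫_ℂ := by
  have h1 : HasLeftDeriv (fun x => ⟪f x, h x⟫_ℂ) fun x =>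
      (fderivInnerCLM ℂ (f x, h x)).comp ((leftFDeriv V f x).prod (leftFDeriv V h x)) := fun x => by
    have h2 := (hasLeftDeriv_leftFDeriv hf x).inner ℂ (hasLeftDeriv_leftFDeriv hh x)
    simp only [expChart_expBase, mul_one] at h2
    exact h2
  rw [leftDeriv_eq (contMDiff_inner hf hh), leftDeriv_eq hf, leftDeriv_eq hh, h1.leftFDeriv_eq]
  rfl

lemma integral_inner_leftDeriv {f h : G → S} (hf : ContMDiff 𝓘(ℝ, V) 𝓘(ℝ, S) ∞ f)
    (hh : ContMDiff 𝓘(ℝ, V) 𝓘(ℝ, S) ∞ h) (v : GroupLieAlgebra 𝓘(ℝ, V) G) :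
    ∫ x, ⟪leftDeriv v f x, h x⟫_ℂ ∂μ = -∫ x, ⟪f x, leftDeriv v h x⟫_ℂ ∂μ := by
  have h1 := integral_leftDeriv μ (contMDiff_inner hf hh) v
  simp only [leftDeriv_inner hf hh] at h1
  rw [integral_add (integrable_of_continuous (hf.continuous.inner (contMDiff_leftDeriv hh v).continuous))
    (integrable_of_continuous ((contMDiff_leftDeriv hf v).continuous.inner hh.continuous))] at h1
  rw [eq_neg_iff_add_eq_zero, add_comm]
  exact h1

variable {g : InvariantMetric V G} [CompleteSpace S] {q : ℕ}
  (e : Module.Basis (Fin q) ℝ (GroupLieAlgebra 𝓘(ℝ, V) G)) (M : SpinorModule g.quadratic S)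

/-- The basic Dirac operator on functions. -/
def diracFun (f : G → S) (x : G) : S :=
  (1 / Complex.I) • ∑ i, M.c (e i) (leftDeriv (e i) f x)

lemma contMDiff_clm {f : G → S} (hf : ContMDiff 𝓘(ℝ, V) 𝓘(ℝ, S) ∞ f) (A : S →L[ℂ] S) :
    ContMDiff 𝓘(ℝ, V) 𝓘(ℝ, S) ∞ fun x => A (f x) :=
  (A.restrictScalars ℝ).contDiff.contMDiff.comp hf

lemma leftDeriv_clm_apply {f : G → S} (hf : ContMDiff 𝓘(ℝ, V) 𝓘(ℝ, S) ∞ f) (A : S →L[ℂ] S)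
    (v : GroupLieAlgebra 𝓘(ℝ, V) G) (x : G) :
    leftDeriv v (fun x => A (f x)) x = A (leftDeriv v f x) :=
  congrFun (leftDeriv_clm hf (A.restrictScalars ℝ) v) x

lemma contMDiff_diracFun {f : G → S} (hf : ContMDiff 𝓘(ℝ, V) 𝓘(ℝ, S) ∞ f) :
    ContMDiff 𝓘(ℝ, V) 𝓘(ℝ, S) ∞ (diracFun e M f) := by
  have h : ∀ s : Finset (Fin q), ContMDiff 𝓘(ℝ, V) 𝓘(ℝ, S) ∞
      fun x => ∑ i ∈ s, M.c (e i) (leftDeriv (e i) f x) := fun s =>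
    contMDiff_finsetSum fun i _ => contMDiff_clm (contMDiff_leftDeriv hf _) _
  exact contMDiff_clm (h Finset.univ) ((1 / Complex.I) • ContinuousLinearMap.id ℂ S)

/-- Three signs balance: invariant derivatives are skew, Clifford multiplication is self-adjoint,
and 1 / √-1 is imaginary. -/
lemma integral_inner_diracFun {f h : G → S} (hf : ContMDiff 𝓘(ℝ, V) 𝓘(ℝ, S) ∞ f)
    (hh : ContMDiff 𝓘(ℝ, V) 𝓘(ℝ, S) ∞ h) :
    ∫ x, ⟪diracFun e M f x, h x⟫_ℂ ∂μ = ∫ x, ⟪f x, diracFun e M h x⟫_ℂ ∂μ := by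
  simp only [diracFun, inner_smul_left, inner_smul_right, sum_inner, inner_sum]
  rw [integral_const_mul, integral_const_mul, integral_finsetSum, integral_finsetSum]
  · rw [Finset.mul_sum, Finset.mul_sum]
    refine Finset.sum_congr rfl fun i _ => ?_
    have h1 := integral_inner_leftDeriv μ hf (contMDiff_clm hh (M.c (e i))) (e i)
    simp only [leftDeriv_clm_apply hh] at h1
    simp only [SpinorModule.inner_c]
    rw [h1]
    simp
  · exact fun i _ => integrable_of_continuous
      (hf.continuous.inner (contMDiff_clm (contMDiff_leftDeriv hh _) _).continuous)
  · exact fun i _ => integrable_of_continuous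
      ((contMDiff_clm (contMDiff_leftDeriv hf _) _).continuous.inner hh.continuous)

instance : AddCommGroup (repAlg V G ⊗[ℂ] S) := TensorProduct.addCommGroup

/-- The algebraic form of the basic Dirac operator. -/
def repDirac : Module.End ℂ (repAlg V G ⊗[ℂ] S) :=
  tensorDirac (fun (_ : Unit) i => repDeriv (e i)) (fun _ i => (M.c (e i)).toLinearMap) ()

variable (V G S) in
/-- Spinors with coefficients in `repAlg`, as functions. -/
def repFun : repAlg V G ⊗[ℂ] S →ₗ[ℂ] C(G, S) := tensorFun (repAlg V G) continuous_of_mem_repAlg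

lemma repFun_tmul (w : repAlg V G) (s : S) (x : G) :
    repFun V G S (w ⊗ₜ s) x = (w : G → ℂ) x • s := rfl

lemma contMDiff_repFun (p : repAlg V G ⊗[ℂ] S) :
    ContMDiff 𝓘(ℝ, V) 𝓘(ℝ, S) ∞ (repFun V G S p) := by
  induction p with
  | zero => rw [map_zero]; exact contMDiff_const
  | add a b ha hb => rw [map_add]; exact ha.add hb
  | tmul w s =>
    exact (((ContinuousLinearMap.id ℂ ℂ).smulRight s).restrictScalars ℝ).contDiff.contMDiff.comp
      (contMDiff_of_mem_repAlg w.2)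

lemma repFun_repDirac_tmul (w : repAlg V G) (s : S) :
    ⇑(repFun V G S (repDirac e M (w ⊗ₜ s))) = diracFun e M (repFun V G S (w ⊗ₜ s)) := by
  funext x
  have h1 : ∀ i, leftDeriv (e i) (⇑(repFun V G S (w ⊗ₜ s))) =
      fun x => leftDeriv (e i) (w : G → ℂ) x • s := fun i =>
    leftDeriv_clm (contMDiff_of_mem_repAlg w.2)
      (((ContinuousLinearMap.id ℂ ℂ).smulRight s).restrictScalars ℝ) (e i)
  rw [repDirac, tensorDirac_tmul, map_smul, map_sum]
  simp only [diracFun, h1, map_smul, ContinuousMap.smul_apply, ContinuousMap.sum_apply,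
    repFun_tmul]
  rfl

lemma repFun_repDirac (p : repAlg V G ⊗[ℂ] S) :
    ⇑(repFun V G S (repDirac e M p)) = diracFun e M (repFun V G S p) := by
  induction p with
  | zero =>
    rw [← TensorProduct.zero_tmul (repAlg V G) (0 : S)]
    exact repFun_repDirac_tmul e M 0 0
  | add a b ha hb =>
    funext x
    have h1 : ∀ i, leftDeriv (e i) (⇑(repFun V G S a) + ⇑(repFun V G S b)) = _ := fun i =>
      leftDeriv_add (contMDiff_repFun a) (contMDiff_repFun b) (e i)
    simp only [map_add, ContinuousMap.add_apply, ha, hb, diracFun]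
    simp only [ContinuousMap.coe_add, h1, Pi.add_apply, map_add, Finset.sum_add_distrib, smul_add]
  | tmul w s => exact repFun_repDirac_tmul e M w s

variable (V G S) in
/-- Spinors with coefficients in `repAlg`, in `L²`. -/
def repL2 : repAlg V G ⊗[ℂ] S →ₗ[ℂ] Lp S 2 μ :=
  (ContinuousMap.toLp 2 μ ℂ).toLinearMap ∘ₗ repFun V G S

lemma coeFn_repL2 (p : repAlg V G ⊗[ℂ] S) : repL2 V G μ S p =ᵐ[μ] repFun V G S p :=
  ContinuousMap.coeFn_toLp (𝕜 := ℂ) μ _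

lemma inner_repL2 (p p' : repAlg V G ⊗[ℂ] S) :
    ⟪repL2 V G μ S p, repL2 V G μ S p'⟫_ℂ = ∫ x, ⟪repFun V G S p x, repFun V G S p' x⟫_ℂ ∂μ :=
  inner_toLp_toLp μ _ _

lemma repL2_eq_zero {p : repAlg V G ⊗[ℂ] S} : repL2 V G μ S p = 0 ↔ repFun V G S p = 0 := by
  constructor
  · intro h
    exact ContinuousMap.toLp_injective (𝕜 := ℂ) (p := 2) μ (h.trans (map_zero _).symm)
  · intro h
    change ContinuousMap.toLp 2 μ ℂ (repFun V G S p) = 0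
    rw [h, map_zero]

lemma inner_repL2_repDirac (p p' : repAlg V G ⊗[ℂ] S) :
    ⟪repL2 V G μ S (repDirac e M p), repL2 V G μ S p'⟫_ℂ =
      ⟪repL2 V G μ S p, repL2 V G μ S (repDirac e M p')⟫_ℂ := by
  rw [inner_repL2, inner_repL2, repFun_repDirac, repFun_repDirac]
  exact integral_inner_diracFun μ e M (contMDiff_repFun p) (contMDiff_repFun p')

variable [T2Space G]

lemma denseRange_repL2 (M : SpinorModule g.quadratic S) : DenseRange (repL2 V G μ S) := by
  have := M.finiteDimensional
  have h := (Submodule.topologicalClosure_eq_top_iff (K := LinearMap.range (repL2 V G μ S))).2 (by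
    rw [Submodule.eq_bot_iff]
    intro v hv
    refine eq_zero_of_inner_tensorFun μ continuous_of_mem_repAlg
      (fun f hf => star_mem_repAlg hf) (fun a b hab => exists_repAlg_separates μ hab)
      fun f ξ => (Submodule.mem_orthogonal _ v).1 hv _ ⟨f ⊗ₜ ξ, rfl⟩)
  rw [DenseRange, ← LinearMap.coe_range]
  exact Submodule.dense_iff_topologicalClosure_eq_top.2 h

/-- The core of the basic Dirac operator. -/
def repCore : DiracCore (Lp S 2 μ) Unit :=
  DiracCore.ofDense (repL2 V G μ S) (denseRange_repL2 μ M) (fun _ => repDirac e M)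
    (fun _ => inner_repL2_repDirac μ e M) (fun _ _ h => absurd rfl h)
    (tensorDirac_locfin (X := fun (_ : Unit) i => repDeriv (e i)) (fun w => by
      obtain ⟨U, h1, h2, h3⟩ := exists_repDeriv_stable w
      exact ⟨U, h1, h2, fun _ i v hv => h3 (e i) v hv, Set.toFinite _⟩)
      fun _ _ _ => ⟨⊤, by simp, (have := M.finiteDimensional; Module.Finite.fg_top), by simp⟩)

end BasicDirac

end AGN

end

noncomputable section

namespace AGN

set_option linter.unusedSectionVars false

/-- If l differed from the weight of every non-zero block, v would be orthogonal to all blocks. So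
eigenvalues of the squared closure already occur on the core. -/
lemma DiracCore.exists_eigenvector {H : Type*} [NormedAddCommGroup H] [InnerProductSpace ℂ H]
    {ι : Type*} (C : DiracCore H ι) {a : ι → ℝ} {v w : H} {l : ℝ} (hv : v ≠ 0)
    (h1 : (v, w) ∈ C.G a) (h2 : (w, (l : ℂ) • v) ∈ C.G a) :
    ∃ u : C.K, u ≠ 0 ∧ C.A a (C.A a u) = (l : ℂ) • u := by
  by_contra! hcon
  refine hv (C.eq_zero_of_inner fun u => ?_)
  refine C.block_induction (p := fun u => ⟪v, (u : H)⟫_ℂ = 0) (by simp)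
    (fun a b ha hb => by simp [ha, hb]) (fun χ u hu => ?_) u
  rcases eq_or_ne u 0 with rfl | h0
  · simp
  have h3 := C.A_A_apply a hu
  have h4 : weight a χ ≠ l := fun h => hcon u h0 (by rw [h3, h])
  have h5 : ⟪(l : ℂ) • v, (u : H)⟫_ℂ = ⟪w, (C.A a u : H)⟫_ℂ := h2 u
  have h6 : ⟪w, (C.A a u : H)⟫_ℂ = ⟪v, (C.A a (C.A a u) : H)⟫_ℂ := h1 (C.A a u)
  rw [h3, h5.symm] at h6
  simp only [Submodule.coe_smul, inner_smul_left, inner_smul_right, Complex.conj_ofReal] at h6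
  have h7 : ((l : ℂ) - weight a χ) * ⟪v, (u : H)⟫_ℂ = 0 := by rw [sub_mul, h6, sub_self]
  rcases mul_eq_zero.1 h7 with h | h
  · exact absurd (by exact_mod_cast (sub_eq_zero.1 h).symm) h4
  · exact h

section Garding

variable {V : Type*} [NormedAddCommGroup V] [NormedSpace ℝ V] [FiniteDimensional ℝ V]
  {G : Type*} [Group G] [TopologicalSpace G] [ChartedSpace V G] [LieGroup 𝓘(ℝ, V) ∞ G]
  [IsTopologicalGroup G] [CompactSpace G] [SecondCountableTopology G]
  [MeasurableSpace G] [BorelSpace G] (μ : Measure G) [IsProbabilityMeasure μ] [μ.IsHaarMeasure]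
  {S : Type*} [NormedAddCommGroup S] [InnerProductSpace ℂ S]
  {g : InvariantMetric V G} [CompleteSpace S] {q : ℕ}
  (e : Module.Basis (Fin q) ℝ (GroupLieAlgebra 𝓘(ℝ, V) G)) (M : SpinorModule g.quadratic S)

/-! ### The Gårding inequality -/

lemma integral_inner_self {f : G → S} : ∫ x, ⟪f x, f x⟫_ℂ ∂μ = (sqInt μ f : ℂ) := by
  rw [sqInt, ← integral_complex_ofReal]
  refine integral_congr_ae (Eventually.of_forall fun y => ?_)
  simp only [inner_self_eq_norm_sq_to_K]
  norm_cast

lemma norm_integral_inner_le {f h : G → S} (hf : Continuous f) (hh : Continuous h) :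
    ‖∫ x, ⟪f x, h x⟫_ℂ ∂μ‖ ≤ √(sqInt μ f) * √(sqInt μ h) := by
  have : NormedSpace ℝ S := inferInstance
  refine (norm_integral_le_integral_norm _).trans (le_trans ?_ (integral_norm_mul_le μ hf hh))
  exact integral_mono (integrable_of_continuous (hf.inner hh).norm)
    (integrable_of_continuous (hf.norm.mul hh.norm)) fun x => norm_inner_le_norm _ _

lemma exists_sqInt_leftFDeriv_le : ∃ C : ℝ, 0 ≤ C ∧ ∀ f : G → S, ContMDiff 𝓘(ℝ, V) 𝓘(ℝ, S) ∞ f →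
    sqInt μ (leftFDeriv V f) ≤ C * ∑ j, sqInt μ (leftDeriv (e j) f) := by
  let b : Module.Basis (Fin q) ℝ V := e.map algVec
  let k : Fin q → ℝ := fun j => ‖LinearMap.toContinuousLinearMap (b.coord j)‖
  refine ⟨∑ j, k j ^ 2, Finset.sum_nonneg fun j _ => by positivity, fun f hf => ?_⟩
  have hb : ∀ x, ‖leftFDeriv V f x‖ ≤ ∑ j, k j * ‖leftDeriv (e j) f x‖ := by
    intro x
    refine ContinuousLinearMap.opNorm_le_bound _ (Finset.sum_nonneg fun j _ => by positivity)
      fun w => ?_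
    conv_lhs => rw [← b.sum_repr w, map_sum]
    rw [Finset.sum_mul]
    refine (norm_sum_le _ _).trans (Finset.sum_le_sum fun j _ => ?_)
    rw [map_smul, norm_smul, leftDeriv_eq hf]
    have h1 : ‖b.repr w j‖ ≤ k j * ‖w‖ :=
      (LinearMap.toContinuousLinearMap (b.coord j)).le_opNorm w
    have h2 : b j = algVec (e j) := by simp [b]
    rw [h2]
    calc _ ≤ k j * ‖w‖ * ‖leftFDeriv V f x (algVec (e j))‖ := by gcongr
      _ = _ := by ring
  have hc : ∀ j, Continuous fun x => ‖leftDeriv (e j) f x‖ ^ 2 := fun j =>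
    (contMDiff_leftDeriv hf _).continuous.norm.pow 2
  calc sqInt μ (leftFDeriv V f)
      ≤ ∫ x, (∑ j, k j ^ 2) * ∑ j, ‖leftDeriv (e j) f x‖ ^ 2 ∂μ := by
        refine integral_mono
          (integrable_of_continuous ((contMDiff_leftFDeriv hf).continuous.norm.pow 2))
          (integrable_of_continuous (continuous_const.mul
            (continuous_finsetSum _ fun j _ => hc j))) fun x => ?_
        exact (pow_le_pow_left₀ (norm_nonneg _) (hb x) 2).trans
          (Finset.sum_mul_sq_le_sq_mul_sq _ _ _)
    _ = _ := by
        rw [integral_const_mul, integral_finsetSum _ fun j _ => integrable_of_continuous (hc j)]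
        rfl

/-- The Clifford relation splits the double sum: the part symmetric in j, k reduces to the diagonal,
and the antisymmetric part sees only the commutators a j k - a k j. -/
lemma sum_clifford_mul (T : Fin q → Fin q → S →L[ℂ] S)
    (hT : ∀ j k, T j k + T k j = if j = k then (2 : ℂ) • 1 else 0) (a : Fin q → Fin q → S) :
    ∑ j, ∑ k, T j k (a j k) =
      ∑ j, a j j + (1 / 2 : ℂ) • ∑ j, ∑ k, T j k (a j k - a k j) := by
  have h1 : ∑ j, ∑ k, T j k (a k j) = ∑ j, ∑ k, ((if j = k then (2 : ℂ) • a j k else 0) -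
      T j k (a j k)) := by
    rw [Finset.sum_comm]
    refine Finset.sum_congr rfl fun j _ => Finset.sum_congr rfl fun k _ => ?_
    have h2 := congrArg (fun A : S →L[ℂ] S => A (a j k)) (hT j k)
    rw [eq_sub_iff_add_eq, add_comm]
    split_ifs at h2 ⊢ with h <;> simpa [h] using h2
  simp only [map_sub, Finset.sum_sub_distrib] at h1 ⊢
  rw [h1]
  simp only [Finset.sum_ite_eq, Finset.mem_univ, if_true, ← Finset.smul_sum]
  module

/-- By `sum_clifford_mul` the second-order part is diagonal, and the off-diagonal part contains only
commutators of derivatives, which are of first order by `leftDeriv_comm`. -/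
lemma diracFun_diracFun (he : ∀ i j, g.form (e i) (e j) = if i = j then 1 else 0) {f : G → S}
    (hf : ContMDiff 𝓘(ℝ, V) 𝓘(ℝ, S) ∞ f) (x : G) :
    diracFun e M (diracFun e M f) x = -(∑ j, leftDeriv (e j) (leftDeriv (e j) f) x +
      (1 / 2 : ℂ) • ∑ j, ∑ k, M.c (e j) (M.c (e k) (leftDeriv (algVec.symm
        (chartBracket V G (algVec (e j)) (algVec (e k)))) f x))) := by
  have hd : ∀ k, ContMDiff 𝓘(ℝ, V) 𝓘(ℝ, S) ∞ fun x => M.c (e k) (leftDeriv (e k) f x) := fun k =>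
    contMDiff_clm (contMDiff_leftDeriv hf _) _
  have h1 : ∀ j, leftDeriv (e j) (diracFun e M f) x =
      (1 / Complex.I) • ∑ k, M.c (e k) (leftDeriv (e j) (leftDeriv (e k) f) x) := by
    intro j
    have h2 : ∀ s : Finset (Fin q), ContMDiff 𝓘(ℝ, V) 𝓘(ℝ, S) ∞
        (fun x => ∑ k ∈ s, M.c (e k) (leftDeriv (e k) f x)) ∧
        leftDeriv (e j) (fun x => ∑ k ∈ s, M.c (e k) (leftDeriv (e k) f x)) x =
          ∑ k ∈ s, M.c (e k) (leftDeriv (e j) (leftDeriv (e k) f) x) := by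
      intro s
      refine ⟨contMDiff_finsetSum fun k _ => hd k, ?_⟩
      induction s using Finset.induction_on with
      | empty =>
        simp only [Finset.sum_empty]
        have := leftDeriv_clm_apply hf 0 (e j) x
        simpa using this
      | insert k s hk ih =>
        simp only [Finset.sum_insert hk]
        rw [← ih, ← leftDeriv_clm_apply (contMDiff_leftDeriv hf (e k)) (M.c (e k))]
        exact congrFun (leftDeriv_add (hd k) (contMDiff_finsetSum fun k _ => hd k) (e j)) x
    have h3 := leftDeriv_clm_apply (h2 Finset.univ).1
      ((1 / Complex.I) • ContinuousLinearMap.id ℂ S) (e j) x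
    rw [(h2 Finset.univ).2] at h3
    exact h3
  have hI : (1 / Complex.I) * (1 / Complex.I) = -1 := by
    rw [div_mul_div_comm, Complex.I_mul_I]; norm_num
  have h4 := sum_clifford_mul (fun j k => M.c (e j) * M.c (e k)) (fun j k => ?_)
    (fun j k => leftDeriv (e j) (leftDeriv (e k) f) x)
  · rw [diracFun]
    simp only [h1, map_smul, map_sum, ← Finset.smul_sum]
    rw [smul_smul, hI, neg_one_smul]
    congr 1
    simp only [leftDeriv_comm hf] at h4
    exact h4
  · rw [M.c_mul_add, InvariantMetric.quadratic, LinearMap.BilinMap.polar_toQuadraticMap, he, he]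
    by_cases h : j = k
    · subst h
      simp only [if_true]
      norm_num
    · simp [h, Ne.symm h]

/-- Pairing f with the formula for D² f and integrating by parts gives ∑ ‖e_j f‖² - ‖D f‖² as an
integral of f against first-order terms. Half of the derivative norm absorbs them, which explains
the factor 2. -/
lemma exists_garding (he : ∀ i j, g.form (e i) (e j) = if i = j then 1 else 0) :
    ∃ C : ℝ, 0 ≤ C ∧ ∀ f : G → S, ContMDiff 𝓘(ℝ, V) 𝓘(ℝ, S) ∞ f →
      ∑ j, sqInt μ (leftDeriv (e j) f) ≤ 2 * sqInt μ (diracFun e M f) + C * sqInt μ f := by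
  obtain ⟨C₁, hC₁, hC⟩ := exists_sqInt_leftFDeriv_le (S := S) μ e
  let v : Fin q → Fin q → V := fun j k => chartBracket V G (algVec (e j)) (algVec (e k))
  let N : Fin q → Fin q → ℝ := fun j k => ‖M.c (e j)‖ * (‖M.c (e k)‖ * ‖v j k‖)
  let K : ℝ := ∑ j, ∑ k, N j k
  have hK : 0 ≤ K := Finset.sum_nonneg fun j _ => Finset.sum_nonneg fun k _ => by positivity
  refine ⟨K ^ 2 * C₁, by positivity, fun f hf => ?_⟩
  set A := ∑ j, sqInt μ (leftDeriv (e j) f) with hA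
  have hA0 : 0 ≤ A := Finset.sum_nonneg fun j _ => sqInt_nonneg μ _
  have hD := contMDiff_diracFun e M hf
  let R : Fin q → Fin q → G → S := fun j k x =>
    M.c (e j) (M.c (e k) (leftDeriv (algVec.symm (v j k)) f x))
  have hR : ∀ j k, ContMDiff 𝓘(ℝ, V) 𝓘(ℝ, S) ∞ (R j k) := fun j k =>
    contMDiff_clm (contMDiff_clm (contMDiff_leftDeriv hf _) _) _
  have h1 : (sqInt μ (diracFun e M f) : ℂ) =
      A - (1 / 2 : ℂ) * ∑ j, ∑ k, ∫ x, ⟪f x, R j k x⟫_ℂ ∂μ := by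
    rw [← integral_inner_self, integral_inner_diracFun μ e M hf hD]
    have h2 : ∀ x, ⟪f x, diracFun e M (diracFun e M f) x⟫_ℂ =
        -(∑ j, ⟪f x, leftDeriv (e j) (leftDeriv (e j) f) x⟫_ℂ +
          (1 / 2 : ℂ) * ∑ j, ∑ k, ⟪f x, R j k x⟫_ℂ) := fun x => by
      rw [diracFun_diracFun e M he hf, inner_neg_right, inner_add_right, inner_sum,
        inner_smul_right, inner_sum]
      simp only [inner_sum, R, v]
    simp only [h2]
    have i1 : ∀ j, Integrable (fun x => ⟪f x, leftDeriv (e j) (leftDeriv (e j) f) x⟫_ℂ) μ :=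
      fun j => integrable_of_continuous
        (hf.continuous.inner (contMDiff_leftDeriv (contMDiff_leftDeriv hf _) _).continuous)
    have i2 : ∀ j k, Integrable (fun x => ⟪f x, R j k x⟫_ℂ) μ := fun j k =>
      integrable_of_continuous (hf.continuous.inner (hR j k).continuous)
    rw [integral_neg, integral_add (integrable_finsetSum _ fun j _ => i1 j)
      ((integrable_finsetSum _ fun j _ => integrable_finsetSum _ fun k _ => i2 j k).const_mul _),
      integral_finsetSum _ fun j _ => i1 j, integral_const_mul,
      integral_finsetSum _ fun j _ => integrable_finsetSum _ fun k _ => i2 j k]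
    have h3 : ∀ j, ∫ x, ∑ k, ⟪f x, R j k x⟫_ℂ ∂μ = ∑ k, ∫ x, ⟪f x, R j k x⟫_ℂ ∂μ := fun j =>
      integral_finsetSum _ fun k _ => i2 j k
    have h4 : ∀ j, ∫ x, ⟪f x, leftDeriv (e j) (leftDeriv (e j) f) x⟫_ℂ ∂μ =
        -(sqInt μ (leftDeriv (e j) f) : ℂ) := fun j => by
      rw [← integral_inner_self, integral_inner_leftDeriv μ hf (contMDiff_leftDeriv hf _), neg_neg]
    simp only [h3, h4, Finset.sum_neg_distrib]
    rw [hA]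
    push_cast
    ring
  have h5 : ∀ j k, ‖∫ x, ⟪f x, R j k x⟫_ℂ ∂μ‖ ≤ N j k * (√(sqInt μ f) * √(C₁ * A)) := by
    intro j k
    refine (norm_integral_inner_le μ hf.continuous (hR j k).continuous).trans ?_
    have h6 : sqInt μ (R j k) ≤ (N j k) ^ 2 * (C₁ * A) := by
      refine le_trans ?_ (mul_le_mul_of_nonneg_left (hC f hf) (sq_nonneg _))
      rw [sqInt, sqInt, ← integral_const_mul]
      refine integral_mono (integrable_of_continuous ((hR j k).continuous.norm.pow 2))
        (integrable_of_continuous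
          (continuous_const.mul ((contMDiff_leftFDeriv hf).continuous.norm.pow 2))) fun x => ?_
      simp only
      rw [← mul_pow]
      refine pow_le_pow_left₀ (norm_nonneg _) ?_ 2
      calc ‖R j k x‖ ≤ ‖M.c (e j)‖ * (‖M.c (e k)‖ * (‖leftFDeriv V f x‖ * ‖v j k‖)) := by
            refine (ContinuousLinearMap.le_opNorm _ _).trans ?_
            gcongr
            refine (ContinuousLinearMap.le_opNorm _ _).trans ?_
            gcongr
            rw [leftDeriv_eq hf]
            exact ContinuousLinearMap.le_opNorm _ _
        _ = N j k * ‖leftFDeriv V f x‖ := by simp only [N]; ring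
    have h7 : √(sqInt μ (R j k)) ≤ N j k * √(C₁ * A) := by
      rw [← Real.sqrt_sq (show 0 ≤ N j k by positivity), ← Real.sqrt_mul (sq_nonneg _)]
      exact Real.sqrt_le_sqrt h6
    calc _ ≤ √(sqInt μ f) * (N j k * √(C₁ * A)) := by gcongr
      _ = _ := by ring
  set F := sqInt μ f
  have hF : 0 ≤ F := sqInt_nonneg μ f
  set B := sqInt μ (diracFun e M f)
  have h8 : A - B ≤ 1 / 2 * (K * (√F * √(C₁ * A))) := by
    have h9 : ((A - B : ℝ) : ℂ) = (1 / 2 : ℂ) * ∑ j, ∑ k, ∫ x, ⟪f x, R j k x⟫_ℂ ∂μ := by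
      push_cast
      rw [h1]
      ring
    have h10 : ‖((A - B : ℝ) : ℂ)‖ ≤ 1 / 2 * (K * (√F * √(C₁ * A))) := by
      rw [h9, norm_mul]
      have : ‖(1 / 2 : ℂ)‖ = 1 / 2 := by norm_num
      rw [this]
      gcongr
      refine (norm_sum_le _ _).trans ?_
      rw [Finset.sum_mul]
      refine Finset.sum_le_sum fun j _ => (norm_sum_le _ _).trans ?_
      rw [Finset.sum_mul]
      exact Finset.sum_le_sum fun k _ => h5 j k
    rw [Complex.norm_real] at h10
    exact (le_abs_self _).trans h10
  -- The arithmetic–geometric mean inequality, in the form (K √C₁ √F - √A)² ≥ 0.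
  have h11 : K * (√F * √(C₁ * A)) ≤ A + K ^ 2 * C₁ * F := by
    rw [Real.sqrt_mul hC₁]
    have e1 := Real.sq_sqrt hF
    have e2 := Real.sq_sqrt hC₁
    have e3 := Real.sq_sqrt hA0
    have e4 := sq_nonneg (K * √C₁ * √F - √A)
    have e5 : 0 ≤ K * (√F * (√C₁ * √A)) := by positivity
    have e6 : (K * √C₁ * √F - √A) ^ 2 = K ^ 2 * C₁ * F + A - 2 * (K * (√F * (√C₁ * √A))) := by
      rw [sub_sq, mul_pow, mul_pow, e1, e2, e3]; ring
    linarith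
  linarith

end Garding

end AGN

end

noncomputable section

namespace AGN

set_option linter.unusedSectionVars false

section Rellich

/-! ### A compactness estimate -/

/-- Bessel's inequality for the indicator of s times each vector of an orthonormal basis of S; there
are dim S such vectors, each of squared norm ν s. -/
lemma sum_sq_norm_setIntegral_le {T : Type*} [TopologicalSpace T] [CompactSpace T]
    [SecondCountableTopology T] [MeasurableSpace T] [BorelSpace T] (ν : Measure T)
    [IsFiniteMeasure ν] {S : Type*} [NormedAddCommGroup S] [InnerProductSpace ℂ S]
    [FiniteDimensional ℂ S] {ι : Type*} [Fintype ι] (f : ι → C(T, S))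
    (hf : Orthonormal ℂ fun i => ContinuousMap.toLp 2 ν ℂ (f i)) {s : Set T}
    (hs : MeasurableSet s) :
    ∑ i, ‖∫ x in s, f i x ∂ν‖ ^ 2 ≤ Module.finrank ℂ S * ν.real s := by
  have : CompleteSpace S := FiniteDimensional.complete ℂ S
  let b := stdOrthonormalBasis ℂ S
  have h1 : ∀ i, ∫ x in s, ContinuousMap.toLp 2 ν ℂ (f i) x ∂ν = ∫ x in s, f i x ∂ν := fun i =>
    integral_congr_ae (ae_restrict_of_ae (ContinuousMap.coeFn_toLp (𝕜 := ℂ) (p := 2) ν (f i)))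
  have h2 : ∀ k, ∑ i, ‖⟪b k, ∫ x in s, f i x ∂ν⟫_ℂ‖ ^ 2 ≤ ν.real s := fun k => by
    have h3 := hf.sum_inner_products_le (s := Finset.univ)
      (x := indicatorConstLp 2 hs (measure_ne_top ν s) (b k))
    rw [norm_indicatorConstLp (by norm_num) (by norm_num), b.orthonormal.1 k, one_mul,
      ← Real.rpow_natCast, ← Real.rpow_mul measureReal_nonneg] at h3
    norm_num at h3
    refine le_trans (Finset.sum_le_sum fun i _ => ?_) h3
    rw [← h1, ← L2.inner_indicatorConstLp_eq_inner_setIntegral ℂ hs (measure_ne_top ν s),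
      ← inner_conj_symm, RCLike.norm_conj]
  calc ∑ i, ‖∫ x in s, f i x ∂ν‖ ^ 2 = ∑ i, ∑ k, ‖⟪b k, ∫ x in s, f i x ∂ν⟫_ℂ‖ ^ 2 :=
        Finset.sum_congr rfl fun i _ => (b.sum_sq_norm_inner_right _).symm
    _ = ∑ k, ∑ i, ‖⟪b k, ∫ x in s, f i x ∂ν⟫_ℂ‖ ^ 2 := Finset.sum_comm
    _ ≤ ∑ k : Fin (Module.finrank ℂ S), ν.real s := Finset.sum_le_sum fun k _ => h2 k
    _ = _ := by simp

variable {V : Type*} [NormedAddCommGroup V] [NormedSpace ℝ V] [FiniteDimensional ℝ V]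
  {G : Type*} [Group G] [TopologicalSpace G] [ChartedSpace V G] [LieGroup 𝓘(ℝ, V) ∞ G]
  [IsTopologicalGroup G] [CompactSpace G] [SecondCountableTopology G]
  [MeasurableSpace G] [BorelSpace G] (μ : Measure G) [IsProbabilityMeasure μ] [μ.IsHaarMeasure]
  {S : Type*} [NormedAddCommGroup S] [InnerProductSpace ℂ S]
  {q : ℕ} (e : Module.Basis (Fin q) ℝ (GroupLieAlgebra 𝓘(ℝ, V) G))

lemma exists_nhds_sqInt_translate_sub_le [CompleteSpace S] (K : ℝ) {η : ℝ} (hη : 0 < η) :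
    ∃ U ∈ 𝓝 (1 : G), ∀ y ∈ U, ∀ f : G → S, ContMDiff 𝓘(ℝ, V) 𝓘(ℝ, S) ∞ f →
      ∑ j, sqInt μ (leftDeriv (e j) f) ≤ K → sqInt μ (fun x => f (x * y) - f x) ≤ η := by
  obtain ⟨r, C, hr, hb, hC⟩ := exists_ball_logDeriv V G
  obtain ⟨C₁, hC₁, hF⟩ := exists_sqInt_leftFDeriv_le (S := S) μ e
  have h1 : ∀ᶠ u in 𝓝 (expBase V G), (C * ‖u - expBase V G‖) ^ 2 * (C₁ * K) < η := by
    have h2 : Continuous fun u => (C * ‖u - expBase V G‖) ^ 2 * (C₁ * K) := by fun_prop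
    exact h2.continuousAt.eventually (gt_mem_nhds (by simpa using hη))
  have h3 : ∀ᶠ y in 𝓝 (1 : G), y ∈ (extChartAt 𝓘(ℝ, V) (1 : G)).source :=
    extChartAt_source_mem_nhds (I := 𝓘(ℝ, V)) (1 : G)
  have h4 := (continuousAt_extChartAt (I := 𝓘(ℝ, V)) (1 : G)).eventually
    (h1.and (Metric.ball_mem_nhds (expBase V G) hr))
  refine ⟨_, h3.and h4, fun y ⟨hy1, hy2, hy3⟩ f hf hfK => ?_⟩
  have h5 := sqInt_translate_sub_le μ hr hb hC hf hy3
  have h6 : expChart V G (extChartAt 𝓘(ℝ, V) (1 : G) y) = y :=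
    (extChartAt 𝓘(ℝ, V) (1 : G)).left_inv hy1
  rw [h6] at h5
  refine h5.trans (le_trans ?_ hy2.le)
  exact mul_le_mul_of_nonneg_left ((hF f hf).trans (mul_le_mul_of_nonneg_left hfK hC₁))
    (sq_nonneg _)

/-- Jensen's inequality for the squared norm, then Fubini. -/
lemma sqInt_average_sub_le [CompleteSpace S] (ν : Measure G) [IsProbabilityMeasure ν] {f : G → S}
    (hf : Continuous f) {η : ℝ} (h : ∀ᵐ y ∂ν, sqInt μ (fun x => f (x * y) - f x) ≤ η) :
    sqInt μ (fun x => ∫ y, f (x * y) ∂ν - f x) ≤ η := by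
  have hc : Continuous fun p : G × G => ‖f (p.1 * p.2) - f p.1‖ ^ 2 := by fun_prop
  have hi : Integrable (fun p : G × G => ‖f (p.1 * p.2) - f p.1‖ ^ 2) (μ.prod ν) := by
    obtain ⟨B, hB⟩ := isCompact_univ.exists_bound_of_continuousOn hc.continuousOn
    exact Integrable.of_bound hc.aestronglyMeasurable B (Eventually.of_forall fun x => hB x trivial)
  have hT : Continuous fun x => ∫ y, f (x * y) ∂ν := by
    obtain ⟨B, hB⟩ := isCompact_univ.exists_bound_of_continuousOn hf.continuousOn
    refine continuous_of_dominated (bound := fun _ => B)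
      (fun x => (hf.comp (continuous_const.mul continuous_id)).aestronglyMeasurable)
      (fun x => Eventually.of_forall fun y => hB _ trivial) (integrable_const _)
      (Eventually.of_forall fun y => hf.comp (continuous_id.mul continuous_const))
  calc sqInt μ (fun x => ∫ y, f (x * y) ∂ν - f x)
      ≤ ∫ x, ∫ y, ‖f (x * y) - f x‖ ^ 2 ∂ν ∂μ := by
        refine integral_mono (integrable_of_continuous ((hT.sub hf).norm.pow 2))
          hi.integral_prod_left fun x => ?_
        have h1 : Continuous fun y => f (x * y) := hf.comp (continuous_const.mul continuous_id)
        have h2 : Continuous fun y => f (x * y) - f x := h1.sub continuous_const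
        have h3 := ((convexOn_univ_norm (E := S)).pow (fun _ _ => norm_nonneg _) 2).map_integral_le
          (μ := ν) (f := fun y => f (x * y) - f x) (continuous_norm.pow 2).continuousOn
          isClosed_univ (Eventually.of_forall fun _ => trivial) (integrable_of_continuous h2)
          (integrable_of_continuous (h2.norm.pow 2))
        rw [integral_sub (integrable_of_continuous h1) (integrable_const _)] at h3
        simpa using h3
    _ = ∫ y, sqInt μ (fun x => f (x * y) - f x) ∂ν := integral_integral_swap hi
    _ ≤ ∫ _, η ∂ν := integral_mono_ae hi.integral_prod_right (integrable_const _) h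
    _ = η := by simp

/-- A quantitative Rellich theorem. Averaging over a small neighbourhood U of 1 changes each f i
little, so the averages keep a fixed part of their mean square. At each point, however, Bessel's
inequality bounds the sum of the squared averages by dim S / μ U. -/
lemma exists_card_le [FiniteDimensional ℂ S] (K : ℝ) :
    ∃ N : ℕ, ∀ (ι : Type) [Fintype ι] (f : ι → C(G, S)),
      (∀ i, ContMDiff 𝓘(ℝ, V) 𝓘(ℝ, S) ∞ (f i)) →
      (Orthonormal ℂ fun i => ContinuousMap.toLp 2 μ ℂ (f i)) →
      (∀ i, ∑ j, sqInt μ (leftDeriv (e j) (f i)) ≤ K) → Fintype.card ι ≤ N := by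
  have : CompleteSpace S := FiniteDimensional.complete ℂ S
  obtain ⟨U₀, hU₀, hU⟩ := exists_nhds_sqInt_translate_sub_le (S := S) μ e K
    (show (0 : ℝ) < 1 / 4 by norm_num)
  obtain ⟨U, hUU, hUo, h1U⟩ := mem_nhds_iff.1 hU₀
  have hμU : μ U ≠ 0 := (hUo.measure_pos μ ⟨1, h1U⟩).ne'
  have hμU' : 0 < μ.real U := ENNReal.toReal_pos hμU (measure_ne_top _ _)
  let ν := ProbabilityTheory.cond μ U
  have : IsProbabilityMeasure ν := ProbabilityTheory.cond_isProbabilityMeasure hμU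
  have hν : ∀ h : G → S, ∫ y, h y ∂ν = (μ.real U)⁻¹ • ∫ y in U, h y ∂μ := fun h => by
    simp only [ν, ProbabilityTheory.cond]
    rw [integral_smul_measure, ENNReal.toReal_inv]
    rfl
  obtain ⟨N, hN⟩ := exists_nat_ge (4 * (Module.finrank ℂ S * (μ.real U)⁻¹))
  refine ⟨N, fun ι _ f hf ho hfK => ?_⟩
  have hT : ∀ i, Continuous fun x => ∫ y, f i (x * y) ∂ν := fun i => by
    obtain ⟨B, hB⟩ := isCompact_univ.exists_bound_of_continuousOn (f i).continuous.continuousOn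
    refine continuous_of_dominated (bound := fun _ => B)
      (fun x => ((f i).continuous.comp (continuous_const.mul continuous_id)).aestronglyMeasurable)
      (fun x => Eventually.of_forall fun y => hB _ trivial) (integrable_const _)
      (Eventually.of_forall fun y => (f i).continuous.comp (continuous_id.mul continuous_const))
  -- From 1 = ‖f i‖² ≤ 2 ‖average‖² + 2 ‖average - f i‖² and the tolerance 1 / 4 chosen for U.
  have h1 : ∀ i, 1 / 4 ≤ sqInt μ (fun x => ∫ y, f i (x * y) ∂ν) := fun i => by
    have h2 : sqInt μ (fun x => ∫ y, f i (x * y) ∂ν - f i x) ≤ 1 / 4 := by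
      refine sqInt_average_sub_le μ ν (f i).continuous ?_
      have h3 : ∀ᵐ y ∂ν, y ∈ U := ProbabilityTheory.ae_cond_mem hUo.measurableSet
      filter_upwards [h3] with y hy using hU y (hUU hy) (f i) (hf i) (hfK i)
    have h4 : sqInt μ (f i) = 1 := by
      have h5 := inner_self_eq_norm_sq_to_K (𝕜 := ℂ) (ContinuousMap.toLp 2 μ ℂ (f i))
      rw [inner_toLp_toLp, integral_inner_self, ho.1 i] at h5
      norm_cast at h5
      simpa using h5
    have h6 : sqInt μ (f i) ≤ 2 * sqInt μ (fun x => ∫ y, f i (x * y) ∂ν) +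
        2 * sqInt μ (fun x => ∫ y, f i (x * y) ∂ν - f i x) := by
      have c1 : Continuous fun x => ‖∫ y, f i (x * y) ∂ν‖ ^ 2 := (hT i).norm.pow 2
      have c2 : Continuous fun x => ‖∫ y, f i (x * y) ∂ν - f i x‖ ^ 2 :=
        ((hT i).sub (f i).continuous).norm.pow 2
      simp only [sqInt]
      have i1 := (integrable_of_continuous (μ := μ) c1).const_mul 2
      have i2 := (integrable_of_continuous (μ := μ) c2).const_mul 2
      rw [← integral_const_mul, ← integral_const_mul, ← integral_add i1 i2]
      refine integral_mono (integrable_of_continuous ((f i).continuous.norm.pow 2)) (i1.add i2)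
        fun x => ?_
      have h7 := norm_sub_le (∫ y, f i (x * y) ∂ν) (∫ y, f i (x * y) ∂ν - f i x)
      rw [sub_sub_cancel] at h7
      simp only
      nlinarith [norm_nonneg (f i x),
        sq_nonneg (‖∫ y, f i (x * y) ∂ν‖ - ‖∫ y, f i (x * y) ∂ν - f i x‖)]
    linarith
  -- The average at x is an integral over the translate x U, which has the same measure as U.
  have h2 : ∀ x, ∑ i, ‖∫ y, f i (x * y) ∂ν‖ ^ 2 ≤ Module.finrank ℂ S * (μ.real U)⁻¹ := fun x => by
    have hm : MeasurableSet ((fun z => x⁻¹ * z) ⁻¹' U) :=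
      hUo.measurableSet.preimage (measurable_const_mul _)
    have h3 : ∀ i, ∫ y in U, f i (x * y) ∂μ = ∫ z in (fun z => x⁻¹ * z) ⁻¹' U, f i z ∂μ := by
      intro i
      rw [← (measurePreserving_mul_left μ x).setIntegral_preimage_emb
        (measurableEmbedding_mulLeft x) (f i), ← Set.preimage_comp]
      congr 3
      ext z
      simp
    have h4 : μ.real ((fun z => x⁻¹ * z) ⁻¹' U) = μ.real U := by
      rw [measureReal_def, measure_preimage_mul, measureReal_def]
    have h5 := sum_sq_norm_setIntegral_le μ f ho hm
    rw [h4] at h5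
    simp only [hν, h3, norm_smul, mul_pow, ← Finset.mul_sum]
    rw [Real.norm_of_nonneg (inv_nonneg.2 hμU'.le)]
    calc _ ≤ (μ.real U)⁻¹ ^ 2 * (Module.finrank ℂ S * μ.real U) := by gcongr
      _ = _ := by field_simp
  have h3 : (Fintype.card ι : ℝ) * (1 / 4) ≤ Module.finrank ℂ S * (μ.real U)⁻¹ := by
    calc (Fintype.card ι : ℝ) * (1 / 4) = ∑ _i : ι, (1 / 4 : ℝ) := by simp
      _ ≤ ∑ i, sqInt μ (fun x => ∫ y, f i (x * y) ∂ν) := Finset.sum_le_sum fun i _ => h1 i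
      _ = ∫ x, ∑ i, ‖∫ y, f i (x * y) ∂ν‖ ^ 2 ∂μ :=
        (integral_finsetSum _ fun i _ => integrable_of_continuous ((hT i).norm.pow 2)).symm
      _ ≤ ∫ _, Module.finrank ℂ S * (μ.real U)⁻¹ ∂μ :=
        integral_mono (integrable_of_continuous (continuous_finsetSum _ fun i _ =>
          (hT i).norm.pow 2)) (integrable_const _) h2
      _ = _ := by simp
  have h4 : (Fintype.card ι : ℝ) ≤ N := by linarith
  exact_mod_cast h4

end Rellich

end AGN

end

noncomputable section

namespace AGN

set_option linter.unusedSectionVars false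

/-! ### Cores given as dense images. -/

namespace DiracCore

variable {H : Type*} [NormedAddCommGroup H] [InnerProductSpace ℂ H] {ι : Type*}
variable {P : Type*} [AddCommGroup P] [Module ℂ P] {j : P →ₗ[ℂ] H} {hj : DenseRange j}
  {D : ι → Module.End ℂ P} {symm : ∀ γ p p', ⟪j (D γ p), j p'⟫_ℂ = ⟪j p, j (D γ p')⟫_ℂ}
  {anti : ∀ γ γ', γ ≠ γ' → D γ * D γ' = -(D γ' * D γ)}
  {locfin : ∀ p : P, ∃ U : Submodule ℂ P, p ∈ U ∧ U.FG ∧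
    (∀ γ, ∀ v ∈ U, D γ v ∈ U) ∧ {γ | ∃ v ∈ U, D γ v ≠ 0}.Finite}

variable (j hj D symm anti locfin) in
/-- The map onto the core. -/
def ofDenseMap : P →ₗ[ℂ] (ofDense j hj D symm anti locfin).K := j.rangeRestrict

lemma ofDense_D (γ : ι) (p : P) :
    (ofDense j hj D symm anti locfin).D γ (ofDenseMap j hj D symm anti locfin p) =
      ofDenseMap j hj D symm anti locfin (D γ p) :=
  rangeOp_apply hj (symm γ) p

lemma ofDense_A (a : ι → ℝ) (p : P) :
    (ofDense j hj D symm anti locfin).A a (ofDenseMap j hj D symm anti locfin p) =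
      ofDenseMap j hj D symm anti locfin (∑ᶠ γ, (a γ : ℂ) • D γ p) := by
  rw [A_apply]
  simp only [ofDense_D]
  obtain ⟨U, hp, -, -, hf⟩ := locfin p
  refine (((ofDenseMap j hj D symm anti locfin).toAddMonoidHom.map_finsum
    (hf.subset fun γ hγ => ?_)).trans (finsum_congr fun γ => ?_)).symm
  · exact ⟨p, hp, fun h => hγ (by simp [h])⟩
  · exact map_smul (ofDenseMap j hj D symm anti locfin) _ _

lemma exists_ofDenseMap_eq (u : (ofDense j hj D symm anti locfin).K) :
    ∃ p, ofDenseMap j hj D symm anti locfin p = u :=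
  j.surjective_rangeRestrict u

end DiracCore

section Gap

variable {V : Type*} [NormedAddCommGroup V] [NormedSpace ℝ V] [FiniteDimensional ℝ V]
  {G : Type*} [Group G] [TopologicalSpace G] [ChartedSpace V G] [LieGroup 𝓘(ℝ, V) ∞ G]
  [IsTopologicalGroup G] [CompactSpace G] [SecondCountableTopology G] [T2Space G]
  [MeasurableSpace G] [BorelSpace G] (μ : Measure G) [IsProbabilityMeasure μ] [μ.IsHaarMeasure]
  {S : Type*} [NormedAddCommGroup S] [InnerProductSpace ℂ S]
  {g : InvariantMetric V G} [CompleteSpace S] {q : ℕ}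
  (e : Module.Basis (Fin q) ℝ (GroupLieAlgebra 𝓘(ℝ, V) G)) (M : SpinorModule g.quadratic S)

/-! ### The spectral gap of the basic Dirac operator -/

/-- The map onto the core of the basic Dirac operator. -/
def repMap : repAlg V G ⊗[ℂ] S →ₗ[ℂ] (repCore μ e M).K := DiracCore.ofDenseMap _ _ _ _ _ _

lemma coe_repMap (p : repAlg V G ⊗[ℂ] S) : (repMap μ e M p : Lp S 2 μ) = repL2 V G μ S p := rfl

lemma exists_repMap_eq (u : (repCore μ e M).K) : ∃ p, repMap μ e M p = u :=
  DiracCore.exists_ofDenseMap_eq u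

lemma repMap_eq_zero {p : repAlg V G ⊗[ℂ] S} : repMap μ e M p = 0 ↔ repFun V G S p = 0 := by
  rw [← repL2_eq_zero μ, ← coe_repMap μ e M, Submodule.coe_eq_zero]

lemma repCore_D (p : repAlg V G ⊗[ℂ] S) :
    (repCore μ e M).D () (repMap μ e M p) = repMap μ e M (repDirac e M p) :=
  DiracCore.ofDense_D () p

lemma repCore_A_one (u : (repCore μ e M).K) :
    (repCore μ e M).A (fun _ => 1) u = (repCore μ e M).D () u := by
  rw [DiracCore.A_apply, finsum_unique]
  simp

/-- The smooth functions lie between the representative functions and the domain of the adjoint, so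
`closedOperator_eq_op` applies. -/
lemma basicDirac_eq_op : basicDirac e M μ = (repCore μ e M).op fun _ => 1 := by
  refine DiracCore.closedOperator_eq_op _ _ _ ?_ ?_
  · intro u
    obtain ⟨p, rfl⟩ := exists_repMap_eq μ e M u
    rw [repCore_A_one, repCore_D]
    refine ⟨repFun V G S p, contMDiff_repFun p, coeFn_repL2 μ p, ?_⟩
    refine (coeFn_repL2 μ _).trans (Eventually.of_forall fun x => ?_)
    rw [repFun_repDirac]
    rfl
  · rintro ⟨v, w⟩ ⟨f, hf, h1, h2⟩
    rw [DiracCore.mem_G]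
    intro u
    obtain ⟨p, rfl⟩ := exists_repMap_eq μ e M u
    rw [repCore_A_one, repCore_D, coe_repMap, coe_repMap, L2.inner_def, L2.inner_def]
    refine (integral_congr_ae ?_).trans ((integral_inner_diracFun μ e M hf
      (contMDiff_repFun p)).trans (integral_congr_ae ?_))
    · filter_upwards [h2, coeFn_repL2 μ p] with x hx hx'
      rw [hx, hx']
      rfl
    · filter_upwards [h1, coeFn_repL2 μ (repDirac e M p)] with x hx hx'
      rw [← repFun_repDirac, hx, hx']

/-- `p` is an eigenvector of the square of the algebraic Dirac operator. -/
def IsRepEigenvector (l : ℝ) (p : repAlg V G ⊗[ℂ] S) : Prop :=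
  repFun V G S p ≠ 0 ∧
    repFun V G S (repDirac e M (repDirac e M p)) = (l : ℂ) • repFun V G S p

lemma isRepEigenvector_iff {l : ℝ} {p : repAlg V G ⊗[ℂ] S} : IsRepEigenvector e M l p ↔
    repMap μ e M p ≠ 0 ∧ (repCore μ e M).D () ((repCore μ e M).D () (repMap μ e M p)) =
      (l : ℂ) • repMap μ e M p := by
  rw [repCore_D, repCore_D, ne_eq, repMap_eq_zero, ← map_smul, ← sub_eq_zero (a := repMap _ _ _ _),
    ← map_sub, repMap_eq_zero, map_sub, sub_eq_zero, map_smul]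
  rfl

lemma mem_nonzeroEigenvaluesSq {l : ℝ} :
    l ∈ nonzeroEigenvaluesSq e M μ ↔ l ≠ 0 ∧ ∃ p, IsRepEigenvector e M l p := by
  rw [nonzeroEigenvaluesSq, basicDirac_eq_op, DiracCore.graph_op]
  refine and_congr_right fun _ => ⟨?_, ?_⟩
  · rintro ⟨v, w, hv, h1, h2⟩
    obtain ⟨u, hu, h⟩ := (repCore μ e M).exists_eigenvector hv h1 h2
    obtain ⟨p, rfl⟩ := exists_repMap_eq μ e M u
    rw [repCore_A_one, repCore_A_one] at h
    exact ⟨p, (isRepEigenvector_iff μ e M).2 ⟨hu, h⟩⟩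
  · rintro ⟨p, hp⟩
    obtain ⟨h1, h2⟩ := (isRepEigenvector_iff μ e M).1 hp
    refine ⟨_, _, fun h => h1 (Subtype.ext h), DiracCore.core_mem_G _ _ _, ?_⟩
    have h3 := (repCore μ e M).core_mem_G (fun _ => 1) ((repCore μ e M).D () (repMap μ e M p))
    rw [repCore_A_one, h2] at h3
    rw [repCore_A_one]
    exact h3

variable {e M}

lemma IsRepEigenvector.inner_eq_zero {l l' : ℝ} {p p' : repAlg V G ⊗[ℂ] S}
    (h : IsRepEigenvector e M l p) (h' : IsRepEigenvector e M l' p') (hl : l ≠ l') :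
    ⟪repL2 V G μ S p, repL2 V G μ S p'⟫_ℂ = 0 := by
  have h1 : ∀ {l p}, IsRepEigenvector e M l p →
      repL2 V G μ S (repDirac e M (repDirac e M p)) = (l : ℂ) • repL2 V G μ S p := fun {l p} h => by
    change ContinuousMap.toLp 2 μ ℂ (repFun V G S (repDirac e M (repDirac e M p))) = _
    rw [h.2, map_smul]
    rfl
  have h2 := (inner_repL2_repDirac μ e M (repDirac e M p) p').trans
    (inner_repL2_repDirac μ e M p (repDirac e M p'))
  rw [h1 h, h1 h', inner_smul_left, inner_smul_right, Complex.conj_ofReal,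
    ← sub_eq_zero, ← sub_mul] at h2
  exact (mul_eq_zero.1 h2).resolve_left (sub_ne_zero.2 (by exact_mod_cast hl))

lemma IsRepEigenvector.sqInt_eq {l : ℝ} {p : repAlg V G ⊗[ℂ] S} (h : IsRepEigenvector e M l p) :
    sqInt μ (diracFun e M (repFun V G S p)) = l * sqInt μ (repFun V G S p) := by
  have h1 := integral_inner_diracFun μ e M (contMDiff_repFun p)
    (contMDiff_diracFun e M (contMDiff_repFun p))
  rw [integral_inner_self, ← repFun_repDirac, ← repFun_repDirac, h.2] at h1
  simp only [ContinuousMap.smul_apply, inner_smul_right] at h1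
  rw [integral_const_mul, integral_inner_self] at h1
  rw [← repFun_repDirac]
  exact_mod_cast h1

lemma IsRepEigenvector.sqInt_pos {l : ℝ} {p : repAlg V G ⊗[ℂ] S} (h : IsRepEigenvector e M l p) :
    0 < sqInt μ (repFun V G S p) := by
  refine (sqInt_nonneg μ _).lt_of_ne' fun h0 => h.1 ((repL2_eq_zero μ).1 ?_)
  rw [← inner_self_eq_zero (𝕜 := ℂ), inner_repL2, integral_inner_self, h0, Complex.ofReal_zero]

lemma IsRepEigenvector.nonneg (μ : Measure G) [IsProbabilityMeasure μ] [μ.IsHaarMeasure]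
    {l : ℝ} {p : repAlg V G ⊗[ℂ] S} (h : IsRepEigenvector e M l p) :
    0 ≤ l := by
  have h3 := sqInt_nonneg μ (diracFun e M (repFun V G S p))
  rw [h.sqInt_eq μ] at h3
  exact nonneg_of_mul_nonneg_left h3 (h.sqInt_pos μ)

lemma IsRepEigenvector.smul {l : ℝ} {p : repAlg V G ⊗[ℂ] S} (h : IsRepEigenvector e M l p) {z : ℂ}
    (hz : z ≠ 0) : IsRepEigenvector e M l (z • p) := by
  refine ⟨by rw [map_smul]; exact smul_ne_zero hz h.1, ?_⟩
  rw [map_smul, map_smul, map_smul, map_smul, h.2, smul_comm]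

variable (e M) in
-- Eigenvectors for distinct eigenvalues are orthogonal. If normalized, they satisfy the derivative
-- bound 2 B + C of the Gårding inequality, so `exists_card_le` limits their number.
lemma finite_eigenvalues_le (μ : Measure G) [IsProbabilityMeasure μ] [μ.IsHaarMeasure]
    (he : ∀ i j, g.form (e i) (e j) = if i = j then 1 else 0) (B : ℝ) :
    {l : ℝ | l ≤ B ∧ ∃ p, IsRepEigenvector e M l p}.Finite := by
  have := M.finiteDimensional
  obtain ⟨C, hC, hG⟩ := exists_garding μ e M he
  obtain ⟨N, hN⟩ := exists_card_le (S := S) μ e (2 * B + C)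
  by_contra hinf
  obtain ⟨t, ht, hcard⟩ := Set.Infinite.exists_subset_card_eq hinf (N + 1)
  have h1 : ∀ l : t, ∃ p, IsRepEigenvector e M l p ∧ ‖repL2 V G μ S p‖ = 1 := fun l => by
    obtain ⟨-, p, hp⟩ := ht l.2
    have h2 : repL2 V G μ S p ≠ 0 := fun h => hp.1 ((repL2_eq_zero μ).1 h)
    refine ⟨((‖repL2 V G μ S p‖⁻¹ : ℝ) : ℂ) • p, hp.smul ?_, ?_⟩
    · exact_mod_cast inv_ne_zero (norm_ne_zero_iff.2 h2)
    · rw [map_smul, norm_smul, Complex.norm_real, norm_inv, norm_norm,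
        inv_mul_cancel₀ (norm_ne_zero_iff.2 h2)]
  choose p hp hp1 using h1
  have ho : Orthonormal ℂ fun l => ContinuousMap.toLp 2 μ ℂ (repFun V G S (p l)) :=
    ⟨hp1, fun l l' hl => (hp l).inner_eq_zero μ (hp l') fun h => hl (Subtype.ext h)⟩
  have h3 := hN t (fun l => repFun V G S (p l)) (fun l => contMDiff_repFun _) ho fun l => by
    have h4 : sqInt μ (repFun V G S (p l)) = 1 := by
      have h5 := inner_self_eq_norm_sq_to_K (𝕜 := ℂ) (repL2 V G μ S (p l))
      rw [inner_repL2, integral_inner_self, hp1 l] at h5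
      norm_cast at h5
      simpa using h5
    have h6 := hG _ (contMDiff_repFun (p l))
    rw [(hp l).sqInt_eq μ, h4] at h6
    have := (ht l.2).1
    linarith
  rw [Fintype.card_coe, hcard] at h3
  omega

/-- Anticommuting the vanishing sum with c (e k) isolates 2 z k times the cyclic unit vector. -/
lemma SpinorModule.eq_zero_of_sum_smul_c
    (he : ∀ i j, g.form (e i) (e j) = if i = j then 1 else 0) (z : Fin q → ℂ)
    (h : ∀ s, ∑ j, z j • M.c (e j) s = 0) (k : Fin q) : z k = 0 := by
  have h1 : ∀ j, M.c (e k) (M.c (e j) (M.basis 0)) + M.c (e j) (M.c (e k) (M.basis 0)) =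
      if k = j then (2 : ℂ) • M.basis 0 else 0 := fun j => by
    have h2 := congrArg (fun A : S →L[ℂ] S => A (M.basis 0)) (M.c_mul_add (e k) (e j))
    have h3 : QuadraticMap.polar g.quadratic (e k) (e j) = _ :=
      LinearMap.BilinMap.polar_toQuadraticMap (e k) (e j)
    rw [h3, he, he] at h2
    by_cases hkj : k = j
    · subst hkj
      rw [if_pos rfl]
      refine h2.trans ?_
      norm_num
    · rw [if_neg hkj]
      refine h2.trans ?_
      simp [hkj, Ne.symm hkj]
  have h3 : ∑ j, z j • (M.c (e k) (M.c (e j) (M.basis 0)) + M.c (e j) (M.c (e k) (M.basis 0))) =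
      0 := by
    simp only [smul_add, Finset.sum_add_distrib, h, add_zero]
    have h4 := congrArg (M.c (e k)) (h (M.basis 0))
    simpa using h4
  simp only [h1, smul_ite, smul_zero, Finset.sum_ite_eq, Finset.mem_univ, if_true, smul_smul] at h3
  have h5 : M.basis 0 ≠ 0 := fun h0 => by
    have := M.basis.orthonormal.1 0
    rw [h0, norm_zero] at this
    exact zero_ne_one this
  simpa [h5] using h3

variable (e M) in
-- Otherwise D vanishes on the core. Independence of the Clifford vectors then makes all invariant
-- derivatives of representative functions zero, so these are constant on the connected group and
-- cannot separate two points.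
lemma exists_nonzero_eigenvalue (μ : Measure G) [IsProbabilityMeasure μ] [μ.IsHaarMeasure]
    [ConnectedSpace G] [Nontrivial G]
    (he : ∀ i j, g.form (e i) (e j) = if i = j then 1 else 0) :
    ∃ l ≠ 0, ∃ p, IsRepEigenvector e M l p := by
  by_contra! hcon
  have h1 : ∀ u : (repCore μ e M).K, (repCore μ e M).D () u = 0 := by
    refine (repCore μ e M).block_induction (map_zero _)
      (fun u v hu hv => by rw [map_add, hu, hv, add_zero]) fun χ u hu => ?_
    rcases eq_or_ne u 0 with rfl | h0
    · exact map_zero _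
    obtain ⟨h2, -, -, h3⟩ := (repCore μ e M).eigenvalue_real hu h0 ()
    by_contra h4
    obtain ⟨p, rfl⟩ := exists_repMap_eq μ e M u
    refine hcon (χ ()).re (fun h5 => h4 (h3 ?_)) p ((isRepEigenvector_iff μ e M).2 ⟨h0, ?_⟩)
    · rw [h2, h5, Complex.ofReal_zero]
    · rw [← h2]
      exact DiracCore.mem_block _ |>.1 hu ()
  obtain ⟨x, y, hxy⟩ := exists_pair_ne G
  obtain ⟨w, hw, hne⟩ := exists_repAlg_separates (V := V) μ hxy
  have hws := contMDiff_of_mem_repAlg hw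
  refine hne (eq_const_of_leftFDeriv_eq_zero hws (fun x => ?_) x y)
  have h2 : ∀ s, ∑ j, leftDeriv (e j) w x • M.c (e j) s = 0 := fun s => by
    have h3 := h1 (repMap μ e M (⟨w, hw⟩ ⊗ₜ s))
    rw [repCore_D, repMap_eq_zero, repDirac, tensorDirac_tmul, map_smul, map_sum] at h3
    have h4 := DFunLike.congr_fun h3 x
    rw [ContinuousMap.smul_apply, ContinuousMap.sum_apply] at h4
    exact (smul_eq_zero.1 h4).resolve_left (by simp)
  have h3 := SpinorModule.eq_zero_of_sum_smul_c he _ h2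
  have h4 : (leftFDeriv V w x).toLinearMap = 0 := (e.map algVec).ext fun k => by
    have h5 := h3 k
    rw [leftDeriv_eq hws] at h5
    simpa using h5
  ext v
  exact LinearMap.congr_fun h4 v

variable (e M) in
/-- The inverse of the smallest non-zero eigenvalue of the square of the basic Dirac operator. -/
lemma exists_isLeast_eigenvalue (μ : Measure G) [IsProbabilityMeasure μ] [μ.IsHaarMeasure]
    [ConnectedSpace G]
    (he : ∀ i j, g.form (e i) (e j) = if i = j then 1 else 0) :
    ∃ c : ℝ, 0 < c ∧ (Nontrivial G → IsLeast (nonzeroEigenvaluesSq e M μ) (1 / c)) ∧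
      ∀ l p, IsRepEigenvector e M l p → l = 0 ∨ 1 / c ≤ l := by
  by_cases hne : ∃ B ≠ 0, ∃ p, IsRepEigenvector e M B p
  · obtain ⟨B, hB⟩ := hne
    -- Only finitely many eigenvalues are at most the given non-zero eigenvalue B, so a least one
    -- exists among them; larger eigenvalues do not matter.
    obtain ⟨l, ⟨hl0, hl1, hl2⟩, hl3⟩ := Set.exists_min_image
      {l | l ≠ 0 ∧ l ≤ B ∧ ∃ p, IsRepEigenvector e M l p} id
      ((finite_eigenvalues_le e M μ he B).subset fun l hl => hl.2) ⟨B, hB.1, le_rfl, hB.2⟩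
    have hpos : 0 < l := lt_of_le_of_ne (hl2.choose_spec.nonneg μ) hl0.symm
    have hmin : ∀ l' p, IsRepEigenvector e M l' p → l' = 0 ∨ l ≤ l' := fun l' p hp => by
      by_cases h0 : l' = 0
      · exact Or.inl h0
      · rcases le_total l' B with h | h
        · exact Or.inr (hl3 l' ⟨h0, h, p, hp⟩)
        · exact Or.inr (hl1.trans h)
    refine ⟨1 / l, by positivity, fun _ => ?_, ?_⟩
    · rw [one_div_one_div]
      refine ⟨(mem_nonzeroEigenvaluesSq μ e M).2 ⟨hl0, hl2⟩, fun l' hl' => ?_⟩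
      obtain ⟨h0, p, hp⟩ := (mem_nonzeroEigenvaluesSq μ e M).1 hl'
      exact (hmin l' p hp).resolve_left h0
    · simpa only [one_div_one_div] using hmin
  -- Without non-zero eigenvalues the group is trivial and any positive constant will do.
  · refine ⟨1, one_pos, fun _ => absurd (exists_nonzero_eigenvalue e M μ he) hne,
      fun l p hp => Or.inl ?_⟩
    by_contra h0
    exact hne ⟨l, h0, p, hp⟩

end Gap

end AGN

end

noncomputable section

namespace AGN

set_option linter.unusedSectionVars false

section PiManifold

/-! ### Smooth functions of finitely many coordinates -/

variable {V : Type*} [NormedAddCommGroup V] [NormedSpace ℝ V]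
  {G : Type*} [TopologicalSpace G] [ChartedSpace V G] [IsManifold 𝓘(ℝ, V) ∞ G]
  {ι : Type*} [Fintype ι]
  {E' : Type*} [NormedAddCommGroup E'] [NormedSpace ℝ E'] {H' : Type*} [TopologicalSpace H']
  {I' : ModelWithCorners ℝ E' H'} {N : Type*} [TopologicalSpace N] [ChartedSpace H' N]

lemma contMDiffAt_piManifold {f : N → ι → G} {x : N}
    (h : ∀ i, ContMDiffAt I' 𝓘(ℝ, V) ∞ (fun y => f y i) x) :
    ContMDiffAt I' (ModelWithCorners.pi fun _ : ι => 𝓘(ℝ, V)) ∞ f x := by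
  rw [contMDiffAt_iff_target]
  refine ⟨continuousAt_pi.2 fun i => (h i).continuousAt, ?_⟩
  refine contMDiffAt_pi_space.2 fun i => ?_
  exact (contMDiffAt_iff_target.1 (h i)).2

lemma contMDiff_apply_piManifold (i : ι) :
    ContMDiff (ModelWithCorners.pi fun _ : ι => 𝓘(ℝ, V)) 𝓘(ℝ, V) ∞ fun x : ι → G => x i := by
  intro x
  rw [contMDiffAt_iff_source]
  have h1 : ContMDiffAt 𝓘(ℝ, V) 𝓘(ℝ, V) ∞ (extChartAt 𝓘(ℝ, V) (x i)).symm
      (extChartAt 𝓘(ℝ, V) (x i) (x i)) :=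
    (contMDiffOn_extChartAt_symm (n := ∞) (x i)).contMDiffAt (extChartAt_target_mem_nhds (x i))
  have h2 : ContMDiffAt 𝓘(ℝ, ι → V) 𝓘(ℝ, V) ∞ (fun v : ι → V => v i)
      (extChartAt (ModelWithCorners.pi fun _ : ι => 𝓘(ℝ, V)) x x) :=
    (contDiff_apply ℝ V i).contMDiff.contMDiffAt
  exact (ContMDiffAt.comp (extChartAt (ModelWithCorners.pi fun _ : ι => 𝓘(ℝ, V)) x x)
    (g := (extChartAt 𝓘(ℝ, V) (x i)).symm) h1 h2).contMDiffWithinAt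

instance isManifold_pi : IsManifold (ModelWithCorners.pi fun _ : ι => 𝓘(ℝ, V)) ∞ (ι → G) := by
  refine isManifold_of_contDiffOn _ _ _ ?_
  rintro _ _ ⟨e, he, rfl⟩ ⟨e', he', rfl⟩
  refine contDiffOn_pi.2 fun i => ?_
  have h1 := (contDiffGroupoid ∞ 𝓘(ℝ, V)).compatible (he i trivial) (he' i trivial)
  have h2 : ContDiffOn ℝ ∞ (e' i ∘ (e i).symm) ((e i).symm.trans (e' i)).source := by
    have := (mem_groupoid_of_pregroupoid.1 h1).1
    simpa [contDiffPregroupoid] using this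
  refine h2.comp (contDiff_apply ℝ V i).contDiffOn fun v hv => ?_
  have h3 := hv.1
  simp only [Set.mem_preimage, OpenPartialHomeomorph.trans_source, Set.mem_inter_iff] at h3 ⊢
  exact ⟨h3.1 i trivial, h3.2 i trivial⟩

end PiManifold

/-! ### Smooth cylinder functions and their derivatives in one coordinate. -/

section Cylinder

variable {V : Type*} [NormedAddCommGroup V] [NormedSpace ℝ V]
  {G : Type*} [Group G] [TopologicalSpace G] [ChartedSpace V G] [LieGroup 𝓘(ℝ, V) ∞ G]
  {𝒢 : GraphSystem}
  {E : Type*} [NormedAddCommGroup E] [InnerProductSpace ℂ E]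
  {E₁ : Type*} [NormedAddCommGroup E₁] [InnerProductSpace ℂ E₁]
  {E₂ : Type*} [NormedAddCommGroup E₂] [InnerProductSpace ℂ E₂]

lemma IsSmoothCylinder.comp₂ {f : (𝒢.Site → G) → E₁} {h : (𝒢.Site → G) → E₂}
    (hf : IsSmoothCylinder (V := V) 𝒢 f) (hh : IsSmoothCylinder (V := V) 𝒢 h) {Φ : E₁ × E₂ → E}
    (hΦ : ContDiff ℝ ∞ Φ) : IsSmoothCylinder (V := V) 𝒢 fun x => Φ (f x, h x) := by
  classical
  obtain ⟨s, f', hf', hfe⟩ := hf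
  obtain ⟨t, h', hh', hhe⟩ := hh
  have hr : ∀ {r : Finset 𝒢.Site} (hr : r ⊆ s ∪ t),
      ContMDiff (ModelWithCorners.pi fun _ : (s ∪ t : Finset 𝒢.Site) => 𝓘(ℝ, V))
        (ModelWithCorners.pi fun _ : r => 𝓘(ℝ, V)) ∞
        fun (x : (s ∪ t : Finset 𝒢.Site) → G) (i : r) => x ⟨i, hr i.2⟩ := fun hr x =>
    contMDiffAt_piManifold fun i => contMDiff_apply_piManifold _ x
  refine ⟨s ∪ t, fun x => Φ (f' fun i => x ⟨i, Finset.subset_union_left i.2⟩,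
    h' fun i => x ⟨i, Finset.subset_union_right i.2⟩), ?_, fun x => by simp only [hfe, hhe]⟩
  exact hΦ.contMDiff.comp ((hf'.comp (hr Finset.subset_union_left)).prodMk_space
    (hh'.comp (hr Finset.subset_union_right)))

lemma isSmoothCylinder_eval {f : G → E} (hf : ContMDiff 𝓘(ℝ, V) 𝓘(ℝ, E) ∞ f) (γ : 𝒢.Site) :
    IsSmoothCylinder (V := V) 𝒢 fun x => f (x γ) :=
  ⟨{γ}, fun x => f (x ⟨γ, Finset.mem_singleton_self γ⟩),
    hf.comp (contMDiff_apply_piManifold _), fun _ => rfl⟩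

lemma isSmoothCylinder_const (z : E) :
    IsSmoothCylinder (V := V) 𝒢 fun _ : 𝒢.Site → G => z :=
  ⟨∅, fun _ => z, contMDiff_const, fun _ => rfl⟩

lemma IsSmoothCylinder.continuous {f : (𝒢.Site → G) → E} (hf : IsSmoothCylinder (V := V) 𝒢 f) :
    Continuous f := by
  obtain ⟨s, f', hf', hfe⟩ := hf
  rw [funext hfe]
  exact hf'.continuous.comp (continuous_pi fun i => continuous_apply _)

lemma IsSmoothCylinder.contMDiff_update {f : (𝒢.Site → G) → E}
    (hf : IsSmoothCylinder (V := V) 𝒢 f) (x : 𝒢.Site → G) (γ : 𝒢.Site) :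
    ContMDiff 𝓘(ℝ, V) 𝓘(ℝ, E) ∞ fun y => f (Function.update x γ y) := by
  obtain ⟨s, f', hf', hfe⟩ := hf
  simp only [hfe]
  refine hf'.comp fun y => contMDiffAt_piManifold fun i => ?_
  by_cases h : (i : 𝒢.Site) = γ
  · subst h
    simp only [Function.update_self]
    exact contMDiffAt_id
  · simpa [h] using contMDiffAt_const

/-- The derivative depends on finitely many coordinates z and is the derivative in u of the jointly
smooth map that multiplies the coordinate γ of z, if present, by the chart point of u. -/
lemma IsSmoothCylinder.continuous_siteDeriv {f : (𝒢.Site → G) → E}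
    (hf : IsSmoothCylinder (V := V) 𝒢 f) (γ : 𝒢.Site) (v : GroupLieAlgebra 𝓘(ℝ, V) G) :
    Continuous (siteDeriv γ v f) := by
  classical
  have h0 := hf
  obtain ⟨s, f', hf', hfe⟩ := hf
  let p : (s → G) → V → s → G := fun z u i => if (i : 𝒢.Site) = γ then z i * expChart V G u else z i
  have hp : ∀ z, ContMDiffAt ((ModelWithCorners.pi fun _ : s => 𝓘(ℝ, V)).prod 𝓘(ℝ, V))
      (ModelWithCorners.pi fun _ : s => 𝓘(ℝ, V)) ∞ (Function.uncurry p) (z, expBase V G) := by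
    refine fun z => contMDiffAt_piManifold fun i => ?_
    have h1 : ContMDiffAt ((ModelWithCorners.pi fun _ : s => 𝓘(ℝ, V)).prod 𝓘(ℝ, V)) 𝓘(ℝ, V) ∞
        (fun y : (s → G) × V => y.1 i) (z, expBase V G) :=
      ContMDiffAt.comp (z, expBase V G) (g := fun z : s → G => z i)
        (contMDiff_apply_piManifold i z) contMDiffAt_fst
    by_cases h : (i : 𝒢.Site) = γ
    · simp only [Function.uncurry, p, h, if_true]
      exact h1.mul (ContMDiffAt.comp (z, expBase V G) (g := expChart V G)
        (contMDiffAt_expChart expBase_mem) contMDiffAt_snd)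
    · simpa [Function.uncurry, p, h] using h1
  have h1 : ∀ x, siteDeriv γ v f x =
      fderiv ℝ (fun u => f' (p (fun i => x i) u)) (expBase V G) (algVec v) := by
    intro x
    rw [siteDeriv, leftDeriv_eq (h0.contMDiff_update x γ), leftFDeriv]
    congr 2
    funext u
    rw [hfe]
    congr 1
    funext i
    by_cases h : (i : 𝒢.Site) = γ
    · simp [p, h]
    · simp [p, h]
  have h2 : Continuous fun z : s → G => fderiv ℝ (fun u => f' (p z u)) (expBase V G) := by
    refine continuous_iff_continuousAt.2 fun z => ?_
    have h := ContMDiffAt.mfderiv (I := 𝓘(ℝ, V)) (I' := 𝓘(ℝ, E))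
      (J := ModelWithCorners.pi fun _ : s => 𝓘(ℝ, V)) (m := 0) (n := ∞)
      (fun z u => f' (p z u)) (fun _ => expBase V G) (x₀ := z)
      (ContMDiffAt.comp _ (hf' _) (hp z)) contMDiffAt_const (by simp)
    have e := inTangentCoordinates_model_space (I := 𝓘(ℝ, V)) (I' := 𝓘(ℝ, E))
      (fun _ : s → G => expBase V G) (fun z => f' (p z (expBase V G)))
      (fun z => mfderiv 𝓘(ℝ, V) 𝓘(ℝ, E) (fun u => f' (p z u)) (expBase V G)) z
    have h' := (congrArg (fun k => ContMDiffAt (ModelWithCorners.pi fun _ : s => 𝓘(ℝ, V))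
      𝓘(ℝ, V →L[ℝ] E) 0 k z) e).mp h
    simp only [mfderiv_eq_fderiv] at h'
    exact h'.continuousAt
  have h3 : Continuous fun x : 𝒢.Site → G => fun i : s => x i :=
    continuous_pi fun i => continuous_apply _
  rw [funext h1]
  exact (h2.comp h3).clm_apply continuous_const

lemma IsSmoothCylinder.exists_siteDeriv_eq_zero {f : (𝒢.Site → G) → E}
    (hf : IsSmoothCylinder (V := V) 𝒢 f) : ∃ s : Finset 𝒢.Site, ∀ γ ∉ s,
      ∀ v : GroupLieAlgebra 𝓘(ℝ, V) G, siteDeriv γ v f = 0 := by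
  obtain ⟨s, f', hf', hfe⟩ := hf
  refine ⟨s, fun γ hγ v => ?_⟩
  funext x
  have h : (fun y => f (Function.update x γ y)) = fun _ => f x := by
    funext y
    rw [hfe, hfe]
    congr 1
    funext i
    rw [Function.update_of_ne]
    rintro rfl
    exact hγ i.2
  rw [siteDeriv, h, leftDeriv_const]
  rfl

lemma IsSmoothCylinder.inner {f h : (𝒢.Site → G) → E} (hf : IsSmoothCylinder (V := V) 𝒢 f)
    (hh : IsSmoothCylinder (V := V) 𝒢 h) :
    IsSmoothCylinder (V := V) 𝒢 fun x => ⟪f x, h x⟫_ℂ :=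
  hf.comp₂ hh (contDiff_inner (𝕜 := ℂ))

end Cylinder

section ProductMeasure

variable {ι : Type*} {T : Type*} [MeasurableSpace T] (μ : Measure T) [IsProbabilityMeasure μ]

/-! ### The product measure -/

/-- Coordinates are independent, so resampling one of them does not change the product measure. This
allows integration over a single coordinate first. -/
lemma measurePreserving_update [DecidableEq ι] (i : ι) :
    MeasurePreserving (fun p : (ι → T) × T => Function.update p.1 i p.2)
      ((Measure.infinitePi fun _ : ι => μ).prod μ) (Measure.infinitePi fun _ : ι => μ) := by
  have hm : Measurable fun p : (ι → T) × T => Function.update p.1 i p.2 := by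
    refine measurable_pi_lambda _ fun j => ?_
    by_cases h : j = i
    · subst h
      simpa using measurable_snd
    · simp only [Function.update_of_ne h]
      exact (measurable_pi_apply j).comp measurable_fst
  refine ⟨hm, Measure.eq_infinitePi _ fun s t ht => ?_⟩
  rw [Measure.map_apply hm (MeasurableSet.pi s.countable_toSet fun j _ => ht j)]
  by_cases hi : i ∈ s
  · have h : (fun p : (ι → T) × T => Function.update p.1 i p.2) ⁻¹' Set.pi s t =
        Set.pi (s.erase i) t ×ˢ t i := by
      ext p
      simp only [Set.mem_preimage, Set.mem_pi, Set.mem_prod, Finset.mem_coe, Finset.mem_erase]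
      constructor
      · intro h
        exact ⟨fun j hj => by simpa [hj.1] using h j hj.2, by simpa using h i hi⟩
      · rintro ⟨h1, h2⟩ j hj
        by_cases hji : j = i
        · subst hji
          simpa using h2
        · simpa [hji] using h1 j ⟨hji, hj⟩
    rw [h, Measure.prod_prod, Measure.infinitePi_pi _ fun j _ => ht j, mul_comm,
      Finset.mul_prod_erase s (fun j => μ (t j)) hi]
  · have h : (fun p : (ι → T) × T => Function.update p.1 i p.2) ⁻¹' Set.pi s t =
        Set.pi s t ×ˢ Set.univ := by
      ext p
      simp only [Set.mem_preimage, Set.mem_pi, Set.mem_prod, Finset.mem_coe, Set.mem_univ, and_true]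
      refine forall₂_congr fun j hj => ?_
      rw [Function.update_of_ne (ne_of_mem_of_not_mem hj hi)]
    rw [h, Measure.prod_prod, Measure.infinitePi_pi _ fun j _ => ht j, measure_univ, mul_one]

instance isOpenPosMeasure_infinitePi [TopologicalSpace T] [OpensMeasurableSpace T]
    [μ.IsOpenPosMeasure] : (Measure.infinitePi fun _ : ι => μ).IsOpenPosMeasure := by
  refine ⟨fun U hU ⟨x, hx⟩ h0 => ?_⟩
  obtain ⟨s, u, hu, hsub⟩ := isOpen_pi_iff.1 hU x hx
  have h1 := measure_mono_null hsub h0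
  rw [Measure.infinitePi_pi _ fun j hj => (hu j hj).1.measurableSet, Finset.prod_eq_zero_iff] at h1
  obtain ⟨j, hj, h2⟩ := h1
  exact ((hu j hj).1.measure_pos μ ⟨_, (hu j hj).2⟩).ne' h2

end ProductMeasure

/-! ### Integration by parts on the space of connections. -/

section IntegrateByParts

variable {V : Type*} [NormedAddCommGroup V] [NormedSpace ℝ V] [FiniteDimensional ℝ V]
  {G : Type*} [Group G] [TopologicalSpace G] [ChartedSpace V G] [LieGroup 𝓘(ℝ, V) ∞ G]
  [IsTopologicalGroup G] [CompactSpace G] [SecondCountableTopology G]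
  [MeasurableSpace G] [BorelSpace G] (μ : Measure G) [IsProbabilityMeasure μ] [μ.IsHaarMeasure]
  {𝒢 : GraphSystem}
  {E : Type*} [NormedAddCommGroup E] [InnerProductSpace ℂ E]

lemma siteDeriv_inner {f h : (𝒢.Site → G) → E} (hf : IsSmoothCylinder (V := V) 𝒢 f)
    (hh : IsSmoothCylinder (V := V) 𝒢 h) (γ : 𝒢.Site) (v : GroupLieAlgebra 𝓘(ℝ, V) G)
    (x : 𝒢.Site → G) : siteDeriv γ v (fun x => ⟪f x, h x⟫_ℂ) x =
      ⟪f x, siteDeriv γ v h x⟫_ℂ + ⟪siteDeriv γ v f x, h x⟫_ℂ := by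
  have h1 := leftDeriv_inner (hf.contMDiff_update x γ) (hh.contMDiff_update x γ) v (x γ)
  simp only [Function.update_eq_self] at h1
  exact h1

lemma integrable_conn {f : (𝒢.Site → G) → E} (hf : Continuous f) :
    Integrable f (Measure.infinitePi fun _ : 𝒢.Site => μ) := by
  obtain ⟨B, hB⟩ := isCompact_univ.exists_bound_of_continuousOn hf.continuousOn
  exact Integrable.of_bound hf.aestronglyMeasurable B (Eventually.of_forall fun x => hB x trivial)

/-- After resampling the coordinate γ, the inner integral is that of an invariant derivative on G,
which vanishes. -/
lemma integral_siteDeriv {f : (𝒢.Site → G) → ℂ} (hf : IsSmoothCylinder (V := V) 𝒢 f)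
    (γ : 𝒢.Site) (v : GroupLieAlgebra 𝓘(ℝ, V) G) :
    ∫ x, siteDeriv γ v f x ∂Measure.infinitePi (fun _ : 𝒢.Site => μ) = 0 := by
  have hp := measurePreserving_update μ γ
  have hc := hf.continuous_siteDeriv γ v
  have hi := integrable_conn μ hc
  rw [← hp.map_eq, integral_map hp.measurable.aemeasurable
    (by rw [hp.map_eq]; exact hi.aestronglyMeasurable), integral_prod
    (fun p : (𝒢.Site → G) × G => siteDeriv γ v f (Function.update p.1 γ p.2))
    ((hp.integrable_comp hi.aestronglyMeasurable).2 hi)]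
  have h1 : ∀ x, ∫ y, siteDeriv γ v f (Function.update x γ y) ∂μ = 0 := fun x => by
    rw [← integral_leftDeriv μ (hf.contMDiff_update x γ) v]
    refine integral_congr_ae (Eventually.of_forall fun y => ?_)
    simp [siteDeriv]
  simp only [h1, integral_zero]

lemma integral_inner_siteDeriv {f h : (𝒢.Site → G) → E} (hf : IsSmoothCylinder (V := V) 𝒢 f)
    (hh : IsSmoothCylinder (V := V) 𝒢 h) (γ : 𝒢.Site) (v : GroupLieAlgebra 𝓘(ℝ, V) G) :
    ∫ x, ⟪siteDeriv γ v f x, h x⟫_ℂ ∂Measure.infinitePi (fun _ : 𝒢.Site => μ) =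
      -∫ x, ⟪f x, siteDeriv γ v h x⟫_ℂ ∂Measure.infinitePi (fun _ : 𝒢.Site => μ) := by
  have h1 := integral_siteDeriv μ (hf.inner hh) γ v
  simp only [siteDeriv_inner hf hh] at h1
  rw [integral_add (integrable_conn μ (hf.continuous.inner (hh.continuous_siteDeriv γ v)))
    (integrable_conn μ ((hf.continuous_siteDeriv γ v).inner hh.continuous))] at h1
  rw [eq_neg_iff_add_eq_zero, add_comm]
  exact h1

end IntegrateByParts

end AGN

end

noncomputable section

namespace AGN

set_option linter.unusedSectionVars false

section CylinderAlgebra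

variable {V : Type*} [NormedAddCommGroup V] [NormedSpace ℝ V]
  {G : Type*} [Group G] [TopologicalSpace G] [ChartedSpace V G] [LieGroup 𝓘(ℝ, V) ∞ G]
  {𝒢 : GraphSystem}

/-! ### The algebra of representative functions on the space of connections -/

variable (V G 𝒢) in
/-- The functions of the value of the connection at one generator that are in `repAlg`. -/
def cylGenerators : Set ((𝒢.Site → G) → ℂ) :=
  {w | ∃ (γ : 𝒢.Site) (f : repAlg V G), w = fun x => (f : G → ℂ) (x γ)}

variable (V G 𝒢) in
/-- The algebra of representative functions on the space of connections. -/
def cylAlg : Subalgebra ℂ ((𝒢.Site → G) → ℂ) := Algebra.adjoin ℂ (cylGenerators V G 𝒢)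

variable (V G) in
/-- Evaluation at a generator, as a map to `cylAlg`. -/
def evalAlg (γ : 𝒢.Site) : repAlg V G →ₐ[ℂ] cylAlg V G 𝒢 where
  toFun f := ⟨fun x => (f : G → ℂ) (x γ), Algebra.subset_adjoin ⟨γ, f, rfl⟩⟩
  map_one' := rfl
  map_mul' _ _ := rfl
  map_zero' := rfl
  map_add' _ _ := rfl
  commutes' _ := rfl

lemma evalAlg_apply (γ : 𝒢.Site) (f : repAlg V G) (x : 𝒢.Site → G) :
    (evalAlg V G γ f : (𝒢.Site → G) → ℂ) x = (f : G → ℂ) (x γ) := rfl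

lemma cylAlg_induction {p : cylAlg V G 𝒢 → Prop} (h0 : ∀ γ f, p (evalAlg V G γ f))
    (h1 : ∀ z, p (algebraMap ℂ _ z)) (hadd : ∀ a b, p a → p b → p (a + b))
    (hmul : ∀ a b, p a → p b → p (a * b)) (w : cylAlg V G 𝒢) : p w := by
  obtain ⟨w, hw⟩ := w
  refine Algebra.adjoin_induction (p := fun w hw => p ⟨w, hw⟩) ?_ (fun z => h1 z)
    (fun a b ha hb => hadd ⟨a, ha⟩ ⟨b, hb⟩) (fun a b ha hb => hmul ⟨a, ha⟩ ⟨b, hb⟩) hw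
  rintro _ ⟨γ, f, rfl⟩
  exact h0 γ f

lemma isSmoothCylinder_of_mem_cylAlg (w : cylAlg V G 𝒢) :
    IsSmoothCylinder (V := V) 𝒢 (w : (𝒢.Site → G) → ℂ) := by
  refine cylAlg_induction (p := fun w => IsSmoothCylinder (V := V) 𝒢 (w : (𝒢.Site → G) → ℂ))
    (fun γ f => isSmoothCylinder_eval (contMDiff_of_mem_repAlg f.2) γ)
    (fun z => isSmoothCylinder_const z)
    (fun a b ha hb => ha.comp₂ hb contDiff_add) (fun a b ha hb => ha.comp₂ hb contDiff_mul) w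

lemma update_mem_repAlg (w : cylAlg V G 𝒢) (γ : 𝒢.Site) (x : 𝒢.Site → G) :
    (fun y => (w : (𝒢.Site → G) → ℂ) (Function.update x γ y)) ∈ repAlg V G := by
  refine cylAlg_induction (p := fun w =>
    (fun y => (w : (𝒢.Site → G) → ℂ) (Function.update x γ y)) ∈ repAlg V G)
    (fun γ' f => ?_) (fun z => (repAlg V G).algebraMap_mem z)
    (fun a b ha hb => add_mem ha hb) (fun a b ha hb => mul_mem ha hb) w
  by_cases h : γ' = γ
  · subst h
    simp [evalAlg_apply]
  · simp only [evalAlg_apply, Function.update_of_ne h]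
    exact (repAlg V G).algebraMap_mem _

variable (V) in
/-- Restriction to the connections that agree with `x` except at `γ`. -/
def updateAlg (γ : 𝒢.Site) (x : 𝒢.Site → G) : cylAlg V G 𝒢 →ₐ[ℂ] repAlg V G where
  toFun w := ⟨fun y => (w : (𝒢.Site → G) → ℂ) (Function.update x γ y), update_mem_repAlg w γ x⟩
  map_one' := rfl
  map_mul' _ _ := rfl
  map_zero' := rfl
  map_add' _ _ := rfl
  commutes' _ := rfl

lemma updateAlg_apply (γ : 𝒢.Site) (x : 𝒢.Site → G) (w : cylAlg V G 𝒢) (y : G) :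
    (updateAlg V γ x w : G → ℂ) y = (w : (𝒢.Site → G) → ℂ) (Function.update x γ y) := rfl

lemma siteDeriv_cylAlg (γ : 𝒢.Site) (v : GroupLieAlgebra 𝓘(ℝ, V) G) (w : cylAlg V G 𝒢)
    (x : 𝒢.Site → G) :
    siteDeriv γ v (w : (𝒢.Site → G) → ℂ) x = leftDeriv v (updateAlg V γ x w : G → ℂ) (x γ) := rfl

lemma siteDeriv_add (γ : 𝒢.Site) (v : GroupLieAlgebra 𝓘(ℝ, V) G) (a b : cylAlg V G 𝒢) :
    siteDeriv γ v ((a + b : cylAlg V G 𝒢) : (𝒢.Site → G) → ℂ) =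
      siteDeriv γ v (a : (𝒢.Site → G) → ℂ) + siteDeriv γ v (b : (𝒢.Site → G) → ℂ) := by
  funext x
  exact congrFun (leftDeriv_add (contMDiff_of_mem_repAlg (updateAlg V γ x a).2)
    (contMDiff_of_mem_repAlg (updateAlg V γ x b).2) v) (x γ)

lemma siteDeriv_mul (γ : 𝒢.Site) (v : GroupLieAlgebra 𝓘(ℝ, V) G) (a b : cylAlg V G 𝒢) :
    siteDeriv γ v ((a * b : cylAlg V G 𝒢) : (𝒢.Site → G) → ℂ) =
      a * siteDeriv γ v (b : (𝒢.Site → G) → ℂ) + b * siteDeriv γ v (a : (𝒢.Site → G) → ℂ) := by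
  funext x
  refine (congrFun (leftDeriv_mul (contMDiff_of_mem_repAlg (updateAlg V γ x a).2)
    (contMDiff_of_mem_repAlg (updateAlg V γ x b).2) v) (x γ)).trans ?_
  simp [updateAlg_apply, siteDeriv_cylAlg]

lemma siteDeriv_algebraMap (γ : 𝒢.Site) (v : GroupLieAlgebra 𝓘(ℝ, V) G) (z : ℂ) :
    siteDeriv γ v ((algebraMap ℂ (cylAlg V G 𝒢) z : cylAlg V G 𝒢) : (𝒢.Site → G) → ℂ) = 0 := by
  funext x
  exact congrFun (leftDeriv_const (V := V) (G := G) z v) (x γ)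

lemma siteDeriv_evalAlg (γ γ' : 𝒢.Site) (v : GroupLieAlgebra 𝓘(ℝ, V) G) (f : repAlg V G) :
    siteDeriv γ v (evalAlg V G γ' f : (𝒢.Site → G) → ℂ) =
      if γ' = γ then (evalAlg V G γ' (repDeriv v f) : (𝒢.Site → G) → ℂ) else 0 := by
  funext x
  split_ifs with h
  · subst h
    rw [siteDeriv, evalAlg_apply, repDeriv_apply]
    congr 1
    funext y
    simp [evalAlg_apply]
  · rw [siteDeriv]
    simp only [evalAlg_apply, Function.update_of_ne h]
    exact congrFun (leftDeriv_const (V := V) (G := G) _ v) (x γ)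

lemma siteDeriv_mem_cylAlg (γ : 𝒢.Site) (v : GroupLieAlgebra 𝓘(ℝ, V) G) (w : cylAlg V G 𝒢) :
    siteDeriv γ v (w : (𝒢.Site → G) → ℂ) ∈ cylAlg V G 𝒢 := by
  refine cylAlg_induction (p := fun w : cylAlg V G 𝒢 =>
    siteDeriv γ v (w : (𝒢.Site → G) → ℂ) ∈ cylAlg V G 𝒢) (fun γ' f => ?_) (fun z => ?_)
    (fun a b ha hb => ?_) (fun a b ha hb => ?_) w
  · rw [siteDeriv_evalAlg]
    split_ifs
    · exact (evalAlg V G γ' (repDeriv v f)).2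
    · exact zero_mem _
  · rw [siteDeriv_algebraMap]
    exact zero_mem _
  · rw [siteDeriv_add]
    exact add_mem ha hb
  · rw [siteDeriv_mul]
    exact add_mem (mul_mem a.2 hb) (mul_mem b.2 ha)

/-- Left-invariant derivatives in the copy of `G` at `γ`, as operators on `cylAlg`. -/
def cylDeriv (γ : 𝒢.Site) (v : GroupLieAlgebra 𝓘(ℝ, V) G) :
    Derivation ℂ (cylAlg V G 𝒢) (cylAlg V G 𝒢) :=
  Derivation.mk'
    { toFun := fun w => ⟨siteDeriv γ v w, siteDeriv_mem_cylAlg γ v w⟩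
      map_add' := fun a b => Subtype.ext (siteDeriv_add γ v a b)
      map_smul' := fun z a => Subtype.ext (by
        rw [Algebra.smul_def]
        refine (siteDeriv_mul γ v (algebraMap ℂ _ z) a).trans ?_
        rw [siteDeriv_algebraMap]
        funext x
        simp) }
    fun a b => Subtype.ext (siteDeriv_mul γ v a b)

lemma coe_cylDeriv (γ : 𝒢.Site) (v : GroupLieAlgebra 𝓘(ℝ, V) G) (w : cylAlg V G 𝒢) :
    (cylDeriv γ v w : (𝒢.Site → G) → ℂ) = siteDeriv γ v (w : (𝒢.Site → G) → ℂ) := rfl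

lemma cylDeriv_evalAlg (γ γ' : 𝒢.Site) (v : GroupLieAlgebra 𝓘(ℝ, V) G) (f : repAlg V G) :
    cylDeriv γ v (evalAlg V G γ' f) = if γ' = γ then evalAlg V G γ' (repDeriv v f) else 0 := by
  apply Subtype.ext
  rw [coe_cylDeriv, siteDeriv_evalAlg]
  split_ifs <;> rfl

/-- The commutator of two derivations is a derivation, so it suffices that it kills the generators,
each of which depends on one coordinate only. -/
lemma cylDeriv_comm {γ γ' : 𝒢.Site} (hγ : γ ≠ γ') (v v' : GroupLieAlgebra 𝓘(ℝ, V) G)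
    (w : cylAlg V G 𝒢) : cylDeriv γ v (cylDeriv γ' v' w) = cylDeriv γ' v' (cylDeriv γ v w) := by
  rw [← sub_eq_zero, ← Derivation.commutator_apply]
  refine cylAlg_induction (p := fun w => ⁅cylDeriv γ v, cylDeriv γ' v'⁆ w = 0) (fun γ'' f => ?_)
    (fun z => Derivation.map_algebraMap _ z) (fun a b ha hb => by rw [map_add, ha, hb, add_zero])
    (fun a b ha hb => by rw [Derivation.leibniz, ha, hb, smul_zero, smul_zero, add_zero]) w
  rw [Derivation.commutator_apply, cylDeriv_evalAlg, cylDeriv_evalAlg]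
  by_cases h : γ'' = γ
  · subst h
    simp [hγ, cylDeriv_evalAlg]
  · by_cases h' : γ'' = γ'
    · subst h'
      simp [h, cylDeriv_evalAlg]
    · simp [h, h']

lemma updateAlg_cylDeriv (γ : 𝒢.Site) (x : 𝒢.Site → G) (v : GroupLieAlgebra 𝓘(ℝ, V) G)
    (w : cylAlg V G 𝒢) : updateAlg V γ x (cylDeriv γ v w) = repDeriv v (updateAlg V γ x w) := by
  apply Subtype.ext
  funext y
  rw [updateAlg_apply, coe_cylDeriv, siteDeriv_cylAlg, repDeriv_apply]
  congr 1
  · funext z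
    simp [updateAlg_apply]
  · simp

/-- Induction on the algebra: sums of stable spaces serve for sums and, by the Leibniz rule,
products of stable spaces for products. The sets of active generators are united. -/
lemma exists_cylDeriv_stable (w : cylAlg V G 𝒢) : ∃ U : Submodule ℂ (cylAlg V G 𝒢), w ∈ U ∧ U.FG ∧
    (∀ (γ : 𝒢.Site) (v : GroupLieAlgebra 𝓘(ℝ, V) G), ∀ w ∈ U, cylDeriv γ v w ∈ U) ∧
    {γ | ∃ v : GroupLieAlgebra 𝓘(ℝ, V) G, ∃ w ∈ U, cylDeriv γ v w ≠ 0}.Finite := by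
  refine cylAlg_induction (p := fun w => ∃ U : Submodule ℂ (cylAlg V G 𝒢), w ∈ U ∧ U.FG ∧
    (∀ (γ : 𝒢.Site) (v : GroupLieAlgebra 𝓘(ℝ, V) G), ∀ w ∈ U, cylDeriv γ v w ∈ U) ∧
    {γ | ∃ v : GroupLieAlgebra 𝓘(ℝ, V) G, ∃ w ∈ U, cylDeriv γ v w ≠ 0}.Finite) ?_ ?_ ?_ ?_ w
  · intro γ f
    obtain ⟨U, h1, h2, h3⟩ := exists_repDeriv_stable f
    refine ⟨U.map (evalAlg V G γ).toLinearMap, ⟨f, h1, rfl⟩, h2.map _, ?_, ?_⟩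
    · rintro γ' v _ ⟨u, hu, rfl⟩
      change cylDeriv γ' v (evalAlg V G γ u) ∈ _
      rw [cylDeriv_evalAlg]
      split_ifs
      · exact ⟨_, h3 v u hu, rfl⟩
      · exact zero_mem _
    · refine (Set.finite_singleton γ).subset ?_
      rintro γ' ⟨v, _, ⟨u, hu, rfl⟩, h⟩
      by_contra h'
      refine h ?_
      change cylDeriv γ' v (evalAlg V G γ u) = 0
      rw [cylDeriv_evalAlg, if_neg fun h'' => h' h''.symm]
  · intro z
    have h : ∀ (γ : 𝒢.Site) (v : GroupLieAlgebra 𝓘(ℝ, V) G),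
        ∀ w ∈ Submodule.span ℂ {(1 : cylAlg V G 𝒢)}, cylDeriv γ v w = 0 := by
      intro γ v w hw
      obtain ⟨z, rfl⟩ := Submodule.mem_span_singleton.1 hw
      simp
    refine ⟨Submodule.span ℂ {1}, Submodule.mem_span_singleton.2 ⟨z, (Algebra.algebraMap_eq_smul_one z).symm⟩,
      Submodule.fg_span_singleton _, fun γ v w hw => by rw [h γ v w hw]; exact zero_mem _, ?_⟩
    refine Set.finite_empty.subset ?_
    rintro γ ⟨v, w, hw, h'⟩
    exact h' (h γ v w hw)
  · rintro a b ⟨U, ha, hU, h1, h2⟩ ⟨U', hb, hU', h1', h2'⟩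
    refine ⟨U ⊔ U', Submodule.add_mem_sup ha hb, hU.sup hU', fun γ v w hw => ?_,
      (h2.union h2').subset ?_⟩
    · obtain ⟨u, hu, u', hu', rfl⟩ := Submodule.mem_sup.1 hw
      rw [map_add]
      exact Submodule.add_mem_sup (h1 γ v u hu) (h1' γ v u' hu')
    · rintro γ ⟨v, w, hw, h⟩
      obtain ⟨u, hu, u', hu', rfl⟩ := Submodule.mem_sup.1 hw
      by_contra hcon
      rw [Set.mem_union, not_or] at hcon
      have e1 : cylDeriv γ v u = 0 := by_contra fun h' => hcon.1 ⟨v, u, hu, h'⟩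
      have e2 : cylDeriv γ v u' = 0 := by_contra fun h' => hcon.2 ⟨v, u', hu', h'⟩
      exact h (by rw [map_add, e1, e2, add_zero])
  · rintro a b ⟨U, ha, hU, h1, h2⟩ ⟨U', hb, hU', h1', h2'⟩
    refine ⟨U * U', Submodule.mul_mem_mul ha hb, hU.mul hU', fun γ v w hw => ?_,
      (h2.union h2').subset ?_⟩
    · refine Submodule.mul_induction_on hw (fun u hu u' hu' => ?_) fun a b ha hb => ?_
      · rw [Derivation.leibniz, smul_eq_mul, smul_eq_mul, mul_comm u']
        exact add_mem (Submodule.mul_mem_mul hu (h1' γ v u' hu'))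
          (Submodule.mul_mem_mul (h1 γ v u hu) hu')
      · rw [map_add]
        exact add_mem ha hb
    · rintro γ ⟨v, w, hw, h⟩
      by_contra hcon
      rw [Set.mem_union, not_or] at hcon
      refine h (Submodule.mul_induction_on hw (fun u hu u' hu' => ?_) fun a b ha hb => by
        rw [map_add, ha, hb, add_zero])
      have e1 : cylDeriv γ v u = 0 := by_contra fun h' => hcon.1 ⟨v, u, hu, h'⟩
      have e2 : cylDeriv γ v u' = 0 := by_contra fun h' => hcon.2 ⟨v, u', hu', h'⟩
      rw [Derivation.leibniz, e1, e2, smul_zero, smul_zero, add_zero]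

lemma star_mem_cylAlg {w : (𝒢.Site → G) → ℂ} (hw : w ∈ cylAlg V G 𝒢) : star w ∈ cylAlg V G 𝒢 := by
  refine cylAlg_induction (p := fun w : cylAlg V G 𝒢 => star (w : (𝒢.Site → G) → ℂ) ∈ cylAlg V G 𝒢)
    (fun γ f => (evalAlg V G γ ⟨_, star_mem_repAlg f.2⟩).2)
    (fun z => (cylAlg V G 𝒢).algebraMap_mem (star z))
    (fun a b ha hb => ?_) (fun a b ha hb => ?_) ⟨w, hw⟩
  · exact (star_add (a : (𝒢.Site → G) → ℂ) b).symm ▸ add_mem ha hb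
  · exact (star_mul (a : (𝒢.Site → G) → ℂ) b).symm ▸ mul_mem hb ha

lemma continuous_of_mem_cylAlg (w : (𝒢.Site → G) → ℂ) (hw : w ∈ cylAlg V G 𝒢) : Continuous w :=
  (isSmoothCylinder_of_mem_cylAlg ⟨w, hw⟩).continuous

end CylinderAlgebra

end AGN

end

noncomputable section

namespace AGN

set_option linter.unusedSectionVars false

section FinLp

variable {κ : Type*} {F : Type*} [NormedAddCommGroup F] [InnerProductSpace ℂ F]

/-! ### Finitely supported families in the Hilbert sum -/

variable (κ F) in
/-- Finitely supported families, as square summable families. -/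
def finLp : (κ →₀ F) →ₗ[ℂ] lp (fun _ : κ => F) 2 where
  toFun y := ⟨fun σ => y σ, (memℓp_zero y.hasFiniteSupport).of_exponent_ge zero_le⟩
  map_add' _ _ := rfl
  map_smul' _ _ := rfl

@[simp] lemma finLp_apply (y : κ →₀ F) (σ : κ) : finLp κ F y σ = y σ := rfl

lemma finLp_single [DecidableEq κ] (σ : κ) (ξ : F) :
    finLp κ F (Finsupp.single σ ξ) = lp.single 2 σ ξ := by
  ext τ
  rw [finLp_apply, lp.single_apply, Finsupp.single_apply, Pi.single_apply]
  simp only [eq_comm]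

lemma inner_finLp_single (σ : κ) (ξ : F) (Ψ : lp (fun _ : κ => F) 2) :
    ⟪finLp κ F (Finsupp.single σ ξ), Ψ⟫_ℂ = ⟪ξ, Ψ σ⟫_ℂ := by
  classical
  rw [finLp_single, lp.inner_single_left]

lemma denseRange_finLp : DenseRange (finLp κ F) := by
  classical
  intro Ψ
  have h := lp.hasSum_single (p := 2) (by norm_num) Ψ
  refine mem_closure_of_tendsto h (Eventually.of_forall fun s => ?_)
  refine ⟨∑ σ ∈ s, Finsupp.single σ (Ψ σ), ?_⟩
  rw [map_sum]
  simp only [finLp_single]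

end FinLp

section Clifford

variable {V : Type*} [NormedAddCommGroup V] [NormedSpace ℝ V]
  {G : Type*} [Group G] [TopologicalSpace G] [ChartedSpace V G]
  {S : Type*} [NormedAddCommGroup S] [InnerProductSpace ℂ S] [CompleteSpace S]
  {g : InvariantMetric V G} (M : SpinorModule g.quadratic S)
  {𝒢 : GraphSystem} {F : Type*} [NormedAddCommGroup F] [InnerProductSpace ℂ F]

/-! ### The Clifford algebra of all generators on finite families -/

variable (F) in
/-- The action of an operator on `S` on the tensor factor at `γ`. -/
def siteOp (γ : 𝒢.Site) (T : S →L[ℂ] S) : Module.End ℂ (Conf M 𝒢 →₀ F) :=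
  Finsupp.lsum ℂ fun σ => ∑ k, ⟪M.basis k, T (M.basis (σ γ))⟫_ℂ • Finsupp.lsingle (σ.update γ k)

variable {M}

lemma siteOp_single (γ : 𝒢.Site) (T : S →L[ℂ] S) (σ : Conf M 𝒢) (ξ : F) :
    siteOp M F γ T (Finsupp.single σ ξ) =
      ∑ k, ⟪M.basis k, T (M.basis (σ γ))⟫_ℂ • Finsupp.single (σ.update γ k) ξ := by
  rw [siteOp, Finsupp.lsum_single, LinearMap.sum_apply]
  rfl

lemma end_ext {A B : Module.End ℂ (Conf M 𝒢 →₀ F)}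
    (h : ∀ σ ξ, A (Finsupp.single σ ξ) = B (Finsupp.single σ ξ)) : A = B :=
  Finsupp.lhom_ext h

lemma siteOp_mul (γ : 𝒢.Site) (T T' : S →L[ℂ] S) :
    siteOp M F γ T * siteOp M F γ T' = siteOp M F γ (T * T') := by
  classical
  refine end_ext fun σ ξ => ?_
  rw [Module.End.mul_apply, siteOp_single, siteOp_single, map_sum]
  simp only [map_smul, siteOp_single, Finsupp.coe_update, Function.update_self, Finsupp.update_idem,
    Finset.smul_sum, smul_smul]
  rw [Finset.sum_comm]
  refine Finset.sum_congr rfl fun l _ => ?_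
  rw [← Finset.sum_smul]
  congr 1
  conv_rhs => rw [mul_apply_eq_comp, ← M.basis.sum_repr' (T' (M.basis (σ γ)))]
  rw [map_sum, inner_sum]
  simp only [map_smul, inner_smul_right]

lemma siteOp_comm {γ γ' : 𝒢.Site} (h : γ ≠ γ') (T T' : S →L[ℂ] S) :
    Commute (siteOp M F γ T) (siteOp M F γ' T') := by
  classical
  refine end_ext fun σ ξ => ?_
  rw [Module.End.mul_apply, Module.End.mul_apply, siteOp_single, siteOp_single, map_sum, map_sum]
  simp only [map_smul, siteOp_single, Finsupp.coe_update, Function.update_of_ne h,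
    Function.update_of_ne h.symm, Finset.smul_sum, smul_smul]
  rw [Finset.sum_comm]
  refine Finset.sum_congr rfl fun l _ => Finset.sum_congr rfl fun k _ => ?_
  rw [mul_comm]
  congr 2
  ext j
  simp [Function.update_comm h]

lemma siteOp_one (γ : 𝒢.Site) : siteOp M F γ 1 = 1 := by
  classical
  refine end_ext fun σ ξ => ?_
  rw [siteOp_single]
  have h : ∀ k, ⟪M.basis k, (1 : S →L[ℂ] S) (M.basis (σ γ))⟫_ℂ = if k = σ γ then 1 else 0 :=
    fun k => orthonormal_iff_ite.1 M.basis.orthonormal k (σ γ)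
  simp only [h, ite_smul, zero_smul, one_smul, Finset.sum_ite_eq', Finset.mem_univ, if_true]
  rw [Finsupp.update_self]
  rfl

lemma siteOp_neg (γ : 𝒢.Site) (T : S →L[ℂ] S) (y : Conf M 𝒢 →₀ F) :
    siteOp M F γ (-T) y = -siteOp M F γ T y := by
  induction y using Finsupp.induction_linear with
  | zero => simp
  | add a b ha hb => rw [map_add, map_add, ha, hb, neg_add]
  | single σ ξ =>
    rw [siteOp_single, siteOp_single, ← Finset.sum_neg_distrib]
    refine Finset.sum_congr rfl fun k _ => ?_
    rw [_root_.neg_apply, inner_neg_right, neg_smul]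

/-- Symmetry for the inner product on finite families. -/
def IsFinSymmetric (A : Module.End ℂ (Conf M 𝒢 →₀ F)) : Prop :=
  ∀ y y', ⟪finLp _ F (A y), finLp _ F y'⟫_ℂ = ⟪finLp _ F y, finLp _ F (A y')⟫_ℂ

lemma IsFinSymmetric.mul {A B : Module.End ℂ (Conf M 𝒢 →₀ F)} (hA : IsFinSymmetric A)
    (hB : IsFinSymmetric B) (h : Commute A B) : IsFinSymmetric (A * B) := fun y y' => by
  rw [Module.End.mul_apply, hA, hB, ← Module.End.mul_apply, h.eq]

lemma isFinSymmetric_of_single {A : Module.End ℂ (Conf M 𝒢 →₀ F)}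
    (h : ∀ σ ξ τ η, ⟪A (Finsupp.single σ ξ) τ, η⟫_ℂ = ⟪ξ, A (Finsupp.single τ η) σ⟫_ℂ) :
    IsFinSymmetric A := by
  intro y y'
  induction y using Finsupp.induction_linear with
  | zero => simp
  | add a b ha hb => simp only [map_add, inner_add_left, ha, hb]
  | single σ ξ =>
    induction y' using Finsupp.induction_linear with
    | zero => simp
    | add a b ha hb => simp only [map_add, inner_add_right, ha, hb]
    | single τ η =>
      rw [inner_finLp_single, ← inner_conj_symm, inner_finLp_single, inner_conj_symm,
        finLp_apply, finLp_apply]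
      exact h σ ξ τ η

lemma siteOp_single_apply (γ : 𝒢.Site) (T : S →L[ℂ] S) (σ τ : Conf M 𝒢) (ξ : F) :
    siteOp M F γ T (Finsupp.single σ ξ) τ =
      open scoped Classical in
      if ∀ j, j ≠ γ → τ j = σ j then ⟪M.basis (τ γ), T (M.basis (σ γ))⟫_ℂ • ξ else 0 := by
  classical
  rw [siteOp_single, Finsupp.finsetSum_apply]
  simp only [Finsupp.smul_apply, Finsupp.single_apply]
  split_ifs with h
  · rw [Finset.sum_eq_single (τ γ)]
    · rw [if_pos]
      ext j
      by_cases hj : j = γ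
      · subst hj; simp
      · simp [hj, h j hj]
    · intro k _ hk
      rw [if_neg, smul_zero]
      rintro rfl
      simp at hk
    · simp
  · refine Finset.sum_eq_zero fun k _ => ?_
    rw [if_neg, smul_zero]
    rintro rfl
    exact h fun j hj => by simp [hj]

lemma isFinSymmetric_siteOp (γ : 𝒢.Site) {T : S →L[ℂ] S} (hT : ∀ s t, ⟪T s, t⟫_ℂ = ⟪s, T t⟫_ℂ) :
    IsFinSymmetric (siteOp M F γ T) := by
  classical
  refine isFinSymmetric_of_single fun σ ξ τ η => ?_
  rw [siteOp_single_apply, siteOp_single_apply]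
  have h : (∀ j, j ≠ γ → τ j = σ j) ↔ ∀ j, j ≠ γ → σ j = τ j :=
    forall₂_congr fun j _ => eq_comm
  by_cases h' : ∀ j, j ≠ γ → τ j = σ j
  · rw [if_pos h', if_pos (h.1 h'), inner_smul_left, inner_smul_right, inner_conj_symm, hT]
  · rw [if_neg h', if_neg (h.not.1 h'), inner_zero_left, inner_zero_right]

variable (M 𝒢 F) in
/-- The product of the grading operators at the first generators. -/
def gradingOp : ℕ → Module.End ℂ (Conf M 𝒢 →₀ F)
  | 0 => 1
  | n + 1 => gradingOp n *
      open scoped Classical in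
      if h : ∃ k, n < 𝒢.N k then siteOp M F ⟨n, h⟩ M.grading else 1

lemma gradingOp_succ_of_site (γ : 𝒢.Site) :
    gradingOp M 𝒢 F (γ + 1) = gradingOp M 𝒢 F γ * siteOp M F γ M.grading := by
  rw [gradingOp, dif_pos γ.2]

/-- The product is indexed by natural numbers, and a number that is not a generator contributes the
factor 1; hence two kinds of successor step. -/
lemma gradingOp_induction {p : ℕ → Module.End ℂ (Conf M 𝒢 →₀ F) → Prop} (h0 : p 0 1)
    (hs : ∀ γ : 𝒢.Site, p γ (gradingOp M 𝒢 F γ) →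
      p (γ + 1) (gradingOp M 𝒢 F γ * siteOp M F γ M.grading))
    (hn : ∀ n, (¬ ∃ k, n < 𝒢.N k) → p n (gradingOp M 𝒢 F n) → p (n + 1) (gradingOp M 𝒢 F n))
    (n : ℕ) : p n (gradingOp M 𝒢 F n) := by
  induction n with
  | zero => exact h0
  | succ n ih =>
    by_cases h : ∃ k, n < 𝒢.N k
    · have := hs ⟨n, h⟩ ih
      rwa [← gradingOp_succ_of_site] at this
    · rw [gradingOp, dif_neg h, mul_one]
      exact hn n h ih

lemma commute_gradingOp {A : Module.End ℂ (Conf M 𝒢 →₀ F)} (n : ℕ)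
    (h : ∀ γ : 𝒢.Site, (γ : ℕ) < n → Commute (siteOp M F γ M.grading) A) :
    Commute (gradingOp M 𝒢 F n) A := by
  refine gradingOp_induction (p := fun n B => (∀ γ : 𝒢.Site, (γ : ℕ) < n →
    Commute (siteOp M F γ M.grading) A) → Commute B A) (fun _ => Commute.one_left A) ?_ ?_ n h
  · exact fun γ ih h => (ih fun γ' h' => h γ' (by omega)).mul_left (h γ (by omega))
  · exact fun n _ ih h => ih fun γ' h' => h γ' (by omega)

lemma commute_gradingOp_siteOp {n : ℕ} {γ : 𝒢.Site} (h : n ≤ γ) (T : S →L[ℂ] S) :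
    Commute (gradingOp M 𝒢 F n) (siteOp M F γ T) :=
  commute_gradingOp n fun γ' h' => siteOp_comm (fun h'' => by subst h''; omega) _ _

lemma siteOp_grading_comm (γ γ' : 𝒢.Site) :
    Commute (siteOp M F γ M.grading) (siteOp M F γ' M.grading) := by
  by_cases h : γ = γ'
  · subst h
    exact Commute.refl _
  · exact siteOp_comm h _ _

lemma gradingOp_comm (m n : ℕ) : Commute (gradingOp M 𝒢 F m) (gradingOp M 𝒢 F n) :=
  commute_gradingOp m fun _ _ => (commute_gradingOp n fun _ _ => siteOp_grading_comm _ _).symm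

lemma gradingOp_sq (n : ℕ) : gradingOp M 𝒢 F n * gradingOp M 𝒢 F n = 1 := by
  refine gradingOp_induction (p := fun _ B => B * B = 1) (mul_one _) (fun γ ih => ?_)
    (fun _ _ ih => ih) n
  have h := (commute_gradingOp_siteOp (M := M) (F := F) (le_refl (γ : ℕ)) M.grading).symm
  rw [h.mul_mul_mul_comm, ih, siteOp_mul, M.grading_sq,
    siteOp_one, one_mul]

/-- The product contains the grading at γ exactly once; that factor anticommutes with c (v), the
others act at different positions and commute. -/
lemma gradingOp_anticomm {n : ℕ} {γ : 𝒢.Site} (h : (γ : ℕ) < n)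
    (v : GroupLieAlgebra 𝓘(ℝ, V) G) (y : Conf M 𝒢 →₀ F) :
    gradingOp M 𝒢 F n (siteOp M F γ (M.c v) y) =
      -siteOp M F γ (M.c v) (gradingOp M 𝒢 F n y) := by
  refine gradingOp_induction (p := fun n B => (γ : ℕ) < n → ∀ y, B (siteOp M F γ (M.c v) y) =
    -siteOp M F γ (M.c v) (B y)) (fun h => absurd h (by omega)) (fun γ' ih h y => ?_)
    (fun n hn ih h => ?_) n h y
  · rw [Module.End.mul_apply, Module.End.mul_apply]
    by_cases h' : γ = γ'
    · subst h'
      have h1 := LinearMap.congr_fun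
        (commute_gradingOp_siteOp (M := M) (F := F) (le_refl (γ : ℕ)) (M.c v)).eq
      have h2 : siteOp M F γ M.grading (siteOp M F γ (M.c v) y) =
          -siteOp M F γ (M.c v) (siteOp M F γ M.grading y) := by
        rw [← Module.End.mul_apply, ← Module.End.mul_apply, siteOp_mul, siteOp_mul, ← siteOp_neg]
        exact congrArg (fun T => siteOp M F γ T y) (M.grading_anticomm v)
      rw [h2, map_neg]
      exact congrArg Neg.neg (h1 _)
    · have h1 : (γ : ℕ) < γ' := lt_of_le_of_ne (by omega) fun h'' => h' (Subtype.ext h'')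
      have h2 := LinearMap.congr_fun (siteOp_comm (M := M) (F := F) (Ne.symm h') M.grading
        (M.c v)).eq y
      rw [Module.End.mul_apply, Module.End.mul_apply] at h2
      rw [h2, ih h1]
  · refine ih (lt_of_le_of_ne (by omega) ?_)
    rintro rfl
    exact hn γ.2

lemma isFinSymmetric_gradingOp (n : ℕ) : IsFinSymmetric (gradingOp M 𝒢 F n) :=
  gradingOp_induction (p := fun _ B => IsFinSymmetric B) (fun _ _ => rfl)
    (fun γ ih => ih.mul (isFinSymmetric_siteOp γ M.inner_grading)
      (commute_gradingOp_siteOp le_rfl _)) (fun _ _ ih => ih) n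

variable (M F) in
/-- Clifford multiplication by a vector in the copy of the Lie algebra at `γ`. -/
def cliffordOp (γ : 𝒢.Site) (v : GroupLieAlgebra 𝓘(ℝ, V) G) : Module.End ℂ (Conf M 𝒢 →₀ F) :=
  gradingOp M 𝒢 F γ * siteOp M F γ (M.c v)

/-- The string of gradings before γ commutes with operators at γ and squares to 1. So the strings
disappear from D_γ², which can then be compared with the basic operator. -/
lemma cliffordOp_mul (γ : 𝒢.Site) (v v' : GroupLieAlgebra 𝓘(ℝ, V) G) :
    cliffordOp M F γ v * cliffordOp M F γ v' = siteOp M F γ (M.c v) * siteOp M F γ (M.c v') := by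
  have h := (commute_gradingOp_siteOp (M := M) (F := F) (le_refl (γ : ℕ)) (M.c v)).symm
  rw [cliffordOp, cliffordOp, h.mul_mul_mul_comm,
    gradingOp_sq, one_mul]

/-- The string of the later generator contains the grading at the earlier one, and this produces the
sign. -/
lemma cliffordOp_anticomm {γ γ' : 𝒢.Site} (h : γ ≠ γ') (v v' : GroupLieAlgebra 𝓘(ℝ, V) G)
    (y : Conf M 𝒢 →₀ F) :
    cliffordOp M F γ v (cliffordOp M F γ' v' y) =
      -cliffordOp M F γ' v' (cliffordOp M F γ v y) := by
  have key : ∀ {γ γ' : 𝒢.Site} (_ : γ < γ') (v v' : GroupLieAlgebra 𝓘(ℝ, V) G)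
      (y : Conf M 𝒢 →₀ F), cliffordOp M F γ' v' (cliffordOp M F γ v y) =
        -cliffordOp M F γ v (cliffordOp M F γ' v' y) := by
    intro γ γ' h v v' y
    have h2 := LinearMap.congr_fun (commute_gradingOp_siteOp (M := M) (F := F)
      (show (γ : ℕ) ≤ γ' from h.le) (M.c v')).eq
    have h3 := LinearMap.congr_fun (gradingOp_comm (M := M) (𝒢 := 𝒢) (F := F) γ γ').eq
    have h4 := LinearMap.congr_fun (siteOp_comm (M := M) (F := F) h.ne (M.c v) (M.c v')).eq
    simp only [cliffordOp, Module.End.mul_apply] at h2 h3 h4 ⊢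
    rw [← h2, ← h3, ← h4, gradingOp_anticomm (show (γ : ℕ) < γ' from h), map_neg]
  rcases lt_or_gt_of_ne h with h | h
  · rw [key h v v', neg_neg]
  · exact key h v' v y

lemma isFinSymmetric_cliffordOp (γ : 𝒢.Site) (v : GroupLieAlgebra 𝓘(ℝ, V) G) :
    IsFinSymmetric (cliffordOp M F γ v) :=
  (isFinSymmetric_gradingOp _).mul (isFinSymmetric_siteOp γ (M.inner_c v))
    (commute_gradingOp_siteOp le_rfl _)

end Clifford

end AGN

end

noncomputable section

namespace AGN

set_option linter.unusedSectionVars false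

section CliffordMatrix

variable {V : Type*} [NormedAddCommGroup V] [NormedSpace ℝ V]
  {G : Type*} [Group G] [TopologicalSpace G] [ChartedSpace V G]
  {S : Type*} [NormedAddCommGroup S] [InnerProductSpace ℂ S] [CompleteSpace S]
  {g : InvariantMetric V G} {M : SpinorModule g.quadratic S}
  {𝒢 : GraphSystem} {F : Type*} [NormedAddCommGroup F] [InnerProductSpace ℂ F]

/-! ### Matrix elements of the Clifford algebra -/

lemma finite_sites_lt (n : ℕ) : {j : 𝒢.Site | (j : ℕ) < n}.Finite :=
  Set.Finite.of_finite_image ((Set.finite_lt_nat n).subset (by rintro _ ⟨j, hj, rfl⟩; exact hj))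
    Subtype.val_injective.injOn

lemma gradingOp_single_apply (n : ℕ) (σ τ : Conf M 𝒢) (ξ : F) :
    gradingOp M 𝒢 F n (Finsupp.single σ ξ) τ =
      open scoped Classical in
      if ∀ j : 𝒢.Site, n ≤ j → τ j = σ j then
        (∏ᶠ (j : 𝒢.Site) (_ : (j : ℕ) < n), ⟪M.basis (τ j), M.grading (M.basis (σ j))⟫_ℂ) • ξ
      else 0 := by
  classical
  refine gradingOp_induction (p := fun n B => ∀ σ : Conf M 𝒢, B (Finsupp.single σ ξ) τ =
      if ∀ j : 𝒢.Site, n ≤ j → τ j = σ j then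
        (∏ᶠ (j : 𝒢.Site) (_ : (j : ℕ) < n), ⟪M.basis (τ j), M.grading (M.basis (σ j))⟫_ℂ) • ξ
      else 0) (fun σ => ?_) (fun γ ih σ => ?_) (fun n hn ih σ => ?_) n σ
  · simp only [Module.End.one_apply, Finsupp.single_apply, Nat.zero_le, true_imp_iff,
      Nat.not_lt_zero, finprod_false, finprod_one, one_smul]
    exact if_congr ⟨fun h j => by rw [h], fun h => Finsupp.ext fun j => (h j).symm⟩ rfl rfl
  · rw [Module.End.mul_apply, siteOp_single, map_sum, Finsupp.finsetSum_apply]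
    simp only [map_smul, Finsupp.smul_apply, ih]
    rw [Finset.sum_eq_single (τ γ)]
    · have h1 : (∀ j : 𝒢.Site, (γ : ℕ) ≤ j → τ j = σ.update γ (τ γ) j) ↔
          ∀ j : 𝒢.Site, (γ : ℕ) + 1 ≤ j → τ j = σ j := by
        refine ⟨fun h j hj => ?_, fun h j hj => ?_⟩
        · have h2 : j ≠ γ := fun h' => by subst h'; omega
          simpa [h2] using h j (by omega)
        · by_cases h2 : j = γ
          · subst h2; simp
          · have h3 : (γ : ℕ) ≠ j := fun h' => h2 (Subtype.ext h'.symm)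
            simpa [h2] using h j (by omega)
      by_cases h2 : ∀ j : 𝒢.Site, (γ : ℕ) + 1 ≤ j → τ j = σ j
      · rw [if_pos h2, if_pos (h1.2 h2), smul_smul]
        congr 1
        have h3 : {j : 𝒢.Site | (j : ℕ) < γ + 1} = insert γ {j : 𝒢.Site | (j : ℕ) < γ} := by
          ext j
          simp only [Set.mem_ofPred_eq, Set.mem_insert_iff, Subtype.ext_iff]
          omega
        have h4 := finprod_mem_insert (fun j : 𝒢.Site =>
          ⟪M.basis (τ j), M.grading (M.basis (σ j))⟫_ℂ)
          (show γ ∉ {j : 𝒢.Site | (j : ℕ) < γ} by simp) (finite_sites_lt (γ : ℕ))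
        rw [← h3] at h4
        refine Eq.trans ?_ h4.symm
        congr 1
        refine finprod_mem_congr (s := {j : 𝒢.Site | (j : ℕ) < γ}) rfl fun j hj => ?_
        have h5 : j ≠ γ := fun h' => by subst h'; simp at hj
        simp [h5]
      · rw [if_neg h2, if_neg (h1.not.2 h2), smul_zero]
    · intro k _ hk
      rw [if_neg, smul_zero]
      intro h
      have := h γ le_rfl
      simp at this
      exact hk this.symm
    · simp
  · rw [ih]
    have h1 : ∀ j : 𝒢.Site, (j : ℕ) ≠ n := fun j h => hn (h ▸ j.2)
    have h2 : ∀ j : 𝒢.Site, (j : ℕ) < n + 1 ↔ (j : ℕ) < n := fun j => by have := h1 j; omega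
    have h3 : ∀ j : 𝒢.Site, n + 1 ≤ j ↔ n ≤ (j : ℕ) := fun j => by have := h1 j; omega
    simp only [h2, h3]

/-- This ties the product of operators used in the proof to the matrix through which the Dirac
operators and the von Neumann algebra are defined. -/
lemma cliffordOp_single_apply (γ : 𝒢.Site) (v : GroupLieAlgebra 𝓘(ℝ, V) G) (σ τ : Conf M 𝒢)
    (ξ : F) :
    cliffordOp M F γ v (Finsupp.single σ ξ) τ = siteClifford M γ v τ σ • ξ := by
  classical
  rw [cliffordOp, Module.End.mul_apply, siteOp_single, map_sum, Finsupp.finsetSum_apply,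
    siteClifford]
  simp only [map_smul, Finsupp.smul_apply, gradingOp_single_apply]
  rw [Finset.sum_eq_single (τ γ)]
  · have h1 : (∀ j : 𝒢.Site, (γ : ℕ) ≤ j → τ j = σ.update γ (τ γ) j) ↔
        ∀ j : 𝒢.Site, γ < j → τ j = σ j := by
      refine ⟨fun h j hj => ?_, fun h j hj => ?_⟩
      · simpa [hj.ne'] using h j hj.le
      · by_cases h2 : j = γ
        · subst h2; simp
        · simpa [h2] using h j (lt_of_le_of_ne hj (Ne.symm h2))
    by_cases h2 : ∀ j : 𝒢.Site, γ < j → τ j = σ j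
    · rw [if_pos h2, if_pos (h1.2 h2), smul_smul, mul_comm]
      congr 2
      refine finprod_mem_congr (s := {j : 𝒢.Site | (j : ℕ) < γ}) rfl fun j hj => ?_
      have h5 : j ≠ γ := fun h' => by rw [h'] at hj; exact lt_irrefl (γ : ℕ) hj
      simp [h5]
    · rw [if_neg h2, if_neg (h1.not.2 h2), smul_zero, zero_smul]
  · intro k _ hk
    rw [if_neg, smul_zero]
    intro h
    have := h γ le_rfl
    simp at this
    exact hk this.symm
  · simp

/-- Columns are finite because the operator maps finite families to finite families; Hermitian
symmetry transfers this to rows. -/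
lemma finite_siteClifford (γ : 𝒢.Site) (v : GroupLieAlgebra 𝓘(ℝ, V) G) (τ : Conf M 𝒢) :
    {σ | siteClifford M γ v τ σ ≠ 0}.Finite := by
  classical
  have h0 := (cliffordOp M ℂ γ v (Finsupp.single τ 1)).hasFiniteSupport
  refine h0.subset fun σ hσ => ?_
  have h1 := isFinSymmetric_cliffordOp (M := M) (F := ℂ) γ v (Finsupp.single σ 1)
    (Finsupp.single τ 1)
  rw [inner_finLp_single, ← inner_conj_symm, inner_finLp_single, finLp_apply, finLp_apply,
    cliffordOp_single_apply] at h1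
  simp only [Function.mem_support]
  intro h2
  rw [h2] at h1
  simp at h1
  exact hσ h1

lemma star_siteClifford (γ : 𝒢.Site) (v : GroupLieAlgebra 𝓘(ℝ, V) G) (σ τ : Conf M 𝒢) :
    star (siteClifford M γ v τ σ) = siteClifford M γ v σ τ := by
  have h1 := isFinSymmetric_cliffordOp (M := M) (F := ℂ) γ v (Finsupp.single σ 1)
    (Finsupp.single τ 1)
  rw [inner_finLp_single, ← inner_conj_symm, inner_finLp_single, finLp_apply, finLp_apply,
    cliffordOp_single_apply, cliffordOp_single_apply] at h1
  simpa using h1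

lemma cliffordOp_apply (γ : 𝒢.Site) (v : GroupLieAlgebra 𝓘(ℝ, V) G) (y : Conf M 𝒢 →₀ F)
    (τ : Conf M 𝒢) :
    cliffordOp M F γ v y τ = ∑ᶠ σ, siteClifford M γ v τ σ • y σ := by
  induction y using Finsupp.induction_linear with
  | zero => simp
  | add a b ha hb =>
    have hf : ∀ a : Conf M 𝒢 →₀ F, (Function.support fun σ => siteClifford M γ v τ σ • a σ).Finite :=
      fun a => (finite_siteClifford γ v τ).subset fun σ hσ h => hσ (by simp [h])
    rw [map_add, Finsupp.add_apply, ha, hb, ← finsum_add_distrib (hf a) (hf b)]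
    simp only [Finsupp.add_apply, smul_add]
  | single σ ξ =>
    classical
    rw [cliffordOp_single_apply, finsum_eq_single _ σ fun σ' h => by
      rw [Finsupp.single_eq_of_ne h, smul_zero], Finsupp.single_eq_same]

lemma cliffordOp_mem_supported {N : ℕ} {γ : 𝒢.Site} (h : (γ : ℕ) < N)
    (v : GroupLieAlgebra 𝓘(ℝ, V) G) {y : Conf M 𝒢 →₀ F}
    (hy : y ∈ Finsupp.supported F ℂ {σ : Conf M 𝒢 | ∀ j : 𝒢.Site, N ≤ j → σ j = 0}) :
    cliffordOp M F γ v y ∈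
      Finsupp.supported F ℂ {σ : Conf M 𝒢 | ∀ j : 𝒢.Site, N ≤ j → σ j = 0} := by
  classical
  rw [Finsupp.mem_supported'] at hy ⊢
  intro τ hτ
  rw [cliffordOp_apply]
  refine finsum_eq_zero_of_forall_eq_zero fun σ => ?_
  by_cases hσ : σ ∈ {σ : Conf M 𝒢 | ∀ j : 𝒢.Site, N ≤ j → σ j = 0}
  · rw [siteClifford, if_neg, zero_smul]
    exact fun h' => hτ fun j hj => (h' j (show (γ : ℕ) < j from lt_of_lt_of_le h hj)).trans (hσ j hj)
  · rw [hy σ hσ, smul_zero]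

/-- Beyond all generators in s and all labels occurring in t, every configuration is the vacuum 0.
The families supported on such configurations form a finite-dimensional space, stable under the
operators in s. -/
lemma exists_cliffordOp_stable [FiniteDimensional ℂ F] (s : Set 𝒢.Site) (hs : s.Finite)
    (t : Finset (Conf M 𝒢 →₀ F)) : ∃ U : Submodule ℂ (Conf M 𝒢 →₀ F), (∀ y ∈ t, y ∈ U) ∧ U.FG ∧
      ∀ γ ∈ s, ∀ v : GroupLieAlgebra 𝓘(ℝ, V) G, ∀ y ∈ U, cliffordOp M F γ v y ∈ U := by
  classical
  obtain ⟨N, hN⟩ : ∃ N : ℕ, ∀ j ∈ hs.toFinset ∪ t.biUnion fun y => y.support.biUnion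
      fun σ => σ.support, (j : ℕ) < N := by
    obtain ⟨B, hB⟩ := (Finset.finite_toSet ((hs.toFinset ∪ t.biUnion fun y => y.support.biUnion
      fun σ => σ.support).image Subtype.val)).bddAbove
    refine ⟨B + 1, fun j hj => Nat.lt_succ_of_le (hB ?_)⟩
    exact Finset.mem_coe.2 (Finset.mem_image_of_mem _ hj)
  refine ⟨Finsupp.supported F ℂ {σ : Conf M 𝒢 | ∀ j : 𝒢.Site, N ≤ j → σ j = 0}, ?_, ?_, ?_⟩
  · intro y hy
    rw [Finsupp.mem_supported]
    intro σ hσ j hj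
    by_contra h
    have := hN j (Finset.mem_union_right _ (Finset.mem_biUnion.2 ⟨y, hy,
      Finset.mem_biUnion.2 ⟨σ, hσ, Finsupp.mem_support_iff.2 h⟩⟩))
    omega
  · have hf : {σ : Conf M 𝒢 | ∀ j : 𝒢.Site, N ≤ j → σ j = 0}.Finite := by
      have := (finite_sites_lt (𝒢 := 𝒢) N).to_subtype
      refine Set.Finite.of_injOn (f := fun (σ : Conf M 𝒢) (j : {j : 𝒢.Site | (j : ℕ) < N}) =>
        σ (j : 𝒢.Site)) (t := Set.univ) (fun _ _ => trivial) (fun σ hσ τ hτ h => ?_)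
        (Set.toFinite _)
      ext j
      by_cases hj : (j : ℕ) < N
      · exact congrArg Fin.val (congrFun h ⟨j, hj⟩)
      · rw [hσ j (not_lt.1 hj), hτ j (not_lt.1 hj)]
    have := hf.to_subtype
    exact Module.Finite.iff_fg.1 (Module.Finite.equiv
      (Finsupp.supportedEquivFinsupp {σ : Conf M 𝒢 | ∀ j : 𝒢.Site, N ≤ j → σ j = 0}).symm)
  · exact fun γ hγ v y hy => cliffordOp_mem_supported
      (hN γ (Finset.mem_union_left _ (hs.mem_toFinset.2 hγ))) v hy

/-- The component of a finite family in the tensor factor at `γ`. -/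
def spinorSlice (γ : 𝒢.Site) (τ : Conf M 𝒢) (ξ : F) : (Conf M 𝒢 →₀ F) →ₗ[ℂ] S :=
  ∑ k, LinearMap.smulRight ((innerSL ℂ ξ).toLinearMap ∘ₗ Finsupp.lapply (τ.update γ k))
    (M.basis k)

lemma spinorSlice_apply (γ : 𝒢.Site) (τ : Conf M 𝒢) (ξ : F) (y : Conf M 𝒢 →₀ F) :
    spinorSlice γ τ ξ y = ∑ k, ⟪ξ, y (τ.update γ k)⟫_ℂ • M.basis k := by
  rw [spinorSlice, LinearMap.sum_apply]
  rfl

lemma spinorSlice_siteOp (γ : 𝒢.Site) (τ : Conf M 𝒢) (ξ : F) (T : S →L[ℂ] S)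
    (y : Conf M 𝒢 →₀ F) : spinorSlice γ τ ξ (siteOp M F γ T y) = T (spinorSlice γ τ ξ y) := by
  classical
  induction y using Finsupp.induction_linear with
  | zero => simp
  | add a b ha hb => simp only [map_add, ha, hb]
  | single σ η =>
    rw [spinorSlice_apply, spinorSlice_apply, map_sum]
    simp only [siteOp_single_apply, map_smul]
    by_cases h : ∀ j, j ≠ γ → τ j = σ j
    · have h1 : ∀ k, ∀ j, j ≠ γ → τ.update γ k j = σ j := fun k j hj => by simp [hj, h j hj]
      have h2 : ∀ k, Finsupp.single σ η (τ.update γ k) = if k = σ γ then η else 0 := fun k => by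
        rw [Finsupp.single_apply]
        congr 1
        refine propext ⟨fun h' => by rw [h']; simp, fun h' => ?_⟩
        ext j
        by_cases hj : j = γ
        · subst hj; simp [h']
        · simp [hj, h j hj]
      simp only [if_pos (h1 _), h2, apply_ite (fun z => ⟪ξ, z⟫_ℂ), inner_zero_right, ite_smul,
        zero_smul, Finset.sum_ite_eq', Finset.mem_univ, if_true]
      conv_rhs => rw [← M.basis.sum_repr' (T (M.basis (σ γ))), Finset.smul_sum]
      refine Finset.sum_congr rfl fun k _ => ?_
      rw [inner_smul_right, smul_smul, mul_comm]
      simp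
    · have h1 : ∀ k, ¬ ∀ j, j ≠ γ → τ.update γ k j = σ j := fun k h' =>
        h fun j hj => by simpa [hj] using h' j hj
      have h2 : ∀ k, Finsupp.single σ η (τ.update γ k) = 0 := fun k => by
        rw [Finsupp.single_apply, if_neg]
        rintro rfl
        exact h fun j hj => by simp [hj]
      simp only [if_neg (h1 _), h2, inner_zero_right, zero_smul]

end CliffordMatrix

end AGN

end

noncomputable section

namespace AGN

set_option linter.unusedSectionVars false

section ProductCore

variable {V : Type*} [NormedAddCommGroup V] [NormedSpace ℝ V] [FiniteDimensional ℝ V]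
  {G : Type*} [Group G] [TopologicalSpace G] [ChartedSpace V G] [LieGroup 𝓘(ℝ, V) ∞ G]
  [IsTopologicalGroup G] [CompactSpace G] [SecondCountableTopology G]
  [MeasurableSpace G] [BorelSpace G]
  {S : Type*} [NormedAddCommGroup S] [InnerProductSpace ℂ S] [CompleteSpace S]
  {g : InvariantMetric V G} {q : ℕ}
  (e : Module.Basis (Fin q) ℝ (GroupLieAlgebra 𝓘(ℝ, V) G)) (M : SpinorModule g.quadratic S)
  (𝒢 : GraphSystem) (E : Type*) [NormedAddCommGroup E] [InnerProductSpace ℂ E]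

/-! ### The Dirac operators of the generators on algebraic families -/

/-- Finite sums of `w ⊗ ξ ⊗ s` with `w` a representative function of finitely many generators. -/
abbrev ConnCore : Type _ := cylAlg V G 𝒢 ⊗[ℂ] (Conf M 𝒢 →₀ E)

instance : AddCommGroup (ConnCore M 𝒢 E) := TensorProduct.addCommGroup

/-- The algebraic form of the Dirac operator at `γ`. -/
def connDirac (γ : 𝒢.Site) : Module.End ℂ (ConnCore M 𝒢 E) :=
  tensorDirac (fun (γ : 𝒢.Site) i => (cylDeriv γ (e i)).toLinearMap)
    (fun γ i => cliffordOp M E γ (e i)) γ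

/-- The elements of `ConnCore` as families of functions. -/
def connFun : ConnCore M 𝒢 E →ₗ[ℂ] (Conf M 𝒢 →₀ C(𝒢.Site → G, E)) :=
  Finsupp.mapRange.linearMap (tensorFun (cylAlg V G 𝒢) continuous_of_mem_cylAlg) ∘ₗ
    (TensorProduct.finsuppRight ℂ ℂ (cylAlg V G 𝒢) E (Conf M 𝒢)).toLinearMap

variable {M 𝒢 E}

lemma connFun_tmul (w : cylAlg V G 𝒢) (y : Conf M 𝒢 →₀ E) (σ : Conf M 𝒢) :
    connFun M 𝒢 E (w ⊗ₜ y) σ = tensorFun (cylAlg V G 𝒢) continuous_of_mem_cylAlg (w ⊗ₜ y σ) := by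
  rw [connFun, LinearMap.comp_apply, Finsupp.mapRange.linearMap_apply, Finsupp.mapRange_apply]
  congr 1
  exact TensorProduct.finsuppRight_apply_tmul_apply w y σ

lemma connFun_tmul_apply (w : cylAlg V G 𝒢) (y : Conf M 𝒢 →₀ E) (σ : Conf M 𝒢)
    (x : 𝒢.Site → G) : connFun M 𝒢 E (w ⊗ₜ y) σ x = (w : (𝒢.Site → G) → ℂ) x • y σ := by
  rw [connFun_tmul, tensorFun_tmul]

lemma isSmoothCylinder_smul (w : cylAlg V G 𝒢) (ξ : E) :
    IsSmoothCylinder (V := V) 𝒢 fun x => (w : (𝒢.Site → G) → ℂ) x • ξ :=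
  (isSmoothCylinder_of_mem_cylAlg w).comp₂ (isSmoothCylinder_of_mem_cylAlg w)
    (Φ := fun z : ℂ × ℂ => z.1 • ξ) (by fun_prop)

lemma isSmoothCylinder_connFun (p : ConnCore M 𝒢 E) (σ : Conf M 𝒢) :
    IsSmoothCylinder (V := V) 𝒢 (connFun M 𝒢 E p σ) := by
  induction p using TensorProduct.induction_on with
  | zero => rw [map_zero]; exact isSmoothCylinder_const (0 : E)
  | add a b ha hb => rw [map_add]; exact ha.comp₂ hb contDiff_add
  | tmul w y =>
    rw [funext (connFun_tmul_apply w y σ)]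
    exact isSmoothCylinder_smul w (y σ)

lemma siteDeriv_smul (w : cylAlg V G 𝒢) (ξ : E) (γ : 𝒢.Site) (v : GroupLieAlgebra 𝓘(ℝ, V) G) :
    siteDeriv γ v (fun x => (w : (𝒢.Site → G) → ℂ) x • ξ) =
      fun x => (cylDeriv γ v w : (𝒢.Site → G) → ℂ) x • ξ := by
  funext x
  exact congrFun (leftDeriv_clm (contMDiff_of_mem_repAlg (updateAlg V γ x w).2)
    (((ContinuousLinearMap.id ℂ ℂ).smulRight ξ).restrictScalars ℝ) v) (x γ)

lemma siteDeriv_connFun_add (a b : ConnCore M 𝒢 E) (γ : 𝒢.Site) (v : GroupLieAlgebra 𝓘(ℝ, V) G)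
    (σ : Conf M 𝒢) (x : 𝒢.Site → G) :
    siteDeriv γ v (connFun M 𝒢 E (a + b) σ) x =
      siteDeriv γ v (connFun M 𝒢 E a σ) x + siteDeriv γ v (connFun M 𝒢 E b σ) x := by
  rw [map_add]
  exact congrFun (leftDeriv_add ((isSmoothCylinder_connFun a σ).contMDiff_update x γ)
    ((isSmoothCylinder_connFun b σ).contMDiff_update x γ) v) (x γ)

lemma connFun_connDirac (γ : 𝒢.Site) (p : ConnCore M 𝒢 E) (τ : Conf M 𝒢) (x : 𝒢.Site → G) :
    connFun M 𝒢 E (connDirac e M 𝒢 E γ p) τ x =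
      siteDirac e M γ (fun σ => connFun M 𝒢 E p σ) τ x := by
  induction p using TensorProduct.induction_on with
  | zero =>
    have h : ∀ v, siteDeriv (V := V) γ v (0 : (𝒢.Site → G) → E) x = 0 := fun v =>
      congrFun (leftDeriv_const (V := V) (G := G) (0 : E) v) (x γ)
    rw [map_zero, map_zero, siteDirac]
    simp [h]
  | add a b ha hb =>
    have hf : ∀ (i : Fin q) (a : ConnCore M 𝒢 E), (Function.support fun σ =>
        siteClifford M γ (e i) τ σ • siteDeriv γ (e i) (connFun M 𝒢 E a σ) x).Finite :=
      fun i a => (finite_siteClifford γ (e i) τ).subset fun σ hσ h => hσ (by simp [h])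
    rw [map_add, map_add, Finsupp.add_apply, ContinuousMap.add_apply, ha, hb]
    simp only [siteDirac, siteDeriv_connFun_add, smul_add]
    rw [← smul_add, ← Finset.sum_add_distrib]
    congr 1
    exact Finset.sum_congr rfl fun i _ => (finsum_add_distrib (hf i a) (hf i b)).symm
  | tmul w y =>
    rw [connDirac, tensorDirac_tmul, map_smul, map_sum, Finsupp.smul_apply,
      Finsupp.finsetSum_apply, ContinuousMap.smul_apply, ContinuousMap.sum_apply, siteDirac]
    congr 1
    refine Finset.sum_congr rfl fun i _ => ?_
    rw [connFun_tmul_apply, cliffordOp_apply, smul_finsum]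
    refine finsum_congr fun σ => ?_
    rw [funext (connFun_tmul_apply w y σ), siteDeriv_smul, smul_comm]
    rfl

variable (μ : Measure G) [IsProbabilityMeasure μ]

variable (M 𝒢 E) in
/-- The elements of `ConnCore` as elements of the limit Hilbert space. -/
def connL2 : ConnCore M 𝒢 E →ₗ[ℂ] LimitSpace M μ 𝒢 E :=
  finLp _ _ ∘ₗ Finsupp.mapRange.linearMap
    (ContinuousMap.toLp 2 (Measure.infinitePi fun _ : 𝒢.Site => μ) ℂ).toLinearMap ∘ₗ connFun M 𝒢 E

lemma connL2_apply (p : ConnCore M 𝒢 E) (σ : Conf M 𝒢) :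
    connL2 M 𝒢 E μ p σ = ContinuousMap.toLp 2 (Measure.infinitePi fun _ : 𝒢.Site => μ) ℂ
      (connFun M 𝒢 E p σ) := by
  rw [connL2, LinearMap.comp_apply, finLp_apply]
  rfl

lemma coeFn_connL2 (p : ConnCore M 𝒢 E) (σ : Conf M 𝒢) :
    connL2 M 𝒢 E μ p σ =ᵐ[Measure.infinitePi fun _ : 𝒢.Site => μ] connFun M 𝒢 E p σ := by
  rw [connL2_apply]
  exact ContinuousMap.coeFn_toLp (𝕜 := ℂ) _ _

lemma connL2_single (w : cylAlg V G 𝒢) (σ : Conf M 𝒢) (ξ : E) :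
    connL2 M 𝒢 E μ (w ⊗ₜ Finsupp.single σ ξ) = finLp _ _ (Finsupp.single σ
      (ContinuousMap.toLp 2 (Measure.infinitePi fun _ : 𝒢.Site => μ) ℂ
        (tensorFun (cylAlg V G 𝒢) continuous_of_mem_cylAlg (w ⊗ₜ ξ)))) := by
  classical
  ext τ : 2
  rw [connL2_apply, connFun_tmul, finLp_apply, Finsupp.single_apply, Finsupp.single_apply]
  split_ifs
  · rfl
  · rw [TensorProduct.tmul_zero, map_zero, map_zero]

lemma inner_connL2_single (w : cylAlg V G 𝒢) (σ : Conf M 𝒢) (ξ : E) (Ψ : LimitSpace M μ 𝒢 E) :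
    ⟪connL2 M 𝒢 E μ (w ⊗ₜ Finsupp.single σ ξ), Ψ⟫_ℂ =
      ∫ x, ⟪(w : (𝒢.Site → G) → ℂ) x • ξ, Ψ σ x⟫_ℂ ∂Measure.infinitePi fun _ : 𝒢.Site => μ := by
  rw [connL2_single, inner_finLp_single, inner_toLp]
  rfl

lemma inner_connL2_tmul (w w' : cylAlg V G 𝒢) (y y' : Conf M 𝒢 →₀ E) :
    ⟪connL2 M 𝒢 E μ (w ⊗ₜ y), connL2 M 𝒢 E μ (w' ⊗ₜ y')⟫_ℂ =
      (∫ x, ⟪(w : (𝒢.Site → G) → ℂ) x, (w' : (𝒢.Site → G) → ℂ) x⟫_ℂ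
        ∂Measure.infinitePi fun _ : 𝒢.Site => μ) * ⟪finLp _ E y, finLp _ E y'⟫_ℂ := by
  induction y using Finsupp.induction_linear with
  | zero => simp
  | add a b ha hb =>
    rw [TensorProduct.tmul_add, map_add, map_add, inner_add_left, inner_add_left, ha, hb, mul_add]
  | single σ ξ =>
    rw [inner_connL2_single, inner_finLp_single, finLp_apply, ← integral_mul_const]
    refine integral_congr_ae ?_
    filter_upwards [coeFn_connL2 μ (w' ⊗ₜ y') σ] with x hx
    rw [hx, connFun_tmul_apply, inner_smul_left, inner_smul_right]
    simp only [RCLike.inner_apply]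
    ring

variable [μ.IsHaarMeasure]

lemma inner_connL2_connDirac (γ : 𝒢.Site) (p p' : ConnCore M 𝒢 E) :
    ⟪connL2 M 𝒢 E μ (connDirac e M 𝒢 E γ p), connL2 M 𝒢 E μ p'⟫_ℂ =
      ⟪connL2 M 𝒢 E μ p, connL2 M 𝒢 E μ (connDirac e M 𝒢 E γ p')⟫_ℂ := by
  refine tensorDirac_symm (fun i w w' y y' => ?_) p p'
  rw [inner_connL2_tmul, inner_connL2_tmul, isFinSymmetric_cliffordOp, ← neg_mul]
  congr 1
  exact integral_inner_siteDeriv μ (isSmoothCylinder_of_mem_cylAlg w)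
    (isSmoothCylinder_of_mem_cylAlg w') γ (e i)

lemma connDirac_anti {γ γ' : 𝒢.Site} (h : γ ≠ γ') :
    connDirac e M 𝒢 E γ * connDirac e M 𝒢 E γ' = -(connDirac e M 𝒢 E γ' * connDirac e M 𝒢 E γ) :=
  tensorDirac_anti (fun i j => LinearMap.ext fun w => cylDeriv_comm h (e i) (e j) w)
    fun i j => LinearMap.ext fun y => cliffordOp_anticomm h (e i) (e j) y

variable [T2Space G] [FiniteDimensional ℂ E]

variable (M 𝒢 E) in
-- Two distinct connections differ at some generator, and a representative function of the value
-- there separates them.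
lemma denseRange_connL2 : DenseRange (connL2 M 𝒢 E μ) := by
  have h := (Submodule.topologicalClosure_eq_top_iff (K := LinearMap.range (connL2 M 𝒢 E μ))).2 (by
    rw [Submodule.eq_bot_iff]
    intro Ψ hΨ
    ext σ : 2
    refine eq_zero_of_inner_tensorFun _ continuous_of_mem_cylAlg
      (fun f hf => star_mem_cylAlg (V := V) hf) (fun a b hab => ?_) fun f ξ => ?_
    · obtain ⟨γ, hγ⟩ := Function.ne_iff.1 hab
      obtain ⟨w, hw, hne⟩ := exists_repAlg_separates (V := V) μ hγ
      exact ⟨evalAlg V G γ ⟨w, hw⟩, (evalAlg V G γ ⟨w, hw⟩).2, hne⟩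
    · have h1 := (Submodule.mem_orthogonal _ Ψ).1 hΨ _ ⟨f ⊗ₜ Finsupp.single σ ξ, rfl⟩
      rwa [connL2_single, inner_finLp_single] at h1)
  rw [DenseRange, ← LinearMap.coe_range]
  exact Submodule.dense_iff_topologicalClosure_eq_top.2 h

lemma connDirac_locfin (p : ConnCore M 𝒢 E) : ∃ U : Submodule ℂ (ConnCore M 𝒢 E), p ∈ U ∧ U.FG ∧
    (∀ γ, ∀ v ∈ U, connDirac e M 𝒢 E γ v ∈ U) ∧
    {γ | ∃ v ∈ U, connDirac e M 𝒢 E γ v ≠ 0}.Finite := by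
  refine tensorDirac_locfin (fun w => ?_) (fun s hs t => ?_) p
  · obtain ⟨U, h1, h2, h3, h4⟩ := exists_cylDeriv_stable w
    exact ⟨U, h1, h2, fun γ i v hv => h3 γ (e i) v hv,
      h4.subset fun γ ⟨i, v, hv, h⟩ => ⟨e i, v, hv, h⟩⟩
  · obtain ⟨U, h1, h2, h3⟩ := exists_cliffordOp_stable (M := M) (F := E) s hs t
    exact ⟨U, h1, h2, fun γ hγ i v hv => h3 γ hγ (e i) v hv⟩

variable (M 𝒢 E) in
/-- The common core of the Dirac operators of the generators. -/
def prodCore : DiracCore (LimitSpace M μ 𝒢 E) 𝒢.Site :=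
  DiracCore.ofDense (connL2 M 𝒢 E μ) (denseRange_connL2 M 𝒢 E μ) (connDirac e M 𝒢 E)
    (inner_connL2_connDirac e μ) (fun _ _ => connDirac_anti e) (connDirac_locfin e)

variable (M 𝒢 E) in
/-- The map onto the core. -/
def prodMap : ConnCore M 𝒢 E →ₗ[ℂ] (prodCore e M 𝒢 E μ).K := DiracCore.ofDenseMap _ _ _ _ _ _

lemma coe_prodMap (p : ConnCore M 𝒢 E) :
    (prodMap e M 𝒢 E μ p : LimitSpace M μ 𝒢 E) = connL2 M 𝒢 E μ p := rfl

lemma exists_prodMap_eq (u : (prodCore e M 𝒢 E μ).K) : ∃ p, prodMap e M 𝒢 E μ p = u :=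
  DiracCore.exists_ofDenseMap_eq u

lemma prodCore_D (γ : 𝒢.Site) (p : ConnCore M 𝒢 E) :
    (prodCore e M 𝒢 E μ).D γ (prodMap e M 𝒢 E μ p) =
      prodMap e M 𝒢 E μ (connDirac e M 𝒢 E γ p) :=
  DiracCore.ofDense_D γ p

lemma prodCore_A (a : 𝒢.Site → ℝ) (p : ConnCore M 𝒢 E) :
    (prodCore e M 𝒢 E μ).A a (prodMap e M 𝒢 E μ p) =
      prodMap e M 𝒢 E μ (∑ᶠ γ, (a γ : ℂ) • connDirac e M 𝒢 E γ p) :=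
  DiracCore.ofDense_A a p

end ProductCore

end AGN

end

noncomputable section

namespace AGN

set_option linter.unusedSectionVars false

section DiracOperator

variable {V : Type*} [NormedAddCommGroup V] [NormedSpace ℝ V] [FiniteDimensional ℝ V]
  {G : Type*} [Group G] [TopologicalSpace G] [ChartedSpace V G] [LieGroup 𝓘(ℝ, V) ∞ G]
  [IsTopologicalGroup G] [CompactSpace G] [SecondCountableTopology G]
  [MeasurableSpace G] [BorelSpace G]
  {S : Type*} [NormedAddCommGroup S] [InnerProductSpace ℂ S] [CompleteSpace S]
  {g : InvariantMetric V G} {q : ℕ}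
  (e : Module.Basis (Fin q) ℝ (GroupLieAlgebra 𝓘(ℝ, V) G)) {M : SpinorModule g.quadratic S}
  {𝒢 : GraphSystem} {E : Type*} [NormedAddCommGroup E] [InnerProductSpace ℂ E]

/-! ### The Dirac operators in terms of the core -/

lemma cliffordOp_single (γ : 𝒢.Site) (v : GroupLieAlgebra 𝓘(ℝ, V) G) (τ : Conf M 𝒢) (ξ : E) :
    cliffordOp M E γ v (Finsupp.single τ ξ) =
      ∑ σ ∈ (finite_siteClifford (M := M) γ v τ).toFinset,
        Finsupp.single σ (siteClifford M γ v σ τ • ξ) := by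
  classical
  ext ρ
  rw [cliffordOp_single_apply, Finsupp.finsetSum_apply]
  simp only [Finsupp.single_apply, Finset.sum_ite_eq', Set.Finite.mem_toFinset, Set.mem_ofPred_eq]
  split_ifs with h
  · rfl
  · rw [not_not] at h
    rw [← star_siteClifford, h, star_zero, zero_smul]

lemma connCore_induction {P : ConnCore M 𝒢 E → Prop} (h0 : P 0)
    (hadd : ∀ p p', P p → P p' → P (p + p')) (hs : ∀ w σ ξ, P (w ⊗ₜ Finsupp.single σ ξ))
    (p : ConnCore M 𝒢 E) : P p := by
  induction p using TensorProduct.induction_on with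
  | zero => exact h0
  | add a b ha hb => exact hadd a b ha hb
  | tmul w y =>
    induction y using Finsupp.induction_linear with
    | zero => rwa [TensorProduct.tmul_zero]
    | add a b ha hb =>
      rw [TensorProduct.tmul_add]
      exact hadd _ _ ha hb
    | single σ ξ => exact hs w σ ξ

lemma siteDirac_eq_sum (γ : 𝒢.Site) (f : Conf M 𝒢 → (𝒢.Site → G) → E) (τ : Conf M 𝒢)
    (x : 𝒢.Site → G) : siteDirac e M γ f τ x = (1 / Complex.I) • ∑ i,
      ∑ σ ∈ (finite_siteClifford (M := M) γ (e i) τ).toFinset,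
        siteClifford M γ (e i) τ σ • siteDeriv γ (e i) (f σ) x := by
  rw [siteDirac]
  congr 1
  refine Finset.sum_congr rfl fun i _ => finsum_eq_sum_of_support_subset _ fun σ hσ => ?_
  rw [Set.Finite.coe_toFinset]
  exact fun h => hσ (by simp [h])

lemma continuous_siteDirac {f : Conf M 𝒢 → (𝒢.Site → G) → E}
    (hf : ∀ σ, IsSmoothCylinder (V := V) 𝒢 (f σ)) (γ : 𝒢.Site) (τ : Conf M 𝒢) :
    Continuous (siteDirac e M γ f τ) := by
  rw [funext (siteDirac_eq_sum e γ f τ)]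
  exact (continuous_finsetSum _ fun i _ => continuous_finsetSum _ fun σ _ =>
    ((hf σ).continuous_siteDeriv γ (e i)).const_smul _).const_smul _

variable (μ : Measure G) [IsProbabilityMeasure μ] [μ.IsHaarMeasure]

lemma inner_connL2_cliffordOp {f : Conf M 𝒢 → (𝒢.Site → G) → E}
    (hf : ∀ σ, IsSmoothCylinder (V := V) 𝒢 (f σ)) {Ψ : LimitSpace M μ 𝒢 E}
    (hΨ : ∀ σ, Ψ σ =ᵐ[Measure.infinitePi fun _ : 𝒢.Site => μ] f σ) (γ : 𝒢.Site)
    (v : GroupLieAlgebra 𝓘(ℝ, V) G) (w : cylAlg V G 𝒢) (τ : Conf M 𝒢) (ξ : E) :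
    ⟪connL2 M 𝒢 E μ (cylDeriv γ v w ⊗ₜ cliffordOp M E γ v (Finsupp.single τ ξ)), Ψ⟫_ℂ =
      -∑ σ ∈ (finite_siteClifford (M := M) γ v τ).toFinset, siteClifford M γ v τ σ *
        ∫ x, ⟪(w : (𝒢.Site → G) → ℂ) x • ξ, siteDeriv γ v (f σ) x⟫_ℂ
          ∂Measure.infinitePi fun _ : 𝒢.Site => μ := by
  rw [cliffordOp_single, TensorProduct.tmul_sum, map_sum, sum_inner, ← Finset.sum_neg_distrib]
  refine Finset.sum_congr rfl fun σ _ => ?_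
  have h1 := integral_inner_siteDeriv μ (isSmoothCylinder_smul w ξ) (hf σ) γ v
  rw [siteDeriv_smul] at h1
  rw [← Finsupp.smul_single, TensorProduct.tmul_smul, map_smul, inner_smul_left, inner_connL2_single, ← mul_neg, ← h1]
  congr 1
  · exact star_siteClifford γ v τ σ
  · refine integral_congr_ae ?_
    filter_upwards [hΨ σ] with x hx
    rw [hx]

/-- One side is only a smooth cylinder family, not a core vector, so the operator is moved over by
integration by parts and the Hermitian matrix rather than by symmetry on the core. -/
lemma inner_connL2_connDirac_single {f : Conf M 𝒢 → (𝒢.Site → G) → E}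
    (hf : ∀ σ, IsSmoothCylinder (V := V) 𝒢 (f σ)) {Ψ : LimitSpace M μ 𝒢 E}
    (hΨ : ∀ σ, Ψ σ =ᵐ[Measure.infinitePi fun _ : 𝒢.Site => μ] f σ) (γ : 𝒢.Site)
    (w : cylAlg V G 𝒢) (τ : Conf M 𝒢) (ξ : E) :
    ⟪connL2 M 𝒢 E μ (connDirac e M 𝒢 E γ (w ⊗ₜ Finsupp.single τ ξ)), Ψ⟫_ℂ =
      ∫ x, ⟪(w : (𝒢.Site → G) → ℂ) x • ξ, siteDirac e M γ f τ x⟫_ℂ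
        ∂Measure.infinitePi fun _ : 𝒢.Site => μ := by
  have hc : ∀ i σ, Integrable (fun x => ⟪(w : (𝒢.Site → G) → ℂ) x • ξ,
      siteClifford M γ (e i) τ σ • siteDeriv γ (e i) (f σ) x⟫_ℂ)
      (Measure.infinitePi fun _ : 𝒢.Site => μ) := fun i σ =>
    integrable_conn μ ((isSmoothCylinder_smul w ξ).continuous.inner
      (((hf σ).continuous_siteDeriv γ (e i)).const_smul _))
  have h0 : ∀ x, ⟪(w : (𝒢.Site → G) → ℂ) x • ξ, siteDirac e M γ f τ x⟫_ℂ =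
      (1 / Complex.I) * ∑ i, ∑ σ ∈ (finite_siteClifford (M := M) γ (e i) τ).toFinset,
        ⟪(w : (𝒢.Site → G) → ℂ) x • ξ,
          siteClifford M γ (e i) τ σ • siteDeriv γ (e i) (f σ) x⟫_ℂ := fun x => by
    rw [siteDirac_eq_sum, inner_smul_right, inner_sum]
    simp only [inner_sum]
  simp only [h0]
  rw [integral_const_mul, integral_finsetSum _ fun i _ => integrable_finsetSum _ fun σ _ => hc i σ]
  rw [connDirac, tensorDirac_tmul, map_smul, map_sum, inner_smul_left, sum_inner,
    Finset.mul_sum, Finset.mul_sum]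
  refine Finset.sum_congr rfl fun i _ => ?_
  rw [integral_finsetSum _ fun σ _ => hc i σ]
  have h2 : ∀ σ, (∫ x, ⟪(w : (𝒢.Site → G) → ℂ) x • ξ,
      siteClifford M γ (e i) τ σ • siteDeriv γ (e i) (f σ) x⟫_ℂ
        ∂Measure.infinitePi fun _ : 𝒢.Site => μ) = siteClifford M γ (e i) τ σ *
      ∫ x, ⟪(w : (𝒢.Site → G) → ℂ) x • ξ, siteDeriv γ (e i) (f σ) x⟫_ℂ
        ∂Measure.infinitePi fun _ : 𝒢.Site => μ := fun σ => by
    rw [← integral_const_mul]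
    simp only [inner_smul_right]
  simp only [h2]
  have h1 := inner_connL2_cliffordOp μ hf hΨ γ (e i) w τ ξ
  refine (congrArg (_ * ·) h1).trans ?_
  rw [mul_neg, ← neg_mul]
  congr 1
  simp

variable [T2Space G] [FiniteDimensional ℂ E]

lemma exists_finset_connDirac (p : ConnCore M 𝒢 E) :
    ∃ s : Finset 𝒢.Site, ∀ γ ∉ s, connDirac e M 𝒢 E γ p = 0 := by
  obtain ⟨U, hp, -, -, hf⟩ := connDirac_locfin e p
  refine ⟨hf.toFinset, fun γ hγ => ?_⟩
  by_contra h
  exact hγ (hf.mem_toFinset.2 ⟨p, hp, h⟩)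

lemma finsum_smul_eq_sum {κ F : Type*} [AddCommGroup F] [Module ℂ F] (a : κ → ℂ) {z : κ → F}
    {s : Finset κ} (h : ∀ γ ∉ s, z γ = 0) : ∑ᶠ γ, a γ • z γ = ∑ γ ∈ s, a γ • z γ :=
  finsum_eq_sum_of_support_subset _ fun γ hγ => by
    by_contra h'
    exact hγ (by simp [h γ h'])

lemma exists_finset_siteDirac {f : Conf M 𝒢 → (𝒢.Site → G) → E} (hfin : {σ | f σ ≠ 0}.Finite)
    (hf : ∀ σ, IsSmoothCylinder (V := V) 𝒢 (f σ)) :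
    ∃ s : Finset 𝒢.Site, ∀ γ ∉ s, ∀ τ x, siteDirac e M γ f τ x = 0 := by
  classical
  choose t ht using fun σ => (hf σ).exists_siteDeriv_eq_zero
  refine ⟨hfin.toFinset.biUnion t, fun γ hγ τ x => ?_⟩
  have h1 : ∀ i σ, siteDeriv γ (e i) (f σ) x = 0 := fun i σ => by
    by_cases h : f σ = 0
    · rw [h]
      exact congrFun (leftDeriv_const (V := V) (G := G) (0 : E) (e i)) (x γ)
    · rw [ht σ γ (fun h' => hγ (Finset.mem_biUnion.2 ⟨σ, hfin.mem_toFinset.2 h, h'⟩))]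
      rfl
  simp [siteDirac, h1]

variable (M 𝒢 E) in
-- Core vectors are smooth cylinder families, and by `inner_connL2_connDirac_single` smooth cylinder
-- families lie in the domain of the adjoint; the sandwich `closedOperator_eq_op` applies.
theorem diracOperator_eq_op (a : ℕ → ℝ) : diracOperator e M μ 𝒢 E a =
    (prodCore e M 𝒢 E μ).op fun γ => a (𝒢.level γ) := by
  refine DiracCore.closedOperator_eq_op _ _ _ ?_ ?_
  · intro u
    obtain ⟨p, rfl⟩ := exists_prodMap_eq e μ u
    obtain ⟨s, hs⟩ := exists_finset_connDirac e p
    refine ⟨fun σ => connFun M 𝒢 E p σ, ?_, isSmoothCylinder_connFun p, coeFn_connL2 μ p,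
      fun τ => ?_⟩
    · refine (connFun M 𝒢 E p).hasFiniteSupport.subset fun σ hσ h => hσ ?_
      simp only [h]
      rfl
    · rw [prodCore_A, coe_prodMap, finsum_smul_eq_sum _ hs]
      refine (coeFn_connL2 μ _ τ).trans (Eventually.of_forall fun x => ?_)
      rw [map_sum, Finsupp.finsetSum_apply, ContinuousMap.sum_apply]
      refine Eq.trans (Finset.sum_congr rfl fun γ _ => ?_) (finsum_smul_eq_sum
        (fun γ => (a (𝒢.level γ) : ℂ)) (s := s) fun γ hγ => ?_).symm
      · rw [map_smul, Finsupp.smul_apply, ContinuousMap.smul_apply, connFun_connDirac]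
      · rw [← connFun_connDirac, hs γ hγ, map_zero]
        rfl
  · rintro ⟨Ψ, Φ⟩ ⟨f, hfin, hf, h1, h2⟩
    rw [DiracCore.mem_G]
    intro u
    obtain ⟨p, rfl⟩ := exists_prodMap_eq e μ u
    obtain ⟨s, hs⟩ := exists_finset_connDirac e p
    obtain ⟨s', hs'⟩ := exists_finset_siteDirac e hfin hf
    -- The core vector and the smooth family are moved by different finite sets s and s' of
    -- generators. Pairings at generators outside either set vanish, so the sums over s and s'
    -- agree.
    have h3 : ∀ γ ∉ s', ⟪connL2 M 𝒢 E μ (connDirac e M 𝒢 E γ p), Ψ⟫_ℂ = 0 := fun γ hγ => by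
      refine connCore_induction (P := fun p => ⟪connL2 M 𝒢 E μ (connDirac e M 𝒢 E γ p), Ψ⟫_ℂ = 0)
        ?_ ?_ (fun w τ ξ => ?_) p
      · simp
      · intro p p' h h'
        rw [map_add, map_add, inner_add_left, h, h', add_zero]
      · rw [inner_connL2_connDirac_single e μ hf h1]
        simp [hs' γ hγ]
    have h4 : ⟪connL2 M 𝒢 E μ p, Φ⟫_ℂ = ∑ γ ∈ s', (a (𝒢.level γ) : ℂ) *
        ⟪connL2 M 𝒢 E μ (connDirac e M 𝒢 E γ p), Ψ⟫_ℂ := by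
      refine connCore_induction (P := fun p => ⟪connL2 M 𝒢 E μ p, Φ⟫_ℂ =
        ∑ γ ∈ s', (a (𝒢.level γ) : ℂ) * ⟪connL2 M 𝒢 E μ (connDirac e M 𝒢 E γ p), Ψ⟫_ℂ)
        ?_ ?_ (fun w τ ξ => ?_) p
      · simp
      · intro p p' h h'
        simp only [map_add, inner_add_left, h, h', mul_add, Finset.sum_add_distrib]
      · rw [inner_connL2_single]
        have h5 : ∀ γ, Integrable (fun x => (a (𝒢.level γ) : ℂ) *
            ⟪(w : (𝒢.Site → G) → ℂ) x • ξ, siteDirac e M γ f τ x⟫_ℂ)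
            (Measure.infinitePi fun _ : 𝒢.Site => μ) := fun γ =>
          (integrable_conn μ ((isSmoothCylinder_smul w ξ).continuous.inner
            (continuous_siteDirac e hf γ τ))).const_mul _
        refine (integral_congr_ae ?_).trans ((integral_finsetSum s' fun γ _ => h5 γ).trans ?_)
        · filter_upwards [h2 τ] with x hx
          rw [hx, finsum_smul_eq_sum (fun γ => (a (𝒢.level γ) : ℂ)) fun γ hγ => hs' γ hγ τ x,
            inner_sum]
          simp only [inner_smul_right]
        · refine Finset.sum_congr rfl fun γ _ => ?_
          rw [integral_const_mul, inner_connL2_connDirac_single e μ hf h1]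
    rw [prodCore_A, coe_prodMap, coe_prodMap, finsum_smul_eq_sum _ hs]
    rw [← inner_conj_symm, ← inner_conj_symm Ψ]
    congr 1
    rw [map_sum, sum_inner]
    simp only [map_smul, inner_smul_left, Complex.conj_ofReal]
    refine h4.trans ((finsum_smul_eq_sum (fun γ => (a (𝒢.level γ) : ℂ)) h3).symm.trans
      (finsum_smul_eq_sum (fun γ => (a (𝒢.level γ) : ℂ)) fun γ hγ => ?_))
    rw [hs γ hγ, map_zero, inner_zero_left]

end DiracOperator

end AGN

end

noncomputable section

namespace AGN

set_option linter.unusedSectionVars false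

section ProductGap

variable {V : Type*} [NormedAddCommGroup V] [NormedSpace ℝ V] [FiniteDimensional ℝ V]
  {G : Type*} [Group G] [TopologicalSpace G] [ChartedSpace V G] [LieGroup 𝓘(ℝ, V) ∞ G]
  [IsTopologicalGroup G] [CompactSpace G] [SecondCountableTopology G]
  [MeasurableSpace G] [BorelSpace G]
  {S : Type*} [NormedAddCommGroup S] [InnerProductSpace ℂ S] [CompleteSpace S]
  {g : InvariantMetric V G} {q : ℕ}
  (e : Module.Basis (Fin q) ℝ (GroupLieAlgebra 𝓘(ℝ, V) G)) {M : SpinorModule g.quadratic S}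
  {𝒢 : GraphSystem} {E : Type*} [NormedAddCommGroup E] [InnerProductSpace ℂ E]

/-! ### The spectral gap of the Dirac operators of the generators -/

variable (M 𝒢 E) in
/-- The ungraded form of the Dirac operator at `γ`. -/
def ungradedDirac (γ : 𝒢.Site) : Module.End ℂ (ConnCore M 𝒢 E) :=
  tensorDirac (fun (γ : 𝒢.Site) i => (cylDeriv γ (e i)).toLinearMap)
    (fun γ i => siteOp M E γ (M.c (e i))) γ

lemma connDirac_sq (γ : 𝒢.Site) :
    connDirac e M 𝒢 E γ * connDirac e M 𝒢 E γ =
      ungradedDirac e M 𝒢 E γ * ungradedDirac e M 𝒢 E γ := by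
  rw [connDirac, ungradedDirac, tensorDirac_mul, tensorDirac_mul]
  simp only [cliffordOp_mul]

/-- Restriction of a family to one tensor factor. -/
def connSlice (γ : 𝒢.Site) (x : 𝒢.Site → G) (τ : Conf M 𝒢) (ξ : E) :
    ConnCore M 𝒢 E →ₗ[ℂ] repAlg V G ⊗[ℂ] S :=
  TensorProduct.map (updateAlg V γ x).toLinearMap (spinorSlice γ τ ξ)

lemma connSlice_tmul (γ : 𝒢.Site) (x : 𝒢.Site → G) (τ : Conf M 𝒢) (ξ : E) (w : cylAlg V G 𝒢)
    (y : Conf M 𝒢 →₀ E) :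
    connSlice γ x τ ξ (w ⊗ₜ y) = updateAlg V γ x w ⊗ₜ spinorSlice γ τ ξ y := rfl

lemma connSlice_ungradedDirac (γ : 𝒢.Site) (x : 𝒢.Site → G) (τ : Conf M 𝒢) (ξ : E)
    (p : ConnCore M 𝒢 E) :
    connSlice γ x τ ξ (ungradedDirac e M 𝒢 E γ p) = repDirac e M (connSlice γ x τ ξ p) := by
  induction p using TensorProduct.induction_on with
  | zero => simp only [map_zero]
  | add a b ha hb => simp only [map_add, ha, hb]
  | tmul w y =>
    rw [connSlice_tmul, ungradedDirac, repDirac, tensorDirac_tmul, tensorDirac_tmul, map_smul,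
      map_sum]
    congr 1
    refine Finset.sum_congr rfl fun i _ => ?_
    rw [connSlice_tmul, spinorSlice_siteOp]
    exact congrArg (· ⊗ₜ[ℂ] _) (updateAlg_cylDeriv γ x (e i) w)

lemma repFun_connSlice (γ : 𝒢.Site) (x : 𝒢.Site → G) (τ : Conf M 𝒢) (ξ : E)
    (p : ConnCore M 𝒢 E) (y : G) : repFun V G S (connSlice γ x τ ξ p) y =
      ∑ k, ⟪ξ, connFun M 𝒢 E p (τ.update γ k) (Function.update x γ y)⟫_ℂ • M.basis k := by
  induction p using TensorProduct.induction_on with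
  | zero => simp
  | add a b ha hb =>
    simp only [map_add, ContinuousMap.add_apply, Finsupp.add_apply, inner_add_right, add_smul,
      Finset.sum_add_distrib, ha, hb]
  | tmul w z =>
    rw [connSlice_tmul, repFun_tmul, spinorSlice_apply, updateAlg_apply, Finset.smul_sum]
    simp only [connFun_tmul_apply, inner_smul_right, smul_smul]

/-- Slice at a point and a label where p does not vanish, against the value ξ of p there: one
coefficient of the slice is then ⟪ξ, ξ⟫. -/
lemma exists_repFun_connSlice_ne_zero [Nonempty 𝒢.Site] {p : ConnCore M 𝒢 E}
    (hp : connFun M 𝒢 E p ≠ 0) (γ : 𝒢.Site) :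
    ∃ (x : 𝒢.Site → G) (τ : Conf M 𝒢) (ξ : E), repFun V G S (connSlice γ x τ ξ p) ≠ 0 := by
  obtain ⟨σ, hσ⟩ := Finsupp.ne_iff.1 hp
  obtain ⟨x, hx⟩ := DFunLike.ne_iff.1 hσ
  refine ⟨x, σ, connFun M 𝒢 E p σ x, fun h => hx ?_⟩
  have h1 := DFunLike.congr_fun h (x γ)
  rw [repFun_connSlice, Function.update_eq_self] at h1
  have h2 := congrArg (fun s => ⟪M.basis (σ γ), s⟫_ℂ) h1
  simp only [inner_sum, inner_smul_right, orthonormal_iff_ite.1 M.basis.orthonormal, mul_ite,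
    mul_one, mul_zero, Finset.sum_ite_eq, Finset.mem_univ, if_true, Finsupp.update_self,
    ContinuousMap.zero_apply, inner_zero_right] at h2
  exact inner_self_eq_zero.1 h2

variable (μ : Measure G) [IsProbabilityMeasure μ] [μ.IsHaarMeasure]

lemma connL2_eq_zero {p : ConnCore M 𝒢 E} : connL2 M 𝒢 E μ p = 0 ↔ connFun M 𝒢 E p = 0 := by
  constructor
  · intro h
    ext σ : 1
    refine ContinuousMap.toLp_injective (𝕜 := ℂ) (p := 2)
      (Measure.infinitePi fun _ : 𝒢.Site => μ) ?_
    rw [← connL2_apply, h, Finsupp.zero_apply, map_zero]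
    rfl
  · intro h
    ext σ : 2
    rw [connL2_apply, h, Finsupp.zero_apply, map_zero]
    rfl

variable [T2Space G] [FiniteDimensional ℂ E]

/-- The square of D_γ does not see the gradings, and slicing intertwines its ungraded form with the
basic Dirac operator. Some slice of a non-zero eigenvector is non-zero, hence an eigenvector of D²
for the same l. -/
lemma gap_prodCore {c : ℝ} (hc : ∀ l p, IsRepEigenvector e M l p → l = 0 ∨ 1 / c ≤ l) :
    (prodCore e M 𝒢 E μ).Gap c := by
  intro γ l u hu h
  obtain ⟨p, rfl⟩ := exists_prodMap_eq e μ u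
  have h0 : connFun M 𝒢 E p ≠ 0 := fun h0 =>
    hu (Subtype.ext ((connL2_eq_zero μ).2 h0))
  rw [prodCore_D, prodCore_D, ← map_smul, ← sub_eq_zero, ← map_sub] at h
  have h1 := (connL2_eq_zero μ).1 (congrArg Subtype.val h)
  have : Nonempty 𝒢.Site := ⟨γ⟩
  obtain ⟨x, τ, ξ, hne⟩ := exists_repFun_connSlice_ne_zero h0 γ
  refine hc l _ ⟨hne, ?_⟩
  rw [← connSlice_ungradedDirac, ← connSlice_ungradedDirac, ← sub_eq_zero, ← map_smul, ← map_smul,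
    ← map_sub, ← map_sub]
  have h2 := LinearMap.congr_fun (connDirac_sq (M := M) (𝒢 := 𝒢) (E := E) e γ) p
  rw [Module.End.mul_apply, Module.End.mul_apply] at h2
  rw [← h2]
  ext y
  rw [repFun_connSlice, h1]
  simp

end ProductGap

end AGN

end

noncomputable section

namespace AGN

set_option linter.unusedSectionVars false

section Extension

variable {κ : Type*} {F : Type*} [NormedAddCommGroup F] [InnerProductSpace ℂ F] [CompleteSpace F]

/-! ### Bounded operators on the Hilbert sum -/

/-- The extension of a bounded operator on finitely supported families. -/
def lpExtend (A : Module.End ℂ (κ →₀ F)) : lp (fun _ : κ => F) 2 →L[ℂ] lp (fun _ : κ => F) 2 :=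
  (finLp κ F ∘ₗ A).extendOfNorm (finLp κ F)

lemma lpExtend_finLp {A : Module.End ℂ (κ →₀ F)}
    (hA : ∃ C : ℝ, ∀ y, ‖finLp κ F (A y)‖ ≤ C * ‖finLp κ F y‖) (y : κ →₀ F) :
    lpExtend A (finLp κ F y) = finLp κ F (A y) :=
  LinearMap.extendOfNorm_eq denseRange_finLp hA y

lemma lpExtend_apply {A : Module.End ℂ (κ →₀ F)}
    (hA : ∃ C : ℝ, ∀ y, ‖finLp κ F (A y)‖ ≤ C * ‖finLp κ F y‖) {τ : κ}
    {φ : lp (fun _ : κ => F) 2 → F} (hφ : Continuous φ) (h : ∀ y, A y τ = φ (finLp κ F y))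
    (Ψ : lp (fun _ : κ => F) 2) : lpExtend A Ψ τ = φ Ψ := by
  have hc : Continuous fun Ψ : lp (fun _ : κ => F) 2 => Ψ τ :=
    (lp.evalCLM ℂ (fun _ : κ => F) 2 τ).continuous
  refine denseRange_finLp.induction_on (p := fun Ψ => lpExtend A Ψ τ = φ Ψ) Ψ
    (isClosed_eq (hc.comp (lpExtend A).continuous) hφ) fun y => ?_
  rw [lpExtend_finLp hA, finLp_apply, h]

/-- A bounded operator applied to each component. -/
def lpMap (B : F →L[ℂ] F) : lp (fun _ : κ => F) 2 →L[ℂ] lp (fun _ : κ => F) 2 :=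
  lpExtend (Finsupp.mapRange.linearMap B.toLinearMap)

lemma lpMap_bound (B : F →L[ℂ] F) : ∃ C : ℝ, ∀ y : κ →₀ F,
    ‖finLp κ F (Finsupp.mapRange.linearMap B.toLinearMap y)‖ ≤ C * ‖finLp κ F y‖ := by
  refine ⟨‖B‖, fun y => ?_⟩
  have h : ‖(‖B‖ : ℂ) • finLp κ F y‖ = ‖B‖ * ‖finLp κ F y‖ := by
    rw [norm_smul, Complex.norm_real, norm_norm]
  rw [← h]
  refine lp.norm_mono (by norm_num) fun σ => ?_
  refine (B.le_opNorm (y σ)).trans_eq ?_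
  change _ = ‖(‖B‖ : ℂ) • y σ‖
  rw [norm_smul, Complex.norm_real, norm_norm]

lemma lpMap_finLp_single (B : F →L[ℂ] F) (σ : κ) (ξ : F) :
    lpMap B (finLp κ F (Finsupp.single σ ξ)) = finLp κ F (Finsupp.single σ (B ξ)) := by
  rw [lpMap, lpExtend_finLp (lpMap_bound B), Finsupp.mapRange.linearMap_apply,
    Finsupp.mapRange_single]
  rfl

lemma lpMap_apply (B : F →L[ℂ] F) (Ψ : lp (fun _ : κ => F) 2) (τ : κ) :
    lpMap B Ψ τ = B (Ψ τ) :=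
  lpExtend_apply (lpMap_bound B)
    (B.continuous.comp (lp.evalCLM ℂ (fun _ : κ => F) 2 τ).continuous)
    (fun _ => rfl) Ψ

/-- Commutation with the rank-one operators f₀ ↦ f determines A f from A f₀. -/
lemma exists_scalar_of_commute {A : F →ₗ[ℂ] F} (h : ∀ B : F →L[ℂ] F, ∀ f, A (B f) = B (A f)) :
    ∃ t : ℂ, ∀ f, A f = t • f := by
  by_cases h0 : ∃ f₀ : F, f₀ ≠ 0
  · obtain ⟨f₀, h0⟩ := h0
    have h1 : ⟪f₀, f₀⟫_ℂ ≠ 0 := inner_self_ne_zero.2 h0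
    refine ⟨⟪f₀, A f₀⟫_ℂ / ⟪f₀, f₀⟫_ℂ, fun f => ?_⟩
    have h2 := h ((innerSL ℂ f₀).smulRight f) f₀
    simp only [ContinuousLinearMap.smulRight_apply, innerSL_apply_apply, map_smul] at h2
    rw [div_eq_inv_mul, ← smul_smul, ← h2, smul_smul, inv_mul_cancel₀ h1, one_smul]
  · push Not at h0
    exact ⟨0, fun f => by rw [h0 f, map_zero, smul_zero]⟩

lemma exists_scalar_of_commute_lpMap {T : lp (fun _ : κ => F) 2 →L[ℂ] lp (fun _ : κ => F) 2}
    (hT : ∀ B : F →L[ℂ] F, T * lpMap B = lpMap B * T) (σ τ : κ) :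
    ∃ t : ℂ, ∀ f : F, T (finLp κ F (Finsupp.single σ f)) τ = t • f := by
  refine exists_scalar_of_commute (A := (lp.evalCLM ℂ (fun _ : κ => F) 2 τ).toLinearMap ∘ₗ
    T.toLinearMap ∘ₗ finLp κ F ∘ₗ Finsupp.lsingle σ) fun B f => ?_
  have h1 := congrArg (fun A => A (finLp κ F (Finsupp.single σ f))) (hT B)
  simp only [mul_apply_eq_comp, lpMap_finLp_single] at h1
  exact (congrArg (fun Ψ : lp (fun _ : κ => F) 2 => Ψ τ) h1).trans (lpMap_apply B _ τ)

end Extension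

section Commutant

variable {V : Type*} [NormedAddCommGroup V] [NormedSpace ℝ V]
  {G : Type*} [Group G] [TopologicalSpace G] [ChartedSpace V G]
  {S : Type*} [NormedAddCommGroup S] [InnerProductSpace ℂ S] [CompleteSpace S]
  {g : InvariantMetric V G} {M : SpinorModule g.quadratic S}
  {𝒢 : GraphSystem} {F : Type*} [NormedAddCommGroup F] [InnerProductSpace ℂ F]

/-! ### The Clifford algebra on the limit Hilbert space -/

lemma siteOp_smul (γ : 𝒢.Site) (z : ℂ) (T : S →L[ℂ] S) (y : Conf M 𝒢 →₀ F) :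
    siteOp M F γ (z • T) y = z • siteOp M F γ T y := by
  induction y using Finsupp.induction_linear with
  | zero => simp
  | add a b ha hb => rw [map_add, map_add, ha, hb, smul_add]
  | single σ ξ =>
    simp only [siteOp_single, Finset.smul_sum, smul_smul, _root_.smul_apply, inner_smul_right]

lemma cliffordOp_sq (γ : 𝒢.Site) (v : GroupLieAlgebra 𝓘(ℝ, V) G) (y : Conf M 𝒢 →₀ F) :
    cliffordOp M F γ v (cliffordOp M F γ v y) = ((g.form v v : ℝ) : ℂ) • y := by
  have h1 : M.c v * M.c v = ((g.form v v : ℝ) : ℂ) • (1 : S →L[ℂ] S) := by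
    have h2 := M.c_mul_add v v
    have h3 : QuadraticMap.polar g.quadratic v v = _ := LinearMap.BilinMap.polar_toQuadraticMap v v
    rw [h3, ← two_smul ℂ, ← two_mul, Complex.ofReal_mul, ← smul_smul] at h2
    exact smul_right_injective _ (two_ne_zero (α := ℂ)) h2
  rw [← Module.End.mul_apply, cliffordOp_mul, siteOp_mul, h1, siteOp_smul, siteOp_one,
    Module.End.one_apply]

/-- Clifford multiplication is symmetric with scalar square, hence bounded, and extends to the
Hilbert space. -/
lemma norm_cliffordOp (γ : 𝒢.Site) (v : GroupLieAlgebra 𝓘(ℝ, V) G) (y : Conf M 𝒢 →₀ F) :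
    ‖finLp _ F (cliffordOp M F γ v y)‖ ^ 2 = g.form v v * ‖finLp _ F y‖ ^ 2 := by
  have h := isFinSymmetric_cliffordOp (M := M) (F := F) γ v (cliffordOp M F γ v y) y
  rw [cliffordOp_sq, map_smul, inner_smul_left, Complex.conj_ofReal, inner_self_eq_norm_sq_to_K,
    inner_self_eq_norm_sq_to_K] at h
  exact Complex.ofReal_injective (by
    rw [Complex.ofReal_mul, Complex.ofReal_pow, Complex.ofReal_pow]; exact h.symm)

lemma cliffordOp_bound (γ : 𝒢.Site) (v : GroupLieAlgebra 𝓘(ℝ, V) G) :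
    ∃ C : ℝ, ∀ y : Conf M 𝒢 →₀ F, ‖finLp _ F (cliffordOp M F γ v y)‖ ≤ C * ‖finLp _ F y‖ := by
  have h0 : 0 ≤ g.form v v := by
    rcases eq_or_ne v 0 with rfl | h
    · simp
    · exact (g.pos v h).le
  refine ⟨√(g.form v v), fun y =>
    (pow_le_pow_iff_left₀ (norm_nonneg _) (by positivity) two_ne_zero).1 ?_⟩
  rw [norm_cliffordOp, mul_pow, Real.sq_sqrt h0]

variable [CompleteSpace F]

variable (M 𝒢 F) in
/-- Clifford multiplication by a vector in the copy of the Lie algebra at `γ`, as a bounded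
operator. -/
def cliffordLp (γ : 𝒢.Site) (v : GroupLieAlgebra 𝓘(ℝ, V) G) :
    lp (fun _ : Conf M 𝒢 => F) 2 →L[ℂ] lp (fun _ : Conf M 𝒢 => F) 2 :=
  lpExtend (cliffordOp M F γ v)

lemma cliffordLp_finLp (γ : 𝒢.Site) (v : GroupLieAlgebra 𝓘(ℝ, V) G) (y : Conf M 𝒢 →₀ F) :
    cliffordLp M 𝒢 F γ v (finLp _ F y) = finLp _ F (cliffordOp M F γ v y) :=
  lpExtend_finLp (cliffordOp_bound γ v) y

lemma cliffordLp_apply (γ : 𝒢.Site) (v : GroupLieAlgebra 𝓘(ℝ, V) G)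
    (Ψ : lp (fun _ : Conf M 𝒢 => F) 2) (τ : Conf M 𝒢) :
    cliffordLp M 𝒢 F γ v Ψ τ = ∑ᶠ σ, siteClifford M γ v τ σ • Ψ σ := by
  refine lpExtend_apply (φ := fun Ψ => ∑ᶠ σ, siteClifford M γ v τ σ • Ψ σ)
    (cliffordOp_bound γ v) ?_ (fun y => cliffordOp_apply γ v y τ) Ψ
  have h : (fun Ψ : lp (fun _ : Conf M 𝒢 => F) 2 => ∑ᶠ σ, siteClifford M γ v τ σ • Ψ σ) =
      fun Ψ => ∑ σ ∈ (finite_siteClifford (M := M) γ v τ).toFinset,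
        siteClifford M γ v τ σ • Ψ σ := by
    funext Ψ
    refine finsum_eq_sum_of_support_subset _ fun σ hσ => ?_
    rw [Set.Finite.coe_toFinset]
    exact fun h => hσ (by simp [h])
  rw [h]
  exact continuous_finsetSum _ fun σ _ =>
    (lp.evalCLM ℂ (fun _ : Conf M 𝒢 => F) 2 σ).continuous.const_smul _

lemma inner_cliffordLp (γ : 𝒢.Site) (v : GroupLieAlgebra 𝓘(ℝ, V) G)
    (Ψ Φ : lp (fun _ : Conf M 𝒢 => F) 2) :
    ⟪cliffordLp M 𝒢 F γ v Ψ, Φ⟫_ℂ = ⟪Ψ, cliffordLp M 𝒢 F γ v Φ⟫_ℂ := by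
  refine denseRange_finLp.induction_on (p := fun Ψ => ⟪cliffordLp M 𝒢 F γ v Ψ, Φ⟫_ℂ =
    ⟪Ψ, cliffordLp M 𝒢 F γ v Φ⟫_ℂ) Ψ (isClosed_eq (by fun_prop) (by fun_prop)) fun y => ?_
  refine denseRange_finLp.induction_on (p := fun Φ => ⟪cliffordLp M 𝒢 F γ v (finLp _ F y), Φ⟫_ℂ =
    ⟪finLp _ F y, cliffordLp M 𝒢 F γ v Φ⟫_ℂ) Φ (isClosed_eq (by fun_prop) (by fun_prop)) fun y' => ?_
  rw [cliffordLp_finLp, cliffordLp_finLp, isFinSymmetric_cliffordOp]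

end Commutant

end AGN

end

noncomputable section

namespace AGN

set_option linter.unusedSectionVars false

section Membership

variable {V : Type*} [NormedAddCommGroup V] [NormedSpace ℝ V]
  {G : Type*} [Group G] [TopologicalSpace G] [ChartedSpace V G] [MeasurableSpace G]
  {μ : Measure G} [IsProbabilityMeasure μ]
  {S : Type*} [NormedAddCommGroup S] [InnerProductSpace ℂ S] [CompleteSpace S]
  {g : InvariantMetric V G} {M : SpinorModule g.quadratic S}
  {𝒢 : GraphSystem} {E : Type*} [NormedAddCommGroup E] [InnerProductSpace ℂ E] [CompleteSpace E]

/-! ### The von Neumann algebra -/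

/-- Double commutant: the commutant of the generators is closed under adjoints, so commuting with
its elements T already includes their adjoints. -/
lemma mem_vonNeumann {A : LimitSpace M μ 𝒢 E →L[ℂ] LimitSpace M μ 𝒢 E}
    (h : ∀ T : LimitSpace M μ 𝒢 E →L[ℂ] LimitSpace M μ 𝒢 E,
      (∀ B : L2Conn μ 𝒢 E →L[ℂ] L2Conn μ 𝒢 E, T * lpMap B = lpMap B * T) →
      (∀ γ v, T * cliffordLp M 𝒢 (L2Conn μ 𝒢 E) γ v = cliffordLp M 𝒢 (L2Conn μ 𝒢 E) γ v * T) →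
      T * A = A * T) : A ∈ vonNeumann M μ 𝒢 E := by
  let s : Set (LimitSpace M μ 𝒢 E →L[ℂ] LimitSpace M μ 𝒢 E) :=
    {T | ∃ B : L2Conn μ 𝒢 E →L[ℂ] L2Conn μ 𝒢 E, ∀ Ψ σ, (T Ψ) σ = B (Ψ σ)} ∪
      {T | ∃ (γ : 𝒢.Site) (v : GroupLieAlgebra 𝓘(ℝ, V) G), ∀ Ψ τ,
        (T Ψ) τ = ∑ᶠ σ, siteClifford M γ v τ σ • Ψ σ}
  have hs : ∀ T ∈ StarSubalgebra.centralizer ℂ s, T * A = A * T := fun T hT => by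
    have hT' := fun B hB => (StarSubalgebra.mem_centralizer_iff ℂ |>.1 hT B hB).1.symm
    refine h T (fun B => hT' _ (Or.inl ⟨B, fun Ψ σ => lpMap_apply B Ψ σ⟩)) fun γ v =>
      hT' _ (Or.inr ⟨γ, v, fun Ψ τ => cliffordLp_apply γ v Ψ τ⟩)
  change A ∈ StarSubalgebra.centralizer ℂ (StarSubalgebra.centralizer ℂ s : Set _)
  rw [StarSubalgebra.mem_centralizer_iff]
  exact fun T hT => ⟨hs T hT, hs _ (star_mem hT)⟩

end Membership

section Main

variable {V : Type*} [NormedAddCommGroup V] [NormedSpace ℝ V] [FiniteDimensional ℝ V]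
  {G : Type*} [Group G] [TopologicalSpace G] [ChartedSpace V G] [LieGroup 𝓘(ℝ, V) ∞ G]
  [IsTopologicalGroup G] [CompactSpace G] [SecondCountableTopology G]
  [MeasurableSpace G] [BorelSpace G]
  {S : Type*} [NormedAddCommGroup S] [InnerProductSpace ℂ S] [CompleteSpace S]
  {g : InvariantMetric V G} {q : ℕ}
  (e : Module.Basis (Fin q) ℝ (GroupLieAlgebra 𝓘(ℝ, V) G)) {M : SpinorModule g.quadratic S}
  {𝒢 : GraphSystem} {E : Type*} [NormedAddCommGroup E] [InnerProductSpace ℂ E]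
  (μ : Measure G) [IsProbabilityMeasure μ] [μ.IsHaarMeasure]

/-! ### The commutant and the Dirac operators -/

lemma connL2_cliffordOp [CompleteSpace E] (w : cylAlg V G 𝒢) (y : Conf M 𝒢 →₀ E) (γ : 𝒢.Site)
    (v : GroupLieAlgebra 𝓘(ℝ, V) G) :
    connL2 M 𝒢 E μ (w ⊗ₜ cliffordOp M E γ v y) =
      cliffordLp M 𝒢 (L2Conn μ 𝒢 E) γ v (connL2 M 𝒢 E μ (w ⊗ₜ y)) := by
  induction y using Finsupp.induction_linear with
  | zero => simp
  | add a b ha hb => simp only [map_add, TensorProduct.tmul_add, ha, hb]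
  | single σ ξ =>
    rw [connL2_single, cliffordLp_finLp]
    ext τ : 2
    rw [connL2_apply, connFun_tmul, finLp_apply, cliffordOp_single_apply, cliffordOp_single_apply,
      TensorProduct.tmul_smul, map_smul, map_smul]

/-- By `exists_scalar_of_commute_lpMap` the matrix entries of T are scalars, which leave the
function part untouched. The claim is then integration by parts in each entry. -/
lemma inner_commutant_cylDeriv [CompleteSpace E]
    {T : LimitSpace M μ 𝒢 E →L[ℂ] LimitSpace M μ 𝒢 E}
    (hT : ∀ B : L2Conn μ 𝒢 E →L[ℂ] L2Conn μ 𝒢 E, T * lpMap B = lpMap B * T)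
    (γ : 𝒢.Site) (v : GroupLieAlgebra 𝓘(ℝ, V) G) (w w' : cylAlg V G 𝒢) (y z : Conf M 𝒢 →₀ E) :
    ⟪T (connL2 M 𝒢 E μ (cylDeriv γ v w ⊗ₜ y)), connL2 M 𝒢 E μ (w' ⊗ₜ z)⟫_ℂ =
      -⟪T (connL2 M 𝒢 E μ (w ⊗ₜ y)), connL2 M 𝒢 E μ (cylDeriv γ v w' ⊗ₜ z)⟫_ℂ := by
  induction y using Finsupp.induction_linear with
  | zero => simp
  | add a b ha hb =>
    simp only [map_add, TensorProduct.tmul_add, inner_add_left, ha, hb, neg_add]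
  | single σ ξ =>
    induction z using Finsupp.induction_linear with
    | zero => simp
    | add a b ha hb => simp only [map_add, TensorProduct.tmul_add, inner_add_right, ha, hb, neg_add]
    | single τ η =>
      obtain ⟨t, ht⟩ := exists_scalar_of_commute_lpMap hT σ τ
      have h : ∀ w w' : cylAlg V G 𝒢, ⟪T (connL2 M 𝒢 E μ (w ⊗ₜ Finsupp.single σ ξ)),
          connL2 M 𝒢 E μ (w' ⊗ₜ Finsupp.single τ η)⟫_ℂ = (starRingEnd ℂ) t *
            ∫ x, ⟪(w : (𝒢.Site → G) → ℂ) x • ξ, (w' : (𝒢.Site → G) → ℂ) x • η⟫_ℂ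
              ∂Measure.infinitePi fun _ : 𝒢.Site => μ := fun w w' => by
        rw [← inner_conj_symm, connL2_single, connL2_single, inner_finLp_single, ht,
          inner_conj_symm, inner_smul_left, inner_toLp_toLp]
        rfl
      rw [h, h, ← mul_neg]
      congr 1
      have h1 := integral_inner_siteDeriv μ (isSmoothCylinder_smul w ξ) (isSmoothCylinder_smul w' η)
        γ v
      rwa [siteDeriv_smul, siteDeriv_smul] at h1

lemma inner_commutant_connDirac [CompleteSpace E]
    {T : LimitSpace M μ 𝒢 E →L[ℂ] LimitSpace M μ 𝒢 E}
    (hT : ∀ B : L2Conn μ 𝒢 E →L[ℂ] L2Conn μ 𝒢 E, T * lpMap B = lpMap B * T)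
    (hT' : ∀ γ v, T * cliffordLp M 𝒢 (L2Conn μ 𝒢 E) γ v = cliffordLp M 𝒢 (L2Conn μ 𝒢 E) γ v * T)
    (γ : 𝒢.Site) (p p' : ConnCore M 𝒢 E) :
    ⟪T (connL2 M 𝒢 E μ (connDirac e M 𝒢 E γ p)), connL2 M 𝒢 E μ p'⟫_ℂ =
      ⟪T (connL2 M 𝒢 E μ p), connL2 M 𝒢 E μ (connDirac e M 𝒢 E γ p')⟫_ℂ := by
  refine tensorDirac_symm (j := T.toLinearMap ∘ₗ connL2 M 𝒢 E μ) (j' := connL2 M 𝒢 E μ)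
    (fun i w w' y y' => ?_) p p'
  change ⟪T (connL2 M 𝒢 E μ (cylDeriv γ (e i) w ⊗ₜ cliffordOp M E γ (e i) y)), _⟫_ℂ =
    -⟪T _, connL2 M 𝒢 E μ (cylDeriv γ (e i) w' ⊗ₜ cliffordOp M E γ (e i) y')⟫_ℂ
  rw [← inner_commutant_cylDeriv μ hT, connL2_cliffordOp, connL2_cliffordOp, ← mul_apply_eq_comp T,
    hT', mul_apply_eq_comp, inner_cliffordLp]

variable [T2Space G] [FiniteDimensional ℂ E] [CompleteSpace E]

/-- An operator T commuting with both sets of generators commutes weakly with each D_γ, and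
`commute_quotient` applies. -/
lemma quotient_mem_vonNeumann {c : ℝ} (hc : 0 < c) (hgap : (prodCore e M 𝒢 E μ).Gap c)
    {a b : 𝒢.Site → ℝ} {ε m : ℝ} (hε : 0 ≤ ε) (hm : 0 < m)
    (hb : ∀ γ, |b γ| ≤ m * |a γ| ^ (1 + ε)) :
    (prodCore e M 𝒢 E μ).quotient a b (1 + ε) ∈ vonNeumann M μ 𝒢 E := by
  refine mem_vonNeumann fun T hT hT' => ContinuousLinearMap.ext fun v => ?_
  refine (prodCore e M 𝒢 E μ).commute_quotient hc hgap hε hm hb (T := T) (fun γ u x => ?_) v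
  obtain ⟨p, rfl⟩ := exists_prodMap_eq e μ u
  obtain ⟨p', rfl⟩ := exists_prodMap_eq e μ x
  rw [prodCore_D, prodCore_D]
  exact inner_commutant_connDirac e μ hT hT' γ p p'

end Main

end AGN

end

noncomputable section

namespace AGN

lemma uniqueDiffOn_of_ordConnected {J : Set ℝ} (h : J.OrdConnected) (h' : J.Nontrivial) :
    UniqueDiffOn ℝ J := by
  refine uniqueDiffOn_convex h.convex ?_
  obtain ⟨x, hx, y, hy, hxy⟩ := h'.exists_lt
  refine (Set.nonempty_Ioo.2 hxy).mono (interior_maximal ?_ isOpen_Ioo)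
  exact Set.Ioo_subset_Icc_self.trans (h.out hx hy)

end AGN

end

/-! ### The main theorem. -/

theorem mainTheorem10
    {V : Type*} [NormedAddCommGroup V] [NormedSpace ℝ V] [FiniteDimensional ℝ V]
    {G : Type*} [Group G] [TopologicalSpace G] [ChartedSpace V G] [LieGroup 𝓘(ℝ, V) ∞ G]
    [T2Space G] [CompactSpace G] [ConnectedSpace G] [MeasurableSpace G] [BorelSpace G]
    (μ : Measure G) [μ.IsHaarMeasure] [IsProbabilityMeasure μ]
    (g : AGN.InvariantMetric V G)
    {q : ℕ} (e : Module.Basis (Fin q) ℝ (GroupLieAlgebra 𝓘(ℝ, V) G))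
    (he : ∀ i j, g.form (e i) (e j) = if i = j then 1 else 0)
    {S : Type*} [NormedAddCommGroup S] [InnerProductSpace ℂ S] [CompleteSpace S]
    (M : AGN.SpinorModule g.quadratic S)
    (E : Type*) [NormedAddCommGroup E] [InnerProductSpace ℂ E] [CompleteSpace E]
    [FiniteDimensional ℂ E] :
    ∃ c : ℝ, 0 < c ∧ (Nontrivial G → IsLeast (AGN.nonzeroEigenvaluesSq e M μ) (1 / c)) ∧
      ∀ (𝒢 : AGN.GraphSystem) (J : Set ℝ) (_ : J.OrdConnected) (_ : J.Nontrivial)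
        (a : ℕ → ℝ → ℝ) (_ : ∀ k, ContDiffOn ℝ 1 (a k) J) (_ : ∀ k, ∀ t ∈ J, a k t ≠ 0)
        (ε : ℝ) (_ : 0 ≤ ε) (_ : ε < 1) (m : ℝ) (_ : 0 < m)
        (_ : ∀ t ∈ J, ∀ k, |derivWithin (a k) J t| / |a k t| ^ (1 + ε) ≤ m),
        (∀ t ∈ J, IsSelfAdjoint (AGN.diracOperator e M μ 𝒢 E fun k => a k t) ∧
          AGN.StrongResolventTendsto
            (fun n => AGN.partialDirac e M μ 𝒢 E (fun k => a k t) n)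
            (AGN.diracOperator e M μ 𝒢 E fun k => a k t)) ∧
        ∃ F R : ℝ → AGN.LimitSpace M μ 𝒢 E →L[ℂ] AGN.LimitSpace M μ 𝒢 E,
          (∀ t ∈ J, F t ∈ AGN.vonNeumann M μ 𝒢 E ∧ R t ∈ AGN.vonNeumann M μ 𝒢 E) ∧
          (∀ v, ContinuousOn (fun t => F t v) J ∧ ContinuousOn (fun t => R t v) J) ∧
          (∀ t ∈ J, ‖F t‖ ≤ c ^ (ε / 2) * m ∧ ‖R t‖ ≤ c ^ (ε / 2) * m) ∧
          (∀ t ∈ J, AGN.derivOperator (fun s => AGN.diracOperator e M μ 𝒢 E fun k => a k s) J t =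
            ((R t).toLinearMap +ᵥ
              (F t).toLinearMap.compPMap
                (AGN.absPow (AGN.diracOperator e M μ 𝒢 E fun k => a k t) (1 + ε))).closure) := by
  have : IsTopologicalGroup G := topologicalGroup_of_lieGroup 𝓘(ℝ, V) ∞
  have : SecondCountableTopology G := ChartedSpace.secondCountable_of_sigmaCompact V G
  obtain ⟨c, hc, hleast, hgap⟩ := AGN.exists_isLeast_eigenvalue e M μ he
  refine ⟨c, hc, hleast, fun 𝒢 J hJ hJ' a ha ha0 ε hε _ m hm hbound => ?_⟩
  let C := AGN.prodCore e M 𝒢 E μ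
  have hC : C.Gap c := AGN.gap_prodCore e μ hgap
  have hop : ∀ a : ℕ → ℝ, AGN.diracOperator e M μ 𝒢 E a = C.op fun γ => a (𝒢.level γ) :=
    AGN.diracOperator_eq_op e M 𝒢 E μ
  -- Non-degeneracy of J makes derivatives within J unique also at endpoints that belong to J.
  have hunique := AGN.uniqueDiffOn_of_ordConnected hJ hJ'
  have hb : ∀ t ∈ J, ∀ γ : 𝒢.Site, |derivWithin (a (𝒢.level γ)) J t| ≤
      m * |a (𝒢.level γ) t| ^ (1 + ε) := fun t ht γ =>
    (div_le_iff₀ (Real.rpow_pos_of_pos (abs_pos.2 (ha0 _ t ht)) _)).1 (hbound t ht _)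
  -- F is the quotient of the derivative by the power of the operator. Since the derivative vanishes
  -- on the kernel of the operator, the remainder R is zero.
  refine ⟨fun t _ => ⟨?_, ?_⟩, fun t => C.quotient (fun γ => a (𝒢.level γ) t)
    (fun γ => derivWithin (a (𝒢.level γ)) J t) (1 + ε), fun _ => 0, fun t ht => ⟨?_, ?_⟩,
    fun v => ⟨?_, continuousOn_const⟩, fun t ht => ⟨?_, ?_⟩, fun t ht => ?_⟩
  · rw [hop]
    exact C.isSelfAdjoint_op _
  · simp only [AGN.partialDirac, hop]
    refine C.strongResolventTendsto_op _ _ fun γ => ?_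
    filter_upwards [eventually_ge_atTop (𝒢.level γ)] with n hn
    rw [if_pos hn]
  · exact AGN.quotient_mem_vonNeumann e μ hc hC hε hm (hb t ht)
  · exact AGN.mem_vonNeumann fun T _ _ => by rw [mul_zero, zero_mul]
  · exact C.continuousOn_quotient hc hC hε hm (fun γ => (ha _).continuousOn)
      (fun γ => ha0 _) (fun γ => (ha _).continuousOn_derivWithin hunique le_rfl) hb v
  · exact C.norm_quotient_le hc hC hε hm (hb t ht)
  · rw [norm_zero]
    positivity
  · simp only [hop]
    rw [C.derivOperator_op (fun γ => a (𝒢.level γ)) (fun γ => derivWithin (a (𝒢.level γ)) J t) ht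
      (hunique t ht) fun γ => ((ha _).differentiableOn one_ne_zero t ht).hasDerivWithinAt]
    exact (C.closure_quotient_absPow hc hC hε hm (hb t ht)).symm
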